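/- Fix $\tau\in\mathbb C$ with $\operatorname{Im}\tau<0$. For $\theta\in\mathbb R$ let $A_\theta$ be the algebra of formal sums $\sum_{(p_1,p_2)\in\mathbb Z^2}a_{p_1,p_2}U_1^{p_1}U_2^{p_2}$ with rapidly decreasing complex coefficients and the product determined by $U_1U_2=e^{2\pi i\theta}U_2U_1$, and let $\delta_\tau$ be the derivation of $A_\theta$ with $\delta_\tau\big(\sum a_{p_1,p_2}U_1^{p_1}U_2^{p_2}\big)=2\pi i\sum(p_1\tau+p_2)a_{p_1,p_2}U_1^{p_1}U_2^{p_2}$. The standard holomorphic bundles of positive rank on the noncommutative torus $T_{\theta,\tau}$ are the following right $A_\theta$-modules $E=E^z_{n,m}(\theta)$ with operators $\overline\nabla_z$, for coprime integers $m,n$ with $n+m\theta>0$ and $z\in\mathbb C$. If $m\neq0$, then $E$ is the Schwartz space $\mathcal S(\mathbb R\times\mathbb Z/m\mathbb Z)$ with $fU_1(x,\alpha)=f\big(x-\tfrac{n+m\theta}{m},\alpha-1\big)$, $fU_2(x,\alpha)=e^{2\pi i(x-\alpha n/m)}f(x,\alpha)$ and $\overline\nabla_z f=\partial f/\partial x+2\pi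 i\big(\tfrac{\tau m}{n+m\theta}x+z\big)f$. If $m=0$ (so $n=1$), then $E=A_\theta$ and $\overline\nabla_z(a)=2\pi i z a+\delta_\tau(a)$. Let $\mathcal C^{st}(\theta,\tau)$ be the dg-category over $\mathbb C$ whose objects are the symbols $E[k]$, where $E$ is a standard holomorphic bundle of positive rank and $k\in\mathbb Z$, and in which $\operatorname{Hom}(E[k],E'[k'])$ is the complex $\operatorname{Hom}_{A_\theta}(E,E')\to\operatorname{Hom}_{A_\theta}(E,E')$ placed in degrees $k-k'$ and $k-k'+1$, with differential $\phi\mapsto\overline\nabla\phi-\phi\overline\nabla$ (up to the sign $(-1)^{k'}$) and composition induced by that of module homomorphisms (two elements of the upper terms having composition zero). Let $H^*(\mathcal C^{st}(\theta,\tau))$ be the graded $\mathbb C$-linear category with the same objects whose morphism spaces are the total cohomology spaces of these complexes. If $\theta$ and $\theta'$ are irrational, then the graded categories $H^*(\mathcal C^{st}(\theta,\tau))$ and $H^*(\mathcal C^{st}(\theta',\tau))$ are equivalent: there is an equivalence of categories given by $\mathbb C$-linear functors that preserve the degrees of morphisms, with unit and counit of degree $0$. -/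

import Mathlib

open CategoryTheory
open scoped SchwartzMap DirectSum

namespace NCTorus

noncomputable section

/-! ### The smooth noncommutative torus -/

/-- `e(t) = exp(2πit)`. -/
def e (t : ℝ) : ℂ := Complex.exp (2 * Real.pi * Complex.I * t)

theorem norm_e (t : ℝ) : ‖e t‖ = 1 := by
  rw [e, show (2 * Real.pi * Complex.I * t : ℂ) = ((2 * Real.pi * t : ℝ) : ℂ) * Complex.I by
    push_cast; ring]
  exact Complex.norm_exp_ofReal_mul_I _

theorem e_add (s t : ℝ) : e (s + t) = e s * e t := by
  rw [e, e, e, ← Complex.exp_add]; congr 1; push_cast; ring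

theorem e_zero : e 0 = 1 := by simp [e]

theorem e_int (k : ℤ) : e k = 1 := by
  rw [e, Complex.exp_eq_one_iff]; exact ⟨k, by push_cast; ring⟩

theorem hasDerivAt_e (t : ℝ) : HasDerivAt e (2 * Real.pi * Complex.I * e t) t := by
  have h1 : HasDerivAt (fun t : ℝ => (2 * Real.pi * Complex.I * t : ℂ))
      (2 * Real.pi * Complex.I * 1) t := (HasDerivAt.ofReal_comp (hasDerivAt_id t)).const_mul _
  have h2 := h1.cexp
  rw [mul_one, mul_comm (Complex.exp _)] at h2
  exact h2

/-- The size `1 + |p₁| + |p₂|` of a point of `ℤ²`. -/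
def wt (p : ℤ × ℤ) : ℝ := 1 + |(p.1 : ℝ)| + |(p.2 : ℝ)|

theorem one_le_wt (p : ℤ × ℤ) : 1 ≤ wt p := by
  unfold wt; have := abs_nonneg (p.1 : ℝ); have := abs_nonneg (p.2 : ℝ); linarith

theorem wt_pos (p : ℤ × ℤ) : 0 < wt p := lt_of_lt_of_le one_pos (one_le_wt p)

theorem wt_le_mul (p q : ℤ × ℤ) : wt q ≤ wt (q - p) * wt p := by
  have h1 : |(q.1 : ℝ)| ≤ |((q.1 - p.1 : ℤ) : ℝ)| + |(p.1 : ℝ)| := by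
    have := abs_add_le ((q.1 - p.1 : ℤ) : ℝ) (p.1 : ℝ); simpa using this
  have h2 : |(q.2 : ℝ)| ≤ |((q.2 - p.2 : ℤ) : ℝ)| + |(p.2 : ℝ)| := by
    have := abs_add_le ((q.2 - p.2 : ℤ) : ℝ) (p.2 : ℝ); simpa using this
  have a1 := abs_nonneg ((q.1 - p.1 : ℤ) : ℝ)
  have a2 := abs_nonneg ((q.2 - p.2 : ℤ) : ℝ)
  have a3 := abs_nonneg (p.1 : ℝ)
  have a4 := abs_nonneg (p.2 : ℝ)
  simp only [wt, Prod.fst_sub, Prod.snd_sub]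
  nlinarith [mul_nonneg a1 a3, mul_nonneg a1 a4, mul_nonneg a2 a3, mul_nonneg a2 a4]

theorem summable_wt : Summable fun p : ℤ × ℤ => (wt p ^ 4)⁻¹ := by
  have h1 : Summable fun n : ℤ => ((1 + |(n : ℝ)|) ^ 2)⁻¹ := by
    have h0 : Summable fun n : ℤ => 1 / |(n : ℝ)| ^ (2 : ℝ) :=
      (Real.summable_abs_int_rpow (b := 2) (by norm_num)).congr fun n => by
        rw [Real.rpow_neg (abs_nonneg _)]; simp
    refine Summable.of_norm_bounded_eventually h0 ?_
    rw [Filter.eventually_cofinite]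
    refine (Set.finite_singleton (0 : ℤ)).subset fun n hn => ?_
    by_contra hne
    apply hn
    have hpos : 0 < |(n : ℝ)| := abs_pos.mpr (by exact_mod_cast hne)
    rw [Real.norm_of_nonneg (by positivity), one_div, Real.rpow_two]
    gcongr
    linarith
  refine Summable.of_nonneg_of_le (fun p => by have := wt_pos p; positivity) (fun p => ?_)
    (h1.mul_of_nonneg h1 (fun n => by positivity) (fun n => by positivity))
  have a3 := abs_nonneg (p.1 : ℝ)
  have a4 := abs_nonneg (p.2 : ℝ)
  rw [← mul_inv]
  have b1 : 1 + |(p.1 : ℝ)| ≤ wt p := by unfold wt; linarith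
  have b2 : 1 + |(p.2 : ℝ)| ≤ wt p := by unfold wt; linarith
  have : (1 + |(p.1 : ℝ)|) ^ 2 * (1 + |(p.2 : ℝ)|) ^ 2 ≤ wt p ^ 2 * wt p ^ 2 := by gcongr
  gcongr
  calc _ ≤ _ := this
    _ = _ := by ring

/-- The rapidly decreasing functions on `ℤ²`. -/
def rapid : Submodule ℂ (ℤ × ℤ → ℂ) where
  carrier := {a | ∀ k : ℕ, ∃ C : ℝ, ∀ p, wt p ^ k * ‖a p‖ ≤ C}
  add_mem' := by
    intro a b ha hb k
    obtain ⟨C, hC⟩ := ha k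
    obtain ⟨D, hD⟩ := hb k
    refine ⟨C + D, fun p => ?_⟩
    have h0 : 0 ≤ wt p ^ k := pow_nonneg (wt_pos p).le k
    calc _ ≤ wt p ^ k * (‖a p‖ + ‖b p‖) := by gcongr; exact norm_add_le _ _
      _ ≤ _ := by rw [mul_add]; exact add_le_add (hC p) (hD p)
  zero_mem' := fun k => ⟨0, fun p => by simp⟩
  smul_mem' := by
    intro c a ha k
    obtain ⟨C, hC⟩ := ha k
    refine ⟨‖c‖ * C, fun p => ?_⟩
    calc _ = ‖c‖ * (wt p ^ k * ‖a p‖) := by simp; ring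
      _ ≤ _ := by gcongr; exact hC p

theorem rapid_summable {a : ℤ × ℤ → ℂ} (ha : a ∈ rapid) (k : ℕ) :
    Summable fun p => wt p ^ k * ‖a p‖ := by
  obtain ⟨C, hC⟩ := ha (k + 4)
  refine Summable.of_nonneg_of_le
    (fun p => mul_nonneg (pow_nonneg (wt_pos p).le k) (norm_nonneg _)) (fun p => ?_)
    (summable_wt.mul_left C)
  have h := wt_pos p
  rw [← div_eq_mul_inv, le_div_iff₀ (by positivity)]
  calc _ = wt p ^ (k + 4) * ‖a p‖ := by ring
    _ ≤ C := hC p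

theorem rapid_summable_norm {a : ℤ × ℤ → ℂ} (ha : a ∈ rapid) : Summable fun p => ‖a p‖ := by
  simpa using rapid_summable ha 0

/-- The algebra `A_θ` of smooth functions on the noncommutative torus: formal sums
`∑ a_p U₁^{p₁} U₂^{p₂}` with rapidly decreasing coefficients. -/
def Alg (_θ : ℝ) : Type := rapid

variable {θ : ℝ}

instance : AddCommGroup (Alg θ) := inferInstanceAs (AddCommGroup rapid)
instance : Module ℂ (Alg θ) := inferInstanceAs (Module ℂ rapid)

/-- The coefficients of an element of `A_θ`. -/
def Alg.coeff (a : Alg θ) : ℤ × ℤ → ℂ := a.1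

theorem Alg.mem (a : Alg θ) : a.coeff ∈ rapid := a.2

theorem Alg.ext {a b : Alg θ} (h : ∀ p, a.coeff p = b.coeff p) : a = b := Subtype.ext (funext h)

@[simp] theorem Alg.coeff_add (a b : Alg θ) (p : ℤ × ℤ) :
    (a + b).coeff p = a.coeff p + b.coeff p := rfl
@[simp] theorem Alg.coeff_smul (c : ℂ) (a : Alg θ) (p : ℤ × ℤ) :
    (c • a).coeff p = c * a.coeff p := rfl
@[simp] theorem Alg.coeff_zero (p : ℤ × ℤ) : (0 : Alg θ).coeff p = 0 := rfl

/-- Auxiliary: a right action of the `U₁^{p₁} U₂^{p₂}` on the functions on a set `X` by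
translations `σ` and phase factors `χ`. -/
structure Weyl (θ : ℝ) (X : Type) where
  χ : ℤ × ℤ → X → ℂ
  σ : ℤ × ℤ → X → X
  norm_χ : ∀ p x, ‖χ p x‖ = 1
  χ_zero : ∀ x, χ 0 x = 1
  σ_zero : ∀ x, σ 0 x = x
  σ_add : ∀ p q x, σ p (σ q x) = σ (p + q) x
  χ_mul : ∀ p q x, χ q x * χ p (σ q x) = e (-θ * (p.2 * q.1)) * χ (p + q) x

namespace Weyl

variable {X : Type} (W : Weyl θ X)

/-- The action of a sequence `a` on a function `f`: `f · ∑ a_p U₁^{p₁} U₂^{p₂}`. -/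
def act (f : X → ℂ) (a : ℤ × ℤ → ℂ) (x : X) : ℂ := ∑' p, a p * (W.χ p x * f (W.σ p x))

theorem norm_term_le {f : X → ℂ} {C : ℝ} (hf : ∀ x, ‖f x‖ ≤ C) (a : ℤ × ℤ → ℂ) (x : X)
    (p : ℤ × ℤ) : ‖a p * (W.χ p x * f (W.σ p x))‖ ≤ ‖a p‖ * C := by
  rw [norm_mul, norm_mul, W.norm_χ, one_mul]
  exact mul_le_mul_of_nonneg_left (hf _) (norm_nonneg _)

theorem summable_term {f : X → ℂ} {C : ℝ} (hf : ∀ x, ‖f x‖ ≤ C) {a : ℤ × ℤ → ℂ}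
    (ha : a ∈ rapid) (x : X) : Summable fun p => a p * (W.χ p x * f (W.σ p x)) :=
  Summable.of_norm_bounded ((rapid_summable_norm ha).mul_right C) (W.norm_term_le hf a x)

theorem norm_act_le {f : X → ℂ} {C : ℝ} (hf : ∀ x, ‖f x‖ ≤ C) {a : ℤ × ℤ → ℂ}
    (ha : a ∈ rapid) (x : X) : ‖W.act f a x‖ ≤ (∑' p, ‖a p‖) * C := by
  rw [← tsum_mul_right]
  exact tsum_of_norm_bounded ((rapid_summable_norm ha).mul_right C).hasSum
    (W.norm_term_le hf a x)

theorem act_add {f : X → ℂ} {C : ℝ} (hf : ∀ x, ‖f x‖ ≤ C) {a b : ℤ × ℤ → ℂ}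
    (ha : a ∈ rapid) (hb : b ∈ rapid) (x : X) :
    W.act f (a + b) x = W.act f a x + W.act f b x := by
  unfold act
  rw [← (W.summable_term hf ha x).tsum_add (W.summable_term hf hb x)]
  exact tsum_congr fun p => by simp only [Pi.add_apply]; ring

theorem add_act {f g : X → ℂ} {C D : ℝ} (hf : ∀ x, ‖f x‖ ≤ C) (hg : ∀ x, ‖g x‖ ≤ D)
    {a : ℤ × ℤ → ℂ} (ha : a ∈ rapid) (x : X) :
    W.act (f + g) a x = W.act f a x + W.act g a x := by
  unfold act
  rw [← (W.summable_term hf ha x).tsum_add (W.summable_term hg ha x)]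
  exact tsum_congr fun p => by simp only [Pi.add_apply]; ring

theorem act_smul (f : X → ℂ) (c : ℂ) (a : ℤ × ℤ → ℂ) (x : X) :
    W.act f (c • a) x = c * W.act f a x := by
  unfold act
  rw [← tsum_mul_left]
  exact tsum_congr fun p => by simp only [Pi.smul_apply, smul_eq_mul]; ring

theorem smul_act (f : X → ℂ) (c : ℂ) (a : ℤ × ℤ → ℂ) (x : X) :
    W.act (c • f) a x = c * W.act f a x := by
  unfold act
  rw [← tsum_mul_left]
  exact tsum_congr fun p => by simp only [Pi.smul_apply, smul_eq_mul]; ring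

theorem act_one (f : X → ℂ) (x : X) : W.act f (Pi.single 0 1) x = f x := by
  unfold act
  rw [tsum_eq_single 0 (fun p hp => by simp [Pi.single_eq_of_ne hp])]
  simp [W.χ_zero, W.σ_zero]

end Weyl

/-- Auxiliary: right multiplication by `U₁^{p₁} U₂^{p₂}` on formal sums. -/
def regWeyl (θ : ℝ) : Weyl θ (ℤ × ℤ) where
  χ p q := e (-θ * ((q - p).2 * p.1))
  σ p q := q - p
  norm_χ _ _ := norm_e _
  χ_zero q := by simp [e_zero]
  σ_zero q := sub_zero q
  σ_add p q x := by abel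
  χ_mul p q x := by
    rw [← e_add, ← e_add]; congr 1
    simp only [Prod.snd_sub, Prod.snd_add, Prod.fst_add]
    push_cast; ring

/-- The twisted convolution: since `U₁U₂ = e(θ)U₂U₁`, one has
`U₁^{r₁}U₂^{r₂} U₁^{p₁}U₂^{p₂} = e(-θ r₂ p₁) U₁^{r₁+p₁}U₂^{r₂+p₂}`. -/
def conv (θ : ℝ) (a b : ℤ × ℤ → ℂ) (q : ℤ × ℤ) : ℂ :=
  ∑' p : ℤ × ℤ, a (q - p) * b p * e (-θ * ((q - p).2 * p.1))

theorem conv_eq_act (a b : ℤ × ℤ → ℂ) (q : ℤ × ℤ) :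
    conv θ a b q = (regWeyl θ).act a b q :=
  tsum_congr fun p => by simp only [regWeyl]; ring

theorem rapid_bounded {a : ℤ × ℤ → ℂ} (ha : a ∈ rapid) : ∃ C, ∀ p, ‖a p‖ ≤ C := by
  simpa using ha 0

theorem conv_mem {a b : ℤ × ℤ → ℂ} (ha : a ∈ rapid) (hb : b ∈ rapid) : conv θ a b ∈ rapid := by
  intro k
  obtain ⟨C, hC⟩ := ha k
  refine ⟨∑' p, C * (wt p ^ k * ‖b p‖), fun q => ?_⟩
  have hs := (rapid_summable hb k).mul_left C
  have h0 : 0 ≤ wt q ^ k := pow_nonneg (wt_pos q).le k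
  have : ‖((wt q ^ k : ℝ) : ℂ) * conv θ a b q‖ = wt q ^ k * ‖conv θ a b q‖ := by
    rw [norm_mul, Complex.norm_real, Real.norm_of_nonneg h0]
  rw [← this, conv, ← tsum_mul_left]
  refine tsum_of_norm_bounded hs.hasSum fun p => ?_
  rw [norm_mul, norm_mul, norm_mul, norm_e, mul_one, Complex.norm_real, Real.norm_of_nonneg h0]
  have h1 : wt q ^ k ≤ wt (q - p) ^ k * wt p ^ k := by
    rw [← mul_pow]; exact pow_le_pow_left₀ (wt_pos q).le (wt_le_mul p q) k
  calc _ ≤ (wt (q - p) ^ k * wt p ^ k) * (‖a (q - p)‖ * ‖b p‖) := by gcongr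
    _ = (wt (q - p) ^ k * ‖a (q - p)‖) * (wt p ^ k * ‖b p‖) := by ring
    _ ≤ _ := by
      gcongr
      · exact mul_nonneg (pow_nonneg (wt_pos p).le k) (norm_nonneg _)
      · exact hC _

theorem Weyl.act_conv {X : Type} (W : Weyl θ X) {f : X → ℂ} {C : ℝ} (hf : ∀ x, ‖f x‖ ≤ C)
    {a b : ℤ × ℤ → ℂ} (ha : a ∈ rapid) (hb : b ∈ rapid) (x : X) :
    W.act f (conv θ a b) x = W.act (W.act f a) b x := by
  let G : ℤ × ℤ → ℤ × ℤ → ℂ := fun r q =>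
    a (r - q) * b q * e (-θ * ((r - q).2 * q.1)) * (W.χ r x * f (W.σ r x))
  have hG : ∀ p q, G (p + q) q = b q * (W.χ q x * (a p * (W.χ p (W.σ q x) *
      f (W.σ p (W.σ q x))))) := by
    intro p q
    have h := W.χ_mul p q x
    simp only [G, add_sub_cancel_right, W.σ_add]
    calc _ = a p * b q * (e (-θ * (p.2 * q.1)) * W.χ (p + q) x) * f (W.σ (p + q) x) := by ring
      _ = _ := by rw [← h]; ring
  let s : (ℤ × ℤ) × (ℤ × ℤ) ≃ (ℤ × ℤ) × (ℤ × ℤ) :=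
    { toFun := fun z => (z.1 + z.2, z.2)
      invFun := fun z => (z.1 - z.2, z.2)
      left_inv := fun z => by simp
      right_inv := fun z => by simp }
  have hsum : Summable (Function.uncurry G) := by
    rw [← s.summable_iff]
    have h1 : Summable fun z : (ℤ × ℤ) × (ℤ × ℤ) => (‖a z.1‖ * ‖b z.2‖) * C :=
      ((rapid_summable_norm ha).mul_of_nonneg (rapid_summable_norm hb)
        (fun _ => norm_nonneg _) (fun _ => norm_nonneg _)).mul_right C
    refine Summable.of_norm_bounded h1 fun z => ?_
    have : (Function.uncurry G ∘ s) z = G (z.1 + z.2) z.2 := rfl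
    rw [this, hG]
    simp only [norm_mul, W.norm_χ, one_mul]
    calc _ = (‖a z.1‖ * ‖b z.2‖) * ‖f (W.σ z.1 (W.σ z.2 x))‖ := by ring
      _ ≤ _ := by gcongr; exact hf _
  calc W.act f (conv θ a b) x = ∑' r, ∑' q, G r q := by
        unfold Weyl.act
        exact tsum_congr fun r => by rw [conv, ← tsum_mul_right]
    _ = ∑' q, ∑' r, G r q := hsum.tsum_comm.symm
    _ = ∑' q, ∑' p, G (p + q) q :=
        tsum_congr fun q => ((Equiv.addRight q).tsum_eq fun r => G r q).symm
    _ = _ := by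
        unfold Weyl.act
        refine tsum_congr fun q => ?_
        rw [← tsum_mul_left, ← tsum_mul_left]
        exact tsum_congr fun p => hG p q

instance : Mul (Alg θ) := ⟨fun a b => ⟨conv θ a.coeff b.coeff, conv_mem a.mem b.mem⟩⟩

/-- The monomial `U₁^{p₁} U₂^{p₂}`. -/
def Alg.mono (p : ℤ × ℤ) : Alg θ := ⟨Pi.single p 1, by
  intro k
  refine ⟨wt p ^ k, fun q => ?_⟩
  by_cases h : q = p
  · subst h; simp
  · simpa [Pi.single_eq_of_ne h] using pow_nonneg (wt_pos p).le k⟩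

instance : One (Alg θ) := ⟨Alg.mono 0⟩

theorem Alg.coeff_one : (1 : Alg θ).coeff = Pi.single 0 1 := rfl

theorem Alg.coeff_mul (a b : Alg θ) : (a * b).coeff = conv θ a.coeff b.coeff := rfl

theorem Alg.coeff_mul' (a b : Alg θ) (q : ℤ × ℤ) :
    (a * b).coeff q = (regWeyl θ).act a.coeff b.coeff q := conv_eq_act _ _ _

instance : Ring (Alg θ) :=
  { (inferInstance : AddCommGroup (Alg θ)) with
    mul := (· * ·)
    one := 1
    left_distrib := fun a b c => Alg.ext fun p => by
      obtain ⟨C, hC⟩ := rapid_bounded a.mem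
      simp only [Alg.coeff_mul', Alg.coeff_add]
      exact (regWeyl θ).act_add hC b.mem c.mem p
    right_distrib := fun a b c => Alg.ext fun p => by
      obtain ⟨C, hC⟩ := rapid_bounded a.mem
      obtain ⟨D, hD⟩ := rapid_bounded b.mem
      simp only [Alg.coeff_mul', Alg.coeff_add]
      exact (regWeyl θ).add_act hC hD c.mem p
    zero_mul := fun a => Alg.ext fun p => by
      rw [Alg.coeff_mul']
      simp [Weyl.act]
    mul_zero := fun a => Alg.ext fun p => by
      rw [Alg.coeff_mul']
      simp [Weyl.act]
    mul_assoc := fun a b c => Alg.ext fun p => by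
      obtain ⟨C, hC⟩ := rapid_bounded a.mem
      rw [Alg.coeff_mul', Alg.coeff_mul', Alg.coeff_mul b c, (regWeyl θ).act_conv hC b.mem c.mem]
      congr 1
      exact funext fun q => Alg.coeff_mul' a b q
    one_mul := fun a => Alg.ext fun p => by
      rw [Alg.coeff_mul, Alg.coeff_one, conv, tsum_eq_single p]
      · simp [e_zero]
      · intro q hq
        rw [Pi.single_eq_of_ne (sub_ne_zero.mpr (Ne.symm hq))]; simp
    mul_one := fun a => Alg.ext fun p => by
      rw [Alg.coeff_mul', Alg.coeff_one, Weyl.act_one] }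

theorem Alg.smul_mul (c : ℂ) (a b : Alg θ) : (c • a) * b = c • (a * b) := Alg.ext fun p => by
  rw [Alg.coeff_smul, Alg.coeff_mul', Alg.coeff_mul']
  exact (regWeyl θ).smul_act a.coeff c b.coeff p

theorem Alg.mul_smul (c : ℂ) (a b : Alg θ) : a * (c • b) = c • (a * b) := Alg.ext fun p => by
  rw [Alg.coeff_smul, Alg.coeff_mul', Alg.coeff_mul']
  exact (regWeyl θ).act_smul a.coeff c b.coeff p

instance : Algebra ℂ (Alg θ) := Algebra.ofModule Alg.smul_mul fun c a b => Alg.mul_smul c a b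

/-- The defining relation `U₁U₂ = e(θ)U₂U₁` holds. -/
theorem Alg.commutation :
    (Alg.mono (1, 0) * Alg.mono (0, 1) : Alg θ) = e θ • (Alg.mono (0, 1) * Alg.mono (1, 0)) := by
  refine Alg.ext fun q => ?_
  rw [Alg.coeff_smul, Alg.coeff_mul, Alg.coeff_mul, conv, conv, tsum_eq_single (0, 1),
    tsum_eq_single (1, 0)]
  · by_cases h : q = (1, 1)
    · subst h
      simp [Alg.mono, Alg.coeff, ← e_add, e_zero]
    · have h1 : q - (0, 1) ≠ (1, 0) := fun h' => h (by rw [sub_eq_iff_eq_add] at h'; simpa using h')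
      have h2 : q - (1, 0) ≠ (0, 1) := fun h' => h (by rw [sub_eq_iff_eq_add] at h'; simpa using h')
      simp [Alg.mono, Alg.coeff, Pi.single_eq_of_ne h1, Pi.single_eq_of_ne h2]
  · intro p hp; simp [Alg.mono, Alg.coeff, Pi.single_eq_of_ne hp]
  · intro p hp; simp [Alg.mono, Alg.coeff, Pi.single_eq_of_ne hp]

/-- The derivation of `A_θ` multiplying `U₁^{p₁} U₂^{p₂}` by `p₁u + p₂v`. -/
def der (u v : ℂ) : Alg θ →ₗ[ℂ] Alg θ where
  toFun a := ⟨fun p => (p.1 * u + p.2 * v) * a.coeff p, by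
    intro k
    obtain ⟨C, hC⟩ := a.mem (k + 1)
    refine ⟨(‖u‖ + ‖v‖) * C, fun p => ?_⟩
    have h1 : ‖(p.1 * u + p.2 * v : ℂ)‖ ≤ wt p * (‖u‖ + ‖v‖) := by
      have := norm_add_le (p.1 * u : ℂ) (p.2 * v)
      rw [norm_mul, norm_mul, Complex.norm_intCast, Complex.norm_intCast] at this
      have a3 := abs_nonneg (p.1 : ℝ)
      have a4 := abs_nonneg (p.2 : ℝ)
      unfold wt
      nlinarith [norm_nonneg u, norm_nonneg v, mul_nonneg a3 (norm_nonneg v),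
        mul_nonneg a4 (norm_nonneg u)]
    have h0 := wt_pos p
    rw [norm_mul]
    calc _ ≤ wt p ^ k * (wt p * (‖u‖ + ‖v‖) * ‖a.coeff p‖) := by gcongr
      _ = (‖u‖ + ‖v‖) * (wt p ^ (k + 1) * ‖a.coeff p‖) := by ring
      _ ≤ _ := by gcongr; exact hC p⟩
  map_add' a b := Alg.ext fun p => mul_add _ _ _
  map_smul' c a := Alg.ext fun p => mul_left_comm _ _ _

theorem coeff_der (u v : ℂ) (a : Alg θ) (p : ℤ × ℤ) :
    (der u v a).coeff p = (p.1 * u + p.2 * v) * a.coeff p := rfl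

theorem der_mul (u v : ℂ) (a b : Alg θ) : der u v (a * b) = der u v a * b + a * der u v b := by
  refine Alg.ext fun q => ?_
  obtain ⟨C, hC⟩ := rapid_bounded a.mem
  obtain ⟨D, hD⟩ := rapid_bounded (der u v a).mem
  rw [Alg.coeff_add, coeff_der, Alg.coeff_mul', Alg.coeff_mul', Alg.coeff_mul', Weyl.act,
    Weyl.act, Weyl.act, ← tsum_mul_left,
    ← ((regWeyl θ).summable_term hD b.mem q).tsum_add
      ((regWeyl θ).summable_term hC (der u v b).mem q)]
  refine tsum_congr fun p => ?_
  simp only [coeff_der, regWeyl, Prod.fst_sub, Prod.snd_sub]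
  push_cast
  ring

/-- The derivation `δ_τ` of `A_θ`, the complex structure of the noncommutative torus:
`δ_τ(∑ a_p U₁^{p₁}U₂^{p₂}) = 2πi ∑ (p₁τ + p₂) a_p U₁^{p₁}U₂^{p₂}`. -/
def delta (τ : ℂ) : Alg θ →ₗ[ℂ] Alg θ :=
  der (2 * Real.pi * Complex.I * τ) (2 * Real.pi * Complex.I)

/-! ### Basic modules and their standard holomorphic structures -/

/-- The underlying space `𝓢(ℝ × ℤ/mℤ)` of the basic module `E_{n,m}(θ)`, `m ≠ 0`; the value of
`f` at `(x, α)` is `f α x`. -/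
def SMod (_θ : ℝ) (_n m : ℤ) : Type := ZMod m.natAbs → 𝓢(ℝ, ℂ)

variable {n m : ℤ}

instance : AddCommGroup (SMod θ n m) :=
  inferInstanceAs (AddCommGroup (ZMod m.natAbs → 𝓢(ℝ, ℂ)))
instance : Module ℂ (SMod θ n m) := inferInstanceAs (Module ℂ (ZMod m.natAbs → 𝓢(ℝ, ℂ)))

instance [NeZero m] : NeZero m.natAbs := ⟨Int.natAbs_ne_zero.mpr (NeZero.ne m)⟩

/-- An element of the module as a function on `ℝ × ℤ/mℤ`. -/
def SMod.fn (f : SMod θ n m) (y : ℝ × ZMod m.natAbs) : ℂ := f y.2 y.1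

theorem SMod.ext {f g : SMod θ n m} (h : ∀ y, f.fn y = g.fn y) : f = g :=
  funext fun α => SchwartzMap.ext fun x => h (x, α)

theorem SMod.fn_add (f g : SMod θ n m) : (f + g).fn = f.fn + g.fn := rfl
theorem SMod.fn_smul (c : ℂ) (f : SMod θ n m) : (c • f).fn = c • f.fn := rfl

theorem SMod.bounded [NeZero m] (f : SMod θ n m) : ∃ C, ∀ y, ‖f.fn y‖ ≤ C := by
  have h : ∀ α : ZMod m.natAbs, ∃ C, ∀ x, ‖f α x‖ ≤ C := fun α => by
    obtain ⟨C, hC⟩ := (f α).decay 0 0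
    exact ⟨C, fun x => by simpa using hC.2 x⟩
  choose C hC using h
  refine ⟨∑ α, |C α|, fun y => (hC y.2 y.1).trans ((le_abs_self _).trans ?_)⟩
  exact Finset.single_le_sum (f := fun α => |C α|) (fun _ _ => abs_nonneg _) (Finset.mem_univ y.2)

/-- The right action of `U₁^{p₁} U₂^{p₂}` on functions on `ℝ × ℤ/mℤ` generated by
`fU₁(x, α) = f(x - (n + mθ)/m, α - 1)` and `fU₂(x, α) = e(x - αn/m) f(x, α)`, that is
`(fU₁^{p₁}U₂^{p₂})(x, α) = e(p₂(x - αn/m)) f(x - p₁(n + mθ)/m, α - p₁)`. -/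
def basicWeyl (θ : ℝ) (n m : ℤ) [NeZero m] : Weyl θ (ℝ × ZMod m.natAbs) where
  χ p y := e (p.2 * (y.1 - y.2.val * n / m))
  σ p y := (y.1 - p.1 * ((n + m * θ) / m), y.2 - p.1)
  norm_χ _ _ := norm_e _
  χ_zero y := by simp [e_zero]
  σ_zero y := by simp
  σ_add p q y := by
    refine Prod.ext ?_ ?_
    · simp only [Prod.fst_add]; push_cast; ring
    · simp only [Prod.fst_add]; push_cast; ring
  χ_mul p q y := by
    obtain ⟨x, α⟩ := y
    have hm : (m : ℝ) ≠ 0 := by exact_mod_cast NeZero.ne m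
    have hdvd : m ∣ ((α - (q.1 : ZMod m.natAbs)).val : ℤ) - (α.val : ℤ) + q.1 := by
      rw [← Int.natAbs_dvd, ← ZMod.intCast_zmod_eq_zero_iff_dvd]
      push_cast
      simp
    obtain ⟨k, hk⟩ := hdvd
    have hk' : (((α - (q.1 : ZMod m.natAbs)).val : ℕ) : ℝ) = α.val - q.1 + m * k := by
      have : ((((α - (q.1 : ZMod m.natAbs)).val : ℤ) - (α.val : ℤ) + q.1 : ℤ) : ℝ)
          = ((m * k : ℤ) : ℝ) := by rw [hk]
      push_cast at this
      linarith
    rw [← e_add, ← e_add]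
    simp only [hk', Prod.snd_add, Int.cast_add]
    have : (q.2 * (x - α.val * n / m) + p.2 * (x - q.1 * ((n + m * θ) / m)
          - (α.val - q.1 + m * k) * n / m) : ℝ)
        = (-θ * (p.2 * q.1) + (p.2 + q.2) * (x - α.val * n / m)) + ((-(p.2 * k * n) : ℤ) : ℝ) := by
      push_cast
      field_simp
      ring
    rw [this, e_add, e_int, mul_one]

/-- `f ↦ ∂f/∂x`. -/
def SMod.D : SMod θ n m →ₗ[ℂ] SMod θ n m where
  toFun f α := SchwartzMap.derivCLM ℂ ℂ (f α)
  map_add' f g := funext fun α => map_add (SchwartzMap.derivCLM ℂ ℂ) (f α) (g α)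
  map_smul' c f := funext fun α => map_smul (SchwartzMap.derivCLM ℂ ℂ) c (f α)

/-- `f ↦ x f`. -/
def SMod.X : SMod θ n m →ₗ[ℂ] SMod θ n m where
  toFun f α := SchwartzMap.smulLeftCLM ℂ (fun x : ℝ => (x : ℂ)) (f α)
  map_add' f g := funext fun α => map_add (SchwartzMap.smulLeftCLM ℂ _) (f α) (g α)
  map_smul' c f := funext fun α => map_smul (SchwartzMap.smulLeftCLM ℂ _) c (f α)

theorem SMod.fn_D (f : SMod θ n m) (y : ℝ × ZMod m.natAbs) :
    (SMod.D f).fn y = deriv (f y.2) y.1 := rfl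

theorem SMod.fn_X (f : SMod θ n m) (y : ℝ × ZMod m.natAbs) :
    (SMod.X f).fn y = y.1 * f.fn y :=
  SchwartzMap.smulLeftCLM_apply_apply (by fun_prop) (f y.2) y.1

section action

variable [NeZero m]

/-- `f · a` as a function on `ℝ × ℤ/mℤ`. -/
def SMod.actFn (f : SMod θ n m) (a : Alg θ) : ℝ × ZMod m.natAbs → ℂ :=
  (basicWeyl θ n m).act f.fn a.coeff

theorem SMod.hasDerivAt_actFn (f : SMod θ n m) (a : Alg θ) (x : ℝ) (α : ZMod m.natAbs) :
    HasDerivAt (fun x => f.actFn a (x, α))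
      ((SMod.D f).actFn a (x, α) + f.actFn (der 0 (2 * Real.pi * Complex.I) a) (x, α)) x := by
  obtain ⟨C, hC⟩ := f.bounded
  obtain ⟨D, hD⟩ := (SMod.D f).bounded
  have s1 := fun y => (basicWeyl θ n m).summable_term hD a.mem y
  have s2 := fun y => (basicWeyl θ n m).summable_term hC (der 0 (2 * Real.pi * Complex.I) a).mem y
  have key := hasDerivAt_tsum (𝕜 := ℝ) (F := ℂ)
    (u := fun p => ‖a.coeff p‖ * D + ‖(der 0 (2 * Real.pi * Complex.I) a).coeff p‖ * C)
    (g := fun p x => a.coeff p * ((basicWeyl θ n m).χ p (x, α) *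
      f.fn ((basicWeyl θ n m).σ p (x, α))))
    (g' := fun p x => a.coeff p * ((basicWeyl θ n m).χ p (x, α) *
      (SMod.D f).fn ((basicWeyl θ n m).σ p (x, α))) +
      (der 0 (2 * Real.pi * Complex.I) a).coeff p * ((basicWeyl θ n m).χ p (x, α) *
      f.fn ((basicWeyl θ n m).σ p (x, α)))) (y₀ := x)
    (((rapid_summable_norm a.mem).mul_right D).add
      ((rapid_summable_norm (der 0 (2 * Real.pi * Complex.I) a).mem).mul_right C))
    ?_ ?_ ((basicWeyl θ n m).summable_term hC a.mem (x, α)) x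
  · rw [(s1 (x, α)).tsum_add (s2 (x, α))] at key
    exact key
  · intro p t
    have h1 : HasDerivAt (fun t : ℝ => e (p.2 * (t - α.val * n / m)))
        (((p.2 : ℝ) * 1) • (2 * Real.pi * Complex.I * e (p.2 * (t - α.val * n / m)))) t :=
      HasDerivAt.scomp t (hasDerivAt_e _) (((hasDerivAt_id t).sub_const _).const_mul _)
    have h2 : HasDerivAt (fun t : ℝ => f (α - p.1) (t - p.1 * ((n + m * θ) / m)))
        ((1 : ℝ) • deriv (f (α - p.1)) (t - p.1 * ((n + m * θ) / m))) t :=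
      HasDerivAt.scomp t ((f (α - p.1)).differentiable _).hasDerivAt
        ((hasDerivAt_id t).sub_const _)
    have h3 := (h1.mul h2).const_mul (a.coeff p)
    refine h3.congr_deriv ?_
    simp only [coeff_der, basicWeyl, SMod.fn_D, one_smul, mul_one, Complex.real_smul]
    simp only [SMod.fn]
    push_cast
    ring
  · intro p t
    exact (norm_add_le _ _).trans (add_le_add ((basicWeyl θ n m).norm_term_le hD _ _ p)
      ((basicWeyl θ n m).norm_term_le hC _ _ p))

theorem SMod.X_actFn (f : SMod θ n m) (a : Alg θ) (y : ℝ × ZMod m.natAbs) :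
    y.1 * f.actFn a y = (SMod.X f).actFn a y + f.actFn (der ((n + m * θ) / m) 0 a) y := by
  obtain ⟨C, hC⟩ := f.bounded
  obtain ⟨D, hD⟩ := (SMod.X f).bounded
  unfold SMod.actFn Weyl.act
  rw [← tsum_mul_left, ← ((basicWeyl θ n m).summable_term hD a.mem y).tsum_add
    ((basicWeyl θ n m).summable_term hC (der ((n + m * θ) / m) 0 a).mem y)]
  refine tsum_congr fun p => ?_
  simp only [SMod.fn_X, coeff_der, basicWeyl]
  push_cast
  ring

theorem SMod.actFn_bound (f : SMod θ n m) (a : Alg θ) :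
    ∃ C, ∀ y, ‖f.actFn a y‖ ≤ C := by
  obtain ⟨C, hC⟩ := f.bounded
  exact ⟨_, fun y => (basicWeyl θ n m).norm_act_le hC a.mem y⟩

theorem SMod.actFn_decay (k : ℕ) : ∀ (f : SMod θ n m) (a : Alg θ),
    ∃ C, ∀ y : ℝ × ZMod m.natAbs, |y.1| ^ k * ‖f.actFn a y‖ ≤ C := by
  induction k with
  | zero => simpa using SMod.actFn_bound
  | succ k ih =>
    intro f a
    obtain ⟨C, hC⟩ := ih (SMod.X f) a
    obtain ⟨D, hD⟩ := ih f (der ((n + m * θ) / m) 0 a)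
    refine ⟨C + D, fun y => ?_⟩
    have h0 : 0 ≤ |y.1| ^ k := by positivity
    have h1 : |y.1| ^ (k + 1) * ‖f.actFn a y‖ = |y.1| ^ k * ‖y.1 * f.actFn a y‖ := by
      rw [norm_mul, Complex.norm_real, Real.norm_eq_abs]; ring
    rw [h1, SMod.X_actFn]
    calc _ ≤ |y.1| ^ k * (_ + _) := mul_le_mul_of_nonneg_left (norm_add_le _ _) h0
      _ ≤ C + D := by rw [mul_add]; exact add_le_add (hC y) (hD y)

theorem SMod.deriv_actFn (f : SMod θ n m) (a : Alg θ) (α : ZMod m.natAbs) :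
    deriv (fun x => f.actFn a (x, α)) = (fun x => (SMod.D f).actFn a (x, α)) +
      fun x => f.actFn (der 0 (2 * Real.pi * Complex.I) a) (x, α) :=
  funext fun x => (f.hasDerivAt_actFn a x α).deriv

theorem SMod.contDiff_actFn (j : ℕ) : ∀ (f : SMod θ n m) (a : Alg θ) (α : ZMod m.natAbs),
    ContDiff ℝ j fun x => f.actFn a (x, α) := by
  induction j with
  | zero =>
    intro f a α
    exact contDiff_zero.mpr
      (continuous_iff_continuousAt.mpr fun x => (f.hasDerivAt_actFn a x α).continuousAt)
  | succ j ih =>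
    intro f a α
    rw [Nat.cast_add, Nat.cast_one, contDiff_succ_iff_deriv]
    refine ⟨fun x => (f.hasDerivAt_actFn a x α).differentiableAt, by simp, ?_⟩
    rw [SMod.deriv_actFn]
    exact (ih _ _ α).add (ih _ _ α)

theorem SMod.actFn_seminorm (k j : ℕ) : ∀ (f : SMod θ n m) (a : Alg θ) (α : ZMod m.natAbs),
    ∃ C, ∀ x : ℝ, |x| ^ k * ‖iteratedDeriv j (fun x => f.actFn a (x, α)) x‖ ≤ C := by
  induction j with
  | zero =>
    intro f a α
    obtain ⟨C, hC⟩ := f.actFn_decay k a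
    exact ⟨C, fun x => by simpa using hC (x, α)⟩
  | succ j ih =>
    intro f a α
    obtain ⟨C, hC⟩ := ih (SMod.D f) a α
    obtain ⟨D, hD⟩ := ih f (der 0 (2 * Real.pi * Complex.I) a) α
    refine ⟨C + D, fun x => ?_⟩
    rw [iteratedDeriv_succ', SMod.deriv_actFn, iteratedDeriv_add
      (SMod.contDiff_actFn j _ _ α).contDiffAt (SMod.contDiff_actFn j _ _ α).contDiffAt]
    calc _ ≤ |x| ^ k * (_ + _) := mul_le_mul_of_nonneg_left (norm_add_le _ _) (by positivity)
      _ ≤ C + D := by rw [mul_add]; exact add_le_add (hC x) (hD x)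

/-- The right action of `A_θ` on `E_{n,m}(θ)`. -/
def SMod.act (f : SMod θ n m) (a : Alg θ) : SMod θ n m := fun α =>
  { toFun := fun x => f.actFn a (x, α)
    smooth' := contDiff_infty.mpr fun j => SMod.contDiff_actFn j f a α
    decay' := fun k j => by
      obtain ⟨C, hC⟩ := SMod.actFn_seminorm k j f a α
      exact ⟨C, fun x => by
        rw [norm_iteratedFDeriv_eq_norm_iteratedDeriv, Real.norm_eq_abs]; exact hC x⟩ }

theorem SMod.fn_act (f : SMod θ n m) (a : Alg θ) : (f.act a).fn = f.actFn a := rfl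

/-- Right `A_θ`-modules are modules over the opposite ring: `op a • f = f · a`. -/
instance : Module (Alg θ)ᵐᵒᵖ (SMod θ n m) where
  smul a f := f.act a.unop
  one_smul f := SMod.ext fun y => (basicWeyl θ n m).act_one f.fn y
  mul_smul a b f := SMod.ext fun y => by
    obtain ⟨C, hC⟩ := f.bounded
    exact (basicWeyl θ n m).act_conv hC b.unop.mem a.unop.mem y
  smul_zero a := SMod.ext fun y => by
    have : (basicWeyl θ n m).act (0 : SMod θ n m).fn a.unop.coeff y = 0 := by
      have h : (0 : SMod θ n m).fn = 0 := rfl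
      simp [Weyl.act, h]
    exact this
  smul_add a f g := SMod.ext fun y => by
    obtain ⟨C, hC⟩ := f.bounded
    obtain ⟨D, hD⟩ := g.bounded
    exact (basicWeyl θ n m).add_act hC hD a.unop.mem y
  add_smul a b f := SMod.ext fun y => by
    obtain ⟨C, hC⟩ := f.bounded
    exact (basicWeyl θ n m).act_add hC a.unop.mem b.unop.mem y
  zero_smul f := SMod.ext fun y => by
    have : (basicWeyl θ n m).act f.fn (0 : Alg θ).coeff y = 0 := by
      simp [Weyl.act]
    exact this

theorem SMod.fn_op_smul (f : SMod θ n m) (a : Alg θ) :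
    (MulOpposite.op a • f).fn = f.actFn a := rfl

instance : IsScalarTower ℂ (Alg θ)ᵐᵒᵖ (SMod θ n m) where
  smul_assoc c a f := SMod.ext fun y => (basicWeyl θ n m).act_smul f.fn c a.unop.coeff y

end action

/-- `(fU₁^{p₁}U₂^{p₂})(x, α) = e(p₂(x - αn/m)) f(x - p₁(n + mθ)/m, α - p₁)`. -/
theorem SMod.op_mono_smul [NeZero m] (f : SMod θ n m) (p : ℤ × ℤ) (x : ℝ) (α : ZMod m.natAbs) :
    (MulOpposite.op (Alg.mono p : Alg θ) • f).fn (x, α) =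
      e (p.2 * (x - α.val * n / m)) * f.fn (x - p.1 * ((n + m * θ) / m), α - p.1) := by
  have h : (Alg.mono p : Alg θ).coeff = Pi.single p 1 := rfl
  rw [SMod.fn_op_smul, SMod.actFn, Weyl.act, h, tsum_eq_single p
    (fun q hq => by rw [Pi.single_eq_of_ne hq, zero_mul])]
  simp [basicWeyl]

/-- A right `A_θ`-module with a holomorphic structure: an operator `∇` with
`∇(e a) = ∇(e) a + e δ_τ(a)`. -/
structure HolMod (θ : ℝ) (τ : ℂ) where
  carrier : Type
  [addCommGroup : AddCommGroup carrier]
  [moduleC : Module ℂ carrier]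
  [module : Module (Alg θ)ᵐᵒᵖ carrier]
  [tower : IsScalarTower ℂ (Alg θ)ᵐᵒᵖ carrier]
  nabla : carrier →ₗ[ℂ] carrier
  leibniz : ∀ (x : carrier) (a : Alg θ), nabla (MulOpposite.op a • x) =
    MulOpposite.op a • nabla x + MulOpposite.op (delta τ a) • x

attribute [instance] HolMod.addCommGroup HolMod.moduleC HolMod.module HolMod.tower

instance {τ : ℂ} (E : HolMod θ τ) : SMulCommClass (Alg θ)ᵐᵒᵖ ℂ E.carrier :=
  IsScalarTower.to_smulCommClass'

/-- The module `A_θ = E_{1,0}(θ)` with `∇_z(a) = 2πi z a + δ_τ(a)`. -/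
def trivialBundle (θ : ℝ) (τ z : ℂ) : HolMod θ τ where
  carrier := Alg θ
  nabla := (2 * Real.pi * Complex.I * z) • LinearMap.id + delta τ
  leibniz x a := by
    simp only [LinearMap.add_apply, LinearMap.smul_apply, LinearMap.id_apply,
      MulOpposite.smul_eq_mul_unop, MulOpposite.unop_op]
    rw [delta, der_mul, add_mul, Alg.smul_mul, add_assoc]

/-- The module `E_{n,m}(θ)`, `m ≠ 0`, `n + mθ ≠ 0`, with
`∇_z(f) = ∂f/∂x + 2πi(τμx + z)f`, where `μ = m/(n + mθ)` is the slope. -/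
def schwartzBundle (θ : ℝ) (τ z : ℂ) (n m : ℤ) (hm : m ≠ 0) (hr : (n + m * θ : ℝ) ≠ 0) :
    HolMod θ τ :=
  haveI : NeZero m := ⟨hm⟩
  { carrier := SMod θ n m
    nabla := SMod.D + (2 * Real.pi * Complex.I) •
      ((τ * (m / (n + m * θ) : ℝ)) • SMod.X + z • LinearMap.id)
    leibniz := fun f a => SMod.ext fun y => by
      obtain ⟨x, α⟩ := y
      have hm' : (m : ℂ) ≠ 0 := by exact_mod_cast hm
      have hr' : (n + m * θ : ℂ) ≠ 0 := by exact_mod_cast hr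
      obtain ⟨C, hC⟩ := f.bounded
      obtain ⟨C₁, hC₁⟩ := (SMod.D f).bounded
      obtain ⟨C₂, hC₂⟩ := (SMod.X f).bounded
      have hd := (f.hasDerivAt_actFn a x α).deriv
      have hx := f.X_actFn a (x, α)
      have e1 : ∀ b : Alg θ, ∀ g : SMod θ n m, (MulOpposite.op b • g).fn (x, α) =
        g.actFn b (x, α) := fun _ _ => rfl
      have e2 : (SMod.D (MulOpposite.op a • f)).fn (x, α) =
        deriv (fun x => f.actFn a (x, α)) x := rfl
      have e3 : ∀ (c : ℂ) (g : SMod θ n m), MulOpposite.op a • (c • g) =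
        c • (MulOpposite.op a • g) := fun c g => SMod.ext fun y =>
          (basicWeyl θ n m).smul_act g.fn c a.coeff y
      have e4 : ∀ u v : ℂ, f.actFn (der u v a) (x, α) =
          u * f.actFn (der 1 0 a) (x, α) + v * f.actFn (der 0 1 a) (x, α) := by
        intro u v
        have : der u v a = u • der 1 0 a + v • der 0 1 a := Alg.ext fun p => by
          simp only [coeff_der, Alg.coeff_add, Alg.coeff_smul]; ring
        rw [this]
        have h := (basicWeyl θ n m).act_add hC (u • der 1 0 a).mem (v • der 0 1 a).mem (x, α)
        refine h.trans ?_
        exact congrArg₂ (· + ·) ((basicWeyl θ n m).act_smul f.fn u (der 1 0 a).coeff (x, α))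
          ((basicWeyl θ n m).act_smul f.fn v (der 0 1 a).coeff (x, α))
      simp only [LinearMap.add_apply, LinearMap.smul_apply, LinearMap.id_apply, smul_add, e3]
      simp only [SMod.fn_add, SMod.fn_smul, Pi.add_apply, Pi.smul_apply, smul_eq_mul, e1, e2, hd,
        SMod.fn_X, hx]
      rw [delta, e4, e4 ((n + m * θ) / m) 0, e4 (_ * τ)]
      push_cast
      field_simp
      ring }

/-- A standard holomorphic bundle `E_{n,m}^z(θ)` of positive rank, `(m, n)` coprime; for `m = 0`
positivity of the rank forces `n = 1`. -/
structure StdBundle (θ : ℝ) where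
  n : ℤ
  m : ℤ
  coprime : IsCoprime m n
  rank_pos : (0 : ℝ) < n + m * θ
  z : ℂ

/-- The module with holomorphic structure given by the data of a standard bundle. -/
def StdBundle.toHolMod (τ : ℂ) (E : StdBundle θ) : HolMod θ τ :=
  if hm : E.m = 0 then trivialBundle θ τ E.z
  else schwartzBundle θ τ E.z E.n E.m hm E.rank_pos.ne'

/-! ### dg-categories and their cohomology categories -/

/-- A dg-category over `ℂ`: `Hom X Y` is the total space of a complex with `deg X Y i` its part of
degree `i`; `comp g f` is the composition `g ∘ f`. -/
class DGCategory (C : Type*) where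
  Hom : C → C → Type
  [addCommGroup : ∀ X Y, AddCommGroup (Hom X Y)]
  [module : ∀ X Y, Module ℂ (Hom X Y)]
  deg : ∀ X Y : C, ℤ → Submodule ℂ (Hom X Y)
  isInternal : ∀ X Y, DirectSum.IsInternal (deg X Y)
  d : ∀ X Y : C, Hom X Y →ₗ[ℂ] Hom X Y
  d_mem : ∀ (X Y : C) (i : ℤ) (f : Hom X Y), f ∈ deg X Y i → d X Y f ∈ deg X Y (i + 1)
  d_d : ∀ (X Y : C) (f : Hom X Y), d X Y (d X Y f) = 0
  one : ∀ X : C, Hom X X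
  one_mem : ∀ X : C, one X ∈ deg X X 0
  comp : ∀ {X Y Z : C}, Hom Y Z →ₗ[ℂ] Hom X Y →ₗ[ℂ] Hom X Z
  comp_mem : ∀ {X Y Z : C} (i j : ℤ) (g : Hom Y Z) (f : Hom X Y), g ∈ deg Y Z i →
    f ∈ deg X Y j → comp g f ∈ deg X Z (i + j)
  one_comp : ∀ {X Y : C} (f : Hom X Y), comp (one Y) f = f
  comp_one : ∀ {X Y : C} (f : Hom X Y), comp f (one X) = f
  assoc : ∀ {W X Y Z : C} (h : Hom Y Z) (g : Hom X Y) (f : Hom W X),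
    comp (comp h g) f = comp h (comp g f)
  leibniz : ∀ {X Y Z : C} (i : ℤ) (g : Hom Y Z) (f : Hom X Y), g ∈ deg Y Z i →
    d X Z (comp g f) = comp (d Y Z g) f + ((i.negOnePow : ℤ) : ℂ) • comp g (d X Y f)

attribute [reducible, instance] DGCategory.addCommGroup DGCategory.module

/-- The full dg-subcategory on a family of objects. -/
@[reducible] def DGCategory.induced {C D : Type*} [DGCategory D] (F : C → D) : DGCategory C where
  Hom X Y := DGCategory.Hom (F X) (F Y)
  deg X Y := DGCategory.deg (F X) (F Y)
  isInternal X Y := DGCategory.isInternal (F X) (F Y)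
  d X Y := DGCategory.d (F X) (F Y)
  d_mem X Y := DGCategory.d_mem (F X) (F Y)
  d_d X Y := DGCategory.d_d (F X) (F Y)
  one X := DGCategory.one (F X)
  one_mem X := DGCategory.one_mem (F X)
  comp := DGCategory.comp
  comp_mem := DGCategory.comp_mem
  one_comp := DGCategory.one_comp
  comp_one := DGCategory.comp_one
  assoc := DGCategory.assoc
  leibniz := DGCategory.leibniz

/-- A graded category over `ℂ`: a `ℂ`-linear category whose morphism spaces are graded, with
identities of degree `0` and degrees adding under composition. -/
class GradedCategory (C : Type*) [Category C] [Preadditive C] [Linear ℂ C] where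
  deg : ∀ X Y : C, ℤ → Submodule ℂ (X ⟶ Y)
  isInternal : ∀ X Y, DirectSum.IsInternal (deg X Y)
  id_mem : ∀ X : C, 𝟙 X ∈ deg X X 0
  comp_mem : ∀ {X Y Z : C} (i j : ℤ) (f : X ⟶ Y) (g : Y ⟶ Z), f ∈ deg X Y i → g ∈ deg Y Z j →
    f ≫ g ∈ deg X Z (i + j)

/-- An equivalence of graded categories: an equivalence by `ℂ`-linear functors preserving the
degrees of morphisms, whose unit and counit have degree `0`. -/
structure GradedEquivalence (C D : Type*) [Category C] [Preadditive C] [Linear ℂ C]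
    [GradedCategory C] [Category D] [Preadditive D] [Linear ℂ D] [GradedCategory D] where
  equiv : C ≌ D
  functor_additive : equiv.functor.Additive
  functor_linear : equiv.functor.Linear ℂ
  inverse_additive : equiv.inverse.Additive
  inverse_linear : equiv.inverse.Linear ℂ
  functor_deg : ∀ {X Y : C} (i : ℤ) (f : X ⟶ Y), f ∈ GradedCategory.deg X Y i →
    equiv.functor.map f ∈ GradedCategory.deg (equiv.functor.obj X) (equiv.functor.obj Y) i
  inverse_deg : ∀ {X Y : D} (i : ℤ) (f : X ⟶ Y), f ∈ GradedCategory.deg X Y i →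
    equiv.inverse.map f ∈ GradedCategory.deg (equiv.inverse.obj X) (equiv.inverse.obj Y) i
  unit_deg : ∀ X : C, equiv.unit.app X ∈ GradedCategory.deg _ _ 0
  counit_deg : ∀ X : D, equiv.counit.app X ∈ GradedCategory.deg _ _ 0

section cohomology

variable {C : Type*} [DGCategory C]

namespace DGCategory

/-- Auxiliary: the projection of a morphism to its component of degree `i`. -/
def proj (X Y : C) (i : ℤ) : Hom X Y →ₗ[ℂ] Hom X Y :=
  (deg X Y i).subtype ∘ₗ DirectSum.component ℂ ℤ (fun i => deg X Y i) i ∘ₗ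
    (LinearEquiv.ofBijective (DirectSum.coeLinearMap (deg X Y)) (isInternal X Y)).symm.toLinearMap

theorem proj_mem (X Y : C) (i : ℤ) (f : Hom X Y) : proj X Y i f ∈ deg X Y i :=
  Submodule.coe_mem _

theorem proj_of_mem {X Y : C} {i : ℤ} (j : ℤ) {f : Hom X Y} (hf : f ∈ deg X Y i) :
    proj X Y j f = if i = j then f else 0 := by
  have h : (LinearEquiv.ofBijective (DirectSum.coeLinearMap (deg X Y)) (isInternal X Y)).symm f
      = DirectSum.lof ℂ ℤ (fun i => deg X Y i) i ⟨f, hf⟩ := by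
    rw [LinearEquiv.symm_apply_eq]
    exact (DirectSum.coeLinearMap_lof (A := deg X Y) i ⟨f, hf⟩).symm
  simp only [proj, LinearMap.comp_apply, LinearEquiv.coe_coe, h]
  by_cases hij : i = j
  · subst hij; simp [DirectSum.component.lof_self]
  · rw [if_neg hij, DirectSum.component.of, dif_neg hij]; simp

theorem induction_deg {X Y : C} {P : Hom X Y → Prop} (f : Hom X Y)
    (h1 : ∀ i, ∀ f ∈ deg X Y i, P f) (h0 : P 0) (hadd : ∀ f g, P f → P g → P (f + g)) : P f := by
  have hf : f ∈ ⨆ i, deg X Y i := by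
    rw [(isInternal X Y).submodule_iSup_eq_top]; trivial
  exact Submodule.iSup_induction (motive := P) _ hf h1 h0 hadd

theorem exists_finset_sum_proj {X Y : C} (f : Hom X Y) :
    ∃ s : Finset ℤ, ∀ t, s ⊆ t → ∑ i ∈ t, proj X Y i f = f := by
  classical
  refine induction_deg (P := fun f => ∃ s : Finset ℤ, ∀ t, s ⊆ t → ∑ i ∈ t, proj X Y i f = f)
    f ?_ ?_ ?_
  · intro i f hf
    refine ⟨{i}, fun t ht => ?_⟩
    simp only [proj_of_mem _ hf]
    rw [Finset.sum_ite_eq, if_pos (ht (Finset.mem_singleton_self i))]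
  · exact ⟨∅, fun t _ => by simp⟩
  · rintro f g ⟨s, hs⟩ ⟨t, ht⟩
    refine ⟨s ∪ t, fun u hu => ?_⟩
    simp only [map_add, Finset.sum_add_distrib]
    rw [hs u (Finset.union_subset_left hu), ht u (Finset.union_subset_right hu)]

theorem proj_d {X Y : C} (i : ℤ) (f : Hom X Y) :
    proj X Y (i + 1) (d X Y f) = d X Y (proj X Y i f) := by
  refine induction_deg (P := fun f => proj X Y (i + 1) (d X Y f) = d X Y (proj X Y i f))
    f ?_ ?_ ?_
  · intro j f hf
    rw [proj_of_mem _ (d_mem X Y j f hf), proj_of_mem _ hf]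
    by_cases h : j = i <;> simp [h]
  · simp
  · intro f g hf hg; simp only [map_add, hf, hg]

theorem d_one (X : C) : d X X (one X) = 0 := by
  have h := leibniz 0 (one X) (one X) (one_mem X)
  simp only [one_comp, comp_one, Int.negOnePow_zero, Units.val_one, Int.cast_one, one_smul] at h
  exact left_eq_add.mp h

/-- Closed morphisms. -/
def cycles (X Y : C) : Submodule ℂ (Hom X Y) := LinearMap.ker (d X Y)

theorem proj_cycles {X Y : C} (i : ℤ) {f : Hom X Y} (hf : f ∈ cycles X Y) :
    proj X Y i f ∈ cycles X Y := by
  have h : d X Y f = 0 := hf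
  show d X Y _ = 0
  rw [← proj_d, h, map_zero]

theorem induction_cycles {X Y : C} {P : Hom X Y → Prop} {f : Hom X Y} (hf : f ∈ cycles X Y)
    (h1 : ∀ i, ∀ f ∈ deg X Y i, f ∈ cycles X Y → P f) (h0 : P 0)
    (hadd : ∀ f g, P f → P g → P (f + g)) : P f := by
  classical
  obtain ⟨s, hs⟩ := exists_finset_sum_proj f
  rw [← hs s subset_rfl]
  exact Finset.sum_induction _ P hadd h0 fun i _ => h1 i _ (proj_mem X Y i f) (proj_cycles i hf)

theorem comp_cycles {X Y Z : C} {g : Hom Y Z} {f : Hom X Y} (hg : g ∈ cycles Y Z)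
    (hf : f ∈ cycles X Y) : comp g f ∈ cycles X Z := by
  refine induction_cycles (P := fun g => comp g f ∈ cycles X Z) hg ?_ ?_ ?_
  · intro i g hi hg
    have h1 : d Y Z g = 0 := hg
    have h2 : d X Y f = 0 := hf
    show d X Z _ = 0
    rw [leibniz i g f hi, h1, h2]; simp
  · simp
  · intro g g' h h'
    rw [map_add, LinearMap.add_apply]; exact add_mem h h'

theorem comp_d_mem {X Y Z : C} {g : Hom Y Z} (hg : g ∈ cycles Y Z) (f : Hom X Y) :
    comp g (d X Y f) ∈ LinearMap.range (d X Z) := by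
  refine induction_cycles (P := fun g => comp g (d X Y f) ∈ LinearMap.range (d X Z)) hg ?_ ?_ ?_
  · intro i g hi hg
    have h1 : d Y Z g = 0 := hg
    have h2 := leibniz i g f hi
    rw [h1, map_zero, LinearMap.zero_apply, zero_add] at h2
    refine ⟨((i.negOnePow : ℤ) : ℂ) • comp g f, ?_⟩
    rw [map_smul, h2, smul_smul, ← Int.cast_mul, ← Units.val_mul, Int.units_mul_self]
    simp
  · simp
  · intro g g' h h'
    rw [map_add, LinearMap.add_apply]; exact add_mem h h'

theorem d_comp_mem {X Y Z : C} (g : Hom Y Z) {f : Hom X Y} (hf : f ∈ cycles X Y) :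
    comp (d Y Z g) f ∈ LinearMap.range (d X Z) := by
  refine induction_deg (P := fun g => comp (d Y Z g) f ∈ LinearMap.range (d X Z)) g ?_ ?_ ?_
  · intro i g hi
    have h1 : d X Y f = 0 := hf
    have h2 := leibniz i g f hi
    rw [h1, map_zero, smul_zero, add_zero] at h2
    exact ⟨_, h2⟩
  · simp
  · intro g g' h h'
    rw [map_add, map_add, LinearMap.add_apply]; exact add_mem h h'

/-- Exact morphisms, inside the closed ones. -/
def boundaries (X Y : C) : Submodule ℂ (cycles X Y) :=
  (LinearMap.range (d X Y)).comap (cycles X Y).subtype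

/-- The total cohomology `H^*Hom(X, Y) = ker d / im d`. -/
abbrev HHom (X Y : C) : Type := cycles X Y ⧸ boundaries X Y

/-- Composition of closed morphisms. -/
def compCycles (X Y Z : C) : cycles Y Z →ₗ[ℂ] cycles X Y →ₗ[ℂ] cycles X Z :=
  LinearMap.mk₂ ℂ (fun g f => ⟨comp g.1 f.1, comp_cycles g.2 f.2⟩)
    (fun g g' f => Subtype.ext (by simp)) (fun c g f => Subtype.ext (by simp))
    (fun g f f' => Subtype.ext (by simp)) (fun c g f => Subtype.ext (by simp))

theorem compCycles_boundaries (X Y Z : C) (g : cycles Y Z) :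
    boundaries X Y ≤ (boundaries X Z).comap (compCycles X Y Z g) := by
  rintro ⟨f, hf⟩ ⟨h, hh⟩
  have hh' : d X Y h = f := hh
  subst hh'
  exact comp_d_mem g.2 h

/-- Auxiliary: composition of a closed morphism with a cohomology class. -/
def compH' (X Y Z : C) : cycles Y Z →ₗ[ℂ] HHom X Y →ₗ[ℂ] HHom X Z where
  toFun g := Submodule.mapQ (boundaries X Y) (boundaries X Z) (compCycles X Y Z g)
    (compCycles_boundaries X Y Z g)
  map_add' g g' := by
    refine Submodule.linearMap_qext _ (LinearMap.ext fun f => ?_)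
    simp
  map_smul' c g := by
    refine Submodule.linearMap_qext _ (LinearMap.ext fun f => ?_)
    simp

/-- The composition of cohomology classes, induced by that of closed morphisms. -/
def compH (X Y Z : C) : HHom Y Z →ₗ[ℂ] HHom X Y →ₗ[ℂ] HHom X Z :=
  (boundaries Y Z).liftQ (compH' X Y Z) (by
    rintro ⟨g, hg⟩ ⟨h, hh⟩
    have hh' : d Y Z h = g := hh
    subst hh'
    rw [LinearMap.mem_ker]
    refine Submodule.linearMap_qext _ (LinearMap.ext fun f => ?_)
    exact (Submodule.Quotient.mk_eq_zero (boundaries X Z)).mpr (d_comp_mem h f.2))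

theorem compH_mk {X Y Z : C} (g : cycles Y Z) (f : cycles X Y) :
    compH X Y Z ((boundaries Y Z).mkQ g) ((boundaries X Y).mkQ f) =
      (boundaries X Z).mkQ (compCycles X Y Z g f) := rfl

/-- The class of the identity. -/
def oneH (X : C) : HHom X X := (boundaries X X).mkQ ⟨one X, d_one X⟩

theorem compH_one {X Y : C} (f : HHom X Y) : compH X X Y f (oneH X) = f := by
  obtain ⟨f, rfl⟩ := (boundaries X Y).mkQ_surjective f
  rw [oneH, compH_mk]
  exact congrArg (boundaries X Y).mkQ (Subtype.ext (comp_one f.1))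

theorem one_compH {X Y : C} (f : HHom X Y) : compH X Y Y (oneH Y) f = f := by
  obtain ⟨f, rfl⟩ := (boundaries X Y).mkQ_surjective f
  rw [oneH, compH_mk]
  exact congrArg (boundaries X Y).mkQ (Subtype.ext (one_comp f.1))

theorem compH_assoc {W X Y Z : C} (h : HHom Y Z) (g : HHom X Y) (f : HHom W X) :
    compH W X Z (compH X Y Z h g) f = compH W Y Z h (compH W X Y g f) := by
  obtain ⟨f, rfl⟩ := (boundaries W X).mkQ_surjective f
  obtain ⟨g, rfl⟩ := (boundaries X Y).mkQ_surjective g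
  obtain ⟨h, rfl⟩ := (boundaries Y Z).mkQ_surjective h
  simp only [compH_mk]
  exact congrArg (boundaries W Z).mkQ (Subtype.ext (assoc h.1 g.1 f.1))

/-- The classes of closed morphisms of degree `i`. -/
def degH (X Y : C) (i : ℤ) : Submodule ℂ (HHom X Y) :=
  ((deg X Y i).comap (cycles X Y).subtype).map (boundaries X Y).mkQ

theorem degH_isInternal (X Y : C) : DirectSum.IsInternal (degH X Y) := by
  classical
  let pc : ℤ → cycles X Y →ₗ[ℂ] cycles X Y := fun i =>
    ((proj X Y i) ∘ₗ (cycles X Y).subtype).codRestrict _ fun f => proj_cycles i f.2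
  have hpc : ∀ i, boundaries X Y ≤ (boundaries X Y).comap (pc i) := by
    rintro i ⟨f, hf⟩ ⟨h, hh⟩
    have hh' : d X Y h = f := hh
    subst hh'
    refine ⟨proj X Y (i - 1) h, ?_⟩
    have := proj_d (i - 1) h
    rw [sub_add_cancel] at this
    exact this.symm
  let ph : ℤ → HHom X Y →ₗ[ℂ] HHom X Y := fun i => Submodule.mapQ _ _ (pc i) (hpc i)
  have hph : ∀ i j, ∀ x ∈ degH X Y i, ph j x = if i = j then x else 0 := by
    rintro i j _ ⟨f, hf, rfl⟩
    have hf' : f.1 ∈ deg X Y i := hf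
    show Submodule.Quotient.mk (pc j f) = _
    have : pc j f = if i = j then f else 0 := Subtype.ext (by
      have := proj_of_mem j hf'
      by_cases h : i = j
      · rw [if_pos h] at this ⊢; exact this
      · rw [if_neg h] at this ⊢; exact this)
    rw [this]
    by_cases h : i = j
    · rw [if_pos h, if_pos h]; rfl
    · rw [if_neg h, if_neg h]; rfl
  refine (DirectSum.isInternal_submodule_iff_iSupIndep_and_iSup_eq_top _).mpr ⟨?_, ?_⟩
  · rw [iSupIndep_def]
    intro i
    rw [Submodule.disjoint_def]
    intro x hx hx'
    have h1 : ph i x = x := by rw [hph i i x hx, if_pos rfl]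
    have h2 : (⨆ j, ⨆ (_ : j ≠ i), degH X Y j) ≤ LinearMap.ker (ph i) := by
      refine iSup_le fun j => iSup_le fun hj => fun y hy => ?_
      rw [LinearMap.mem_ker, hph j i y hy, if_neg hj]
    rw [← h1]; exact h2 hx'
  · rw [eq_top_iff]
    rintro x -
    induction x using Submodule.Quotient.induction_on with
    | H f =>
      obtain ⟨s, hs⟩ := exists_finset_sum_proj f.1
      have : f = ∑ i ∈ s, pc i f := Subtype.ext (by
        rw [AddSubmonoidClass.coe_finsetSum]; exact (hs s subset_rfl).symm)
      rw [this]
      have h3 : (Submodule.Quotient.mk (∑ i ∈ s, pc i f) : HHom X Y) =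
          ∑ i ∈ s, (boundaries X Y).mkQ (pc i f) := map_sum (boundaries X Y).mkQ _ _
      rw [h3]
      refine Submodule.sum_mem _ fun i _ => ?_
      exact Submodule.mem_iSup_of_mem i ⟨pc i f, proj_mem X Y i f.1, rfl⟩

end DGCategory

open DGCategory

/-- The cohomology category `H^*(C)` of a dg-category: the objects are those of `C`, the morphisms
are the total cohomology spaces of the complexes of morphisms. -/
structure HStar (C : Type*) where
  obj : C

instance : Category (HStar C) where
  Hom X Y := HHom X.obj Y.obj
  id X := oneH X.obj
  comp {X Y Z} f g := compH X.obj Y.obj Z.obj g f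
  id_comp f := compH_one f
  comp_id f := one_compH f
  assoc f g h := (compH_assoc h g f).symm

instance : Preadditive (HStar C) where
  homGroup X Y := inferInstanceAs (AddCommGroup (HHom X.obj Y.obj))
  add_comp X Y Z f f' g := (compH X.obj Y.obj Z.obj g).map_add f f'
  comp_add X Y Z f g g' := LinearMap.congr_fun ((compH X.obj Y.obj Z.obj).map_add g g') f

instance : Linear ℂ (HStar C) where
  homModule X Y := inferInstanceAs (Module ℂ (HHom X.obj Y.obj))
  smul_comp X Y Z r f g := (compH X.obj Y.obj Z.obj g).map_smul r f
  comp_smul X Y Z f r g := LinearMap.congr_fun ((compH X.obj Y.obj Z.obj).map_smul r g) f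

instance : GradedCategory (HStar C) where
  deg X Y := degH X.obj Y.obj
  isInternal X Y := degH_isInternal X.obj Y.obj
  id_mem X := ⟨⟨one X.obj, d_one X.obj⟩, one_mem X.obj, rfl⟩
  comp_mem := by
    rintro X Y Z i j _ _ ⟨f, hf, rfl⟩ ⟨g, hg, rfl⟩
    refine ⟨compCycles X.obj Y.obj Z.obj g f, ?_, rfl⟩
    rw [add_comm]
    exact comp_mem j i g.1 f.1 hg hf

end cohomology

/-! ### The dg-category of standard holomorphic bundles -/

section holomorphic

variable {τ : ℂ}

/-- `Hom_{A_θ}(E, E')`. -/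
abbrev HolMod.AHom (E E' : HolMod θ τ) : Type := E.carrier →ₗ[(Alg θ)ᵐᵒᵖ] E'.carrier

/-- `φ ↦ (x ↦ ∇(φ(x)) - φ(∇(x)))`. -/
def HolMod.nablaHom (E E' : HolMod θ τ) : E.AHom E' →ₗ[ℂ] E.AHom E' where
  toFun φ :=
    { toFun := fun x => E'.nabla (φ x) - φ (E.nabla x)
      map_add' := fun x y => by simp only [map_add]; abel
      map_smul' := fun a x => by
        have h1 := E'.leibniz (φ x) a.unop
        have h2 := E.leibniz x a.unop
        rw [MulOpposite.op_unop] at h1 h2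
        simp only [map_smul, RingHom.id_apply, h1, h2, map_add, smul_sub]
        abel }
  map_add' φ ψ := LinearMap.ext fun x => by
    simp only [LinearMap.add_apply, LinearMap.coe_mk, AddHom.coe_mk, map_add]; abel
  map_smul' c φ := LinearMap.ext fun x => by
    simp only [LinearMap.smul_apply, LinearMap.coe_mk, AddHom.coe_mk, map_smul, smul_sub,
      RingHom.id_apply]

theorem HolMod.nablaHom_comp {E E' E'' : HolMod θ τ} (ψ : E'.AHom E'') (φ : E.AHom E') :
    E.nablaHom E'' (ψ ∘ₗ φ) = (E'.nablaHom E'' ψ) ∘ₗ φ + ψ ∘ₗ (E.nablaHom E' φ) :=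
  LinearMap.ext fun x => by simp [HolMod.nablaHom]

/-- A shifted holomorphic module `E[n]`. -/
structure ShiftedHol (θ : ℝ) (τ : ℂ) where
  E : HolMod θ τ
  shift : ℤ

/-- The graded space underlying the complex
`Hom(E[n], E'[n']) = (Hom_{A_θ}(E, E') → Hom_{A_θ}(E, E'))[n' - n]`, placed in degrees `n - n'` and
`n - n' + 1`: the pairs of an element of degree `n - n'` and one of degree `n - n' + 1`. -/
abbrev ShiftedHol.Hom (X Y : ShiftedHol θ τ) : Type := X.E.AHom Y.E × X.E.AHom Y.E

/-- The part of degree `i`. -/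
def ShiftedHol.deg (X Y : ShiftedHol θ τ) (i : ℤ) : Submodule ℂ (X.Hom Y) where
  carrier := {f | (i ≠ X.shift - Y.shift → f.1 = 0) ∧ (i ≠ X.shift - Y.shift + 1 → f.2 = 0)}
  add_mem' := by
    rintro f g ⟨h1, h2⟩ ⟨h3, h4⟩
    exact ⟨fun h => by rw [Prod.fst_add, h1 h, h3 h, add_zero],
      fun h => by rw [Prod.snd_add, h2 h, h4 h, add_zero]⟩
  zero_mem' := ⟨fun _ => rfl, fun _ => rfl⟩
  smul_mem' := by
    rintro c f ⟨h1, h2⟩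
    exact ⟨fun h => by rw [Prod.smul_fst, h1 h, smul_zero],
      fun h => by rw [Prod.smul_snd, h2 h, smul_zero]⟩

theorem ShiftedHol.deg_isInternal (X Y : ShiftedHol θ τ) : DirectSum.IsInternal (X.deg Y) := by
  refine (DirectSum.isInternal_submodule_iff_iSupIndep_and_iSup_eq_top _).mpr ⟨?_, ?_⟩
  · rw [iSupIndep_def]
    intro i
    rw [Submodule.disjoint_def]
    rintro ⟨u, v⟩ ⟨h1, h2⟩ hx
    by_cases hi : i = X.shift - Y.shift
    · have hv : v = 0 := h2 (by omega)
      have : (⨆ j, ⨆ (_ : j ≠ i), X.deg Y j) ≤ LinearMap.ker (LinearMap.fst ℂ _ _) :=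
        iSup_le fun j => iSup_le fun hj => fun y hy => hy.1 (by omega)
      exact Prod.ext (this hx) hv
    · have hu : u = 0 := h1 hi
      by_cases hi' : i = X.shift - Y.shift + 1
      · have : (⨆ j, ⨆ (_ : j ≠ i), X.deg Y j) ≤ LinearMap.ker (LinearMap.snd ℂ _ _) :=
          iSup_le fun j => iSup_le fun hj => fun y hy => hy.2 (by omega)
        exact Prod.ext hu (this hx)
      · exact Prod.ext hu (h2 hi')
  · rw [eq_top_iff]
    rintro ⟨u, v⟩ -
    have : ((u, v) : X.Hom Y) = (u, 0) + (0, v) := by simp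
    rw [this]
    exact add_mem
      (Submodule.mem_iSup_of_mem (X.shift - Y.shift) ⟨fun h => absurd rfl h, fun _ => rfl⟩)
      (Submodule.mem_iSup_of_mem (X.shift - Y.shift + 1) ⟨fun _ => rfl, fun h => absurd rfl h⟩)

/-- The dg-category of the `E[n]`; the differential of `Hom(E[n], E'[n'])` is `(-1)^{n'}` times
`φ ↦ ∇φ - φ∇` (the usual sign for shifts), and morphisms are composed as the elements of the
`Hom_{A_θ}(E, E')`, two elements of the upper terms having composition zero. -/
instance : DGCategory (ShiftedHol θ τ) where
  Hom X Y := X.Hom Y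
  deg X Y := X.deg Y
  isInternal X Y := X.deg_isInternal Y
  d X Y := ((Y.shift.negOnePow : ℤ) : ℂ) •
    (LinearMap.inr ℂ _ _ ∘ₗ X.E.nablaHom Y.E ∘ₗ LinearMap.fst ℂ _ _)
  d_mem := by
    rintro X Y i ⟨u, v⟩ ⟨h1, -⟩
    refine Submodule.smul_mem _ _ ⟨fun _ => rfl, fun h => ?_⟩
    have hu : u = 0 := h1 (by omega)
    subst hu
    exact map_zero (X.E.nablaHom Y.E)
  d_d X Y f := by
    simp
  one X := (LinearMap.id, 0)
  one_mem X := ⟨fun h => absurd (sub_self _).symm h, fun _ => rfl⟩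
  comp {X Y Z} := LinearMap.mk₂ ℂ (fun g f => (g.1 ∘ₗ f.1, g.1 ∘ₗ f.2 + g.2 ∘ₗ f.1))
    (fun g g' f => by
      refine Prod.ext ?_ ?_ <;> simp only [Prod.fst_add, Prod.snd_add, LinearMap.add_comp]; abel)
    (fun c g f => by
      refine Prod.ext ?_ ?_ <;>
        simp only [Prod.smul_fst, Prod.smul_snd, LinearMap.smul_comp, smul_add])
    (fun g f f' => by
      refine Prod.ext ?_ ?_ <;> simp only [Prod.fst_add, Prod.snd_add, LinearMap.comp_add]; abel)
    (fun c g f => by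
      refine Prod.ext ?_ ?_ <;> refine LinearMap.ext fun x => ?_ <;>
        simp [LinearMap.map_smul_of_tower])
  comp_mem := by
    rintro X Y Z i j ⟨g, g'⟩ ⟨f, f'⟩ ⟨h1, h2⟩ ⟨h3, h4⟩
    dsimp only at h1 h2 h3 h4
    refine ⟨fun h => ?_, fun h => ?_⟩
    · simp only [LinearMap.mk₂_apply]
      by_cases hi : i = Y.shift - Z.shift
      · rw [h3 (by omega), LinearMap.comp_zero]
      · rw [h1 hi, LinearMap.zero_comp]
    · simp only [LinearMap.mk₂_apply]
      have e1 : g ∘ₗ f' = 0 := by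
        by_cases hi : i = Y.shift - Z.shift
        · rw [h4 (by omega), LinearMap.comp_zero]
        · rw [h1 hi, LinearMap.zero_comp]
      have e2 : g' ∘ₗ f = 0 := by
        by_cases hi : i = Y.shift - Z.shift + 1
        · rw [h3 (by omega), LinearMap.comp_zero]
        · rw [h2 hi, LinearMap.zero_comp]
      rw [e1, e2, add_zero]
  one_comp f := by simp
  comp_one f := by simp
  assoc h g f := by
    simp only [LinearMap.mk₂_apply, LinearMap.comp_assoc, LinearMap.add_comp, LinearMap.comp_add,
      add_assoc]
  leibniz := by
    rintro X Y Z i ⟨g, g'⟩ ⟨f, f'⟩ ⟨h1, h2⟩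
    dsimp only at h1 h2
    refine Prod.ext (by simp) ?_
    by_cases hi : i = Y.shift - Z.shift
    · have e1 : ((i.negOnePow : ℤ) : ℂ) * ((Y.shift.negOnePow : ℤ) : ℂ) =
          ((Z.shift.negOnePow : ℤ) : ℂ) := by
        rw [hi, Int.negOnePow_sub, ← Int.cast_mul, ← Units.val_mul, mul_comm, ← mul_assoc,
          Int.units_mul_self, one_mul]
      have e2 : ∀ (c : ℂ) (φ : X.E.AHom Y.E), g ∘ₗ (c • φ) = c • (g ∘ₗ φ) := fun c φ =>
        LinearMap.ext fun x => by simp [LinearMap.map_smul_of_tower]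
      simp only [LinearMap.mk₂_apply, LinearMap.smul_apply, LinearMap.comp_apply,
        LinearMap.fst_apply, LinearMap.inr_apply, Prod.smul_mk, Prod.mk_add_mk, smul_zero,
        LinearMap.zero_comp, LinearMap.comp_zero, zero_add, add_zero, HolMod.nablaHom_comp,
        LinearMap.smul_comp, e2, smul_smul, e1, smul_add]
    · have hg : g = 0 := h1 hi
      subst hg
      simp [LinearMap.zero_comp]

/-- The objects `E[n]` of the dg-category `𝒞^{st}(θ, τ)`, `E` a standard holomorphic bundle. -/
structure Cst (θ : ℝ) (τ : ℂ) where
  E : StdBundle θ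
  shift : ℤ

/-- `𝒞^{st}(θ, τ)` as a full dg-subcategory. -/
instance : DGCategory (Cst θ τ) :=
  DGCategory.induced fun X => (⟨X.E.toHolMod τ, X.shift⟩ : ShiftedHol θ τ)

end holomorphic

end

end NCTorus

/-!
The equivalence is obtained by describing the cohomology category in terms that do not depend on
`θ`: every class of morphisms has a numerical invariant, and the composition of invariants is given
by formulas in which `θ` does not occur. Only the degree of a class depends on `θ`, through the
signs of the ranks, and a shift of the objects corrects it.

*Kernels.* For a primitive vector `v = (n, m)`, of either sign of the rank `n + mθ`, the modules of
class `v` are identified with the space `Ker θ Ray.unit v` of rapidly decreasing functions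
`κ(u, t)` on `ℤ² × ℝ` with two periodicities (`Chart`, `trivialChart`, `schwartzChart`). The algebra
itself is `Ker θ Ray.unit Ray.unit`, by Fourier series, and its action is the composition of kernels
`comp`. Since the identity of every class factors through a free module (`exists_frame`), every
module homomorphism is the composition with a unique kernel in `Ker θ v v'`
(`Chart.hom_bijective`). The holomorphic structure becomes a first order differential equation in
`t` (`nab`), with the Leibniz rule `nab_comp`. As `Ker θ v v'` depends on `v'` only up to sign, a
bundle may be given the class `-v` of negative rank (`Chart.neg`).

*Cohomology.* Let `d = det(v, v')`. If `d ≠ 0`, the equation is that of a Gaussian on each line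
`{u} × ℝ`, and the sign of the difference of slopes `d / (r r')` decides: if it is positive, the
Gaussians decrease, the kernel of `nab` consists of the products of a Gaussian with a function on
`ℤ²/(ℤw + ℤw')` (`coef0`), and `nab` is surjective; if it is negative, `nab` is injective and its
cokernel is detected by the integral against the inverse of the Gaussian (`coef1`). In both cases
the cohomology is the space of functions on a group with `|d|` elements. If `v = v'`, the equation
has constant coefficients on each line; there is no cohomology unless the numbers `r z` of the two
bundles agree modulo `ℤτ + ℤ`, in which case the bundles are isomorphic and the cohomology is
spanned by the identity in degree `0` and detected by a trace in degree `1`.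

*Composition.* A holomorphic structure on a bundle of rank `r` is described by `ζ = r z`, and by a
choice of representatives two bundles are isomorphic only if they have the same `Base` `(v, ζ)`. The
product of two Gaussians is a Gaussian multiplied by a theta-type factor `theta`, and completing the
square shows that this factor depends on the classes, on `τ` and on the `ζ`, but not on `θ`
(`gaussK_mul`). Hence the composition of invariants is the operation `invComp`, free of `θ`
(`inv_comp`).

*Degrees.* At another irrational number `θ₀`, a primitive vector may have a rank of the opposite
sign. All classes are represented by the vector of positive rank at `θ₀`, and an object is shifted
if this vector has negative rank at `θ`; by `degree_shift` the degrees of the morphisms then agree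
with those at `θ₀`. So the two categories have the same bases, shifts, invariants, composition and
degrees (`cstInvSystem`), and this determines a graded category up to equivalence
(`InvSystem.nonempty_gradedEquivalence`).
-/

namespace NCTorus

noncomputable section

/-! ### Primitive vectors -/

/-- A primitive vector `(n, m)` of `ℤ²`, the numerical class of a standard bundle. -/
@[ext] structure Ray where
  n : ℤ
  m : ℤ
  coprime : IsCoprime m n

namespace Ray

/-- The generator `(-n, m)` of the kernel of `Ray.ell`. -/
def w (v : Ray) : ℤ × ℤ := (-v.n, v.m)

/-- The linear form `(k, γ) ↦ mk + nγ`. -/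
def ell (v : Ray) (u : ℤ × ℤ) : ℤ := v.m * u.1 + v.n * u.2

/-- The rank `n + mθ`, of either sign. -/
def rk (v : Ray) (θ : ℝ) : ℝ := v.n + v.m * θ

/-- The determinant of two vectors. -/
def det (v v' : Ray) : ℤ := v.n * v'.m - v'.n * v.m

theorem exists_sec (v : Ray) : ∃ u : ℤ × ℤ, v.ell u = 1 := by
  obtain ⟨a, b, h⟩ := v.coprime
  exact ⟨(a, b), by simp only [ell]; linarith⟩

/-- A chosen vector on which the linear form `ell` takes the value `1`. -/
def sec (v : Ray) : ℤ × ℤ := v.exists_sec.choose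

@[simp] theorem ell_sec (v : Ray) : v.ell v.sec = 1 := v.exists_sec.choose_spec

@[simp] theorem ell_zero (v : Ray) : v.ell 0 = 0 := by simp [ell]
theorem ell_add (v : Ray) (a b : ℤ × ℤ) : v.ell (a + b) = v.ell a + v.ell b := by
  simp only [ell, Prod.fst_add, Prod.snd_add]; ring
theorem ell_sub (v : Ray) (a b : ℤ × ℤ) : v.ell (a - b) = v.ell a - v.ell b := by
  simp only [ell, Prod.fst_sub, Prod.snd_sub]; ring
theorem ell_smul (v : Ray) (j : ℤ) (a : ℤ × ℤ) : v.ell (j • a) = j * v.ell a := by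
  simp only [ell, Prod.smul_fst, Prod.smul_snd, smul_eq_mul]; ring
theorem ell_smul_sec (v : Ray) (j : ℤ) : v.ell (j • v.sec) = j := by
  rw [ell_smul, ell_sec, mul_one]
@[simp] theorem ell_w (v v' : Ray) : v.ell v'.w = v.det v' := by
  simp only [ell, w, det]; ring
@[simp] theorem det_self (v : Ray) : v.det v = 0 := by simp [det]
theorem det_swap (v v' : Ray) : v'.det v = -v.det v' := by simp only [det]; ring

/-- The kernel of `ell` is generated by `w`. -/
theorem exists_of_ell_eq_zero (v : Ray) {u : ℤ × ℤ} (h : v.ell u = 0) : ∃ i : ℤ, u = i • v.w := by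
  obtain ⟨a, b, hab⟩ := v.coprime
  refine ⟨a * u.2 - b * u.1, Prod.ext ?_ ?_⟩
  · simp only [ell] at h
    simp only [w, Prod.smul_fst, smul_eq_mul]
    linear_combination (-u.1) * hab + a * h
  · simp only [ell] at h
    simp only [w, Prod.smul_snd, smul_eq_mul]
    linear_combination (-u.2) * hab + b * h

theorem exists_eq_sec_add (v : Ray) (u : ℤ × ℤ) : ∃ i : ℤ, u = v.ell u • v.sec + i • v.w := by
  obtain ⟨i, hi⟩ := v.exists_of_ell_eq_zero (u := u - v.ell u • v.sec)
    (by rw [ell_sub, ell_smul, ell_sec]; ring)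
  exact ⟨i, by rw [← hi]; abel⟩

/-- The rank of a primitive vector is nonzero at an irrational parameter. -/
theorem rk_ne (v : Ray) {θ : ℝ} [h : Fact (Irrational θ)] : v.rk θ ≠ 0 := by
  intro h0
  by_cases hm : v.m = 0
  · have hn : v.n = 0 := by simpa [rk, hm] using h0
    have := v.coprime
    rw [hm, hn] at this
    exact not_isCoprime_zero_zero this
  · have := (h.out.intCast_mul hm).intCast_add v.n
    exact this.ne_zero h0

end Ray

theorem periodic_zsmul {α : Type*} {F : ℤ × ℤ → α} {w : ℤ × ℤ} (h : ∀ u, F (u + w) = F u) (i : ℤ)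
    (u : ℤ × ℤ) : F (u + i • w) = F u := by
  have h' : Function.Periodic F w := h
  exact (h'.zsmul i) u

/-- A function on `ℤ²/ℤw` is determined by its values on the multiples of `sec`, as `ell` identifies
`ℤ²/ℤw` with `ℤ`. -/
theorem eq_ell_smul_sec {α : Type*} {F : ℤ × ℤ → α} (v : Ray) (h : ∀ u, F (u + v.w) = F u)
    (u : ℤ × ℤ) : F u = F (v.ell u • v.sec) := by
  obtain ⟨i, hi⟩ := v.exists_eq_sec_add u
  conv_lhs => rw [hi]
  exact periodic_zsmul h i _

/-- The sum over `ℤ²/ℤw` does not change under translations. -/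
theorem tsum_sec_add {F : ℤ × ℤ → ℂ} (v : Ray) (h : ∀ u, F (u + v.w) = F u) (a : ℤ × ℤ) :
    ∑' j : ℤ, F (j • v.sec + a) = ∑' j : ℤ, F (j • v.sec) := by
  rw [← (Equiv.addRight (v.ell a)).tsum_eq fun j : ℤ => F (j • v.sec)]
  refine tsum_congr fun j => ?_
  rw [eq_ell_smul_sec v h, Ray.ell_add, Ray.ell_smul, Ray.ell_sec, mul_one]
  rfl

/-! ### Rapidly decreasing kernels -/

/-- Families of functions on `ℝ` indexed by `ℤ²`. -/
abbrev Fn : Type := ℤ × ℤ → ℝ → ℂ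

/-- Rapid decrease in terms of a weight function, uniformly on all lines `{u} × ℝ`. -/
def Rap (q : ℤ × ℤ → ℝ → ℝ) (κ : Fn) : Prop :=
  ∀ N : ℕ, ∃ C : ℝ, ∀ u t, (1 + |q u t|) ^ N * ‖κ u t‖ ≤ C

/-- `Sch q j κ`: the first `j` derivatives of `κ` exist and, like `κ`, decrease rapidly. -/
def Sch (q : ℤ × ℤ → ℝ → ℝ) : ℕ → Fn → Prop
  | 0, κ => Rap q κ
  | j + 1, κ => Rap q κ ∧ ∃ κ' : Fn, (∀ u t, HasDerivAt (κ u) (κ' u t) t) ∧ Sch q j κ'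

section rap

variable {q : ℤ × ℤ → ℝ → ℝ}

theorem Rap.add {κ κ' : Fn} (h : Rap q κ) (h' : Rap q κ') : Rap q (κ + κ') := by
  intro N
  obtain ⟨C, hC⟩ := h N
  obtain ⟨C', hC'⟩ := h' N
  refine ⟨C + C', fun u t => ?_⟩
  calc _ ≤ (1 + |q u t|) ^ N * (‖κ u t‖ + ‖κ' u t‖) := by gcongr; exact norm_add_le _ _
    _ ≤ _ := by rw [mul_add]; exact add_le_add (hC u t) (hC' u t)

theorem Rap.smul {κ : Fn} (c : ℂ) (h : Rap q κ) : Rap q (c • κ) := by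
  intro N
  obtain ⟨C, hC⟩ := h N
  refine ⟨‖c‖ * C, fun u t => ?_⟩
  calc _ = ‖c‖ * ((1 + |q u t|) ^ N * ‖κ u t‖) := by simp; ring
    _ ≤ _ := by gcongr; exact hC u t

theorem Rap.zero : Rap q 0 := fun N => ⟨0, fun u t => by simp⟩

theorem Rap.mul_q {κ : Fn} (h : Rap q κ) : Rap q (fun u t => q u t * κ u t) := by
  intro N
  obtain ⟨C, hC⟩ := h (N + 1)
  refine ⟨C, fun u t => le_trans ?_ (hC u t)⟩
  rw [norm_mul, Complex.norm_real, Real.norm_eq_abs, pow_succ, mul_assoc]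
  gcongr
  linarith [abs_nonneg (q u t)]

theorem Sch.rap {j : ℕ} {κ : Fn} (h : Sch q j κ) : Rap q κ := by
  cases j with
  | zero => exact h
  | succ j => exact h.1

theorem Sch.add {j : ℕ} : ∀ {κ κ' : Fn}, Sch q j κ → Sch q j κ' → Sch q j (κ + κ') := by
  induction j with
  | zero => exact fun h h' => Rap.add h h'
  | succ j ih =>
    rintro κ κ' ⟨h, d, hd, hj⟩ ⟨h', d', hd', hj'⟩
    exact ⟨h.add h', d + d', fun u t => (hd u t).add (hd' u t), ih hj hj'⟩

theorem Sch.smul (c : ℂ) {j : ℕ} : ∀ {κ : Fn}, Sch q j κ → Sch q j (c • κ) := by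
  induction j with
  | zero => exact fun h => Rap.smul c h
  | succ j ih =>
    rintro κ ⟨h, d, hd, hj⟩
    exact ⟨h.smul c, c • d, fun u t => (hd u t).const_mul c, ih hj⟩

theorem Sch.zero (j : ℕ) : Sch q j 0 := by
  induction j with
  | zero => exact Rap.zero
  | succ j ih => exact ⟨Rap.zero, 0, fun u t => hasDerivAt_const t 0, ih⟩

theorem Sch.of_succ {j : ℕ} : ∀ {κ : Fn}, Sch q (j + 1) κ → Sch q j κ := by
  induction j with
  | zero => exact fun h => h.1
  | succ j ih =>
    rintro κ ⟨h, d, hd, hj⟩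
    exact ⟨h, d, hd, ih hj⟩

theorem Sch.mul_q {D : ℝ} (hq : ∀ u t, HasDerivAt (q u) D t) {j : ℕ} :
    ∀ {κ : Fn}, Sch q j κ → Sch q j (fun u t => q u t * κ u t) := by
  induction j with
  | zero => exact fun h => Rap.mul_q h
  | succ j ih =>
    rintro κ ⟨h, d, hd, hj⟩
    refine ⟨h.mul_q, (D : ℂ) • κ + fun u t => q u t * d u t, fun u t => ?_, ?_⟩
    · exact (hq u t).ofReal_comp.mul (hd u t)
    · exact Sch.add (Sch.smul _ (Sch.of_succ (j := j) ⟨h, d, hd, hj⟩)) (ih hj)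

/-- Regularity of rapidly decreasing solutions of a first-order linear equation. -/
theorem Sch.of_hasDerivAt {D : ℝ} (hq : ∀ u t, HasDerivAt (q u) D t) {κ h : Fn} (A B : ℂ)
    (hκ : Rap q κ) (hh : ∀ j, Sch q j h)
    (hd : ∀ u t, HasDerivAt (κ u) (h u t + (A * q u t + B) * κ u t) t) (j : ℕ) : Sch q j κ := by
  induction j with
  | zero => exact hκ
  | succ j ih =>
    refine ⟨hκ, h + (A • (fun u t => q u t * κ u t) + B • κ), fun u t => ?_,
      (hh j).add (((ih.mul_q hq).smul A).add (ih.smul B))⟩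
    refine (hd u t).congr_deriv ?_
    simp only [Pi.add_apply, Pi.smul_apply, smul_eq_mul]; ring

/-- The derivative of a family of functions. -/
def dF (κ : Fn) : Fn := fun u => deriv (κ u)

theorem Sch.hasDerivAt {κ : Fn} (h : ∀ j, Sch q j κ) (u : ℤ × ℤ) (t : ℝ) :
    HasDerivAt (κ u) (dF κ u t) t := by
  obtain ⟨-, d, hd, -⟩ := h 1
  exact (hd u t).differentiableAt.hasDerivAt

theorem Sch.dF {κ : Fn} (h : ∀ j, Sch q j κ) (j : ℕ) : Sch q j (dF κ) := by
  obtain ⟨-, d, hd, hj⟩ := h (j + 1)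
  have : NCTorus.dF κ = d := funext fun u => funext fun t => (hd u t).deriv
  rwa [this]

theorem Sch.continuous {κ : Fn} (h : ∀ j, Sch q j κ) (u : ℤ × ℤ) : Continuous (κ u) :=
  continuous_iff_continuousAt.mpr fun t => (Sch.hasDerivAt h u t).continuousAt

theorem Rap.exists_bound {κ : Fn} (h : Rap q κ) (N : ℕ) :
    ∃ C, 0 ≤ C ∧ ∀ u t, (1 + |q u t|) ^ N * ‖κ u t‖ ≤ C := by
  obtain ⟨C, hC⟩ := h N
  exact ⟨C, le_trans (by positivity) (hC 0 0), hC⟩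

end rap

/-! ### The spaces of kernels -/

/-- The height `k - θγ` of the vector `(k, γ)`; in compositions of kernels, the vector acts on the
variable `t` as the translation by its height. -/
def off (θ : ℝ) (u : ℤ × ℤ) : ℝ := u.1 - θ * u.2

theorem off_add (θ : ℝ) (a b : ℤ × ℤ) : off θ (a + b) = off θ a + off θ b := by
  simp only [off, Prod.fst_add, Prod.snd_add]; push_cast; ring
theorem off_neg (θ : ℝ) (a : ℤ × ℤ) : off θ (-a) = -off θ a := by
  simp only [off, Prod.fst_neg, Prod.snd_neg]; push_cast; ring
@[simp] theorem off_zero (θ : ℝ) : off θ 0 = 0 := by simp [off]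
@[simp] theorem off_w (θ : ℝ) (v : Ray) : off θ v.w = -v.rk θ := by
  simp only [off, Ray.w, Ray.rk]; push_cast; ring

/-- The difference of the slopes of two vectors. -/
def slope (θ : ℝ) (v v' : Ray) : ℝ := v.det v' / (v.rk θ * v'.rk θ)

/-- The affine function of `t` that measures the decrease of kernels from `v` to `v'`. -/
def wgt (θ : ℝ) (v v' : Ray) (u : ℤ × ℤ) (t : ℝ) : ℝ := slope θ v v' * t - v.ell u / v.rk θ

theorem hasDerivAt_wgt (θ : ℝ) (v v' : Ray) (u : ℤ × ℤ) (t : ℝ) :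
    HasDerivAt (wgt θ v v' u) (slope θ v v') t := by
  have := ((hasDerivAt_id t).const_mul (slope θ v v')).sub_const (v.ell u / v.rk θ)
  rw [mul_one] at this
  exact this

theorem slope_swap (θ : ℝ) (v v' : Ray) : slope θ v' v = -slope θ v v' := by
  simp only [slope, Ray.det_swap v v', mul_comm (v'.rk θ)]; push_cast; ring

theorem slope_self (θ : ℝ) (v : Ray) : slope θ v v = 0 := by simp [slope]

section weights

theorem wgt_per1 {θ : ℝ} (v v' : Ray) (u : ℤ × ℤ) (t : ℝ) :
    wgt θ v v' (u + v.w) t = wgt θ v v' u t := by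
  simp [wgt, Ray.ell_add]

variable {θ : ℝ} [Fact (Irrational θ)]

theorem slope_add (v₁ v₂ v₃ : Ray) : slope θ v₁ v₃ = slope θ v₂ v₃ + slope θ v₁ v₂ := by
  have h1 := v₁.rk_ne (θ := θ); have h2 := v₂.rk_ne (θ := θ); have h3 := v₃.rk_ne (θ := θ)
  simp only [slope]
  field_simp
  simp only [Ray.det, Ray.rk]; push_cast; ring

/-- Weights add up under the composition of kernels. This is the reason both for the decrease of
compositions and for the Leibniz rule. -/
theorem wgt_add (v₁ v₂ v₃ : Ray) (U u : ℤ × ℤ) (t : ℝ) :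
    wgt θ v₁ v₃ U t = wgt θ v₂ v₃ u t + wgt θ v₁ v₂ (U - u) (t + off θ u) := by
  have h1 := v₁.rk_ne (θ := θ); have h2 := v₂.rk_ne (θ := θ); have h3 := v₃.rk_ne (θ := θ)
  simp only [wgt, slope_add v₁ v₂ v₃, Ray.ell_sub]
  have : slope θ v₁ v₂ * off θ u = v₂.ell u / v₂.rk θ - v₁.ell u / v₁.rk θ := by
    simp only [slope]
    field_simp
    simp only [Ray.det, Ray.rk, Ray.ell, off]; push_cast; ring
  rw [mul_add, this]; push_cast; ring

theorem wgt_per2 (v v' : Ray) (u : ℤ × ℤ) (t : ℝ) :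
    wgt θ v v' (u + v'.w) (t + v'.rk θ) = wgt θ v v' u t := by
  have h1 := v.rk_ne (θ := θ); have h2 := v'.rk_ne (θ := θ)
  simp only [wgt, Ray.ell_add, Ray.ell_w, slope]
  push_cast
  field_simp
  ring

end weights

/-- The kernels of the module homomorphisms from the bundles of class `v` to those of class `v'`:
smooth families of functions `κ(u, t)`, `u ∈ ℤ²`, that are invariant under `u ↦ u + w` and
`(u, t) ↦ (u + w', t + r')`, all of whose derivatives decrease rapidly. -/
def Ker (θ : ℝ) (v v' : Ray) : Submodule ℂ Fn where
  carrier := {κ | (∀ u t, κ (u + v.w) t = κ u t) ∧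
    (∀ u t, κ (u + v'.w) (t + v'.rk θ) = κ u t) ∧ ∀ j, Sch (wgt θ v v') j κ}
  add_mem' := by
    rintro κ κ' ⟨h1, h2, h3⟩ ⟨h1', h2', h3'⟩
    refine ⟨fun u t => ?_, fun u t => ?_, fun j => (h3 j).add (h3' j)⟩
    · simp only [Pi.add_apply, h1, h1']
    · simp only [Pi.add_apply, h2, h2']
  zero_mem' := ⟨fun _ _ => rfl, fun _ _ => rfl, fun j => Sch.zero j⟩
  smul_mem' := by
    rintro c κ ⟨h1, h2, h3⟩
    refine ⟨fun u t => ?_, fun u t => ?_, fun j => (h3 j).smul c⟩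
    · simp only [Pi.smul_apply, h1]
    · simp only [Pi.smul_apply, h2]

section ker

variable {θ : ℝ} {v v' : Ray} {κ : Fn}

theorem Ker.per1 (h : κ ∈ Ker θ v v') (u : ℤ × ℤ) (t : ℝ) : κ (u + v.w) t = κ u t := h.1 u t
theorem Ker.per2 (h : κ ∈ Ker θ v v') (u : ℤ × ℤ) (t : ℝ) :
    κ (u + v'.w) (t + v'.rk θ) = κ u t := h.2.1 u t
theorem Ker.sch (h : κ ∈ Ker θ v v') (j : ℕ) : Sch (wgt θ v v') j κ := h.2.2 j
theorem Ker.rap (h : κ ∈ Ker θ v v') : Rap (wgt θ v v') κ := h.2.2 0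
theorem Ker.hasDerivAt (h : κ ∈ Ker θ v v') (u : ℤ × ℤ) (t : ℝ) :
    HasDerivAt (κ u) (dF κ u t) t := Sch.hasDerivAt h.2.2 u t
theorem Ker.continuous (h : κ ∈ Ker θ v v') (u : ℤ × ℤ) : Continuous (κ u) :=
  Sch.continuous h.2.2 u

theorem Ker.dF (h : κ ∈ Ker θ v v') : dF κ ∈ Ker θ v v' := by
  refine ⟨fun u t => ?_, fun u t => ?_, Sch.dF h.2.2⟩
  · have : κ (u + v.w) = κ u := funext fun t => Ker.per1 h u t
    simp only [NCTorus.dF, this]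
  · have : κ u = fun t => κ (u + v'.w) (t + v'.rk θ) := funext fun t => (Ker.per2 h u t).symm
    simp only [NCTorus.dF]
    conv_rhs => rw [this]
    rw [deriv_comp_add_const]

theorem Ker.mul_wgt [Fact (Irrational θ)] (h : κ ∈ Ker θ v v') :
    (fun u t => wgt θ v v' u t * κ u t) ∈ Ker θ v v' := by
  refine ⟨fun u t => ?_, fun u t => ?_, fun j => (h.2.2 j).mul_q (hasDerivAt_wgt θ v v')⟩
  · simp only [wgt_per1, Ker.per1 h]
  · simp only [wgt_per2, Ker.per2 h]

/-- The holomorphic structure on kernels from a bundle with parameter `z` to one with parameter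
`z + δ`. -/
def nab (θ : ℝ) (τ δ : ℂ) (v v' : Ray) (κ : Fn) : Fn :=
  dF κ + (2 * Real.pi * Complex.I) • (τ • (fun u t => wgt θ v v' u t * κ u t) + δ • κ)

theorem Ker.nab [Fact (Irrational θ)] (h : κ ∈ Ker θ v v') (τ δ : ℂ) :
    nab θ τ δ v v' κ ∈ Ker θ v v' :=
  add_mem (Ker.dF h) (Submodule.smul_mem _ _
    (add_mem (Submodule.smul_mem _ _ (Ker.mul_wgt h)) (Submodule.smul_mem _ _ h)))

end ker

/-! ### Composition of kernels -/

/-- The composition of a kernel `κ` from `v` with a kernel to `v`: a sum over `ℤ²/ℤw`, whose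
elements are represented by the multiples of `v.sec`. -/
def comp (θ : ℝ) (v : Ray) (κ κ' : Fn) : Fn := fun U t =>
  ∑' j : ℤ, κ (j • v.sec) t * κ' (U - j • v.sec) (t + off θ (j • v.sec))

theorem summable_inv_sq : Summable fun n : ℤ => ((1 + |(n : ℝ)|) ^ 2)⁻¹ := by
  have h0 : Summable fun n : ℤ => 1 / |(n : ℝ)| ^ (2 : ℝ) :=
    (Real.summable_abs_int_rpow (b := 2) (by norm_num)).congr fun n => by
      rw [Real.rpow_neg (abs_nonneg _)]; simp
  refine Summable.of_norm_bounded_eventually h0 ?_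
  rw [Filter.eventually_cofinite]
  refine (Set.finite_singleton (0 : ℤ)).subset fun n hn => ?_
  by_contra hne
  apply hn
  have hpos : 0 < |(n : ℝ)| := abs_pos.mpr (by exact_mod_cast hne)
  rw [Real.norm_of_nonneg (by positivity), one_div, Real.rpow_two]
  gcongr
  linarith

/-- Comparison with the distance to the nearest integer below, which makes the estimates of sums
over `j` uniform in `x`. -/
theorem inv_sq_le (r : ℝ) (hr : r ≠ 0) (x : ℝ) (j : ℤ) :
    ((1 + |x - j / r|) ^ 2)⁻¹ ≤ (2 + |r|) ^ 2 * ((1 + |((j - ⌊x * r⌋ : ℤ) : ℝ)|) ^ 2)⁻¹ := by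
  have hr' : 0 < |r| := abs_pos.mpr hr
  have h1 : |((j - ⌊x * r⌋ : ℤ) : ℝ)| ≤ |x * r - j| + 1 := by
    have a1 := Int.floor_le (x * r)
    have a2 := Int.lt_floor_add_one (x * r)
    have : ((j - ⌊x * r⌋ : ℤ) : ℝ) = -(x * r - j) + (x * r - ⌊x * r⌋) := by push_cast; ring
    rw [this]
    refine (abs_add_le _ _).trans ?_
    rw [abs_neg]
    gcongr
    rw [abs_le]; constructor <;> linarith
  have h2 : |x * r - j| = |x - j / r| * |r| := by
    rw [← abs_mul]; congr 1; field_simp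
  have h3 : 1 + |((j - ⌊x * r⌋ : ℤ) : ℝ)| ≤ (2 + |r|) * (1 + |x - j / r|) := by
    rw [h2] at h1
    nlinarith [abs_nonneg (x - j / r)]
  rw [inv_le_iff_one_le_mul₀ (by positivity), ← div_eq_mul_inv, div_mul_eq_mul_div,
    le_div_iff₀ (by positivity), one_mul, ← mul_pow]
  gcongr

theorem summable_shift (r : ℝ) (hr : r ≠ 0) (x : ℝ) :
    Summable fun j : ℤ => ((1 + |x - j / r|) ^ 2)⁻¹ := by
  refine Summable.of_nonneg_of_le (fun j => by positivity) (inv_sq_le r hr x) ?_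
  exact (((Equiv.subRight ⌊x * r⌋).summable_iff).mpr summable_inv_sq).mul_left _

theorem tsum_shift_le (r : ℝ) (hr : r ≠ 0) : ∃ C, ∀ x : ℝ,
    ∑' j : ℤ, ((1 + |x - j / r|) ^ 2)⁻¹ ≤ C := by
  refine ⟨∑' n : ℤ, (2 + |r|) ^ 2 * ((1 + |(n : ℝ)|) ^ 2)⁻¹, fun x => ?_⟩
  rw [← (Equiv.subRight ⌊x * r⌋).tsum_eq fun n : ℤ => (2 + |r|) ^ 2 * ((1 + |(n : ℝ)|) ^ 2)⁻¹]
  exact (summable_shift r hr x).tsum_le_tsum (inv_sq_le r hr x)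
    ((((Equiv.subRight ⌊x * r⌋).summable_iff).mpr summable_inv_sq).mul_left _)

theorem summable_prod_shift {r r' : ℝ} (hr : r ≠ 0) (hr' : r' ≠ 0) (x : ℝ) (y : ℤ → ℝ)
    {a b c : ℝ} (ha : 0 ≤ a) (hb : 0 ≤ b) (hc : 0 ≤ c) : Summable fun p : ℤ × ℤ =>
      a * ((1 + |x - p.1 / r'|) ^ 2)⁻¹ * (b * ((1 + |y p.1 - p.2 / r|) ^ 2)⁻¹ * c) := by
  obtain ⟨S, hS⟩ := tsum_shift_le r hr
  have h1 : ∀ j : ℤ, Summable fun i : ℤ => a * ((1 + |x - j / r'|) ^ 2)⁻¹ *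
      (b * ((1 + |y j - i / r|) ^ 2)⁻¹ * c) := fun j =>
    (((summable_shift r hr (y j)).mul_left b).mul_right c).mul_left _
  refine (summable_prod_of_nonneg fun p => ?_).mpr ⟨h1, ?_⟩
  · show (0 : ℝ) ≤ _
    positivity
  refine Summable.of_nonneg_of_le (fun j => tsum_nonneg fun i => by positivity) (fun j => ?_)
    (((summable_shift r' hr' x).mul_left a).mul_right (b * S * c))
  show ∑' i : ℤ, a * ((1 + |x - j / r'|) ^ 2)⁻¹ * (b * ((1 + |y j - i / r|) ^ 2)⁻¹ * c) ≤ _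
  rw [tsum_mul_left, tsum_mul_right, tsum_mul_left]
  have := hS (y j)
  gcongr

section composition

variable {θ : ℝ} {v₁ v₂ v₃ v₄ : Ray}

theorem wgt_sec (v v' : Ray) (j : ℤ) (t : ℝ) :
    wgt θ v v' (j • v.sec) t = slope θ v v' * t - j / v.rk θ := by
  rw [wgt, Ray.ell_smul, Ray.ell_sec, mul_one]

theorem norm_le_of_rap {q : ℤ × ℤ → ℝ → ℝ} {κ : Fn} {C : ℝ} {N : ℕ}
    (h : ∀ u t, (1 + |q u t|) ^ N * ‖κ u t‖ ≤ C) (u : ℤ × ℤ) (t : ℝ) :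
    ‖κ u t‖ ≤ C * ((1 + |q u t|) ^ N)⁻¹ := by
  rw [← div_eq_mul_inv, le_div_iff₀ (by positivity), mul_comm]; exact h u t

theorem comp_smul_left (c : ℂ) (κ κ' : Fn) : comp θ v₂ (c • κ) κ' = c • comp θ v₂ κ κ' := by
  funext U t
  simp only [comp, Pi.smul_apply, smul_eq_mul, mul_assoc, tsum_mul_left]

theorem comp_smul_right (c : ℂ) (κ κ' : Fn) : comp θ v₂ κ (c • κ') = c • comp θ v₂ κ κ' := by
  funext U t
  simp only [comp, Pi.smul_apply, smul_eq_mul, mul_left_comm _ c, tsum_mul_left]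

/-- The terms of a composition depend only on the class in `ℤ²/ℤw`. -/
theorem comp_term_per {κ κ' : Fn} (h : κ ∈ Ker θ v₂ v₃) (h' : κ' ∈ Ker θ v₁ v₂) (U u : ℤ × ℤ)
    (t : ℝ) : κ (u + v₂.w) t * κ' (U - (u + v₂.w)) (t + off θ (u + v₂.w)) =
      κ u t * κ' (U - u) (t + off θ u) := by
  rw [Ker.per1 h, ← Ker.per2 h' (U - (u + v₂.w)) (t + off θ (u + v₂.w)), off_add, off_w]
  congr 2
  · abel_nf
  · ring

variable [Fact (Irrational θ)]

/-- The basic estimate for the terms of a composition. -/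
theorem comp_term_le {κ κ' : Fn} (h : Rap (wgt θ v₂ v₃) κ) (h' : Rap (wgt θ v₁ v₂) κ') (N : ℕ) :
    ∃ C, 0 ≤ C ∧ ∀ U u t, (1 + |wgt θ v₁ v₃ U t|) ^ N * ‖κ u t * κ' (U - u) (t + off θ u)‖ ≤
      C * ((1 + |wgt θ v₂ v₃ u t|) ^ 2)⁻¹ := by
  obtain ⟨C, hC0, hC⟩ := h.exists_bound (N + 2)
  obtain ⟨C', hC0', hC'⟩ := h'.exists_bound N
  refine ⟨C * C', by positivity, fun U u t => ?_⟩
  rw [← div_eq_mul_inv, le_div_iff₀ (by positivity), norm_mul]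
  set a := wgt θ v₂ v₃ u t
  set b := wgt θ v₁ v₂ (U - u) (t + off θ u)
  have h1 : 1 + |wgt θ v₁ v₃ U t| ≤ (1 + |a|) * (1 + |b|) := by
    rw [wgt_add v₁ v₂ v₃ U u t]
    have := abs_add_le a b
    nlinarith [mul_nonneg (abs_nonneg a) (abs_nonneg b)]
  calc _ ≤ ((1 + |a|) * (1 + |b|)) ^ N * (‖κ u t‖ * ‖κ' (U - u) (t + off θ u)‖)
        * (1 + |a|) ^ 2 := by gcongr
    _ = ((1 + |a|) ^ (N + 2) * ‖κ u t‖) * ((1 + |b|) ^ N * ‖κ' (U - u) (t + off θ u)‖) := by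
      rw [mul_pow]; ring
    _ ≤ _ := mul_le_mul (hC u t) (hC' _ _) (by positivity) hC0

theorem comp_summable {κ κ' : Fn} (h : Rap (wgt θ v₂ v₃) κ) (h' : Rap (wgt θ v₁ v₂) κ')
    (U : ℤ × ℤ) (t : ℝ) : Summable fun j : ℤ =>
      ‖κ (j • v₂.sec) t * κ' (U - j • v₂.sec) (t + off θ (j • v₂.sec))‖ := by
  obtain ⟨C, -, hC⟩ := comp_term_le h h' 0
  refine Summable.of_nonneg_of_le (fun j => norm_nonneg _) (fun j => ?_)
    ((summable_shift (v₂.rk θ) v₂.rk_ne (slope θ v₂ v₃ * t)).mul_left C)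
  have := hC U (j • v₂.sec) t
  rwa [pow_zero, one_mul, wgt_sec] at this

theorem Rap.comp {κ κ' : Fn} (h : Rap (wgt θ v₂ v₃) κ) (h' : Rap (wgt θ v₁ v₂) κ') :
    Rap (wgt θ v₁ v₃) (comp θ v₂ κ κ') := by
  intro N
  obtain ⟨C, hC0, hC⟩ := comp_term_le h h' N
  obtain ⟨S, hS⟩ := tsum_shift_le (v₂.rk θ) v₂.rk_ne
  refine ⟨C * S, fun U t => ?_⟩
  have hs := (summable_shift (v₂.rk θ) v₂.rk_ne (slope θ v₂ v₃ * t)).mul_left C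
  have h0 : 0 ≤ (1 + |wgt θ v₁ v₃ U t|) ^ N := by positivity
  have h1 : (1 + |wgt θ v₁ v₃ U t|) ^ N * ‖NCTorus.comp θ v₂ κ κ' U t‖ =
      ‖(((1 + |wgt θ v₁ v₃ U t|) ^ N : ℝ) : ℂ) * NCTorus.comp θ v₂ κ κ' U t‖ := by
    rw [norm_mul, Complex.norm_real, Real.norm_of_nonneg h0]
  rw [h1, NCTorus.comp, ← tsum_mul_left]
  refine (tsum_of_norm_bounded hs.hasSum fun j => ?_).trans ?_
  · rw [norm_mul, Complex.norm_real, Real.norm_of_nonneg h0, ← wgt_sec]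
    exact hC U (j • v₂.sec) t
  · rw [tsum_mul_left]
    exact mul_le_mul_of_nonneg_left (hS _) hC0

theorem comp_add_left {κ κ₂ κ' : Fn} (h : Rap (wgt θ v₂ v₃) κ) (h₂ : Rap (wgt θ v₂ v₃) κ₂)
    (h' : Rap (wgt θ v₁ v₂) κ') :
    comp θ v₂ (κ + κ₂) κ' = comp θ v₂ κ κ' + comp θ v₂ κ₂ κ' := by
  funext U t
  simp only [comp, Pi.add_apply, add_mul]
  exact (comp_summable h h' U t).of_norm.tsum_add (comp_summable h₂ h' U t).of_norm

theorem comp_add_right {κ κ₂ κ' : Fn} (h' : Rap (wgt θ v₂ v₃) κ') (h : Rap (wgt θ v₁ v₂) κ)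
    (h₂ : Rap (wgt θ v₁ v₂) κ₂) :
    comp θ v₂ κ' (κ + κ₂) = comp θ v₂ κ' κ + comp θ v₂ κ' κ₂ := by
  funext U t
  simp only [comp, Pi.add_apply, mul_add]
  exact (comp_summable h' h U t).of_norm.tsum_add (comp_summable h' h₂ U t).of_norm

/-- Compositions are differentiated termwise. -/
theorem hasDerivAt_comp {κ κ' d d' : Fn} (h : Rap (wgt θ v₂ v₃) κ) (h' : Rap (wgt θ v₁ v₂) κ')
    (hd : ∀ u t, HasDerivAt (κ u) (d u t) t) (hd' : ∀ u t, HasDerivAt (κ' u) (d' u t) t)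
    (hr : Rap (wgt θ v₂ v₃) d) (hr' : Rap (wgt θ v₁ v₂) d') (U : ℤ × ℤ) (t : ℝ) :
    HasDerivAt (comp θ v₂ κ κ' U) ((comp θ v₂ d κ' + comp θ v₂ κ d') U t) t := by
  obtain ⟨C, hC0, hC⟩ := comp_term_le hr h' 0
  obtain ⟨C', hC0', hC'⟩ := comp_term_le h hr' 0
  have key := hasDerivAt_tsum_of_isPreconnected (𝕜 := ℝ) (F := ℂ)
    (u := fun j : ℤ => (C + C') * ((1 + |slope θ v₂ v₃|) ^ 2 *
      ((1 + |slope θ v₂ v₃ * t - j / v₂.rk θ|) ^ 2)⁻¹))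
    (g := fun (j : ℤ) s => κ (j • v₂.sec) s * κ' (U - j • v₂.sec) (s + off θ (j • v₂.sec)))
    (g' := fun (j : ℤ) s => d (j • v₂.sec) s * κ' (U - j • v₂.sec) (s + off θ (j • v₂.sec)) +
      κ (j • v₂.sec) s * d' (U - j • v₂.sec) (s + off θ (j • v₂.sec)))
    (t := Metric.ball t 1) (y₀ := t) (y := t)
    (((summable_shift (v₂.rk θ) v₂.rk_ne (slope θ v₂ v₃ * t)).mul_left _).mul_left _)
    Metric.isOpen_ball (convex_ball t 1).isPreconnected ?_ ?_ (Metric.mem_ball_self one_pos)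
    (comp_summable h h' U t).of_norm (Metric.mem_ball_self one_pos)
  · rw [(comp_summable hr h' U t).of_norm.tsum_add (comp_summable h hr' U t).of_norm] at key
    exact key
  · intro j s _
    exact (hd _ s).mul ((hd' _ _).comp_add_const s _)
  -- for `|t - s| < 1` the weights at `s` and at `t` differ by at most `|slope|`, which costs the
  -- factor `(1 + |slope|)²`
  · intro j s hs
    have h1 := hC U (j • v₂.sec) s
    have h2 := hC' U (j • v₂.sec) s
    rw [pow_zero, one_mul] at h1 h2
    refine (norm_add_le _ _).trans ((add_le_add h1 h2).trans ?_)
    rw [← add_mul, wgt_sec]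
    refine mul_le_mul_of_nonneg_left ?_ (by positivity)
    rw [inv_le_iff_one_le_mul₀ (by positivity), ← div_eq_mul_inv, div_mul_eq_mul_div,
      le_div_iff₀ (by positivity), one_mul, ← mul_pow]
    gcongr
    set a := slope θ v₂ v₃
    rw [Metric.mem_ball, Real.dist_eq, abs_sub_comm] at hs
    have h3 : |a * t - j / v₂.rk θ| ≤ |a| * |t - s| + |a * s - j / v₂.rk θ| := by
      rw [← abs_mul]
      refine le_trans (le_of_eq ?_) (abs_add_le _ _)
      congr 1; ring
    nlinarith [abs_nonneg a, abs_nonneg (a * s - j / v₂.rk θ), mul_nonneg (abs_nonneg a)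
      (abs_nonneg (a * s - j / v₂.rk θ)), mul_le_mul_of_nonneg_left hs.le (abs_nonneg a)]

theorem Sch.comp {j : ℕ} : ∀ {κ κ' : Fn}, Sch (wgt θ v₂ v₃) j κ → Sch (wgt θ v₁ v₂) j κ' →
    Sch (wgt θ v₁ v₃) j (comp θ v₂ κ κ') := by
  induction j with
  | zero => exact fun h h' => Rap.comp h h'
  | succ j ih =>
    rintro κ κ' ⟨h, d, hd, hj⟩ ⟨h', d', hd', hj'⟩
    exact ⟨h.comp h', NCTorus.comp θ v₂ d κ' + NCTorus.comp θ v₂ κ d',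
      hasDerivAt_comp h h' hd hd' hj.rap hj'.rap,
      (ih hj (Sch.of_succ (j := j) ⟨h', d', hd', hj'⟩)).add
        (ih (Sch.of_succ (j := j) ⟨h, d, hd, hj⟩) hj')⟩

theorem Ker.comp {κ κ' : Fn} (h : κ ∈ Ker θ v₂ v₃) (h' : κ' ∈ Ker θ v₁ v₂) :
    comp θ v₂ κ κ' ∈ Ker θ v₁ v₃ := by
  refine ⟨fun U t => ?_, fun U t => ?_, fun j => (h.2.2 j).comp (h'.2.2 j)⟩
  · simp only [NCTorus.comp]
    refine tsum_congr fun j => ?_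
    rw [show U + v₁.w - j • v₂.sec = U - j • v₂.sec + v₁.w by abel, Ker.per1 h']
  · have h1 := tsum_sec_add (F := fun u => κ u t * κ' (U - u) (t + off θ u)) v₂
      (comp_term_per h h' U · t) (-v₃.w)
    refine Eq.trans (tsum_congr fun j => ?_) h1
    rw [← Ker.per2 h (j • v₂.sec + -v₃.w) t, off_add, off_neg, off_w]
    congr 2
    · abel_nf
    · abel_nf
    · ring

theorem comp_assoc {κ₃ κ₂ κ₁ : Fn} (h₃ : κ₃ ∈ Ker θ v₃ v₄) (h₂ : κ₂ ∈ Ker θ v₂ v₃)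
    (h₁ : κ₁ ∈ Ker θ v₁ v₂) :
    comp θ v₂ (comp θ v₃ κ₃ κ₂) κ₁ = comp θ v₃ κ₃ (comp θ v₂ κ₂ κ₁) := by
  funext U t
  -- the terms of the two double sums: in `G` the second vector is relative to the first one, in `H`
  -- it is the sum `u` of both, and `H` depends only on the class of `u` in `ℤ²/ℤw`
  let G : ℤ → ℤ → ℂ := fun j i => κ₃ (j • v₃.sec) t *
    (κ₂ (i • v₂.sec) (t + off θ (j • v₃.sec)) *
      κ₁ (U - j • v₃.sec - i • v₂.sec) (t + off θ (j • v₃.sec) + off θ (i • v₂.sec)))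
  let H : ℤ → ℤ × ℤ → ℂ := fun j u => κ₃ (j • v₃.sec) t *
    κ₂ (u - j • v₃.sec) (t + off θ (j • v₃.sec)) * κ₁ (U - u) (t + off θ u)
  have hGH : ∀ j i, G j i = H j (i • v₂.sec + j • v₃.sec) := by
    intro j i
    simp only [G, H, add_sub_cancel_right, off_add]
    rw [mul_assoc]
    congr 3
    · abel_nf
    · ring
  have hH : ∀ j u, H j (u + v₂.w) = H j u := by
    intro j u
    simp only [H]
    rw [show u + v₂.w - j • v₃.sec = u - j • v₃.sec + v₂.w by abel, Ker.per1 h₂,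
      ← Ker.per2 h₁ (U - (u + v₂.w)), off_add, off_w]
    congr 2
    · abel_nf
    · ring
  have hsum : Summable (Function.uncurry H ∘ fun p : ℤ × ℤ => (p.1, p.2 • v₂.sec)) := by
    obtain ⟨C₁, hC1, h1⟩ := (Ker.rap h₁).exists_bound 0
    obtain ⟨C₂, hC2, h2⟩ := (Ker.rap h₂).exists_bound 2
    obtain ⟨C₃, hC3, h3⟩ := (Ker.rap h₃).exists_bound 2
    refine Summable.of_norm_bounded (g := fun p : ℤ × ℤ =>
      C₃ * ((1 + |slope θ v₃ v₄ * t - p.1 / v₃.rk θ|) ^ 2)⁻¹ *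
        (C₂ * ((1 + |(slope θ v₂ v₃ * (t + off θ (p.1 • v₃.sec)) + v₂.ell (p.1 • v₃.sec) / v₂.rk θ)
          - p.2 / v₂.rk θ|) ^ 2)⁻¹ * C₁)) ?_ ?_
    · exact summable_prod_shift v₂.rk_ne v₃.rk_ne _ (fun j : ℤ =>
        slope θ v₂ v₃ * (t + off θ (j • v₃.sec)) + v₂.ell (j • v₃.sec) / v₂.rk θ) hC3 hC2 hC1
    · rintro ⟨j, i⟩
      have e1 := norm_le_of_rap h1 (U - i • v₂.sec) (t + off θ (i • v₂.sec))
      have e2 := norm_le_of_rap h2 (i • v₂.sec - j • v₃.sec) (t + off θ (j • v₃.sec))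
      have e3 := norm_le_of_rap h3 (j • v₃.sec) t
      rw [pow_zero, inv_one, mul_one] at e1
      rw [wgt_sec] at e3
      have e4 : wgt θ v₂ v₃ (i • v₂.sec - j • v₃.sec) (t + off θ (j • v₃.sec)) =
          (slope θ v₂ v₃ * (t + off θ (j • v₃.sec)) + v₂.ell (j • v₃.sec) / v₂.rk θ)
          - i / v₂.rk θ := by
        simp only [wgt, Ray.ell_sub, Ray.ell_smul v₂ i, Ray.ell_sec, mul_one]; push_cast; ring
      rw [e4] at e2
      simp only [Function.comp, Function.uncurry, H, norm_mul]
      rw [mul_assoc]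
      exact mul_le_mul e3 (mul_le_mul e2 e1 (norm_nonneg _) (by positivity)) (by positivity)
        (by positivity)
  calc _ = ∑' i : ℤ, ∑' j : ℤ, H j (i • v₂.sec) := by
        simp only [comp]
        refine tsum_congr fun i => ?_
        rw [← tsum_mul_right]
    _ = ∑' j : ℤ, ∑' i : ℤ, H j (i • v₂.sec) := Summable.tsum_comm (f := fun j i : ℤ =>
        H j (i • v₂.sec)) hsum
    _ = ∑' j : ℤ, ∑' i : ℤ, G j i := by
        refine tsum_congr fun j => ?_
        rw [← tsum_sec_add v₂ (hH j) (j • v₃.sec)]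
        exact tsum_congr fun i => (hGH j i).symm
    _ = _ := by
        simp only [comp]
        exact tsum_congr fun j => by rw [← tsum_mul_left]

/-- The Leibniz rule for the composition of kernels. -/
theorem nab_comp {κ κ' : Fn} (h : κ ∈ Ker θ v₂ v₃) (h' : κ' ∈ Ker θ v₁ v₂) (τ δ δ' : ℂ) :
    nab θ τ (δ + δ') v₁ v₃ (comp θ v₂ κ κ') =
      comp θ v₂ (nab θ τ δ v₂ v₃ κ) κ' + comp θ v₂ κ (nab θ τ δ' v₁ v₂ κ') := by
  funext U t
  have hd : dF (comp θ v₂ κ κ') U t = comp θ v₂ (dF κ) κ' U t + comp θ v₂ κ (dF κ') U t :=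
    (hasDerivAt_comp (Ker.rap h) (Ker.rap h') (Ker.hasDerivAt h)
      (Ker.hasDerivAt h') (Ker.rap (Ker.dF h)) (Ker.rap (Ker.dF h')) U t).deriv
  have s1 := (comp_summable (Ker.rap (Ker.dF h)) (Ker.rap h') U t).of_norm
  have s2 := (comp_summable (Ker.rap h) (Ker.rap (Ker.dF h')) U t).of_norm
  have s3 := (comp_summable (Ker.rap h) (Ker.rap h') U t).of_norm
  have s4 := (comp_summable (Ker.rap (Ker.nab h τ δ)) (Ker.rap h') U t).of_norm
  have s5 := (comp_summable (Ker.rap h) (Ker.rap (Ker.nab h' τ δ')) U t).of_norm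
  have e1 : comp θ v₂ (nab θ τ δ v₂ v₃ κ) κ' U t + comp θ v₂ κ (nab θ τ δ' v₁ v₂ κ') U t =
      (comp θ v₂ (dF κ) κ' U t + comp θ v₂ κ (dF κ') U t) +
      (2 * Real.pi * Complex.I * (τ * wgt θ v₁ v₃ U t + (δ + δ'))) * comp θ v₂ κ κ' U t := by
    simp only [comp]
    rw [← s4.tsum_add s5, ← s1.tsum_add s2, ← tsum_mul_left,
      ← (s1.add s2).tsum_add (s3.mul_left _)]
    refine tsum_congr fun j => ?_
    rw [wgt_add v₁ v₂ v₃ U (j • v₂.sec) t]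
    simp only [nab, Pi.add_apply, Pi.smul_apply, smul_eq_mul]
    push_cast; ring
  rw [Pi.add_apply, Pi.add_apply, e1, ← hd]
  simp only [nab, Pi.add_apply, Pi.smul_apply, smul_eq_mul]
  ring

end composition

/-! ### Identity kernels and kernels with a given profile -/

/-- The identity kernel. -/
def idK (v : Ray) : Fn := fun u _ => if v.ell u = 0 then 1 else 0

theorem idK_mem (θ : ℝ) (v : Ray) : idK v ∈ Ker θ v v := by
  refine ⟨fun u t => by simp [idK, Ray.ell_add], fun u t => by simp [idK, Ray.ell_add], ?_⟩
  refine Sch.of_hasDerivAt (h := 0) (hasDerivAt_wgt θ v v) 0 0 (fun N => ⟨1, fun u t => ?_⟩)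
    Sch.zero (fun u t => ?_)
  · by_cases h : v.ell u = 0 <;> simp [idK, h, wgt, slope_self]
  · exact (hasDerivAt_const t (if v.ell u = 0 then (1 : ℂ) else 0)).congr_deriv (by simp)

theorem idK_comp {θ : ℝ} {v : Ray} (κ : Fn) : comp θ v (idK v) κ = κ := by
  funext U t
  rw [comp, tsum_eq_single 0]
  · simp [idK]
  · intro j hj
    rw [idK, Ray.ell_smul_sec, if_neg hj, zero_mul]

theorem comp_idK {θ : ℝ} {v v' : Ray} {κ : Fn} (h : κ ∈ Ker θ v v') : comp θ v κ (idK v) = κ := by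
  funext U t
  rw [comp, tsum_eq_single (v.ell U)]
  · rw [← eq_ell_smul_sec (F := fun u => κ u t) v (fun u => Ker.per1 h u t)]
    rw [idK, Ray.ell_sub, Ray.ell_smul_sec, sub_self, if_pos rfl, mul_one]
  · intro j hj
    have : v.ell U - j ≠ 0 := sub_ne_zero.mpr (Ne.symm hj)
    rw [idK, Ray.ell_sub, Ray.ell_smul_sec, if_neg this, mul_zero]

/-- The kernel `c(u) g(q(u, t))`, where `q` is the weight function. -/
def prof (θ : ℝ) (v v' : Ray) (c : ℤ × ℤ → ℂ) (g : ℝ → ℂ) : Fn := fun u t =>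
  c u * g (wgt θ v v' u t)

/-- Functions of one variable with rapidly decreasing derivatives. -/
abbrev SchR (g : ℝ → ℂ) : Prop := ∀ j, Sch (fun _ t => t) j (fun _ => g)

/-- The coefficient functions of kernels: the functions on `ℤ²/(ℤw + ℤw')`. -/
def Wper (v v' : Ray) : Submodule ℂ (ℤ × ℤ → ℂ) where
  carrier := {c | (∀ u, c (u + v.w) = c u) ∧ ∀ u, c (u + v'.w) = c u}
  add_mem' := by
    rintro c c' ⟨h1, h2⟩ ⟨h1', h2'⟩
    exact ⟨fun u => by simp only [Pi.add_apply, h1, h1'],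
      fun u => by simp only [Pi.add_apply, h2, h2']⟩
  zero_mem' := ⟨fun _ => rfl, fun _ => rfl⟩
  smul_mem' := by
    rintro a c ⟨h1, h2⟩
    exact ⟨fun u => by simp only [Pi.smul_apply, h1], fun u => by simp only [Pi.smul_apply, h2]⟩

/-- A function on `ℤ²/(ℤw + ℤw')` takes finitely many values, as the index is `|det|`. -/
theorem Wper.bounded {v v' : Ray} (hd : v.det v' ≠ 0) {c : ℤ × ℤ → ℂ} (hc : c ∈ Wper v v') :
    ∃ C, 0 ≤ C ∧ ∀ u, ‖c u‖ ≤ C := by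
  have h1 : Function.Periodic (fun j : ℤ => c (j • v.sec)) (v.det v') := by
    intro j
    have := eq_ell_smul_sec v hc.1 (j • v.sec + v'.w)
    rw [hc.2, Ray.ell_add, Ray.ell_smul, Ray.ell_sec, Ray.ell_w, mul_one] at this
    exact this.symm
  have h2 : Function.Periodic (fun j : ℤ => c (j • v.sec)) |v.det v'| := by
    rcases abs_choice (v.det v') with h | h <;> rw [h]
    · exact h1
    · exact h1.neg
  have hpos : 0 < |v.det v'| := abs_pos.mpr hd
  refine ⟨∑ i ∈ Finset.Ico 0 |v.det v'|, ‖c (i • v.sec)‖,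
    Finset.sum_nonneg fun _ _ => norm_nonneg _, fun u => ?_⟩
  rw [eq_ell_smul_sec v hc.1 u]
  have h3 : c (v.ell u • v.sec) = c ((v.ell u % |v.det v'|) • v.sec) := by
    have := h2.int_mul (v.ell u / |v.det v'|) (v.ell u % |v.det v'|)
    rw [Int.cast_id, mul_comm, Int.emod_add_mul_ediv] at this
    exact this
  rw [h3]
  exact Finset.single_le_sum (f := fun i : ℤ => ‖c (i • v.sec)‖) (fun _ _ => norm_nonneg _)
    (Finset.mem_Ico.mpr ⟨Int.emod_nonneg _ hpos.ne', Int.emod_lt_of_pos _ hpos⟩)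

theorem sch_prof {θ : ℝ} {v v' : Ray} {c : ℤ × ℤ → ℂ} {C : ℝ} (hc : ∀ u, ‖c u‖ ≤ C) (j : ℕ) :
    ∀ {g : ℝ → ℂ}, Sch (fun _ t => t) j (fun _ => g) →
      Sch (wgt θ v v') j (prof θ v v' c g) := by
  have h0 : ∀ {g : ℝ → ℂ}, Rap (fun _ t => t) (fun _ => g) →
      Rap (wgt θ v v') (prof θ v v' c g) := by
    intro g hg N
    obtain ⟨B, hB0, hB⟩ := hg.exists_bound N
    have hC0 : 0 ≤ C := (norm_nonneg _).trans (hc 0)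
    refine ⟨C * B, fun u t => ?_⟩
    rw [prof, norm_mul, mul_left_comm]
    exact mul_le_mul (hc u) (hB 0 _) (by positivity) hC0
  induction j with
  | zero => exact h0
  | succ j ih =>
    rintro g ⟨hg, d, hd, hj⟩
    have hdd : d = fun _ => deriv g := funext fun u => funext fun t => (hd u t).deriv.symm
    subst hdd
    refine ⟨h0 hg, (slope θ v v' : ℂ) • prof θ v v' c (deriv g), fun u t => ?_, (ih hj).smul _⟩
    have := ((hd u _).scomp t (hasDerivAt_wgt θ v v' u t)).const_mul (c u)
    refine this.congr_deriv ?_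
    simp only [Pi.smul_apply, smul_eq_mul, prof, Complex.real_smul]
    ring

theorem prof_mem {θ : ℝ} [Fact (Irrational θ)] {v v' : Ray} (hd : v.det v' ≠ 0) {c : ℤ × ℤ → ℂ}
    (hc : c ∈ Wper v v') {g : ℝ → ℂ} (hg : SchR g) : prof θ v v' c g ∈ Ker θ v v' := by
  obtain ⟨C, -, hC⟩ := Wper.bounded hd hc
  refine ⟨fun u t => ?_, fun u t => ?_, fun j => sch_prof hC j (hg j)⟩
  · simp only [prof, wgt_per1, hc.1]
  · simp only [prof, wgt_per2, hc.2]

theorem SchR.of_compactSupport {g : ℝ → ℂ} (h1 : ContDiff ℝ (⊤ : ℕ∞) g)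
    (h2 : HasCompactSupport g) : SchR g := by
  have h0 : ∀ {g : ℝ → ℂ}, ContDiff ℝ (⊤ : ℕ∞) g → HasCompactSupport g →
      Rap (fun (_ : ℤ × ℤ) t => t) (fun _ => g) := by
    intro g h1 h2 N
    have hc : Continuous fun t : ℝ => (((1 + |t|) ^ N : ℝ) : ℂ) * g t :=
      (by fun_prop : Continuous fun t : ℝ => (((1 + |t|) ^ N : ℝ) : ℂ)).mul h1.continuous
    obtain ⟨C, hC⟩ := hc.bounded_above_of_compact_support (h2.mul_left)
    refine ⟨C, fun _ t => ?_⟩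
    have := hC t
    rwa [norm_mul, Complex.norm_real, Real.norm_of_nonneg (by positivity)] at this
  intro j
  induction j generalizing g with
  | zero => exact h0 h1 h2
  | succ j ih =>
    have h3 := contDiff_infty_iff_deriv.mp h1
    exact ⟨h0 h1 h2, fun _ => deriv g, fun _ t => (h3.1 t).hasDerivAt, ih h3.2 h2.deriv⟩

/-! ### Independence of the sign -/

/-- The opposite vector. -/
def Ray.neg (v : Ray) : Ray := ⟨-v.n, -v.m, v.coprime.neg_neg⟩

theorem Ray.w_neg (v : Ray) : v.neg.w = -v.w := by
  refine Prod.ext ?_ ?_ <;> simp [Ray.neg, Ray.w]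

theorem Ray.rk_neg (v : Ray) (θ : ℝ) : v.neg.rk θ = -v.rk θ := by
  simp only [Ray.neg, Ray.rk]; push_cast; ring

theorem Ray.ell_neg' (v : Ray) (u : ℤ × ℤ) : v.neg.ell u = -v.ell u := by
  simp only [Ray.neg, Ray.ell]; ring

theorem wgt_neg_right (θ : ℝ) (v v' : Ray) : wgt θ v v'.neg = wgt θ v v' := by
  funext u t
  have : v.det v'.neg = -v.det v' := by simp only [Ray.det, Ray.neg]; ring
  simp only [wgt, slope, Ray.rk_neg, this]
  push_cast
  rw [mul_neg, neg_div_neg_eq]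

/-- Kernels to a class and to the opposite class are the same. -/
theorem Ker_neg_right (θ : ℝ) (v v' : Ray) : Ker θ v v'.neg = Ker θ v v' := by
  ext κ
  simp only [Ker, Submodule.mem_mk, AddSubmonoid.mem_mk, AddSubsemigroup.mem_mk,
    Set.mem_ofPred_eq, wgt_neg_right, Ray.w_neg, Ray.rk_neg]
  refine and_congr_right fun _ => and_congr_left fun _ => ?_
  constructor
  · intro h u t
    rw [← h (u + v'.w) (t + v'.rk θ)]; simp
  · intro h u t
    rw [← h (u + -v'.w) (t + -v'.rk θ)]; simp

/-! ### Frames -/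

/-- The class of the free module of rank one. -/
def Ray.unit : Ray := ⟨1, 0, isCoprime_zero_left.mpr isUnit_one⟩

@[simp] theorem Ray.ell_unit (u : ℤ × ℤ) : Ray.unit.ell u = u.2 := by simp [Ray.ell, Ray.unit]
@[simp] theorem Ray.rk_unit (θ : ℝ) : Ray.unit.rk θ = 1 := by simp [Ray.rk, Ray.unit]
theorem Ray.sec_unit : Ray.unit.sec.2 = 1 := by rw [← Ray.ell_unit, Ray.ell_sec]

theorem hasSum_telescope (a : ℤ → ℂ) (M : ℕ) (h0 : ∀ i : ℤ, M ≤ i → a i = 0)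
    (h1 : ∀ i : ℤ, i ≤ -M → a i = 1) : HasSum (fun i => a i - a (i + 1)) 1 := by
  have e1 : HasSum (fun n : ℕ => a n - a (n + 1)) (a 0) := by
    have := hasSum_sum_of_ne_finset_zero (f := fun n : ℕ => a n - a (n + 1)) (s := Finset.range M)
      (L := SummationFilter.unconditional _) (fun n hn => by
        have : M ≤ n := by simpa using hn
        rw [h0 n (by omega), h0 (n + 1) (by omega), sub_zero])
    have h := Finset.sum_range_sub' (fun n : ℕ => a n) M
    simp only [Nat.cast_add, Nat.cast_one, Nat.cast_zero, h0 M le_rfl, sub_zero] at h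
    rwa [h] at this
  have e2 : HasSum (fun n : ℕ => a (-(n + 1)) - a (-(n + 1) + 1)) (1 - a 0) := by
    have := hasSum_sum_of_ne_finset_zero (f := fun n : ℕ => a (-(n + 1)) - a (-(n + 1) + 1))
      (s := Finset.range M) (L := SummationFilter.unconditional _) (fun n hn => by
        have : M ≤ n := by simpa using hn
        rw [h1 _ (by omega), h1 _ (by omega), sub_self])
    have h := Finset.sum_range_sub (fun n : ℕ => a (-n)) M
    simp only [Nat.cast_add, Nat.cast_one, Nat.cast_zero, h1 (-M) le_rfl, neg_zero] at h
    rw [← h]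
    convert this using 3
    simp
  have := HasSum.of_nat_of_neg_add_one (f := fun i => a i - a (i + 1)) e1 e2
  simpa using this

/-- A smooth bump function, supported in `[-1, 1]`, whose translates by the integers sum
up to `1`. -/
def bump (y : ℝ) : ℝ := Real.smoothTransition (y + 1) - Real.smoothTransition y

/-- A smooth function supported in `[-2, 2]` and equal to `1` on `[-1, 1]`. -/
def plateau (y : ℝ) : ℝ := Real.smoothTransition (y + 2) * Real.smoothTransition (2 - y)

theorem bump_eq_zero {y : ℝ} (h : 1 < |y|) : bump y = 0 := by
  rcases lt_abs.mp h with h | h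
  · rw [bump, Real.smoothTransition.one_of_one_le (by linarith),
      Real.smoothTransition.one_of_one_le (by linarith), sub_self]
  · rw [bump, Real.smoothTransition.zero_of_nonpos (by linarith),
      Real.smoothTransition.zero_of_nonpos (by linarith), sub_self]

theorem plateau_eq_zero {y : ℝ} (h : 2 < |y|) : plateau y = 0 := by
  rcases lt_abs.mp h with h | h
  · rw [plateau, Real.smoothTransition.zero_of_nonpos (x := 2 - y) (by linarith), mul_zero]
  · rw [plateau, Real.smoothTransition.zero_of_nonpos (x := y + 2) (by linarith), zero_mul]

theorem plateau_eq_one {y : ℝ} (h : |y| ≤ 1) : plateau y = 1 := by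
  obtain ⟨h1, h2⟩ := abs_le.mp h
  rw [plateau, Real.smoothTransition.one_of_one_le (by linarith),
    Real.smoothTransition.one_of_one_le (by linarith), mul_one]

theorem schR_of_bounded_support {f : ℝ → ℝ} (h1 : ContDiff ℝ (⊤ : ℕ∞) f)
    {B : ℝ} (h2 : ∀ y, B < |y| → f y = 0) {a : ℝ} (ha : a ≠ 0) (b : ℝ) :
    SchR fun s => ((f (a * s - b) : ℝ) : ℂ) := by
  refine SchR.of_compactSupport ?_ ?_
  · exact Complex.ofRealCLM.contDiff.comp (h1.comp (by fun_prop))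
  · refine HasCompactSupport.intro (isCompact_closedBall (b / a) (B / |a|)) fun s hs => ?_
    rw [Metric.mem_closedBall, Real.dist_eq, not_le, div_lt_iff₀ (abs_pos.mpr ha), ← abs_mul] at hs
    rw [h2 _ (by rwa [sub_mul, div_mul_cancel₀ _ ha, mul_comm s] at hs), Complex.ofReal_zero]

theorem contDiff_bump : ContDiff ℝ (⊤ : ℕ∞) bump :=
  (Real.smoothTransition.contDiff.comp (contDiff_id.add contDiff_const)).sub
    Real.smoothTransition.contDiff

theorem contDiff_plateau : ContDiff ℝ (⊤ : ℕ∞) plateau :=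
  (Real.smoothTransition.contDiff.comp (contDiff_id.add contDiff_const)).mul
    (Real.smoothTransition.contDiff.comp (contDiff_const.sub contDiff_id))

/-- The translates of the bump function form a partition of unity. -/
theorem hasSum_bump (N : ℕ) (hN : 0 < N) (y : ℝ) :
    HasSum (fun i : ℤ => ∑ l ∈ Finset.range N, ((bump (y - i * N - l) : ℝ) : ℂ)) 1 := by
  have hN' : (1 : ℝ) ≤ N := by exact_mod_cast hN
  have h := hasSum_telescope (fun i => ((Real.smoothTransition (y - i * N + 1) : ℝ) : ℂ))
    (⌈|y|⌉₊ + 1) (fun i hi => ?_) (fun i hi => ?_)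
  · convert h using 2 with i
    have := Finset.sum_range_sub' (fun l : ℕ =>
      ((Real.smoothTransition (y - i * N + 1 - l) : ℝ) : ℂ)) N
    simp only [Nat.cast_zero, sub_zero] at this
    rw [show y - ((i + 1 : ℤ) : ℝ) * N + 1 = y - i * N + 1 - N by push_cast; ring, ← this]
    refine Finset.sum_congr rfl fun l _ => ?_
    rw [bump, Complex.ofReal_sub, show y - i * N - l + 1 = y - i * N + 1 - (l : ℝ) by ring,
      show y - i * N - l = y - i * N + 1 - ((l + 1 : ℕ) : ℝ) by push_cast; ring]
  · have h1 := Nat.le_ceil |y|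
    have h2 : (⌈|y|⌉₊ : ℝ) + 1 ≤ i := by exact_mod_cast hi
    have h3 := le_abs_self y
    rw [Real.smoothTransition.zero_of_nonpos (by nlinarith [abs_nonneg y]), Complex.ofReal_zero]
  · have h1 := Nat.le_ceil |y|
    have h2 : (i : ℝ) ≤ -((⌈|y|⌉₊ : ℝ) + 1) := by exact_mod_cast hi
    have h3 := neg_abs_le y
    rw [Real.smoothTransition.one_of_one_le (by nlinarith [abs_nonneg y]), Complex.ofReal_one]

/-- The indicator of the `(k, γ)` with `m ∣ γ`. -/
def divInd (m : ℤ) : ℤ × ℤ → ℂ := fun u => if m ∣ u.2 then 1 else 0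

theorem divInd_mem (v : Ray) : divInd v.m ∈ Wper Ray.unit v ∧ divInd v.m ∈ Wper v Ray.unit := by
  have h1 : ∀ u, divInd v.m (u + Ray.unit.w) = divInd v.m u := fun u => by
    simp [divInd, Ray.w, Ray.unit]
  have h2 : ∀ u, divInd v.m (u + v.w) = divInd v.m u := fun u => by
    simp [divInd, Ray.w]
  exact ⟨⟨h1, h2⟩, ⟨h2, h1⟩⟩

theorem Ray.eq_unit_of_m_eq_zero {v : Ray} (hm : v.m = 0) :
    v = Ray.unit ∨ v = Ray.unit.neg := by
  have := v.coprime
  rw [hm, isCoprime_zero_left, Int.isUnit_iff] at this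
  rcases this with h | h
  · left; ext <;> simp [h, hm, Ray.unit]
  · right; ext <;> simp [h, hm, Ray.unit, Ray.neg]

section frames

variable {θ : ℝ} [Fact (Irrational θ)]

/-- The identity kernel is a sum of compositions of the kernels `x l` and `ξ l`, whose profiles are
translates of the bump function and of the plateau: the plateau is `1` on the support of the bump,
so the diagonal terms sum up to `1` by the partition of unity, and the other terms vanish because
their supports are disjoint. -/
theorem exists_frame_of_ne {v : Ray} (hm : v.m ≠ 0) : ∃ (N : ℕ) (x ξ : ℕ → Fn),
    (∀ l, x l ∈ Ker θ Ray.unit v) ∧ (∀ l, ξ l ∈ Ker θ v Ray.unit) ∧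
      ∑ l ∈ Finset.range N, comp θ Ray.unit (x l) (ξ l) = idK v := by
  have hr := v.rk_ne (θ := θ)
  set r := v.rk θ with hrdef
  -- off the diagonal the arguments of the bump and of the plateau differ by at least `N / |r|`,
  -- which exceeds the sum `1 + 2` of the radii of the supports
  obtain ⟨N, hN⟩ := exists_nat_gt (3 * |r|)
  have hN0 : (0 : ℝ) < N := lt_of_le_of_lt (by positivity) hN
  have hm' : (v.m : ℝ) ≠ 0 := by exact_mod_cast hm
  have ha : (N / v.m : ℝ) ≠ 0 := div_ne_zero hN0.ne' hm'
  have d1 : Ray.unit.det v ≠ 0 := by simpa [Ray.det, Ray.unit] using hm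
  have d2 : v.det Ray.unit ≠ 0 := by simpa [Ray.det, Ray.unit] using hm
  let x : ℕ → Fn := fun l => prof θ Ray.unit v (divInd v.m)
    (fun s => ((bump (N / v.m * s - l) : ℝ) : ℂ))
  let ξ : ℕ → Fn := fun l => prof θ v Ray.unit (divInd v.m)
    (fun s => ((plateau (-(N / v.m) * s - l) : ℝ) : ℂ))
  have hx : ∀ l, x l ∈ Ker θ Ray.unit v := fun l => prof_mem d1 (divInd_mem v).1
    (schR_of_bounded_support contDiff_bump (fun y => bump_eq_zero) ha _)
  have hξ : ∀ l, ξ l ∈ Ker θ v Ray.unit := fun l => prof_mem d2 (divInd_mem v).2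
    (schR_of_bounded_support contDiff_plateau (fun y => plateau_eq_zero) (neg_ne_zero.mpr ha) _)
  refine ⟨N, x, ξ, hx, hξ, ?_⟩
  funext U t
  -- the arguments of the bump and of the plateau, up to the translation by `l`
  have hw1 : ∀ i : ℤ,
      N / v.m * wgt θ Ray.unit v ((i * v.m) • Ray.unit.sec) t = N * t / r - i * N := by
    intro i
    rw [wgt_sec, slope, Ray.rk_unit, ← hrdef]
    simp only [Ray.det, Ray.unit]
    push_cast
    field_simp
    ring
  have hdet : (v.det Ray.unit : ℝ) = -v.m := by simp [Ray.det, Ray.unit]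
  have hw2 : ∀ i i' : ℤ, U.2 = v.m * i' → -(N / v.m) * wgt θ v Ray.unit
      (U - (i * v.m) • Ray.unit.sec) (t + off θ ((i * v.m) • Ray.unit.sec)) =
        N * t / r - i * N + N / r * (U.1 + v.n * i' : ℤ) := by
    intro i i' hi'
    have hr2 : r = v.n + v.m * θ := rfl
    rw [wgt, slope, hdet, Ray.rk_unit, ← hrdef]
    simp only [off, Ray.ell, Prod.fst_sub, Prod.snd_sub, Prod.smul_fst, Prod.smul_snd,
      Ray.sec_unit, hi', smul_eq_mul]
    push_cast
    field_simp
    rw [hr2]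
    ring
  -- only the class of the identity survives
  have key : ∀ l, ∀ i : ℤ, x l ((i * v.m) • Ray.unit.sec) t *
      ξ l (U - (i * v.m) • Ray.unit.sec) (t + off θ ((i * v.m) • Ray.unit.sec)) =
        ((bump (N * t / r - i * N - l) : ℝ) : ℂ) * idK v U t := by
    intro l i
    have c1 : divInd v.m ((i * v.m) • Ray.unit.sec) = 1 := by
      simp [divInd, Ray.sec_unit]
    simp only [x, ξ, prof, hw1, c1, one_mul]
    by_cases hdvd : v.m ∣ U.2
    · obtain ⟨i', hi'⟩ := hdvd
      have c2 : divInd v.m (U - (i * v.m) • Ray.unit.sec) = 1 := by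
        rw [divInd, if_pos]
        rw [Prod.snd_sub, Prod.smul_snd, Ray.sec_unit, hi', smul_eq_mul, mul_one]
        exact dvd_sub (Dvd.intro _ rfl) (Dvd.intro_left _ rfl)
      have hell : v.ell U = v.m * (U.1 + v.n * i') := by rw [Ray.ell, hi']; ring
      rw [c2, one_mul, hw2 i i' hi']
      set y := N * t / r - i * N - l
      by_cases hy : 1 < |y|
      · rw [bump_eq_zero hy]; simp
      · have hy' : |y| ≤ 1 := not_lt.mp hy
        by_cases h0 : U.1 + v.n * i' = 0
        · rw [idK, if_pos (by rw [hell, h0, mul_zero]), h0, Int.cast_zero, mul_zero, add_zero,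
            plateau_eq_one hy', Complex.ofReal_one]
        · have h1 : (1 : ℝ) ≤ |((U.1 + v.n * i' : ℤ) : ℝ)| := by
            exact_mod_cast Int.one_le_abs h0
          have h2 : 3 < |N / r * ((U.1 + v.n * i' : ℤ) : ℝ)| := by
            rw [abs_mul, abs_div, abs_of_pos hN0]
            have : 3 < N / |r| := (lt_div_iff₀ (abs_pos.mpr hr)).mpr hN
            nlinarith
          rw [idK, if_neg (by rw [hell]; exact mul_ne_zero hm h0), plateau_eq_zero]
          · simp
          · have h3 : N * t / r - i * N + N / r * ((U.1 + v.n * i' : ℤ) : ℝ) - l =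
              N / r * ((U.1 + v.n * i' : ℤ) : ℝ) - (-y) := by ring
            rw [h3]
            have := abs_sub_abs_le_abs_sub (N / r * ((U.1 + v.n * i' : ℤ) : ℝ)) (-y)
            rw [abs_neg] at this
            linarith
    · have c2 : divInd v.m (U - (i * v.m) • Ray.unit.sec) = 0 := by
        rw [divInd, if_neg]
        intro h
        apply hdvd
        have := dvd_add h (Dvd.intro_left i rfl : v.m ∣ i * v.m)
        simpa [Ray.sec_unit] using this
      have hell : v.ell U ≠ 0 := by
        intro h
        apply hdvd
        refine v.coprime.dvd_of_dvd_mul_left (z := U.2) ⟨-U.1, ?_⟩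
        simp only [Ray.ell] at h
        linarith
      rw [c2, idK, if_neg hell]; simp
  -- multiples of `sec` that are not divisible by `m` do not contribute
  have zero : ∀ l, ∀ γ : ℤ, ¬ v.m ∣ γ → x l (γ • Ray.unit.sec) t = 0 := by
    intro l γ hγ
    have : divInd v.m (γ • Ray.unit.sec) = 0 := by
      rw [divInd, if_neg]; simpa [Ray.sec_unit] using hγ
    simp only [x, prof, this, zero_mul]
  rw [Finset.sum_apply, Finset.sum_apply]
  simp only [comp]
  rw [← Summable.tsum_finsetSum fun l _ =>
    (comp_summable (Ker.rap (hx l)) (Ker.rap (hξ l)) U t).of_norm]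
  have hinj : Function.Injective fun i : ℤ => i * v.m := fun a b h => mul_right_cancel₀ hm h
  refine HasSum.tsum_eq ((hinj.hasSum_iff ?_).mp ?_)
  · intro γ hγ
    refine Finset.sum_eq_zero fun l _ => ?_
    rw [zero l γ (fun ⟨i, hi⟩ => hγ ⟨i, by simp only [hi]; ring⟩), zero_mul]
  · have := (hasSum_bump N (by exact_mod_cast hN0) (N * t / r)).mul_right (idK v U t)
    rw [one_mul] at this
    refine this.congr_fun fun i => ?_
    simp only [Function.comp, key, Finset.sum_mul]

end frames

/-! ### The algebra as a space of kernels -/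

/-- The right action of `U₁^{p₁} U₂^{p₂}` on families of functions. -/
def kerWeyl (θ : ℝ) : Weyl θ ((ℤ × ℤ) × ℝ) where
  χ p y := e (p.2 * (y.2 - θ * y.1.2))
  σ p y := (y.1 + (0, p.1), y.2)
  norm_χ _ _ := norm_e _
  χ_zero y := by simp [e_zero]
  σ_zero y := Prod.ext (add_zero y.1) rfl
  σ_add p q y := by
    refine Prod.ext ?_ rfl
    simp only [Prod.fst_add, add_assoc, Prod.mk_add_mk, add_zero]
    rw [add_comm q.1]
  χ_mul p q y := by
    rw [← e_add, ← e_add]; congr 1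
    simp only [Prod.snd_add]
    push_cast; ring

/-- The kernel of the multiplication by an element of the algebra. -/
def algFn (θ : ℝ) (a : ℤ × ℤ → ℂ) : Fn := fun u t =>
  ∑' p : ℤ, a (-u.2, p) * e (p * (t - θ * u.2))

section algK

variable {θ : ℝ}

theorem summable_slice {a : ℤ × ℤ → ℂ} (ha : a ∈ rapid) (j : ℤ) :
    Summable fun p : ℤ => ‖a (j, p)‖ := (rapid_summable_norm ha).prod_factor j

theorem summable_algFn {a : ℤ × ℤ → ℂ} (ha : a ∈ rapid) (u : ℤ × ℤ) (t : ℝ) :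
    Summable fun p : ℤ => a (-u.2, p) * e (p * (t - θ * u.2)) :=
  Summable.of_norm (by simpa [norm_mul, norm_e] using summable_slice ha (-u.2))

theorem norm_idK_le (v : Ray) (u : ℤ × ℤ) (t : ℝ) : ‖idK v u t‖ ≤ 1 := by
  rw [idK]; split_ifs <;> simp

/-- The kernel of `a` is obtained by letting `a` act on the identity. -/
theorem algFn_eq_act {a : ℤ × ℤ → ℂ} (ha : a ∈ rapid) (y : (ℤ × ℤ) × ℝ) :
    algFn θ a y.1 y.2 = (kerWeyl θ).act (fun y => idK Ray.unit y.1 y.2) a y := by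
  have hs := (kerWeyl θ).summable_term (f := fun y => idK Ray.unit y.1 y.2) (C := 1)
    (fun y => norm_idK_le _ _ _) ha y
  rw [Weyl.act, hs.tsum_prod, tsum_eq_single (-y.1.2), algFn]
  · refine tsum_congr fun p => ?_
    simp [kerWeyl, idK]
  · intro j hj
    have : y.1.2 + j ≠ 0 := fun h => hj (by linarith)
    simp [kerWeyl, idK, this]

/-- Composition with the kernel of `a` is the action of `a`. -/
theorem comp_algFn [Fact (Irrational θ)] {v : Ray} {κ : Fn} (h : κ ∈ Ker θ Ray.unit v)
    {a : ℤ × ℤ → ℂ} (ha : a ∈ rapid) (y : (ℤ × ℤ) × ℝ) :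
    comp θ Ray.unit κ (algFn θ a) y.1 y.2 = (kerWeyl θ).act (fun y => κ y.1 y.2) a y := by
  obtain ⟨C, -, hC⟩ := (Ker.rap h).exists_bound 0
  have hs := (kerWeyl θ).summable_term (f := fun y => κ y.1 y.2) (C := C)
    (fun y => by simpa using hC y.1 y.2) ha y
  rw [Weyl.act, hs.tsum_prod, comp, ← (Equiv.addLeft y.1.2).tsum_eq]
  refine tsum_congr fun j => ?_
  have h1 : κ ((y.1.2 + j) • Ray.unit.sec) y.2 = κ (y.1 + (0, j)) y.2 := by
    rw [eq_ell_smul_sec (F := fun u => κ u y.2) Ray.unit (fun u => Ker.per1 h u y.2) (y.1 + (0, j))]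
    simp
  simp only [Equiv.coe_addLeft, h1, algFn]
  rw [← tsum_mul_left]
  refine tsum_congr fun p => ?_
  have h2 : (-(y.1 - (y.1.2 + j) • Ray.unit.sec).2) = j := by
    rw [Prod.snd_sub, Prod.smul_snd, Ray.sec_unit, smul_eq_mul]; ring
  have h3 : e (p * (y.2 + off θ ((y.1.2 + j) • Ray.unit.sec) -
      θ * ((y.1 - (y.1.2 + j) • Ray.unit.sec).2 : ℤ))) = e (p * (y.2 - θ * y.1.2)) := by
    rw [show (y.1 - (y.1.2 + j) • Ray.unit.sec).2 = -j by rw [← neg_eq_iff_eq_neg]; exact h2, off,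
      Prod.smul_fst, Prod.smul_snd, Ray.sec_unit]
    have : (p * (y.2 + (((y.1.2 + j) • Ray.unit.sec.1 : ℤ) - θ * ((y.1.2 + j) • (1 : ℤ) : ℤ)) -
        θ * (-j : ℤ)) : ℝ) = p * (y.2 - θ * y.1.2) +
          ((p * ((y.1.2 + j) * Ray.unit.sec.1) : ℤ) : ℝ) := by
      simp only [smul_eq_mul]; push_cast; ring
    rw [this, e_add, e_int, mul_one]
  rw [h2, h3]
  simp only [kerWeyl]
  ring

theorem rap_algFn {a : ℤ × ℤ → ℂ} (ha : a ∈ rapid) :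
    Rap (wgt θ Ray.unit Ray.unit) (algFn θ a) := by
  intro N
  refine ⟨∑' p, wt p ^ N * ‖a p‖, fun u t => ?_⟩
  have h1 := rapid_summable ha N
  have h0 : 0 ≤ (1 + |(u.2 : ℝ)|) ^ N := by positivity
  have h2 : wgt θ Ray.unit Ray.unit u t = -u.2 := by simp [wgt, slope_self]
  rw [h2, abs_neg]
  have h3 : (1 + |(u.2 : ℝ)|) ^ N * ‖algFn θ a u t‖ =
      ‖(((1 + |(u.2 : ℝ)|) ^ N : ℝ) : ℂ) * algFn θ a u t‖ := by
    rw [norm_mul, Complex.norm_real, Real.norm_of_nonneg h0]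
  rw [h3, algFn, ← tsum_mul_left]
  refine (tsum_of_norm_bounded (h1.prod_factor (-u.2)).hasSum fun p => ?_).trans
    (tsum_comp_le_tsum_of_inj h1 (fun p => mul_nonneg (pow_nonneg (wt_pos p).le N) (norm_nonneg _))
      (Prod.mk_right_injective (-u.2)))
  rw [norm_mul, norm_mul, norm_e, mul_one, Complex.norm_real, Real.norm_of_nonneg h0]
  gcongr
  simp only [wt, Int.cast_neg, abs_neg]
  linarith [abs_nonneg (p : ℝ)]

theorem hasDerivAt_algFn (a : Alg θ) (u : ℤ × ℤ) (t : ℝ) : HasDerivAt (algFn θ a.coeff u)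
    (algFn θ (der 0 (2 * Real.pi * Complex.I) a).coeff u t) t := by
  refine hasDerivAt_tsum (𝕜 := ℝ) (F := ℂ)
    (u := fun p : ℤ => ‖(der 0 (2 * Real.pi * Complex.I) a).coeff (-u.2, p)‖)
    (g := fun (p : ℤ) t => a.coeff (-u.2, p) * e (p * (t - θ * u.2)))
    (g' := fun (p : ℤ) t => (der 0 (2 * Real.pi * Complex.I) a).coeff (-u.2, p) *
      e (p * (t - θ * u.2))) (y₀ := t) (summable_slice (Alg.mem _) _) ?_ ?_
      (summable_algFn a.mem u t) t
  · intro p s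
    have h1 : HasDerivAt (fun s : ℝ => e (p * (s - θ * u.2)))
        (((p : ℝ) * 1) • (2 * Real.pi * Complex.I * e (p * (s - θ * u.2)))) s :=
      HasDerivAt.scomp s (hasDerivAt_e _) (((hasDerivAt_id s).sub_const _).const_mul _)
    refine (h1.const_mul (a.coeff (-u.2, p))).congr_deriv ?_
    simp only [coeff_der, Complex.real_smul, mul_one]
    push_cast; ring
  · intro p s
    rw [norm_mul, norm_e, mul_one]

theorem algFn_mem (a : Alg θ) : algFn θ a.coeff ∈ Ker θ Ray.unit Ray.unit := by
  refine ⟨fun u t => by simp [algFn, Ray.w, Ray.unit], fun u t => ?_, fun j => ?_⟩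
  · simp only [algFn]
    refine tsum_congr fun p => ?_
    rw [Prod.snd_add, show Ray.unit.w.2 = 0 from rfl, add_zero, Ray.rk_unit,
      show (p * (t + 1 - θ * u.2) : ℝ) = p * (t - θ * u.2) + p by ring, e_add, e_int, mul_one]
  · induction j generalizing a with
    | zero => exact rap_algFn a.mem
    | succ j ih => exact ⟨rap_algFn a.mem, _, hasDerivAt_algFn a, ih _⟩

theorem integral_e_mul (k : ℤ) : ∫ x in (0 : ℝ)..1, e (k * x) = if k = 0 then 1 else 0 := by
  split_ifs with h
  · simp [h, e_zero]
  · have h1 : ∀ x : ℝ, HasDerivAt (fun x : ℝ => e (k * x))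
        (2 * Real.pi * Complex.I * k * e (k * x)) x := fun x => by
      have := HasDerivAt.scomp x (hasDerivAt_e (k * x)) ((hasDerivAt_id x).const_mul (k : ℝ))
      refine this.congr_deriv ?_
      rw [mul_one, Complex.real_smul]; push_cast; ring
    have hc : Continuous fun x : ℝ => e (k * x) :=
      continuous_iff_continuousAt.mpr fun x => (h1 x).continuousAt
    have h2 := intervalIntegral.integral_eq_sub_of_hasDerivAt (a := 0) (b := 1)
      (fun x _ => h1 x) (by apply Continuous.intervalIntegrable; fun_prop)
    rw [intervalIntegral.integral_const_mul, mul_one, mul_zero, e_int, e_zero, sub_self] at h2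
    refine (mul_eq_zero.mp h2).resolve_left ?_
    have : (k : ℂ) ≠ 0 := by exact_mod_cast h
    simp [this, Real.pi_ne_zero]

theorem continuous_e : Continuous e :=
  continuous_iff_continuousAt.mpr fun x => (hasDerivAt_e x).continuousAt

/-- The Fourier coefficients of a kernel. -/
def coefK (θ : ℝ) (κ : Fn) (p : ℤ × ℤ) : ℂ :=
  ∫ x in (0 : ℝ)..1, κ (0, -p.1) (x - θ * p.1) * e (-(p.2 * x))

theorem coefK_algFn {a : ℤ × ℤ → ℂ} (ha : a ∈ rapid) : coefK θ (algFn θ a) = a := by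
  funext p
  have h1 : ∀ x : ℝ, algFn θ a (0, -p.1) (x - θ * p.1) * e (-(p.2 * x)) =
      ∑' q : ℤ, a (p.1, q) * e ((q - p.2 : ℤ) * x) := by
    intro x
    rw [algFn, ← tsum_mul_right]
    refine tsum_congr fun q => ?_
    rw [mul_assoc, ← e_add, neg_neg]
    congr 2
    push_cast; ring
  have hi : ∀ q : ℤ, IntervalIntegrable (fun x : ℝ => a (p.1, q) * e ((q - p.2 : ℤ) * x))
      MeasureTheory.volume 0 1 := fun q => by
    apply Continuous.intervalIntegrable
    exact continuous_const.mul (continuous_e.comp (by fun_prop))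
  have h2 := MeasureTheory.hasSum_integral_of_summable_integral_norm
    (μ := MeasureTheory.volume.restrict (Set.Ioc (0 : ℝ) 1))
    (F := fun (q : ℤ) (x : ℝ) => a (p.1, q) * e ((q - p.2 : ℤ) * x))
    (fun q => (intervalIntegrable_iff_integrableOn_Ioc_of_le zero_le_one).mp (hi q)) (by
      simp only [norm_mul, norm_e, mul_one]
      simpa using summable_slice ha p.1)
  simp only [← intervalIntegral.integral_of_le (zero_le_one' ℝ),
    intervalIntegral.integral_const_mul, integral_e_mul] at h2
  rw [coefK]
  simp only [h1]
  rw [← h2.tsum_eq, tsum_eq_single p.2]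
  · simp
  · intro q hq
    rw [if_neg (sub_ne_zero.mpr hq), mul_zero]

theorem coefK_dF {κ : Fn} (h : κ ∈ Ker θ Ray.unit Ray.unit) (p : ℤ × ℤ) :
    coefK θ (dF κ) p = 2 * Real.pi * Complex.I * p.2 * coefK θ κ p := by
  have h1 : ∀ x : ℝ, HasDerivAt (fun x : ℝ => κ (0, -p.1) (x - θ * p.1) * e (-(p.2 * x)))
      (dF κ (0, -p.1) (x - θ * p.1) * e (-(p.2 * x)) -
        2 * Real.pi * Complex.I * p.2 * (κ (0, -p.1) (x - θ * p.1) * e (-(p.2 * x)))) x := by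
    intro x
    have a1 := (Ker.hasDerivAt h (0, -p.1) (x - θ * p.1)).comp_sub_const x _
    have a2 := HasDerivAt.scomp x (hasDerivAt_e (-(p.2 * x)))
      ((hasDerivAt_id x).const_mul (p.2 : ℝ)).neg
    refine (a1.mul a2).congr_deriv ?_
    simp only [Complex.real_smul, mul_one, Function.comp, Pi.neg_apply, id]
    push_cast; ring
  have c1 : Continuous fun x : ℝ => dF κ (0, -p.1) (x - θ * p.1) * e (-(p.2 * x)) :=
    ((Ker.continuous (Ker.dF h) _).comp (by fun_prop)).mul (continuous_e.comp (by fun_prop))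
  have c2 : Continuous fun x : ℝ => κ (0, -p.1) (x - θ * p.1) * e (-(p.2 * x)) :=
    ((Ker.continuous h _).comp (by fun_prop)).mul (continuous_e.comp (by fun_prop))
  have c3 : Continuous fun x : ℝ => 2 * Real.pi * Complex.I * p.2 *
      (κ (0, -p.1) (x - θ * p.1) * e (-(p.2 * x))) := continuous_const.mul c2
  have h2 := intervalIntegral.integral_eq_sub_of_hasDerivAt (a := 0) (b := 1)
    (fun x _ => h1 x) ((c1.sub c3).intervalIntegrable _ _)
  rw [intervalIntegral.integral_sub (c1.intervalIntegrable _ _)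
    (c3.intervalIntegrable _ _), intervalIntegral.integral_const_mul] at h2
  have h3 : κ (0, -p.1) (1 - θ * p.1) = κ (0, -p.1) (0 - θ * p.1) := by
    rw [← Ker.per2 h (0, -p.1) (0 - θ * p.1), Ker.per1 h, Ray.rk_unit]
    congr 1; ring
  have h4 : e (-(p.2 * 1)) = 1 := by
    rw [show -((p.2 : ℝ) * 1) = ((-p.2 : ℤ) : ℝ) by push_cast; ring, e_int]
  rw [h3, h4, mul_zero, neg_zero, e_zero, sub_self, sub_eq_zero] at h2
  exact h2

theorem coefK_wgt (κ : Fn) (p : ℤ × ℤ) :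
    coefK θ (fun u t => wgt θ Ray.unit Ray.unit u t * κ u t) p = p.1 * coefK θ κ p := by
  simp only [coefK, wgt, slope_self, Ray.ell_unit, Ray.rk_unit]
  rw [← intervalIntegral.integral_const_mul]
  congr 1; funext x
  push_cast; ring

/-- The Fourier coefficients decrease rapidly, since the multiplication by an exponent amounts to
the multiplication of the kernel by its weight, or to its differentiation. -/
theorem coefK_mem [Fact (Irrational θ)] {κ : Fn} (h : κ ∈ Ker θ Ray.unit Ray.unit) :
    coefK θ κ ∈ rapid := by
  intro k
  induction k generalizing κ with
  | zero =>
    obtain ⟨C, -, hC⟩ := (Ker.rap h).exists_bound 0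
    refine ⟨C, fun p => ?_⟩
    rw [pow_zero, one_mul]
    have := intervalIntegral.norm_integral_le_of_norm_le_const (a := 0) (b := 1) (C := C)
      (f := fun x : ℝ => κ (0, -p.1) (x - θ * p.1) * e (-(p.2 * x))) (fun x _ => by
        rw [norm_mul, norm_e, mul_one]
        simpa using hC (0, -p.1) (x - θ * p.1))
    rw [sub_zero, abs_one, mul_one] at this
    exact this
  | succ k ih =>
    obtain ⟨C₀, h0⟩ := ih h
    obtain ⟨C₁, h1⟩ := ih (Ker.mul_wgt h)
    obtain ⟨C₂, h2⟩ := ih (Ker.dF h)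
    refine ⟨C₀ + C₁ + C₂, fun p => ?_⟩
    have e1 := h1 p
    have e2 := h2 p
    rw [coefK_wgt, norm_mul, Complex.norm_intCast] at e1
    rw [coefK_dF h, norm_mul, norm_mul, Complex.norm_intCast] at e2
    have hpi : 1 ≤ ‖(2 * Real.pi * Complex.I : ℂ)‖ := by
      simp only [norm_mul, Complex.norm_I, Complex.norm_real, Real.norm_of_nonneg Real.pi_pos.le,
        RCLike.norm_ofNat]
      linarith [Real.pi_gt_three]
    have hw : 0 ≤ wt p ^ k := pow_nonneg (wt_pos p).le k
    have e3 : wt p ^ k * (|(p.2 : ℝ)| * ‖coefK θ κ p‖) ≤ C₂ := by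
      refine le_trans ?_ e2
      refine mul_le_mul_of_nonneg_left ?_ hw
      refine mul_le_mul_of_nonneg_right ?_ (norm_nonneg _)
      exact le_mul_of_one_le_left (abs_nonneg _) hpi
    have e0 := h0 p
    calc wt p ^ (k + 1) * ‖coefK θ κ p‖ = wt p ^ k * ‖coefK θ κ p‖ +
          wt p ^ k * (|(p.1 : ℝ)| * ‖coefK θ κ p‖) + wt p ^ k * (|(p.2 : ℝ)| * ‖coefK θ κ p‖) := by
          rw [pow_succ, wt]; ring
      _ ≤ _ := add_le_add (add_le_add e0 e1) e3

/-- On each line, the kernel is the sum of its Fourier series. -/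
theorem algFn_coefK [Fact (Irrational θ)] {κ : Fn} (h : κ ∈ Ker θ Ray.unit Ray.unit) :
    algFn θ (coefK θ κ) = κ := by
  funext u t
  let G : ℝ → ℂ := fun x => κ (0, u.2) (x + θ * u.2)
  have hG : Function.Periodic G 1 := by
    intro x
    simp only [G]
    rw [← Ker.per2 h (0, u.2) (x + θ * u.2), Ker.per1 h, Ray.rk_unit]
    congr 1; ring
  have hGc : Continuous G := (Ker.continuous h _).comp (by fun_prop)
  have : Fact ((0 : ℝ) < 1) := ⟨one_pos⟩
  let f : C(AddCircle (1 : ℝ), ℂ) := ⟨hG.lift, continuous_coinduced_dom.mpr hGc⟩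
  have hfx : ∀ x : ℝ, f (x : AddCircle (1 : ℝ)) = G x := fun x => rfl
  have hcoef : ∀ p : ℤ, fourierCoeff f p = coefK θ κ (-u.2, p) := by
    intro p
    rw [fourierCoeff_eq_intervalIntegral _ _ 0, coefK]
    simp only [zero_add, div_one, one_smul, neg_neg, smul_eq_mul, fourier_coe_apply, hfx, G]
    congr 1; funext x
    rw [mul_comm, e]
    congr 2
    · push_cast; ring
    · push_cast; ring
  have hs : Summable (fourierCoeff f) := by
    have h1 : fourierCoeff f = fun p => coefK θ κ (-u.2, p) := funext hcoef
    rw [h1]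
    exact (summable_slice (coefK_mem h) (-u.2)).of_norm
  have key := has_pointwise_sum_fourier_series_of_summable hs
    ((t - θ * u.2 : ℝ) : AddCircle (1 : ℝ))
  rw [hfx] at key
  have h2 : G (t - θ * u.2) = κ u t := by
    simp only [G]
    rw [sub_add_cancel]
    have := periodic_zsmul (F := fun u => κ u t) (fun u => Ker.per1 h u t) (-u.1) (0, u.2)
    rw [← this]
    congr 1
    refine Prod.ext ?_ ?_ <;> simp [Ray.w, Ray.unit]
  rw [← h2, ← key.tsum_eq, algFn]
  refine tsum_congr fun p => ?_
  rw [hcoef, smul_eq_mul, fourier_coe_apply, e]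
  congr 2
  push_cast; ring

/-- The algebra is isomorphic to the space of kernels from its class to itself. -/
def algK (θ : ℝ) [Fact (Irrational θ)] : Alg θ ≃ₗ[ℂ] Ker θ Ray.unit Ray.unit where
  toFun a := ⟨algFn θ a.coeff, algFn_mem a⟩
  map_add' a b := Subtype.ext (funext fun u => funext fun t => by
    show algFn θ (a.coeff + b.coeff) u t = algFn θ a.coeff u t + algFn θ b.coeff u t
    simp only [algFn, Pi.add_apply, add_mul]
    exact (summable_algFn a.mem u t).tsum_add (summable_algFn b.mem u t))
  map_smul' c a := Subtype.ext (funext fun u => funext fun t => by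
    show algFn θ (c • a.coeff) u t = c * algFn θ a.coeff u t
    simp only [algFn, Pi.smul_apply, smul_eq_mul, mul_assoc, tsum_mul_left])
  invFun κ := ⟨coefK θ κ.1, coefK_mem κ.2⟩
  left_inv a := Subtype.ext (coefK_algFn a.mem)
  right_inv κ := Subtype.ext (algFn_coefK κ.2)

variable [Fact (Irrational θ)]

theorem algK_coe (a : Alg θ) : (algK θ a).1 = algFn θ a.coeff := rfl

theorem algK_mul (a b : Alg θ) :
    (algK θ (a * b)).1 = comp θ Ray.unit (algK θ a).1 (algK θ b).1 := by
  funext u t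
  have h1 := algFn_eq_act (θ := θ) (conv_mem (θ := θ) a.mem b.mem) (u, t)
  rw [algK_coe, algK_coe, algK_coe, Alg.coeff_mul, h1, comp_algFn (algFn_mem a) b.mem (u, t),
    (kerWeyl θ).act_conv (C := 1) (fun y => norm_idK_le _ _ _) a.mem b.mem]
  congr 1
  exact funext fun y => (algFn_eq_act a.mem y).symm

end algK

/-! ### Module homomorphisms are given by kernels -/

section charts

variable {θ : ℝ} [Fact (Irrational θ)] {τ : ℂ}

/-- The identity of every class factors through a free module. -/
theorem exists_frame (v : Ray) : ∃ (N : ℕ) (x ξ : ℕ → Fn),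
    (∀ l, x l ∈ Ker θ Ray.unit v) ∧ (∀ l, ξ l ∈ Ker θ v Ray.unit) ∧
      ∑ l ∈ Finset.range N, comp θ Ray.unit (x l) (ξ l) = idK v := by
  by_cases hm : v.m = 0
  · have h1 : idK v = idK Ray.unit ∧ idK Ray.unit ∈ Ker θ Ray.unit v ∧
        idK Ray.unit ∈ Ker θ v Ray.unit := by
      rcases Ray.eq_unit_of_m_eq_zero hm with rfl | rfl
      · exact ⟨rfl, idK_mem _ _, idK_mem _ _⟩
      · have h2 : idK Ray.unit.neg = idK Ray.unit := by
          funext u t; simp only [idK, Ray.ell_neg', neg_eq_zero]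
        have h3 := idK_mem θ Ray.unit.neg
        rw [Ker_neg_right, h2] at h3
        have h4 := idK_mem θ Ray.unit
        rw [← Ker_neg_right] at h4
        exact ⟨h2, h4, h3⟩
    refine ⟨1, fun _ => idK Ray.unit, fun _ => idK Ray.unit, fun _ => h1.2.1, fun _ => h1.2.2, ?_⟩
    rw [Finset.sum_range_one, idK_comp, h1.1]
  · exact exists_frame_of_ne hm

/-- A description of a module with a holomorphic structure by kernels: an isomorphism with the
kernels from the class of the free module to the class `v` that turns the module structure into
composition of kernels and the holomorphic structure into the one with parameter `z`. -/
structure Chart (E : HolMod θ τ) (v : Ray) (z : ℂ) where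
  ι : E.carrier ≃ₗ[ℂ] Ker θ Ray.unit v
  act : ∀ (x : E.carrier) (a : Alg θ),
    (ι (MulOpposite.op a • x)).1 = comp θ Ray.unit (ι x).1 (algK θ a).1
  nabla : ∀ x : E.carrier, (ι (E.nabla x)).1 = nab θ τ z Ray.unit v (ι x).1

namespace Chart

variable {E E' E'' : HolMod θ τ} {v v' v'' : Ray} {z z' z'' : ℂ}

theorem ι_ext (c : Chart E v z) {x y : E.carrier} (h : (c.ι x).1 = (c.ι y).1) : x = y :=
  c.ι.injective (Subtype.ext h)

/-- The homomorphism with a given kernel. -/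
def hom (c : Chart E v z) (c' : Chart E' v' z') : Ker θ v v' →ₗ[ℂ] E.AHom E' where
  toFun κ :=
    { toFun := fun x => c'.ι.symm ⟨comp θ v κ.1 (c.ι x).1, Ker.comp κ.2 (c.ι x).2⟩
      map_add' := fun x y => c'.ι_ext (by
        rw [LinearEquiv.apply_symm_apply, map_add, map_add, LinearEquiv.apply_symm_apply,
          LinearEquiv.apply_symm_apply]
        exact comp_add_right (Ker.rap κ.2) (Ker.rap (c.ι x).2) (Ker.rap (c.ι y).2))
      map_smul' := fun a x => c'.ι_ext (by
        have h1 := c.act x a.unop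
        have h2 := c'.act (c'.ι.symm ⟨comp θ v κ.1 (c.ι x).1, Ker.comp κ.2 (c.ι x).2⟩) a.unop
        rw [MulOpposite.op_unop] at h1 h2
        rw [RingHom.id_apply, h2, LinearEquiv.apply_symm_apply, LinearEquiv.apply_symm_apply]
        show comp θ v κ.1 (c.ι (a • x)).1 = _
        rw [h1]
        exact (comp_assoc κ.2 (c.ι x).2 (algK θ a.unop).2).symm) }
  map_add' κ κ₂ := LinearMap.ext fun x => c'.ι_ext (by
    simp only [LinearMap.add_apply, LinearMap.coe_mk, AddHom.coe_mk, map_add,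
      LinearEquiv.apply_symm_apply]
    exact comp_add_left (Ker.rap κ.2) (Ker.rap κ₂.2) (Ker.rap (c.ι x).2))
  map_smul' a κ := LinearMap.ext fun x => c'.ι_ext (by
    simp only [LinearMap.smul_apply, LinearMap.coe_mk, AddHom.coe_mk, map_smul,
      LinearEquiv.apply_symm_apply, RingHom.id_apply]
    exact comp_smul_left a κ.1 (c.ι x).1)

theorem ι_hom (c : Chart E v z) (c' : Chart E' v' z') (κ : Ker θ v v') (x : E.carrier) :
    (c'.ι (c.hom c' κ x)).1 = comp θ v κ.1 (c.ι x).1 :=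
  congrArg Subtype.val (c'.ι.apply_symm_apply _)

theorem comp_sum_right {ι : Type*} (s : Finset ι) {v₁ v₂ v₃ : Ray} {κ : Fn} (h : κ ∈ Ker θ v₂ v₃)
    {f : ι → Fn} (hf : ∀ i, f i ∈ Ker θ v₁ v₂) :
    comp θ v₂ κ (∑ i ∈ s, f i) = ∑ i ∈ s, comp θ v₂ κ (f i) := by
  classical
  induction s using Finset.induction_on with
  | empty => funext u t; simp [comp]
  | insert i s hi ih =>
    rw [Finset.sum_insert hi, Finset.sum_insert hi, ← ih]
    exact comp_add_right (Ker.rap h) (Ker.rap (hf i))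
      (Ker.rap (Submodule.sum_mem _ fun j _ => hf j))

theorem comp_sum_left {ι : Type*} (s : Finset ι) {v₁ v₂ v₃ : Ray} {κ : Fn} (h : κ ∈ Ker θ v₁ v₂)
    {f : ι → Fn} (hf : ∀ i, f i ∈ Ker θ v₂ v₃) :
    comp θ v₂ (∑ i ∈ s, f i) κ = ∑ i ∈ s, comp θ v₂ (f i) κ := by
  classical
  induction s using Finset.induction_on with
  | empty => funext u t; simp [comp]
  | insert i s hi ih =>
    rw [Finset.sum_insert hi, Finset.sum_insert hi, ← ih]
    exact comp_add_left (Ker.rap (hf i)) (Ker.rap (Submodule.sum_mem _ fun j _ => hf j)) (Ker.rap h)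

/-- The kernel of a homomorphism `φ` is `∑ φ(x l) ∘ ξ l` for a frame `x`, `ξ` of the identity. -/
theorem hom_bijective (c : Chart E v z) (c' : Chart E' v' z') :
    Function.Bijective (c.hom c') := by
  obtain ⟨N, x, ξ, hx, hξ, hid⟩ := exists_frame (θ := θ) v
  have hxξ : ∀ l, comp θ Ray.unit (x l) (ξ l) ∈ Ker θ v v := fun l => Ker.comp (hx l) (hξ l)
  let X : ℕ → E.carrier := fun l => c.ι.symm ⟨x l, hx l⟩
  have hX : ∀ l, (c.ι (X l)).1 = x l := fun l =>
    congrArg Subtype.val (c.ι.apply_symm_apply ⟨x l, hx l⟩)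
  constructor
  · refine (injective_iff_map_eq_zero _).mpr fun κ hκ => Subtype.ext ?_
    rw [← comp_idK κ.2, ← hid, comp_sum_right _ κ.2 hxξ]
    refine Finset.sum_eq_zero fun l _ => ?_
    rw [← comp_assoc κ.2 (hx l) (hξ l), ← hX l, ← ι_hom c c' κ (X l), hκ, LinearMap.zero_apply,
      map_zero]
    funext u t
    simp [comp]
  · intro φ
    let κ : Fn := ∑ l ∈ Finset.range N, comp θ Ray.unit (c'.ι (φ (X l))).1 (ξ l)
    have hκ' : ∀ l, comp θ Ray.unit (c'.ι (φ (X l))).1 (ξ l) ∈ Ker θ v v' := fun l =>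
      Ker.comp (c'.ι (φ (X l))).2 (hξ l)
    have hκ : κ ∈ Ker θ v v' := Submodule.sum_mem _ fun l _ => hκ' l
    refine ⟨⟨κ, hκ⟩, LinearMap.ext fun y => c'.ι_ext ?_⟩
    rw [ι_hom]
    let a : ℕ → Alg θ := fun l =>
      (algK θ).symm ⟨comp θ v (ξ l) (c.ι y).1, Ker.comp (hξ l) (c.ι y).2⟩
    have ha : ∀ l, (algK θ (a l)).1 = comp θ v (ξ l) (c.ι y).1 := fun l =>
      congrArg Subtype.val ((algK θ).apply_symm_apply _)
    have hy : y = ∑ l ∈ Finset.range N, MulOpposite.op (a l) • X l := by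
      refine c.ι_ext ?_
      rw [map_sum, AddSubmonoidClass.coe_finsetSum]
      simp only [c.act, ha, hX]
      refine (idK_comp (θ := θ) (v := v) (c.ι y).1).symm.trans ?_
      rw [← hid, comp_sum_left _ (c.ι y).2 hxξ]
      exact Finset.sum_congr rfl fun l _ => comp_assoc (hx l) (hξ l) (c.ι y).2
    conv_rhs => rw [hy]
    rw [map_sum, map_sum, AddSubmonoidClass.coe_finsetSum, comp_sum_left _ (c.ι y).2 hκ']
    refine Finset.sum_congr rfl fun l _ => ?_
    rw [map_smul, c'.act, ha, comp_assoc (c'.ι (φ (X l))).2 (hξ l) (c.ι y).2]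

/-- The kernel of a homomorphism. -/
def kernel (c : Chart E v z) (c' : Chart E' v' z') : E.AHom E' ≃ₗ[ℂ] Ker θ v v' :=
  (LinearEquiv.ofBijective (c.hom c') (c.hom_bijective c')).symm

theorem ι_apply (c : Chart E v z) (c' : Chart E' v' z') (φ : E.AHom E') (x : E.carrier) :
    (c'.ι (φ x)).1 = comp θ v (c.kernel c' φ).1 (c.ι x).1 := by
  rw [← ι_hom]
  congr 3
  exact ((LinearEquiv.ofBijective (c.hom c') (c.hom_bijective c')).apply_symm_apply φ).symm

/-- The kernel is determined by the composition with the elements of the module. -/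
theorem kernel_eq (c : Chart E v z) (c' : Chart E' v' z') {φ : E.AHom E'} {κ : Fn}
    (hκ : κ ∈ Ker θ v v') (h : ∀ x, (c'.ι (φ x)).1 = comp θ v κ (c.ι x).1) :
    (c.kernel c' φ).1 = κ := by
  have : c.kernel c' φ = ⟨κ, hκ⟩ := by
    rw [kernel, LinearEquiv.symm_apply_eq]
    exact LinearMap.ext fun x => c'.ι_ext ((h x).trans (ι_hom c c' ⟨κ, hκ⟩ x).symm)
  rw [this]

theorem kernel_comp (c : Chart E v z) (c' : Chart E' v' z') (c'' : Chart E'' v'' z'')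
    (ψ : E'.AHom E'') (φ : E.AHom E') :
    (c.kernel c'' (ψ ∘ₗ φ)).1 = comp θ v' (c'.kernel c'' ψ).1 (c.kernel c' φ).1 :=
  kernel_eq c c'' (Ker.comp (c'.kernel c'' ψ).2 (c.kernel c' φ).2) fun x => by
    rw [comp_assoc (c'.kernel c'' ψ).2 (c.kernel c' φ).2 (c.ι x).2, ← ι_apply, ← ι_apply]
    rfl

theorem kernel_id (c : Chart E v z) : (c.kernel c LinearMap.id).1 = idK v :=
  kernel_eq c c (idK_mem θ v) fun x => by rw [idK_comp]; rfl

theorem kernel_nabla (c : Chart E v z) (c' : Chart E' v' z') (φ : E.AHom E') :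
    (c.kernel c' (E.nablaHom E' φ)).1 = nab θ τ (z' - z) v v' (c.kernel c' φ).1 :=
  kernel_eq c c' (Ker.nab (c.kernel c' φ).2 _ _) fun x => by
    have h1 : E.nablaHom E' φ x = E'.nabla (φ x) - φ (E.nabla x) := rfl
    have h2 := nab_comp (c.kernel c' φ).2 (c.ι x).2 τ (z' - z) z
    rw [sub_add_cancel] at h2
    rw [h1, map_sub, Submodule.coe_sub, c'.nabla, ι_apply c c', ι_apply c c', c.nabla, h2,
      add_sub_cancel_right]

end Chart

theorem algK_nabla (z : ℂ) (a : Alg θ) :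
    (algK θ ((2 * Real.pi * Complex.I * z) • a + delta τ a)).1 =
      nab θ τ z Ray.unit Ray.unit (algK θ a).1 := by
  funext u t
  have h2 : (algK θ ((2 * Real.pi * Complex.I * z) • a + delta τ a)).1 u t =
      (2 * Real.pi * Complex.I * z) * algFn θ a.coeff u t + algFn θ (delta τ a).coeff u t := by
    rw [map_add, map_smul]; rfl
  have h3 : dF (algFn θ a.coeff) u t = algFn θ (der 0 (2 * Real.pi * Complex.I) a).coeff u t :=
    (hasDerivAt_algFn a u t).deriv
  have h4 : algFn θ (delta τ a).coeff u t =
      algFn θ (der 0 (2 * Real.pi * Complex.I) a).coeff u t +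
        2 * Real.pi * Complex.I * τ * (-u.2) * algFn θ a.coeff u t := by
    simp only [algFn]
    rw [← tsum_mul_left, ← (summable_algFn (Alg.mem _) u t).tsum_add
      ((summable_algFn a.mem u t).mul_left _)]
    refine tsum_congr fun p => ?_
    simp only [delta, coeff_der]
    push_cast; ring
  simp only [nab, Pi.add_apply, Pi.smul_apply, smul_eq_mul, h2, h3, h4, algK_coe, wgt, slope_self,
    Ray.ell_unit, Ray.rk_unit]
  push_cast; ring

/-- The description of the trivial bundle by kernels. -/
def trivialChart (θ : ℝ) [Fact (Irrational θ)] (τ z : ℂ) :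
    Chart (trivialBundle θ τ z) Ray.unit z where
  ι := algK θ
  act x a := algK_mul x a
  nabla x := algK_nabla z x

end charts

/-! ### The basic modules as spaces of kernels -/

section schwartz

variable {θ : ℝ} {v : Ray}

/-- The kernel of an element of a basic module: `(u, t) ↦ f(t - γ r/m, -γ)` for `u = (k, γ)`. -/
def toFn (θ : ℝ) (v : Ray) (f : SMod θ v.n v.m) : Fn := fun u t =>
  f.fn (t - u.2 * (v.rk θ / v.m), ((-u.2 : ℤ) : ZMod v.m.natAbs))

theorem hasDerivAt_toFn (f : SMod θ v.n v.m) (u : ℤ × ℤ) (t : ℝ) :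
    HasDerivAt (toFn θ v f u) (toFn θ v (SMod.D f) u t) t :=
  ((f ((-u.2 : ℤ) : ZMod v.m.natAbs)).differentiable _).hasDerivAt.comp_sub_const t _

theorem Ker.per2_zsmul {v v' : Ray} {κ : Fn} (h : κ ∈ Ker θ v v') (i : ℤ) (u : ℤ × ℤ) (t : ℝ) :
    κ (u + i • v'.w) (t + i * v'.rk θ) = κ u t := by
  have h' : Function.Periodic (fun y : (ℤ × ℤ) × ℝ => κ y.1 y.2) (v'.w, v'.rk θ) :=
    fun y => Ker.per2 h y.1 y.2
  have := h'.zsmul i (u, t)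
  simpa only [Prod.smul_mk, Prod.mk_add_mk, zsmul_eq_mul (v'.rk θ)] using this

theorem toFn_add (f g : SMod θ v.n v.m) : toFn θ v (f + g) = toFn θ v f + toFn θ v g := rfl

theorem toFn_smul (c : ℂ) (f : SMod θ v.n v.m) : toFn θ v (c • f) = c • toFn θ v f := rfl

theorem Sch.contDiff {q : ℤ × ℤ → ℝ → ℝ} {κ : Fn} (h : ∀ j, Sch q j κ) (u : ℤ × ℤ) (j : ℕ) :
    ContDiff ℝ j (κ u) := by
  induction j generalizing κ with
  | zero => exact contDiff_zero.mpr (Sch.continuous h u)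
  | succ j ih =>
    rw [Nat.cast_add, Nat.cast_one, contDiff_succ_iff_deriv]
    exact ⟨fun t => (Sch.hasDerivAt h u t).differentiableAt, by simp, ih (Sch.dF h)⟩

variable [NeZero v.m]

theorem natAbs_dvd_val_add (u : ℤ × ℤ) :
    ∃ i : ℤ, -((((-u.2 : ℤ) : ZMod v.m.natAbs).val : ℕ) : ℤ) = u.2 + i * v.m := by
  have hdvd : v.m ∣ (((((-u.2 : ℤ) : ZMod v.m.natAbs).val : ℕ) : ℤ) + u.2) := by
    rw [← Int.natAbs_dvd, ← ZMod.intCast_zmod_eq_zero_iff_dvd]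
    push_cast
    simp
  obtain ⟨k, hk⟩ := hdvd
  exact ⟨-k, by linarith⟩

variable [Fact (Irrational θ)]

theorem wgt_unit (u : ℤ × ℤ) (t : ℝ) :
    wgt θ Ray.unit v u t = v.m / v.rk θ * (t - u.2 * (v.rk θ / v.m)) := by
  have hm : (v.m : ℝ) ≠ 0 := by exact_mod_cast NeZero.ne v.m
  have hr := v.rk_ne (θ := θ)
  simp only [wgt, slope, Ray.rk_unit, Ray.ell_unit]
  simp only [Ray.det, Ray.unit]
  push_cast
  field_simp
  ring

theorem wgt_mul_toFn (f : SMod θ v.n v.m) (u : ℤ × ℤ) (t : ℝ) :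
    wgt θ Ray.unit v u t * toFn θ v f u t =
      ((v.m / v.rk θ : ℝ) : ℂ) * toFn θ v (SMod.X f) u t := by
  rw [wgt_unit, toFn, toFn, SMod.fn_X]
  push_cast; ring

theorem rap_toFn (f : SMod θ v.n v.m) : Rap (wgt θ Ray.unit v) (toFn θ v f) := by
  intro N
  induction N generalizing f with
  | zero =>
    obtain ⟨C, hC⟩ := f.bounded
    exact ⟨C, fun u t => by rw [pow_zero, one_mul]; exact hC _⟩
  | succ N ih =>
    obtain ⟨C, hC⟩ := ih f
    obtain ⟨C', hC'⟩ := ih (SMod.X f)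
    refine ⟨C + |v.m / v.rk θ| * C', fun u t => ?_⟩
    have h1 : |wgt θ Ray.unit v u t| * ‖toFn θ v f u t‖ =
        |v.m / v.rk θ| * ‖toFn θ v (SMod.X f) u t‖ := by
      have := congrArg norm (wgt_mul_toFn f u t)
      rwa [norm_mul, norm_mul, Complex.norm_real, Complex.norm_real, Real.norm_eq_abs,
        Real.norm_eq_abs] at this
    calc (1 + |wgt θ Ray.unit v u t|) ^ (N + 1) * ‖toFn θ v f u t‖ =
        (1 + |wgt θ Ray.unit v u t|) ^ N * ‖toFn θ v f u t‖ + (1 + |wgt θ Ray.unit v u t|) ^ N *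
          (|wgt θ Ray.unit v u t| * ‖toFn θ v f u t‖) := by ring
      _ = (1 + |wgt θ Ray.unit v u t|) ^ N * ‖toFn θ v f u t‖ + |v.m / v.rk θ| *
          ((1 + |wgt θ Ray.unit v u t|) ^ N * ‖toFn θ v (SMod.X f) u t‖) := by rw [h1]; ring
      _ ≤ _ := by
        gcongr
        · exact hC u t
        · exact hC' u t

theorem toFn_mem (f : SMod θ v.n v.m) : toFn θ v f ∈ Ker θ Ray.unit v := by
  have hm : (v.m : ℝ) ≠ 0 := by exact_mod_cast NeZero.ne v.m
  refine ⟨fun u t => by simp [toFn, Ray.w, Ray.unit], fun u t => ?_, fun j => ?_⟩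
  · simp only [toFn, Prod.snd_add, Ray.w]
    congr 2
    · push_cast
      field_simp
      ring
    · have : ((v.m : ℤ) : ZMod v.m.natAbs) = 0 := by
        rw [ZMod.intCast_zmod_eq_zero_iff_dvd]; simp
      push_cast
      rw [this]; ring
  · induction j generalizing f with
    | zero => exact rap_toFn f
    | succ j ih => exact ⟨rap_toFn f, _, hasDerivAt_toFn f, ih _⟩

theorem Ker.decay {κ : Fn} (h : κ ∈ Ker θ Ray.unit v) (γ : ℤ) (k j : ℕ) :
    ∃ C, ∀ x : ℝ, |x| ^ k *
      ‖iteratedDeriv j (fun x => κ (0, γ) (x + γ * (v.rk θ / v.m))) x‖ ≤ C := by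
  induction j generalizing κ with
  | zero =>
    have hm : (v.m : ℝ) ≠ 0 := by exact_mod_cast NeZero.ne v.m
    have hr := v.rk_ne (θ := θ)
    obtain ⟨C, -, hC⟩ := (Ker.rap h).exists_bound k
    refine ⟨|v.rk θ / v.m| ^ k * C, fun x => ?_⟩
    have h1 := hC (0, γ) (x + γ * (v.rk θ / v.m))
    rw [wgt_unit, add_sub_cancel_right, abs_mul] at h1
    rw [iteratedDeriv_zero]
    have h2 : |x| = |v.rk θ / v.m| * (|v.m / v.rk θ| * |x|) := by
      rw [← mul_assoc, ← abs_mul, div_mul_div_cancel₀ hm, div_self hr, abs_one, one_mul]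
    calc _ = |v.rk θ / v.m| ^ k * ((|v.m / v.rk θ| * |x|) ^ k *
          ‖κ (0, γ) (x + γ * (v.rk θ / v.m))‖) := by
          conv_lhs => rw [h2]
          rw [mul_pow, mul_assoc]
      _ ≤ |v.rk θ / v.m| ^ k * ((1 + |v.m / v.rk θ| * |x|) ^ k *
          ‖κ (0, γ) (x + γ * (v.rk θ / v.m))‖) := by gcongr; linarith
      _ ≤ _ := by gcongr
  | succ j ih =>
    obtain ⟨C, hC⟩ := ih (Ker.dF h)
    refine ⟨C, fun x => ?_⟩
    rw [iteratedDeriv_succ']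
    have : deriv (fun x => κ (0, γ) (x + γ * (v.rk θ / v.m))) =
        fun x => NCTorus.dF κ (0, γ) (x + γ * (v.rk θ / v.m)) :=
      funext fun x => ((Ker.hasDerivAt h (0, γ) _).comp_add_const x _).deriv
    rw [this]
    exact hC x

/-- The element of a basic module with a given kernel. -/
def ofFn (κ : Ker θ Ray.unit v) : SMod θ v.n v.m := fun α =>
  { toFun := fun x => κ.1 (0, -(α.val : ℤ)) (x + (-(α.val : ℤ) : ℤ) * (v.rk θ / v.m))
    smooth' := contDiff_infty.mpr fun j =>
      (Sch.contDiff κ.2.2.2 _ j).comp (contDiff_id.add contDiff_const)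
    decay' := fun k j => by
      obtain ⟨C, hC⟩ := Ker.decay κ.2 (-(α.val : ℤ)) k j
      exact ⟨C, fun x => by
        rw [norm_iteratedFDeriv_eq_norm_iteratedDeriv, Real.norm_eq_abs]; exact hC x⟩ }

theorem toFn_ofFn (κ : Ker θ Ray.unit v) : toFn θ v (ofFn κ) = κ.1 := by
  have hm : (v.m : ℝ) ≠ 0 := by exact_mod_cast NeZero.ne v.m
  funext u t
  obtain ⟨i, hi⟩ := natAbs_dvd_val_add (v := v) u
  show κ.1 (0, _) (t - u.2 * (v.rk θ / v.m) + _ * (v.rk θ / v.m)) = _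
  rw [hi, ← Ker.per2_zsmul κ.2 i u t]
  have h1 := periodic_zsmul (F := fun u' => κ.1 u' (t + i * v.rk θ))
    (fun u' => Ker.per1 κ.2 u' _) (-(u.1 - i * v.n)) (0, u.2 + i * v.m)
  refine Eq.trans ?_ (h1.symm.trans ?_)
  · refine congrArg (κ.1 (0, u.2 + i * v.m)) ?_
    push_cast
    field_simp
    ring
  · refine congrArg (fun y => κ.1 y (t + i * v.rk θ)) (Prod.ext ?_ ?_)
    · simp [Ray.w, Ray.unit]
      ring
    · simp [Ray.w, Ray.unit]

theorem ofFn_toFn (f : SMod θ v.n v.m) : ofFn ⟨toFn θ v f, toFn_mem f⟩ = f := by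
  refine SMod.ext fun y => ?_
  show f.fn (y.1 + (-(y.2.val : ℤ) : ℤ) * (v.rk θ / v.m) - (-(y.2.val : ℤ) : ℤ) * (v.rk θ / v.m),
    ((-(-(y.2.val : ℤ)) : ℤ) : ZMod v.m.natAbs)) = _
  rw [add_sub_cancel_right, neg_neg, Int.cast_natCast, ZMod.natCast_zmod_val]

theorem toFn_act (f : SMod θ v.n v.m) (a : Alg θ) :
    toFn θ v (MulOpposite.op a • f) = comp θ Ray.unit (toFn θ v f) (algK θ a).1 := by
  have hm : (v.m : ℝ) ≠ 0 := by exact_mod_cast NeZero.ne v.m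
  funext u t
  rw [algK_coe, comp_algFn (toFn_mem f) a.mem (u, t), toFn, SMod.fn_op_smul, SMod.actFn, Weyl.act,
    Weyl.act]
  refine tsum_congr fun p => ?_
  congr 2
  · simp only [basicWeyl, kerWeyl]
    obtain ⟨i, hi⟩ := natAbs_dvd_val_add (v := v) u
    have hi' : ((((-u.2 : ℤ) : ZMod v.m.natAbs).val : ℕ) : ℝ) = -(u.2 + i * v.m) := by
      have : ((-((((-u.2 : ℤ) : ZMod v.m.natAbs).val : ℕ) : ℤ) : ℤ) : ℝ) =
        ((u.2 + i * v.m : ℤ) : ℝ) := by rw [hi]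
      push_cast at this ⊢
      linarith
    rw [hi']
    have : (p.2 * (t - u.2 * (v.rk θ / v.m) - -(u.2 + i * v.m) * v.n / v.m) : ℝ) =
        p.2 * (t - θ * u.2) + ((p.2 * (i * v.n) : ℤ) : ℝ) := by
      simp only [Ray.rk]
      push_cast
      field_simp
      ring
    rw [this, e_add, e_int, mul_one]
  · simp only [basicWeyl, kerWeyl, toFn, Prod.snd_add]
    congr 2
    · simp only [Ray.rk]
      push_cast
      ring
    · push_cast
      ring

theorem toFn_nabla (τ z : ℂ) (f : SMod θ v.n v.m) :
    toFn θ v ((SMod.D + (2 * Real.pi * Complex.I) •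
      ((τ * (v.m / (v.n + v.m * θ) : ℝ)) • SMod.X + z • LinearMap.id) :
        SMod θ v.n v.m →ₗ[ℂ] SMod θ v.n v.m) f) = nab θ τ z Ray.unit v (toFn θ v f) := by
  simp only [LinearMap.add_apply, LinearMap.smul_apply, LinearMap.id_apply, toFn_add, toFn_smul]
  funext u t
  have hd : dF (toFn θ v f) u t = toFn θ v (SMod.D f) u t := (hasDerivAt_toFn f u t).deriv
  simp only [nab, Pi.add_apply, Pi.smul_apply, smul_eq_mul, hd, wgt_mul_toFn, Ray.rk]
  ring

/-- The description of a basic module by kernels. -/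
def schwartzChart (τ z : ℂ) (hm : v.m ≠ 0) (hr : (v.n + v.m * θ : ℝ) ≠ 0) :
    Chart (schwartzBundle θ τ z v.n v.m hm hr) v z where
  ι :=
    { toFun := fun f => ⟨toFn θ v f, toFn_mem f⟩
      map_add' := fun _ _ => rfl
      map_smul' := fun _ _ => rfl
      invFun := fun κ => ofFn κ
      left_inv := ofFn_toFn
      right_inv := fun κ => Subtype.ext (toFn_ofFn κ) }
  act f a := toFn_act f a
  nabla f := toFn_nabla τ z f

end schwartz

/-- The class of a standard bundle. -/
def stdRay {θ : ℝ} (E : StdBundle θ) : Ray := ⟨E.n, E.m, E.coprime⟩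

theorem stdRay_rk {θ : ℝ} (E : StdBundle θ) : 0 < (stdRay E).rk θ := E.rank_pos

theorem exists_stdChart {θ : ℝ} [Fact (Irrational θ)] (τ : ℂ) (E : StdBundle θ) :
    Nonempty (Chart (E.toHolMod τ) (stdRay E) E.z) := by
  by_cases hm : E.m = 0
  · have h1 : E.toHolMod τ = trivialBundle θ τ E.z := dif_pos hm
    have h2 : stdRay E = Ray.unit := by
      rcases Ray.eq_unit_of_m_eq_zero (v := stdRay E) hm with h | h
      · exact h
      · have := stdRay_rk E
        rw [h, Ray.rk_neg, Ray.rk_unit] at this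
        linarith
    rw [h1, h2]
    exact ⟨trivialChart θ τ E.z⟩
  · have h1 : E.toHolMod τ = schwartzBundle θ τ E.z E.n E.m hm E.rank_pos.ne' := dif_neg hm
    rw [h1]
    have : NeZero (stdRay E).m := ⟨hm⟩
    exact ⟨schwartzChart (v := stdRay E) τ E.z hm E.rank_pos.ne'⟩

/-- Charts may be taken with either sign of the class. -/
theorem Chart.neg {θ : ℝ} [Fact (Irrational θ)] {τ : ℂ} {E : HolMod θ τ} {v : Ray} {z : ℂ}
    (c : Chart E v z) : Nonempty (Chart E v.neg z) := by
  refine ⟨⟨c.ι.trans (LinearEquiv.ofEq _ _ (Ker_neg_right θ Ray.unit v).symm), fun x a => c.act x a,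
    fun x => ?_⟩⟩
  show (c.ι (E.nabla x)).1 = nab θ τ z Ray.unit v.neg (c.ι x).1
  rw [c.nabla, nab, nab, wgt_neg_right]

/-! ### Gaussian solutions of the holomorphy equation -/

open MeasureTheory in
theorem integral_inv_one_add_sq_shift (y : ℝ) :
    Integrable (fun s : ℝ => (1 + (y - s) ^ 2)⁻¹) ∧ ∫ s : ℝ, (1 + (y - s) ^ 2)⁻¹ = Real.pi := by
  have h := integrable_inv_one_add_sq.comp_sub_left y
  refine ⟨h, ?_⟩
  rw [integral_sub_left_eq_self (fun s : ℝ => (1 + s ^ 2)⁻¹) volume y, integral_univ_inv_one_add_sq]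

/-- A Gaussian absorbs every polynomial. -/
theorem exists_gauss_le {a : ℝ} (ha : 0 < a) (N : ℕ) :
    ∃ K, 0 ≤ K ∧ ∀ x : ℝ, (1 + |x|) ^ N * Real.exp (-a * x ^ 2) ≤ K := by
  refine ⟨Real.exp a * ((2 / a) ^ N * N.factorial), by positivity, fun x => ?_⟩
  set s := 1 + |x|
  have hs : 1 ≤ s := by simp [s]
  have h1 : s ^ 2 ≤ 2 * (1 + x ^ 2) := by
    rw [← sq_abs x]; simp only [s]; nlinarith [sq_nonneg (1 - |x|)]
  have h2 : Real.exp (-a * x ^ 2) ≤ Real.exp a * Real.exp (-(a * s ^ 2 / 2)) := by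
    rw [← Real.exp_add]; apply Real.exp_le_exp.mpr; nlinarith
  have h3 := Real.pow_div_factorial_le_exp (a * s ^ 2 / 2) (by positivity) N
  rw [div_le_iff₀ (by positivity)] at h3
  have h4 : s ^ N ≤ (2 / a) ^ N * (a * s ^ 2 / 2) ^ N := by
    rw [← mul_pow]
    refine pow_le_pow_left₀ (by positivity) ?_ N
    have : 2 / a * (a * s ^ 2 / 2) = s ^ 2 := by field_simp
    rw [this]; nlinarith
  calc s ^ N * Real.exp (-a * x ^ 2) ≤
      ((2 / a) ^ N * (Real.exp (a * s ^ 2 / 2) * N.factorial)) *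
        (Real.exp a * Real.exp (-(a * s ^ 2 / 2))) := by
        refine mul_le_mul (h4.trans ?_) h2 (Real.exp_pos _).le (by positivity)
        gcongr
    _ = Real.exp a * ((2 / a) ^ N * N.factorial) *
        (Real.exp (a * s ^ 2 / 2) * Real.exp (-(a * s ^ 2 / 2))) := by ring
    _ = _ := by rw [← Real.exp_add]; simp

theorem exists_gauss_le_inv {a : ℝ} (ha : 0 < a) (N : ℕ) : ∃ K, 0 ≤ K ∧ ∀ x : ℝ,
    (1 + |x|) ^ N * Real.exp (-a * x ^ 2) ≤ K * (1 + x ^ 2)⁻¹ := by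
  obtain ⟨K, hK0, hK⟩ := exists_gauss_le ha (N + 2)
  refine ⟨K, hK0, fun x => ?_⟩
  rw [← div_eq_mul_inv, le_div_iff₀ (by positivity)]
  refine le_trans ?_ (hK x)
  have h1 : 1 + x ^ 2 ≤ (1 + |x|) ^ 2 := by rw [← sq_abs x]; nlinarith [abs_nonneg x]
  calc _ ≤ (1 + |x|) ^ N * Real.exp (-a * x ^ 2) * (1 + |x|) ^ 2 := by gcongr
    _ = _ := by ring

/-- The Gaussian `exp(-πiτ(y + δ/τ)²/D)`, a solution of `D g' + 2πi(τy + δ)g = 0`. -/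
def gauss (τ δ : ℂ) (D y : ℝ) : ℂ :=
  Complex.exp (-(Real.pi * Complex.I * τ * (y + δ / τ) ^ 2 / D))

section gauss

variable {τ δ : ℂ} {D : ℝ}

theorem gauss_ne_zero (y : ℝ) : gauss τ δ D y ≠ 0 := Complex.exp_ne_zero _

theorem gauss_neg (y : ℝ) : gauss τ δ (-D) y = (gauss τ δ D y)⁻¹ := by
  rw [gauss, gauss, ← Complex.exp_neg]
  congr 1
  push_cast
  rw [div_neg]

theorem hasDerivAt_gauss (hτ : τ ≠ 0) (y : ℝ) : HasDerivAt (gauss τ δ D)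
    (-(2 * Real.pi * Complex.I * (τ * y + δ) / D) * gauss τ δ D y) y := by
  have h1 : HasDerivAt (fun y : ℝ => -(Real.pi * Complex.I * τ * (y + δ / τ) ^ 2 / D : ℂ))
      (-(2 * Real.pi * Complex.I * (τ * y + δ) / D)) y := by
    have := ((((((hasDerivAt_id y).ofReal_comp).add_const (δ / τ)).pow 2).const_mul
      (Real.pi * Complex.I * τ : ℂ)).div_const (D : ℂ)).neg
    refine this.congr_deriv ?_
    simp only [id]
    congr 2
    push_cast
    field_simp
  exact h1.cexp.congr_deriv (mul_comm _ _)

theorem continuous_gauss : Continuous (gauss τ δ D) := by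
  unfold gauss
  fun_prop

theorem contDiff_gauss : ContDiff ℝ (⊤ : ℕ∞) (gauss τ δ D) := by
  unfold gauss
  have : ContDiff ℝ (⊤ : ℕ∞) fun y : ℝ => (y : ℂ) := Complex.ofRealCLM.contDiff
  fun_prop

/-- The absolute value of the Gaussian is a real Gaussian with centre `-x₀`. -/
theorem norm_gauss (hτ : τ.im < 0) : ∃ x₀ c₀ : ℝ, ∀ y,
    ‖gauss τ δ D y‖ = Real.exp (Real.pi * τ.im / D * (y + x₀) ^ 2 + c₀) := by
  have hτ0 : τ ≠ 0 := by rintro rfl; simp at hτ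
  refine ⟨δ.im / τ.im, Real.pi / D * ((τ * (δ / τ) ^ 2).im - δ.im ^ 2 / τ.im), fun y => ?_⟩
  rw [gauss, Complex.norm_exp]
  congr 1
  have h1 : -(Real.pi * Complex.I * τ * (y + δ / τ) ^ 2 / D : ℂ) =
      ((-(Real.pi / D) : ℝ) : ℂ) * (Complex.I * (τ * y ^ 2 + 2 * y * δ + τ * (δ / τ) ^ 2)) := by
    push_cast
    field_simp
    ring
  have h2 : (τ * (y : ℂ) ^ 2 + 2 * y * δ).im = τ.im * y ^ 2 + 2 * y * δ.im := by
    have : τ * (y : ℂ) ^ 2 + 2 * y * δ = ((y ^ 2 : ℝ) : ℂ) * τ + ((2 * y : ℝ) : ℂ) * δ := by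
      push_cast; ring
    rw [this, Complex.add_im, Complex.im_ofReal_mul, Complex.im_ofReal_mul]; ring
  rw [h1, Complex.re_ofReal_mul, Complex.I_mul_re, Complex.add_im, h2]
  have := hτ.ne
  field_simp
  ring

/-- Gaussians with positive parameter decrease rapidly. -/
theorem schR_gauss (hτ : τ.im < 0) (hD : 0 < D) : SchR (gauss τ δ D) := by
  have hτ0 : τ ≠ 0 := by rintro rfl; simp at hτ
  obtain ⟨x₀, c₀, h⟩ := norm_gauss (δ := δ) (D := D) hτ
  refine Sch.of_hasDerivAt (D := 1) (h := 0) (fun _ t => hasDerivAt_id t)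
    (-(2 * Real.pi * Complex.I * τ / D)) (-(2 * Real.pi * Complex.I * δ / D)) ?_ Sch.zero ?_
  · intro N
    have ha : 0 < -(Real.pi * τ.im / D) := by
      rw [neg_pos]; exact div_neg_of_neg_of_pos (mul_neg_of_pos_of_neg Real.pi_pos hτ) hD
    obtain ⟨K, hK0, hK⟩ := exists_gauss_le ha N
    refine ⟨(1 + |x₀|) ^ N * (K * Real.exp c₀), fun _ y => ?_⟩
    rw [h, Real.exp_add]
    have h1 : 1 + |y| ≤ (1 + |x₀|) * (1 + |y + x₀|) := by
      have := abs_sub (y + x₀) x₀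
      rw [add_sub_cancel_right] at this
      nlinarith [mul_nonneg (abs_nonneg x₀) (abs_nonneg (y + x₀))]
    have h2 := hK (y + x₀)
    rw [neg_neg] at h2
    calc (1 + |y|) ^ N * _ ≤ ((1 + |x₀|) * (1 + |y + x₀|)) ^ N *
          (Real.exp (Real.pi * τ.im / D * (y + x₀) ^ 2) * Real.exp c₀) := by gcongr
      _ = (1 + |x₀|) ^ N * (((1 + |y + x₀|) ^ N *
          Real.exp (Real.pi * τ.im / D * (y + x₀) ^ 2)) * Real.exp c₀) := by rw [mul_pow]; ring
      _ ≤ _ := by gcongr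
  · intro _ y
    refine (hasDerivAt_gauss hτ0 y).congr_deriv ?_
    simp only [Pi.zero_apply, id]
    ring

end gauss

/-! ### The equation on the line -/

section line

open MeasureTheory

variable {τ δ : ℂ} {D : ℝ}

/-- The estimate behind the solutions: the quotient of two values of the Gaussian absorbs the
polynomial weights. -/
theorem exists_kernel_bound {a : ℝ} (ha : 0 < a) (N : ℕ) : ∃ K, 0 ≤ K ∧ ∀ (y s : ℝ) (x h : ℂ)
    (C : ℝ), ‖x‖ ≤ Real.exp (-a * (y - s) ^ 2) → (1 + |s|) ^ N * ‖h‖ ≤ C →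
      (1 + |y|) ^ N * ‖x * h‖ ≤ C * K * (1 + (y - s) ^ 2)⁻¹ := by
  obtain ⟨K, hK0, hK⟩ := exists_gauss_le_inv ha N
  refine ⟨K, hK0, fun y s x h C hx hh => ?_⟩
  have h1 : 1 + |y| ≤ (1 + |s|) * (1 + |y - s|) := by
    have := abs_add_le s (y - s)
    rw [add_sub_cancel] at this
    nlinarith [mul_nonneg (abs_nonneg s) (abs_nonneg (y - s))]
  have hC : 0 ≤ C := le_trans (by positivity) hh
  rw [norm_mul]
  calc _ ≤ ((1 + |s|) * (1 + |y - s|)) ^ N * (Real.exp (-a * (y - s) ^ 2) * ‖h‖) := by gcongr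
    _ = ((1 + |s|) ^ N * ‖h‖) * ((1 + |y - s|) ^ N * Real.exp (-a * (y - s) ^ 2)) := by
      rw [mul_pow]; ring
    _ ≤ C * (K * (1 + (y - s) ^ 2)⁻¹) := mul_le_mul hh (hK _) (by positivity) hC
    _ = _ := by ring

/-- Integrals of functions dominated by a multiple of `1/(1 + (y - s)²)`. -/
theorem norm_setIntegral_le {S : Set ℝ} (hS : MeasurableSet S) {f : ℝ → ℂ} {w B y : ℝ} (hw : 0 ≤ w)
    (hB : 0 ≤ B) (h : ∀ s ∈ S, w * ‖f s‖ ≤ B * (1 + (y - s) ^ 2)⁻¹) :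
    w * ‖∫ s in S, f s‖ ≤ B * Real.pi := by
  obtain ⟨hi, he⟩ := integral_inv_one_add_sq_shift y
  have h1 : w * ‖∫ s in S, f s‖ = ‖∫ s in S, (w : ℂ) * f s‖ := by
    rw [integral_const_mul, norm_mul, Complex.norm_real, Real.norm_of_nonneg hw]
  rw [h1, ← he, ← integral_const_mul]
  refine (norm_integral_le_of_norm_le (hi.const_mul B).integrableOn
    (ae_restrict_of_forall_mem hS fun s hs => ?_)).trans ?_
  · rw [norm_mul, Complex.norm_real, Real.norm_of_nonneg hw]
    exact h s hs
  · exact setIntegral_le_integral (hi.const_mul B) (Filter.Eventually.of_forall fun s => by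
      show (0:ℝ) ≤ _
      positivity)

/-- Rapidly decreasing continuous functions are integrable. -/
theorem integrable_of_rap {q : ℤ × ℤ → ℝ → ℝ} {κ : Fn} {A : ℝ} (hA : A ≠ 0) {b : ℤ × ℤ → ℝ}
    (hq : ∀ u t, q u t = A * t - b u) (hκ : Rap q κ) (u : ℤ × ℤ) (hc : Continuous (κ u)) :
    Integrable (κ u) := by
  obtain ⟨C, hC0, hC⟩ := hκ.exists_bound 2
  have h1 : Integrable fun t : ℝ => C * (1 + (A * t - b u) ^ 2)⁻¹ :=
    ((integrable_inv_one_add_sq.comp_sub_right (b u)).comp_mul_left' hA).const_mul C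
  refine h1.mono' hc.aestronglyMeasurable (Filter.Eventually.of_forall fun t => ?_)
  rw [← div_eq_mul_inv, le_div_iff₀ (by positivity), mul_comm]
  refine le_trans ?_ (hC u t)
  rw [hq, ← sq_abs (A * t - b u)]
  gcongr
  nlinarith [abs_nonneg (A * t - b u)]

/-- The variation of constants. -/
theorem hasDerivAt_gauss_mul (hτ : τ ≠ 0) (hD : D ≠ 0) {F h : ℝ → ℂ} {y : ℝ}
    (hF : HasDerivAt F (h y / gauss τ δ D y / D) y) :
    HasDerivAt (fun y => gauss τ δ D y * F y) (h y / D + (-(2 * Real.pi * Complex.I * τ / D) * y +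
      -(2 * Real.pi * Complex.I * δ / D)) * (gauss τ δ D y * F y)) y := by
  refine ((hasDerivAt_gauss hτ y).mul hF).congr_deriv ?_
  have := gauss_ne_zero (τ := τ) (δ := δ) (D := D) y
  have hD' : (D : ℂ) ≠ 0 := by exact_mod_cast hD
  field_simp
  ring

/-- For a positive parameter, the equation has a rapidly decreasing solution. Its value on a line
depends only on the right-hand side on this line, so that it inherits periodicities. -/
theorem exists_solution_of_pos (hτ : τ.im < 0) (hD : 0 < D) {h : Fn}
    (hh : ∀ j, Sch (fun _ t => t) j h) : ∃ κ : Fn, (∀ j, Sch (fun _ t => t) j κ) ∧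
      (∀ u y, D * dF κ u y + 2 * Real.pi * Complex.I * (τ * y + δ) * κ u y = h u y) ∧
      ∀ u u', h u = h u' → κ u = κ u' := by
  have hτ0 : τ ≠ 0 := by rintro rfl; simp at hτ
  obtain ⟨x₀, c₀, hn⟩ := norm_gauss (δ := δ) (D := D) hτ
  have ha : 0 < -(Real.pi * τ.im / D) := by
    rw [neg_pos]; exact div_neg_of_neg_of_pos (mul_neg_of_pos_of_neg Real.pi_pos hτ) hD
  let g := gauss τ δ D
  -- the integral starts at the centre `-x₀` of the Gaussian, so that `|g y / g s|` is bounded by a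
  -- Gaussian in `y - s` for all `s` between `-x₀` and `y`
  let κ : Fn := fun u y => g y * ∫ s in (-x₀)..y, h u s / g s / D
  have hcont : ∀ u, Continuous fun s => h u s / g s / D := fun u =>
    ((Sch.continuous hh u).div continuous_gauss fun s => gauss_ne_zero s).div_const _
  have hd : ∀ u y, HasDerivAt (κ u) (((D : ℂ)⁻¹ • h) u y + (-(2 * Real.pi * Complex.I * τ / D) * y +
      -(2 * Real.pi * Complex.I * δ / D)) * κ u y) y := by
    intro u y
    have := hasDerivAt_gauss_mul (δ := δ) hτ0 hD.ne' (h := h u)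
      ((hcont u).integral_hasStrictDerivAt (-x₀) y).hasDerivAt
    refine this.congr_deriv ?_
    simp only [Pi.smul_apply, smul_eq_mul]
    rw [div_eq_inv_mul (h u y)]
  have hrap : Rap (fun _ t => t) κ := by
    intro N
    obtain ⟨C, hC0, hC⟩ := (Sch.rap (hh 0)).exists_bound N
    obtain ⟨K, hK0, hK⟩ := exists_kernel_bound ha N
    refine ⟨C / D * K * Real.pi, fun u y => ?_⟩
    have e1 : ‖κ u y‖ = ‖∫ s in Set.uIoc (-x₀) y, g y * (h u s / g s / D)‖ := by
      simp only [κ]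
      rw [← intervalIntegral.integral_const_mul, intervalIntegral.norm_intervalIntegral_eq]
    rw [e1]
    refine norm_setIntegral_le (y := y) measurableSet_uIoc (by positivity) (by positivity)
      fun s hs => ?_
    have e2 : g y * (h u s / g s / D) = g y / g s * (h u s / D) := by ring
    rw [e2]
    refine hK y s _ _ _ ?_ ?_
    · rw [norm_div, hn, hn, ← Real.exp_sub, Real.exp_le_exp]
      have : (y + x₀ - (s + x₀)) * (s + x₀) ≥ 0 := by
        rcases Set.mem_uIoc.mp hs with ⟨h1, h2⟩ | ⟨h1, h2⟩
        · exact mul_nonneg (by linarith) (by linarith)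
        · exact mul_nonneg_of_nonpos_of_nonpos (by linarith) (by linarith)
      nlinarith
    · rw [norm_div, Complex.norm_real, Real.norm_of_nonneg hD.le, ← mul_div_assoc]
      exact div_le_div_of_nonneg_right (hC u s) hD.le
  refine ⟨κ, Sch.of_hasDerivAt (D := 1) (fun _ t => hasDerivAt_id t) _ _ hrap
    (fun j => (hh j).smul (D : ℂ)⁻¹) hd, fun u y => ?_, fun u u' he => ?_⟩
  · have hD' : (D : ℂ) ≠ 0 := by exact_mod_cast hD.ne'
    rw [dF, (hd u y).deriv]
    simp only [Pi.smul_apply, smul_eq_mul]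
    field_simp
    ring
  · simp only [κ, he]

theorem integrable_div_gauss (hτ : τ.im < 0) (hD : D < 0) {h : Fn}
    (hh : ∀ j, Sch (fun _ t => t) j h) (u : ℤ × ℤ) :
    Integrable fun y => h u y / gauss τ δ D y := by
  have h1 : Integrable (h u) := integrable_of_rap (A := 1) one_ne_zero (b := fun _ => 0)
    (fun _ t => by ring) (Sch.rap (hh 0)) u (Sch.continuous hh u)
  obtain ⟨C, hC⟩ := (Sch.rap (schR_gauss (δ := δ) hτ (neg_pos.mpr hD) 0)) 0
  have h2 : ∀ y, h u y / gauss τ δ D y = gauss τ δ (-D) y * h u y := fun y => by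
    rw [gauss_neg, div_eq_inv_mul]
  simp only [h2]
  exact h1.bdd_mul continuous_gauss.aestronglyMeasurable
    (Filter.Eventually.of_forall fun y => by simpa using hC 0 y)

/-- For a negative parameter, the equation has a rapidly decreasing solution when the right-hand
side is orthogonal to the inverse of the Gaussian. -/
theorem exists_solution_of_neg (hτ : τ.im < 0) (hD : D < 0) {h : Fn}
    (hh : ∀ j, Sch (fun _ t => t) j h) (h0 : ∀ u, ∫ y, h u y / gauss τ δ D y = 0) :
    ∃ κ : Fn, (∀ j, Sch (fun _ t => t) j κ) ∧
      (∀ u y, D * dF κ u y + 2 * Real.pi * Complex.I * (τ * y + δ) * κ u y = h u y) ∧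
      ∀ u u', h u = h u' → κ u = κ u' := by
  have hτ0 : τ ≠ 0 := by rintro rfl; simp at hτ
  obtain ⟨x₀, c₀, hn⟩ := norm_gauss (δ := δ) (D := D) hτ
  have ha : 0 < Real.pi * τ.im / D := div_pos_of_neg_of_neg
    (mul_neg_of_pos_of_neg Real.pi_pos hτ) hD
  let g := gauss τ δ D
  have hint : ∀ u, Integrable fun s => h u s / g s / D := fun u =>
    (integrable_div_gauss hτ hD hh u).div_const _
  have h0' : ∀ u, ∫ s, h u s / g s / D = 0 := fun u => by
    rw [integral_div, h0 u, zero_div]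
  let κ : Fn := fun u y => g y * ∫ s in Set.Iic y, h u s / g s / D
  have hcont : ∀ u, Continuous fun s => h u s / g s / D := fun u =>
    ((Sch.continuous hh u).div continuous_gauss fun s => gauss_ne_zero s).div_const _
  have hd : ∀ u y, HasDerivAt (κ u) (((D : ℂ)⁻¹ • h) u y + (-(2 * Real.pi * Complex.I * τ / D) * y +
      -(2 * Real.pi * Complex.I * δ / D)) * κ u y) y := by
    intro u y
    have h1 : HasDerivAt (fun y => ∫ s in Set.Iic y, h u s / g s / D) (h u y / g y / D) y := by
      have h2 : (fun y => ∫ s in Set.Iic y, h u s / g s / D) = fun y =>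
          (∫ s in (0)..y, h u s / g s / D) + ∫ s in Set.Iic (0 : ℝ), h u s / g s / D := by
        funext y
        rw [← intervalIntegral.integral_Iic_sub_Iic (hint u).integrableOn (hint u).integrableOn,
          sub_add_cancel]
      rw [h2]
      exact ((hcont u).integral_hasStrictDerivAt 0 y).hasDerivAt.add_const _
    refine (hasDerivAt_gauss_mul (δ := δ) hτ0 hD.ne (h := h u) h1).congr_deriv ?_
    simp only [Pi.smul_apply, smul_eq_mul]
    rw [div_eq_inv_mul (h u y)]
  have hrap : Rap (fun _ t => t) κ := by
    intro N
    obtain ⟨C, hC0, hC⟩ := (Sch.rap (hh 0)).exists_bound N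
    obtain ⟨K, hK0, hK⟩ := exists_kernel_bound ha N
    refine ⟨C / |D| * K * Real.pi, fun u y => ?_⟩
    have key : ∀ s, 0 ≤ (s - y) * (y + x₀) → (1 + |y|) ^ N * ‖g y * (h u s / g s / D)‖ ≤
        C / |D| * K * (1 + (y - s) ^ 2)⁻¹ := by
      intro s hs
      have e2 : g y * (h u s / g s / D) = g y / g s * (h u s / D) := by ring
      rw [e2]
      refine hK y s _ _ _ ?_ ?_
      · rw [norm_div, hn, hn, ← Real.exp_sub, Real.exp_le_exp]
        nlinarith
      · rw [norm_div, Complex.norm_real, Real.norm_eq_abs, ← mul_div_assoc]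
        exact div_le_div_of_nonneg_right (hC u s) (abs_nonneg D)
    -- as the total integral vanishes, one may integrate from the end of the line that lies on the
    -- same side of the centre `-x₀` as `y`
    rcases le_total (y + x₀) 0 with hy | hy
    · have e1 : κ u y = ∫ s in Set.Iic y, g y * (h u s / g s / D) := by
        rw [integral_const_mul]
      rw [e1]
      refine norm_setIntegral_le (y := y) measurableSet_Iic (by positivity) (by positivity)
        fun s hs => key s (mul_nonneg_of_nonpos_of_nonpos (sub_nonpos.mpr hs) hy)
    · have e1 : ‖κ u y‖ = ‖∫ s in Set.Ioi y, g y * (h u s / g s / D)‖ := by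
        have := intervalIntegral.integral_Iic_add_Ioi (b := y) (hint u).integrableOn
          (hint u).integrableOn
        rw [h0'] at this
        rw [integral_const_mul, ← neg_eq_of_add_eq_zero_right this, mul_neg, norm_neg]
      rw [e1]
      refine norm_setIntegral_le (y := y) measurableSet_Ioi (by positivity) (by positivity)
        fun s hs => key s (mul_nonneg (sub_nonneg.mpr (le_of_lt hs)) hy)
  refine ⟨κ, Sch.of_hasDerivAt (D := 1) (fun _ t => hasDerivAt_id t) _ _ hrap
    (fun j => (hh j).smul (D : ℂ)⁻¹) hd, fun u y => ?_, fun u u' he => ?_⟩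
  · have hD' : (D : ℂ) ≠ 0 := by exact_mod_cast hD.ne
    rw [dF, (hd u y).deriv]
    simp only [Pi.smul_apply, smul_eq_mul]
    field_simp
    ring
  · simp only [κ, he]

/-- A function divided by the Gaussian. -/
theorem hasDerivAt_div_gauss (hτ : τ ≠ 0) (hD : D ≠ 0) {f : ℝ → ℂ} {f' : ℂ} {y : ℝ}
    (hf : HasDerivAt f f' y) : HasDerivAt (fun y => f y / gauss τ δ D y)
      ((D * f' + 2 * Real.pi * Complex.I * (τ * y + δ) * f y) / gauss τ δ D y / D) y := by
  have hg := gauss_ne_zero (τ := τ) (δ := δ) (D := D) y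
  refine (hf.div (hasDerivAt_gauss hτ y) hg).congr_deriv ?_
  have hD' : (D : ℂ) ≠ 0 := by exact_mod_cast hD
  field_simp
  ring

/-- The right-hand side of a solvable equation is orthogonal to the inverse of the Gaussian. -/
theorem integral_div_gauss_eq_zero (hτ : τ.im < 0) (hD : D < 0) {κ h : Fn}
    (hκ : ∀ j, Sch (fun _ t => t) j κ) (hh : ∀ j, Sch (fun _ t => t) j h)
    (he : ∀ u y, D * dF κ u y + 2 * Real.pi * Complex.I * (τ * y + δ) * κ u y = h u y)
    (u : ℤ × ℤ) : ∫ y, h u y / gauss τ δ D y = 0 := by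
  have hτ0 : τ ≠ 0 := by rintro rfl; simp at hτ
  have hD' : (D : ℂ) ≠ 0 := by exact_mod_cast hD.ne
  have h1 := integral_eq_zero_of_hasDerivAt_of_integrable
    (f := fun y => κ u y / gauss τ δ D y) (f' := fun y => h u y / gauss τ δ D y / D)
    (fun y => by
      have := hasDerivAt_div_gauss (δ := δ) hτ0 hD.ne (Sch.hasDerivAt hκ u y)
      rwa [he] at this)
    ((integrable_div_gauss hτ hD hh u).div_const _) (integrable_div_gauss hτ hD hκ u)
  rw [integral_div, div_eq_zero_iff] at h1
  exact h1.resolve_right hD'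

/-- The solutions of the homogeneous equation are the multiples of the Gaussian. -/
theorem eq_mul_gauss (hτ : τ ≠ 0) (hD : D ≠ 0) {f f' : ℝ → ℂ} (hf : ∀ y, HasDerivAt f (f' y) y)
    (he : ∀ y, D * f' y + 2 * Real.pi * Complex.I * (τ * y + δ) * f y = 0) (y₀ y : ℝ) :
    f y = f y₀ / gauss τ δ D y₀ * gauss τ δ D y := by
  have h1 : ∀ y, HasDerivAt (fun y => f y / gauss τ δ D y) 0 y := fun y => by
    have := hasDerivAt_div_gauss (δ := δ) hτ hD (hf y)
    rwa [he, zero_div, zero_div] at this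
  have h2 := is_const_of_deriv_eq_zero (fun y => (h1 y).differentiableAt)
    (fun y => (h1 y).deriv) y y₀
  rw [← h2, div_mul_cancel₀ _ (gauss_ne_zero y)]

/-- For a negative parameter, the Gaussian is unbounded. -/
theorem eq_zero_of_mul_gauss_bounded (hτ : τ.im < 0) (hD : D < 0) {c : ℂ} {C : ℝ}
    (h : ∀ y, ‖c * gauss τ δ D y‖ ≤ C) : c = 0 := by
  obtain ⟨x₀, c₀, hn⟩ := norm_gauss (δ := δ) (D := D) hτ
  by_contra hc
  have ha : 0 < Real.pi * τ.im / D := div_pos_of_neg_of_neg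
    (mul_neg_of_pos_of_neg Real.pi_pos hτ) hD
  set a := Real.pi * τ.im / D
  have hcp : 0 < ‖c‖ := norm_pos_iff.mpr hc
  set B := |C / ‖c‖| + |c₀| + 1
  have h1 := h (B / a + 1 - x₀)
  rw [norm_mul, hn, mul_comm, ← le_div_iff₀ hcp, sub_add_cancel] at h1
  have h2 := Real.add_one_le_exp (a * (B / a + 1) ^ 2 + c₀)
  have hB : 1 ≤ B := by have := abs_nonneg (C / ‖c‖); have := abs_nonneg c₀; simp only [B]; linarith
  have h3 : B ≤ a * (B / a + 1) ^ 2 := by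
    have : a * (B / a + 1) ^ 2 = B * (B / a) + 2 * B + a := by field_simp; ring
    rw [this]
    have : 0 ≤ B * (B / a) := by positivity
    linarith
  have h4 := le_abs_self (C / ‖c‖)
  have h5 := neg_abs_le c₀
  simp only [B] at h3 hB
  linarith

end line

/-! ### Cohomology between different classes -/

section transversal

open MeasureTheory

variable {θ : ℝ} {τ δ : ℂ} {v v' : Ray}

/-- The Gaussian on the lines `{u} × ℝ`. -/
def gaussK (θ : ℝ) (τ δ : ℂ) (v v' : Ray) : Fn := fun u t =>
  gauss τ δ (slope θ v v') (wgt θ v v' u t)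

theorem gaussK_ne_zero (u : ℤ × ℤ) (t : ℝ) : gaussK θ τ δ v v' u t ≠ 0 := gauss_ne_zero _

theorem gaussK_per1 (u : ℤ × ℤ) (t : ℝ) :
    gaussK θ τ δ v v' (u + v.w) t = gaussK θ τ δ v v' u t := by
  rw [gaussK, wgt_per1, gaussK]

theorem continuous_gaussK (u : ℤ × ℤ) : Continuous (gaussK θ τ δ v v' u) :=
  continuous_gauss.comp (((continuous_id.const_mul _).sub continuous_const))

/-- The point of the line `{u} × ℝ` where the weight function has a given value. -/
def wgtInv (θ : ℝ) (v v' : Ray) (u : ℤ × ℤ) (y : ℝ) : ℝ := (y + v.ell u / v.rk θ) / slope θ v v'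

theorem wgt_wgtInv (hD : slope θ v v' ≠ 0) (u : ℤ × ℤ) (y : ℝ) :
    wgt θ v v' u (wgtInv θ v v' u y) = y := by
  rw [wgt, wgtInv, mul_div_cancel₀ _ hD, add_sub_cancel_right]

theorem wgtInv_wgt (hD : slope θ v v' ≠ 0) (u : ℤ × ℤ) (t : ℝ) :
    wgtInv θ v v' u (wgt θ v v' u t) = t := by
  rw [wgt, wgtInv, sub_add_cancel, mul_div_cancel_left₀ _ hD]

theorem hasDerivAt_wgtInv (u : ℤ × ℤ) (y : ℝ) :
    HasDerivAt (wgtInv θ v v' u) (slope θ v v')⁻¹ y := by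
  have := ((hasDerivAt_id y).add_const (v.ell u / v.rk θ)).div_const (slope θ v v')
  rwa [one_div] at this

/-- A family of functions of `t` in terms of the weight function. -/
def profOf (θ : ℝ) (v v' : Ray) (κ : Fn) : Fn := fun u y => κ u (wgtInv θ v v' u y)

theorem profOf_wgt (hD : slope θ v v' ≠ 0) (κ : Fn) (u : ℤ × ℤ) (t : ℝ) :
    profOf θ v v' κ u (wgt θ v v' u t) = κ u t := by
  rw [profOf, wgtInv_wgt hD]

theorem sch_profOf (hD : slope θ v v' ≠ 0) (j : ℕ) :
    ∀ {κ : Fn}, Sch (wgt θ v v') j κ → Sch (fun _ t => t) j (profOf θ v v' κ) := by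
  have h0 : ∀ {κ : Fn}, Rap (wgt θ v v') κ → Rap (fun _ t => t) (profOf θ v v' κ) := by
    intro κ h N
    obtain ⟨C, hC⟩ := h N
    refine ⟨C, fun u y => ?_⟩
    have := hC u (wgtInv θ v v' u y)
    rwa [wgt_wgtInv hD] at this
  induction j with
  | zero => exact h0
  | succ j ih =>
    rintro κ ⟨h, d, hd, hj⟩
    refine ⟨h0 h, ((slope θ v v')⁻¹ : ℂ) • profOf θ v v' d, fun u y => ?_, (ih hj).smul _⟩
    refine ((hd u _).scomp y (hasDerivAt_wgtInv u y)).congr_deriv ?_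
    simp only [Pi.smul_apply, smul_eq_mul, profOf, Complex.real_smul, Complex.ofReal_inv]

theorem sch_comp_wgt (j : ℕ) : ∀ {Φ : Fn}, Sch (fun _ t => t) j Φ →
    Sch (wgt θ v v') j (fun u t => Φ u (wgt θ v v' u t)) := by
  have h0 : ∀ {Φ : Fn}, Rap (fun _ t => t) Φ →
      Rap (wgt θ v v') (fun u t => Φ u (wgt θ v v' u t)) := by
    intro Φ h N
    obtain ⟨C, hC⟩ := h N
    exact ⟨C, fun u t => hC u _⟩
  induction j with
  | zero => exact h0
  | succ j ih =>
    rintro Φ ⟨h, d, hd, hj⟩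
    refine ⟨h0 h, (slope θ v v' : ℂ) • fun u t => d u (wgt θ v v' u t), fun u t => ?_,
      (ih hj).smul _⟩
    refine ((hd u _).scomp t (hasDerivAt_wgt θ v v' u t)).congr_deriv ?_
    simp only [Pi.smul_apply, smul_eq_mul, Complex.real_smul]

theorem dF_profOf (hD : slope θ v v' ≠ 0) {κ : Fn} (hκ : κ ∈ Ker θ v v') (u : ℤ × ℤ) (y : ℝ) :
    slope θ v v' * dF (profOf θ v v' κ) u y = profOf θ v v' (dF κ) u y := by
  have h := ((Ker.hasDerivAt hκ u (wgtInv θ v v' u y)).scomp y (hasDerivAt_wgtInv u y)).deriv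
  have hD' : (slope θ v v' : ℂ) ≠ 0 := by exact_mod_cast hD
  have h' : dF (profOf θ v v' κ) u y = _ := h
  rw [h', Complex.real_smul, Complex.ofReal_inv, mul_inv_cancel_left₀ hD', profOf]

theorem nab_comp_wgt {Φ : Fn} (hΦ : ∀ j, Sch (fun _ t => t) j Φ) (u : ℤ × ℤ) (t : ℝ) :
    nab θ τ δ v v' (fun u t => Φ u (wgt θ v v' u t)) u t =
      slope θ v v' * dF Φ u (wgt θ v v' u t) +
        2 * Real.pi * Complex.I * (τ * wgt θ v v' u t + δ) * Φ u (wgt θ v v' u t) := by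
  have h := ((Sch.hasDerivAt hΦ u _).scomp t (hasDerivAt_wgt θ v v' u t)).deriv
  have h' : dF (fun u t => Φ u (wgt θ v v' u t)) u t = _ := h
  simp only [nab, Pi.add_apply, Pi.smul_apply, smul_eq_mul, h', Complex.real_smul]
  ring

theorem profOf_nab (hD : slope θ v v' ≠ 0) {κ : Fn} (hκ : κ ∈ Ker θ v v') (u : ℤ × ℤ) (y : ℝ) :
    slope θ v v' * dF (profOf θ v v' κ) u y +
      2 * Real.pi * Complex.I * (τ * y + δ) * profOf θ v v' κ u y =
        profOf θ v v' (nab θ τ δ v v' κ) u y := by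
  rw [dF_profOf hD hκ]
  simp only [profOf, nab, Pi.add_apply, Pi.smul_apply, smul_eq_mul, wgt_wgtInv hD]
  ring

/-- The coefficients of a holomorphic kernel. -/
def coef0 (θ : ℝ) (τ δ : ℂ) (v v' : Ray) (κ : Fn) : ℤ × ℤ → ℂ := fun u =>
  κ u 0 / gaussK θ τ δ v v' u 0

theorem coef0_mul_gaussK (c : ℤ × ℤ → ℂ) :
    coef0 θ τ δ v v' (fun u t => c u * gaussK θ τ δ v v' u t) = c :=
  funext fun u => mul_div_cancel_right₀ _ (gaussK_ne_zero u 0)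

/-- The functional on the kernels that describes the first cohomology. -/
def coef1 (θ : ℝ) (τ δ : ℂ) (v v' : Ray) (κ : Fn) : ℤ × ℤ → ℂ := fun u =>
  ∫ t, κ u t / gaussK θ τ δ v v' u t

theorem coef1_eq (hD : slope θ v v' ≠ 0) (κ : Fn) (u : ℤ × ℤ) : coef1 θ τ δ v v' κ u =
    |(slope θ v v')⁻¹| • ∫ y, profOf θ v v' κ u y / gauss τ δ (slope θ v v') y := by
  have h := Measure.integral_comp_mul_left
    (fun y => profOf θ v v' κ u (y - v.ell u / v.rk θ) /
      gauss τ δ (slope θ v v') (y - v.ell u / v.rk θ)) (slope θ v v')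
  rw [integral_sub_right_eq_self (fun y => profOf θ v v' κ u y / gauss τ δ (slope θ v v') y)] at h
  rw [← h, coef1]
  congr 1
  funext t
  have := profOf_wgt hD κ u t
  rw [wgt] at this
  rw [this, gaussK, wgt]

theorem integrable_div_gaussK (hτ : τ.im < 0) (hD : slope θ v v' < 0) {κ : Fn}
    (hκ : κ ∈ Ker θ v v') (u : ℤ × ℤ) : Integrable fun t => κ u t / gaussK θ τ δ v v' u t := by
  have h1 := integrable_div_gauss (δ := δ) hτ hD (fun j => sch_profOf hD.ne j (Ker.sch hκ j)) u
  have h2 := (h1.comp_sub_right (v.ell u / v.rk θ)).comp_mul_left' hD.ne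
  refine h2.congr (Filter.Eventually.of_forall fun t => ?_)
  show profOf θ v v' κ u (wgt θ v v' u t) / gaussK θ τ δ v v' u t = _
  rw [profOf_wgt hD.ne]

variable [Fact (Irrational θ)]

theorem slope_ne_zero (hd : v.det v' ≠ 0) : slope θ v v' ≠ 0 :=
  div_ne_zero (by exact_mod_cast hd) (mul_ne_zero v.rk_ne v'.rk_ne)

theorem gaussK_per2 (u : ℤ × ℤ) (t : ℝ) :
    gaussK θ τ δ v v' (u + v'.w) (t + v'.rk θ) = gaussK θ τ δ v v' u t := by
  rw [gaussK, wgt_per2, gaussK]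

theorem profOf_per (hd : v.det v' ≠ 0) {κ : Fn} (hκ : κ ∈ Ker θ v v') (u : ℤ × ℤ) :
    profOf θ v v' κ (u + v.w) = profOf θ v v' κ u ∧
      profOf θ v v' κ (u + v'.w) = profOf θ v v' κ u := by
  have h1 := v.rk_ne (θ := θ)
  have h2 := v'.rk_ne (θ := θ)
  have hd' : (v.det v' : ℝ) ≠ 0 := by exact_mod_cast hd
  constructor
  · funext y
    rw [profOf, profOf, Ker.per1 hκ]
    simp [wgtInv, Ray.ell_add]
  · funext y
    have : wgtInv θ v v' (u + v'.w) y = wgtInv θ v v' u y + v'.rk θ := by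
      simp only [wgtInv, Ray.ell_add, Ray.ell_w, slope]
      push_cast
      field_simp
      ring
    rw [profOf, profOf, this, Ker.per2 hκ]

theorem comp_wgt_mem {Φ : Fn} (hΦ : ∀ j, Sch (fun _ t => t) j Φ)
    (h1 : ∀ u, Φ (u + v.w) = Φ u) (h2 : ∀ u, Φ (u + v'.w) = Φ u) :
    (fun u t => Φ u (wgt θ v v' u t)) ∈ Ker θ v v' :=
  ⟨fun u t => by simp only [wgt_per1, h1], fun u t => by simp only [wgt_per2, h2],
    fun j => sch_comp_wgt j (hΦ j)⟩

/-- Holomorphic kernels are multiples of the Gaussian. -/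
theorem eq_mul_gaussK (hτ : τ ≠ 0) (hd : v.det v' ≠ 0) {κ : Fn} (hκ : κ ∈ Ker θ v v')
    (h0 : nab θ τ δ v v' κ = 0) (u : ℤ × ℤ) (t₀ t : ℝ) :
    κ u t = κ u t₀ / gaussK θ τ δ v v' u t₀ * gaussK θ τ δ v v' u t := by
  have hD := slope_ne_zero (θ := θ) hd
  have h1 := eq_mul_gauss (δ := δ) hτ hD
    (Sch.hasDerivAt (fun j => sch_profOf hD j (Ker.sch hκ j)) u)
    (fun y => by rw [profOf_nab hD hκ, h0]; rfl) (wgt θ v v' u t₀) (wgt θ v v' u t)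
  rwa [profOf_wgt hD, profOf_wgt hD] at h1

theorem eq_coef0_mul (hτ : τ ≠ 0) (hd : v.det v' ≠ 0) {κ : Fn} (hκ : κ ∈ Ker θ v v')
    (h0 : nab θ τ δ v v' κ = 0) (u : ℤ × ℤ) (t : ℝ) :
    κ u t = coef0 θ τ δ v v' κ u * gaussK θ τ δ v v' u t := eq_mul_gaussK hτ hd hκ h0 u 0 t

/-- The coefficients of a holomorphic kernel inherit both periodicities. -/
theorem coef0_mem (hτ : τ ≠ 0) (hd : v.det v' ≠ 0) {κ : Fn} (hκ : κ ∈ Ker θ v v')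
    (h0 : nab θ τ δ v v' κ = 0) : coef0 θ τ δ v v' κ ∈ Wper v v' := by
  have h : ∀ u t, κ u t / gaussK θ τ δ v v' u t = coef0 θ τ δ v v' κ u := fun u t => by
    rw [eq_coef0_mul hτ hd hκ h0 u t, mul_div_cancel_right₀ _ (gaussK_ne_zero u t)]
  refine ⟨fun u => ?_, fun u => ?_⟩
  · rw [coef0, Ker.per1 hκ, gaussK_per1, ← coef0]
  · rw [← h _ (0 + v'.rk θ), Ker.per2 hκ, gaussK_per2, ← coef0]

theorem mul_gaussK_mem (hτ : τ.im < 0) (hd : v.det v' ≠ 0) (hD : 0 < slope θ v v')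
    {c : ℤ × ℤ → ℂ} (hc : c ∈ Wper v v') :
    (fun u t => c u * gaussK θ τ δ v v' u t) ∈ Ker θ v v' :=
  prof_mem hd hc (schR_gauss hτ hD)

theorem nab_mul_gaussK (hτ : τ ≠ 0) (hd : v.det v' ≠ 0) (c : ℤ × ℤ → ℂ) :
    nab θ τ δ v v' (fun u t => c u * gaussK θ τ δ v v' u t) = 0 := by
  have hD := slope_ne_zero (θ := θ) hd
  have hD' : (slope θ v v' : ℂ) ≠ 0 := by exact_mod_cast hD
  funext u t
  have h := (((hasDerivAt_gauss (δ := δ) (D := slope θ v v') hτ _).scomp t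
    (hasDerivAt_wgt θ v v' u t)).const_mul (c u)).deriv
  have h' : dF (fun u t => c u * gauss τ δ (slope θ v v') (wgt θ v v' u t)) u t = _ := h
  simp only [nab, Pi.add_apply, Pi.smul_apply, smul_eq_mul, gaussK, h', Complex.real_smul]
  field_simp
  simp

theorem exists_nab_eq_of_pos (hτ : τ.im < 0) (hd : v.det v' ≠ 0) (hD : 0 < slope θ v v') {h : Fn}
    (hh : h ∈ Ker θ v v') : ∃ κ ∈ Ker θ v v', nab θ τ δ v v' κ = h := by
  obtain ⟨Φ, h1, h2, h3⟩ := exists_solution_of_pos (δ := δ) hτ hD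
    (fun j => sch_profOf hD.ne' j (Ker.sch hh j))
  refine ⟨_, comp_wgt_mem h1 (fun u => h3 _ _ (profOf_per hd hh u).1)
    (fun u => h3 _ _ (profOf_per hd hh u).2), ?_⟩
  funext u t
  rw [nab_comp_wgt h1, h2, profOf_wgt hD.ne']

theorem eq_zero_of_nab_eq_zero (hτ : τ.im < 0) (hd : v.det v' ≠ 0) (hD : slope θ v v' < 0)
    {κ : Fn} (hκ : κ ∈ Ker θ v v') (h0 : nab θ τ δ v v' κ = 0) : κ = 0 := by
  have hτ0 : τ ≠ 0 := by rintro rfl; simp at hτ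
  obtain ⟨C, hC⟩ := Ker.rap hκ 0
  have : ∀ u, coef0 θ τ δ v v' κ u = 0 := fun u =>
    eq_zero_of_mul_gauss_bounded (δ := δ) (C := C) hτ hD fun y => by
      have h1 := eq_coef0_mul hτ0 hd hκ h0 u (wgtInv θ v v' u y)
      rw [gaussK, wgt_wgtInv hD.ne] at h1
      rw [← h1]
      simpa using hC u (wgtInv θ v v' u y)
  funext u t
  rw [eq_coef0_mul hτ0 hd hκ h0 u t, this, zero_mul]; rfl

/-- For a negative difference of slopes, `coef1` detects the cokernel of `nab`. -/
theorem coef1_eq_zero_iff (hτ : τ.im < 0) (hd : v.det v' ≠ 0) (hD : slope θ v v' < 0) {h : Fn}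
    (hh : h ∈ Ker θ v v') :
    coef1 θ τ δ v v' h = 0 ↔ ∃ κ ∈ Ker θ v v', nab θ τ δ v v' κ = h := by
  have hD' : |(slope θ v v')⁻¹| ≠ 0 := abs_ne_zero.mpr (inv_ne_zero hD.ne)
  constructor
  · intro h0
    obtain ⟨Φ, h1, h2, h3⟩ := exists_solution_of_neg (δ := δ) hτ hD
      (fun j => sch_profOf hD.ne j (Ker.sch hh j)) (fun u => by
        have := congrFun h0 u
        rw [coef1_eq hD.ne] at this
        exact (smul_eq_zero.mp this).resolve_left hD')
    refine ⟨_, comp_wgt_mem h1 (fun u => h3 _ _ (profOf_per hd hh u).1)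
      (fun u => h3 _ _ (profOf_per hd hh u).2), ?_⟩
    funext u t
    rw [nab_comp_wgt h1, h2, profOf_wgt hD.ne]
  · rintro ⟨κ, hκ, rfl⟩
    funext u
    rw [coef1_eq hD.ne, integral_div_gauss_eq_zero (δ := δ) hτ hD
      (fun j => sch_profOf hD.ne j (Ker.sch hκ j)) (fun j => sch_profOf hD.ne j (Ker.sch hh j))
      (fun u y => profOf_nab hD.ne hκ u y), smul_zero]
    rfl

/-- The functional `coef1` takes values in the functions on `ℤ²/(ℤw + ℤw')`. -/
theorem coef1_mem {κ : Fn} (hκ : κ ∈ Ker θ v v') : coef1 θ τ δ v v' κ ∈ Wper v v' := by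
  refine ⟨fun u => ?_, fun u => ?_⟩
  · simp only [coef1, Ker.per1 hκ, gaussK_per1]
  · rw [coef1, ← integral_add_right_eq_self _ (v'.rk θ)]
    simp only [Ker.per2 hκ, gaussK_per2, coef1]

theorem integral_plateau_ne_zero : (∫ y, ((plateau y : ℝ) : ℂ)) ≠ 0 := by
  rw [integral_complex_ofReal]
  have h : 0 < ∫ y, plateau y := by
    refine Continuous.integral_pos_of_hasCompactSupport_nonneg_nonzero (x := 0)
      contDiff_plateau.continuous ?_ ?_ ?_
    · refine HasCompactSupport.intro (isCompact_closedBall 0 2) fun s hs => plateau_eq_zero ?_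
      rw [Metric.mem_closedBall, Real.dist_eq, not_le, sub_zero] at hs
      exact hs
    · exact fun y => mul_nonneg (Real.smoothTransition.nonneg _) (Real.smoothTransition.nonneg _)
    · rw [plateau_eq_one (by simp)]; exact one_ne_zero
  exact_mod_cast h.ne'

/-- Every coefficient function is a value of `coef1`: the profile of the kernel is a multiple of the
Gaussian, cut off by the plateau, so that the Gaussian cancels in the integral. -/
theorem exists_coef1_eq (τ δ : ℂ) (hd : v.det v' ≠ 0) {c : ℤ × ℤ → ℂ} (hc : c ∈ Wper v v') :
    ∃ κ ∈ Ker θ v v', coef1 θ τ δ v v' κ = c := by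
  have hD := slope_ne_zero (θ := θ) hd
  have hD' : ((|(slope θ v v')⁻¹| : ℝ) : ℂ) ≠ 0 := by
    exact_mod_cast abs_ne_zero.mpr (inv_ne_zero hD)
  set I := (∫ y, ((plateau y : ℝ) : ℂ))
  have hI : I ≠ 0 := integral_plateau_ne_zero
  let g : ℝ → ℂ := fun y => ((plateau y : ℝ) : ℂ) * gauss τ δ (slope θ v v') y
  have hg : SchR g := by
    refine SchR.of_compactSupport ((Complex.ofRealCLM.contDiff.comp contDiff_plateau).mul
      contDiff_gauss) ?_
    refine HasCompactSupport.intro (isCompact_closedBall 0 2) fun s hs => ?_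
    rw [Metric.mem_closedBall, Real.dist_eq, not_le, sub_zero] at hs
    simp only [g, plateau_eq_zero hs, Complex.ofReal_zero, zero_mul]
  set a := (((|(slope θ v v')⁻¹| : ℝ) : ℂ) * I)⁻¹
  refine ⟨prof θ v v' (a • c) g, prof_mem hd ((Wper v v').smul_mem a hc) hg, ?_⟩
  funext u
  rw [coef1_eq hD]
  have : ∀ y, profOf θ v v' (prof θ v v' (a • c) g) u y / gauss τ δ (slope θ v v') y =
      (a * c u) * ((plateau y : ℝ) : ℂ) := fun y => by
    simp only [profOf, prof, wgt_wgtInv hD, g, Pi.smul_apply, smul_eq_mul]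
    have := gauss_ne_zero (τ := τ) (δ := δ) (D := slope θ v v') y
    field_simp
  simp only [this]
  rw [integral_const_mul, Complex.real_smul]
  show _ * (a * c u * I) = c u
  have ha : a * (((|(slope θ v v')⁻¹| : ℝ) : ℂ) * I) = 1 := inv_mul_cancel₀ (mul_ne_zero hD' hI)
  linear_combination c u * ha

end transversal

/-! ### Cohomology between bundles of the same class -/

section parallel

open MeasureTheory

variable {θ : ℝ} {τ δ : ℂ} {v : Ray}

theorem wgt_self (u : ℤ × ℤ) (t : ℝ) : wgt θ v v u t = -(v.ell u / v.rk θ) := by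
  rw [wgt, slope_self, zero_mul, zero_sub]

/-- The exponents of the equation on the components `ell = j` of the kernels. -/
def expo (θ : ℝ) (τ δ : ℂ) (v : Ray) (u : ℤ × ℤ) : ℂ :=
  2 * Real.pi * Complex.I * (δ - τ * v.ell u / v.rk θ)

theorem nab_self (κ : Fn) (u : ℤ × ℤ) (t : ℝ) :
    nab θ τ δ v v κ u t = dF κ u t + expo θ τ δ v u * κ u t := by
  simp only [nab, Pi.add_apply, Pi.smul_apply, smul_eq_mul, wgt_self, expo]
  push_cast
  ring

theorem Ker.periodic {κ : Fn} (hκ : κ ∈ Ker θ v v) (u : ℤ × ℤ) :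
    Function.Periodic (κ u) (v.rk θ) := fun t => by
  rw [← Ker.per1 hκ, Ker.per2 hκ]

/-- Holomorphic kernels are exponential functions. -/
theorem eq_mul_exp {κ : Fn} (hκ : κ ∈ Ker θ v v) (h0 : nab θ τ δ v v κ = 0) (u : ℤ × ℤ) (t : ℝ) :
    κ u t = κ u 0 * Complex.exp (-(expo θ τ δ v u * t)) := by
  have h1 : ∀ t : ℝ, HasDerivAt (fun t : ℝ => κ u t * Complex.exp (expo θ τ δ v u * t)) 0 t := by
    intro t
    have h2 : HasDerivAt (fun t : ℝ => Complex.exp (expo θ τ δ v u * t))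
        (Complex.exp (expo θ τ δ v u * t) * (expo θ τ δ v u * 1)) t :=
      ((hasDerivAt_id t).ofReal_comp.const_mul (expo θ τ δ v u)).cexp
    have h3 := congrFun (congrFun h0 u) t
    rw [nab_self] at h3
    refine ((Ker.hasDerivAt hκ u t).mul h2).congr_deriv ?_
    have h4 : dF κ u t = -(expo θ τ δ v u * κ u t) := eq_neg_of_add_eq_zero_left h3
    rw [h4]
    ring
  have h2 := is_const_of_deriv_eq_zero (fun y => (h1 y).differentiableAt)
    (fun y => (h1 y).deriv) t 0
  simp only [Complex.ofReal_zero, mul_zero, Complex.exp_zero, mul_one] at h2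
  rw [← h2, mul_assoc, ← Complex.exp_add]
  simp

theorem integral_nab_self_eq_zero {κ : Fn} (hκ : κ ∈ Ker θ v v) {u : ℤ × ℤ}
    (hu : expo θ τ δ v u = 0) : ∫ t in (0)..v.rk θ, nab θ τ δ v v κ u t = 0 := by
  have h1 : ∀ t, nab θ τ δ v v κ u t = dF κ u t := fun t => by
    rw [nab_self, hu, zero_mul, add_zero]
  simp only [h1]
  rw [intervalIntegral.integral_eq_sub_of_hasDerivAt (fun t _ => Ker.hasDerivAt hκ u t)
    ((Ker.continuous (Ker.dF hκ) u).intervalIntegrable _ _), sub_eq_zero]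
  have := Ker.periodic hκ u 0
  rwa [zero_add] at this

/-- The trace on the kernels from a class to itself. -/
def trK (θ : ℝ) (v : Ray) (κ : Fn) : ℂ := ∫ t in (0)..|v.rk θ|, κ 0 t

theorem trK_eq_zero_iff {κ : Fn} (hκ : κ ∈ Ker θ v v) :
    trK θ v κ = 0 ↔ ∫ t in (0)..v.rk θ, κ 0 t = 0 := by
  rcases abs_choice (v.rk θ) with h | h
  · rw [trK, h]
  · have h1 := (Ker.periodic hκ 0).intervalIntegral_add_eq (-v.rk θ) 0
    rw [neg_add_cancel, zero_add] at h1
    rw [trK, h, intervalIntegral.integral_symm, h1, neg_eq_zero]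

theorem expo_zero (u : ℤ × ℤ) (hu : v.ell u = 0) : expo θ τ 0 v u = 0 := by
  simp [expo, hu]

/-- The invertible holomorphic kernels between isomorphic bundles of the same class. -/
def shiftK (θ : ℝ) (v : Ray) (j k : ℤ) : Fn := fun u t =>
  if v.ell u = j then e (-(k * t / v.rk θ)) else 0

theorem hasDerivAt_shiftK (j k : ℤ) (u : ℤ × ℤ) (t : ℝ) : HasDerivAt (shiftK θ v j k u)
    (-(2 * Real.pi * Complex.I * k / v.rk θ) * shiftK θ v j k u t) t := by
  by_cases h : v.ell u = j
  · have h1 : HasDerivAt (fun t : ℝ => -(k * t / v.rk θ)) (-(k / v.rk θ)) t := by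
      have := (((hasDerivAt_id t).const_mul (k : ℝ)).div_const (v.rk θ)).neg
      rwa [mul_one] at this
    have h2 := (hasDerivAt_e _).scomp t h1
    have h3 : shiftK θ v j k u = e ∘ fun t : ℝ => -(k * t / v.rk θ) := by
      funext t; simp only [shiftK, if_pos h, Function.comp]
    rw [h3]
    refine h2.congr_deriv ?_
    rw [Complex.real_smul]
    simp only [Function.comp]
    push_cast
    ring
  · have h3 : shiftK θ v j k u = fun _ => 0 := by
      funext t; simp only [shiftK, if_neg h]
    rw [h3, mul_zero]
    exact hasDerivAt_const t 0

theorem shiftK_comp (j k : ℤ) : comp θ v (shiftK θ v (-j) (-k)) (shiftK θ v j k) =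
    e (-(k * off θ ((-j) • v.sec) / v.rk θ)) • idK v := by
  funext U t
  rw [comp, tsum_eq_single (-j)]
  · simp only [shiftK, Ray.ell_sub, Ray.ell_smul_sec, if_true, Pi.smul_apply, idK, smul_eq_mul]
    by_cases h : v.ell U = 0
    · rw [if_pos (by omega), if_pos h, ← e_add, mul_one]
      congr 1
      push_cast
      ring
    · rw [if_neg (by omega), if_neg h, mul_zero, mul_zero]
  · intro i hi
    rw [shiftK, Ray.ell_smul_sec, if_neg hi, zero_mul]

theorem nab_idK (τ : ℂ) (v : Ray) : nab θ τ 0 v v (idK v) = 0 := by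
  funext u t
  have h : dF (idK v) u t = 0 := by
    show deriv (fun _ : ℝ => if v.ell u = 0 then (1 : ℂ) else 0) t = 0
    exact deriv_const _ _
  rw [nab_self, h, zero_add]
  by_cases hu : v.ell u = 0
  · rw [expo_zero u hu, zero_mul]; rfl
  · rw [idK, if_neg hu, mul_zero]; rfl

variable [Fact (Irrational θ)]

theorem exp_expo_eq_one_iff (u : ℤ × ℤ) : Complex.exp (expo θ τ δ v u * v.rk θ) = 1 ↔
    ∃ k : ℤ, v.rk θ * δ = τ * v.ell u + k := by
  have hr : (v.rk θ : ℂ) ≠ 0 := by exact_mod_cast v.rk_ne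
  rw [Complex.exp_eq_one_iff]
  refine exists_congr fun k => ?_
  have : expo θ τ δ v u * v.rk θ = (v.rk θ * δ - τ * v.ell u) * (2 * Real.pi * Complex.I) := by
    rw [expo]; field_simp
  rw [this, mul_left_inj' Complex.two_pi_I_ne_zero, sub_eq_iff_eq_add']

theorem eq_zero_or_resonant {κ : Fn} (hκ : κ ∈ Ker θ v v) (h0 : nab θ τ δ v v κ = 0) (u : ℤ × ℤ) :
    κ u = 0 ∨ ∃ k : ℤ, v.rk θ * δ = τ * v.ell u + k := by
  rw [← exp_expo_eq_one_iff, or_iff_not_imp_right]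
  intro h
  have h1 := Ker.periodic hκ u 0
  rw [eq_mul_exp hκ h0, zero_add] at h1
  have h2 : κ u 0 = 0 := by
    by_contra hne
    apply h
    have h3 : Complex.exp (-(expo θ τ δ v u * v.rk θ)) = 1 :=
      mul_left_cancel₀ hne (h1.trans (mul_one _).symm)
    rwa [Complex.exp_neg, inv_eq_one] at h3
  funext t
  rw [eq_mul_exp hκ h0, h2, zero_mul]; rfl

/-- The periodic solution of `f' + cf = h`: a primitive of `h` if `c = 0`, and otherwise the
multiple by `(e^{cr} - 1)⁻¹` of the integral of `e^{c(s - t)} h(s)` over the period from `t` to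
`t + r`. The bound is uniform in `c` as long as `|Re(cr)| ≥ 1`. -/
theorem exists_periodic_solution {r : ℝ} {c : ℂ} {h : ℝ → ℂ} (hh : Continuous h)
    (hp : Function.Periodic h r)
    (h1 : Complex.exp (c * r) = 1 → c = 0 ∧ ∫ s in (0)..r, h s = 0) :
    ∃ f : ℝ → ℂ, (∀ t, HasDerivAt f (h t - c * f t) t) ∧ Function.Periodic f r ∧
      ∀ B, 1 ≤ |(c * r).re| → (∀ t, ‖h t‖ ≤ B) → ∀ t, ‖f t‖ ≤ 2 * |r| * B := by
  by_cases hc : Complex.exp (c * r) = 1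
  · obtain ⟨rfl, h2⟩ := h1 hc
    refine ⟨fun t => ∫ s in (0)..t, h s, fun t => ?_, fun t => ?_, fun B hB => ?_⟩
    · rw [zero_mul, sub_zero]
      exact (hh.integral_hasStrictDerivAt 0 t).hasDerivAt
    · have e1 : ∫ s in t..t + r, h s = 0 := by
        rw [hp.intervalIntegral_add_eq t 0, zero_add, h2]
      have := intervalIntegral.integral_add_adjacent_intervals (μ := volume)
        (hh.intervalIntegrable 0 t) (hh.intervalIntegrable t (t + r))
      rw [e1, add_zero] at this
      exact this.symm
    · simp at hB
      linarith
  · have hc' : Complex.exp (c * r) - 1 ≠ 0 := sub_ne_zero.mpr hc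
    let k : ℝ → ℂ := fun s => Complex.exp (c * s) * h s
    have hk : Continuous k := by fun_prop
    have hkp : ∀ s, k (s + r) = Complex.exp (c * r) * k s := fun s => by
      simp only [k, hp s]
      rw [← mul_assoc, ← Complex.exp_add]
      congr 2
      push_cast; ring
    let f : ℝ → ℂ := fun t => (Complex.exp (c * r) - 1)⁻¹ *
      (Complex.exp (-(c * t)) * ∫ s in t..t + r, k s)
    have hf : ∀ t, f t = (Complex.exp (c * r) - 1)⁻¹ *
        ∫ s in (0)..r, Complex.exp (c * s) * h (s + t) := by
      intro t
      have e1 : ∫ s in t..t + r, k s = ∫ s in (0)..r, k (s + t) := by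
        rw [intervalIntegral.integral_comp_add_right]; simp [add_comm]
      simp only [f]
      rw [e1, ← intervalIntegral.integral_const_mul]
      congr 2
      funext s
      simp only [k]
      rw [← mul_assoc, ← Complex.exp_add]
      congr 2
      push_cast; ring
    refine ⟨f, fun t => ?_, fun t => ?_, fun B hB hb t => ?_⟩
    · have e1 : HasDerivAt (fun t : ℝ => Complex.exp (-(c * t)))
          (Complex.exp (-(c * t)) * -(c * 1)) t :=
        (((hasDerivAt_id t).ofReal_comp.const_mul c).neg).cexp
      have e2 : HasDerivAt (fun t : ℝ => ∫ s in t..t + r, k s) (k (t + r) - k t) t := by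
        have e3 : (fun t : ℝ => ∫ s in t..t + r, k s) =
            fun t : ℝ => (∫ s in (0)..t + r, k s) - ∫ s in (0)..t, k s := funext fun t =>
          (intervalIntegral.integral_interval_sub_left (hk.intervalIntegrable _ _)
            (hk.intervalIntegrable _ _)).symm
        rw [e3]
        exact ((hk.integral_hasStrictDerivAt 0 (t + r)).hasDerivAt.comp_add_const t r).sub
          (hk.integral_hasStrictDerivAt 0 t).hasDerivAt
      refine ((e1.mul e2).const_mul (Complex.exp (c * r) - 1)⁻¹).congr_deriv ?_
      have e4 : Complex.exp (-(c * t)) * k t = h t := by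
        simp only [k]
        rw [← mul_assoc, ← Complex.exp_add]
        simp
      rw [hkp]
      have e5 : h t = (Complex.exp (c * r) - 1)⁻¹ * ((Complex.exp (c * r) - 1) * h t) := by
        rw [inv_mul_cancel_left₀ hc']
      rw [e5, ← e4]
      simp only [f]
      ring
    · rw [hf, hf]
      congr 2
      funext s
      rw [← add_assoc, hp]
    · set x := Real.exp (c * r).re
      have hx : ‖Complex.exp (c * r)‖ = x := Complex.norm_exp _
      have hx0 : 0 < x := Real.exp_pos _
      have hB0 : 0 ≤ B := (norm_nonneg _).trans (hb 0)
      have e1 : max 1 x ≤ 2 * ‖Complex.exp (c * r) - 1‖ := by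
        have e2 := abs_norm_sub_norm_le (Complex.exp (c * r)) 1
        rw [hx, norm_one] at e2
        refine le_trans ?_ (mul_le_mul_of_nonneg_left e2 two_pos.le)
        rcases le_abs.mp hB with h | h
        · have := Real.add_one_le_exp (c * r).re
          rw [max_eq_right (by linarith), abs_of_nonneg (by linarith)]
          linarith
        · have e3 := Real.add_one_le_exp (-(c * r).re)
          have e4 : x * Real.exp (-(c * r).re) = 1 := by
            rw [← Real.exp_add]; simp
          have e5 : x ≤ 1 / 2 := by nlinarith
          rw [max_eq_left (by linarith), abs_of_nonpos (by linarith)]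
          linarith
      have e2 : ‖∫ s in (0)..r, Complex.exp (c * s) * h (s + t)‖ ≤ max 1 x * B * |r - 0| := by
        refine intervalIntegral.norm_integral_le_of_norm_le_const fun s hs => ?_
        rw [norm_mul, Complex.norm_exp]
        refine mul_le_mul ?_ (hb _) (norm_nonneg _) (by positivity)
        have e3 : (c * s).re = c.re * s := by simp
        have e4 : x = Real.exp (c.re * r) := by simp [x]
        rw [e3, e4]
        rcases le_or_gt (c.re * s) 0 with h | h
        · exact le_max_of_le_left (Real.exp_le_one_iff.mpr h)
        · refine le_max_of_le_right (Real.exp_le_exp.mpr ?_)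
          rcases Set.mem_uIoc.mp hs with ⟨h3, h4⟩ | ⟨h3, h4⟩
          · have : 0 < c.re := by by_contra hcc; nlinarith
            nlinarith
          · rcases eq_or_lt_of_le h4 with h5 | h5
            · rw [h5] at h; simp at h
            · have : c.re < 0 := by by_contra hcc; nlinarith
              nlinarith
      rw [hf, norm_mul, norm_inv, sub_zero] at *
      have e3 : 0 < ‖Complex.exp (c * r) - 1‖ := norm_pos_iff.mpr hc'
      rw [inv_mul_le_iff₀ e3]
      refine e2.trans ?_
      calc max 1 x * B * |r| ≤ (2 * ‖Complex.exp (c * r) - 1‖) * B * |r| := by gcongr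
        _ = _ := by ring

/-- The equation between bundles of the same class can be solved if the right-hand side has
vanishing integral in the resonant component. -/
theorem exists_nab_self_eq (hτ : τ.im < 0) {h : Fn} (hh : h ∈ Ker θ v v)
    (h1 : ∀ u, (∃ k : ℤ, v.rk θ * δ = τ * v.ell u + k) →
      expo θ τ δ v u = 0 ∧ ∫ s in (0)..v.rk θ, h u s = 0) :
    ∃ κ ∈ Ker θ v v, nab θ τ δ v v κ = h := by
  have hr := v.rk_ne (θ := θ)
  choose f hf1 hf2 hf3 using fun j : ℤ => exists_periodic_solution (c := expo θ τ δ v (j • v.sec))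
    (Ker.continuous hh (j • v.sec)) (Ker.periodic hh _)
    (fun he => h1 _ ((exp_expo_eq_one_iff _).mp he))
  let κ : Fn := fun u => f (v.ell u)
  have hd : ∀ u t, HasDerivAt (κ u) (h u t - expo θ τ δ v u * κ u t) t := by
    intro u t
    have e1 : expo θ τ δ v (v.ell u • v.sec) = expo θ τ δ v u := by
      rw [expo, Ray.ell_smul_sec, expo]
    have e2 : h u t = h (v.ell u • v.sec) t :=
      eq_ell_smul_sec (F := fun u => h u t) v (fun u => Ker.per1 hh u t) u
    rw [e2, ← e1]
    exact hf1 (v.ell u) t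
  -- as `Im τ ≠ 0`, the uniform bound for periodic solutions applies to all but finitely many lines
  have hfin : {j : ℤ | ¬ 1 ≤ |(expo θ τ δ v (j • v.sec) * v.rk θ).re|}.Finite := by
    have e1 : ∀ j : ℤ, (expo θ τ δ v (j • v.sec) * v.rk θ).re =
        2 * Real.pi * (τ.im * j - v.rk θ * δ.im) := by
      intro j
      have hr' : (v.rk θ : ℂ) ≠ 0 := by exact_mod_cast hr
      have : expo θ τ δ v (j • v.sec) * v.rk θ = ((2 * Real.pi : ℝ) : ℂ) *
          (Complex.I * (((v.rk θ : ℝ) : ℂ) * δ - ((j : ℝ) : ℂ) * τ)) := by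
        rw [expo, Ray.ell_smul_sec]
        push_cast
        field_simp
      rw [this, Complex.re_ofReal_mul, Complex.I_mul_re, Complex.sub_im, Complex.im_ofReal_mul,
        Complex.im_ofReal_mul]
      ring
    simp only [e1]
    set A := v.rk θ * δ.im
    refine (Set.finite_Icc ⌊(A + 1) / τ.im⌋ ⌈(A - 1) / τ.im⌉).subset fun j hj => ?_
    simp only [Set.mem_ofPred_eq, not_le] at hj
    have e2 : |τ.im * j - A| < 1 := by
      rw [abs_mul, abs_of_pos (by positivity)] at hj
      have := Real.pi_gt_three
      nlinarith [abs_nonneg (τ.im * j - A)]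
    obtain ⟨e3, e4⟩ := abs_lt.mp e2
    constructor
    · have : (A + 1) / τ.im ≤ j := by rw [div_le_iff_of_neg hτ]; linarith
      exact_mod_cast (Int.floor_le _).trans this
    · have : (j : ℝ) ≤ (A - 1) / τ.im := by rw [le_div_iff_of_neg hτ]; linarith
      exact_mod_cast this.trans (Int.le_ceil _)
  have hb : ∀ j, ∃ B, ∀ t, ‖f j t‖ ≤ B := by
    intro j
    have hc : Continuous (f j) := continuous_iff_continuousAt.mpr fun t => (hf1 j t).continuousAt
    obtain ⟨B, hB⟩ := (hf2 j).isBounded_of_continuous hr hc |>.exists_norm_le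
    exact ⟨B, fun t => hB _ ⟨t, rfl⟩⟩
  choose B hB using hb
  have hrap : Rap (wgt θ v v) κ := by
    intro N
    obtain ⟨C, hC0, hC⟩ := (Ker.rap hh).exists_bound N
    refine ⟨2 * |v.rk θ| * C + ∑ j ∈ hfin.toFinset, (1 + |(j : ℝ) / v.rk θ|) ^ N * |B j|,
      fun u t => ?_⟩
    have hs : ∀ s : Finset ℤ, 0 ≤ ∑ j ∈ s, (1 + |(j : ℝ) / v.rk θ|) ^ N * |B j| := fun s =>
      Finset.sum_nonneg fun j _ => by positivity
    rw [wgt_self, abs_neg]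
    by_cases hj : v.ell u ∈ hfin.toFinset
    · have e1 := Finset.single_le_sum (f := fun j : ℤ => (1 + |(j : ℝ) / v.rk θ|) ^ N * |B j|)
        (fun j _ => by positivity) hj
      have e2 : ‖κ u t‖ ≤ |B (v.ell u)| := (hB _ t).trans (le_abs_self _)
      calc _ ≤ (1 + |(v.ell u : ℝ) / v.rk θ|) ^ N * |B (v.ell u)| := by gcongr
        _ ≤ _ := e1
        _ ≤ _ := le_add_of_nonneg_left (by positivity)
    · simp only [Set.Finite.mem_toFinset, Set.mem_ofPred_eq, not_not] at hj
      have e1 := hf3 _ (C * ((1 + |(v.ell u : ℝ) / v.rk θ|) ^ N)⁻¹) hj (fun t => by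
        have := norm_le_of_rap hC (v.ell u • v.sec) t
        rwa [wgt_self, abs_neg, Ray.ell_smul_sec] at this) t
      refine le_trans ?_ (le_add_of_nonneg_right (hs _))
      calc _ ≤ (1 + |(v.ell u : ℝ) / v.rk θ|) ^ N * (2 * |v.rk θ| *
            (C * ((1 + |(v.ell u : ℝ) / v.rk θ|) ^ N)⁻¹)) := by gcongr
        _ = _ := by field_simp
  refine ⟨κ, ⟨fun u t => ?_, fun u t => ?_, ?_⟩, ?_⟩
  · simp [κ, Ray.ell_add]
  · simp only [κ, Ray.ell_add, Ray.ell_w, Ray.det_self, add_zero]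
    exact hf2 _ t
  · refine Sch.of_hasDerivAt (hasDerivAt_wgt θ v v) (-(2 * Real.pi * Complex.I * τ))
      (-(2 * Real.pi * Complex.I * δ)) hrap (fun j => Ker.sch hh j) fun u t => ?_
    refine (hd u t).congr_deriv ?_
    rw [wgt_self, expo]
    push_cast
    ring
  · funext u t
    rw [nab_self, dF, (hd u t).deriv]
    ring

/-- The holomorphic endomorphisms of a bundle are the scalars. -/
theorem eq_smul_idK (hτ : τ.im < 0) {κ : Fn} (hκ : κ ∈ Ker θ v v) (h0 : nab θ τ 0 v v κ = 0) :
    κ = κ 0 0 • idK v := by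
  funext u t
  have h1 := eq_zero_or_resonant hκ h0 u
  simp only [Pi.smul_apply, smul_eq_mul, idK]
  by_cases hu : v.ell u = 0
  · rw [if_pos hu, mul_one, eq_mul_exp hκ h0, expo_zero u hu, zero_mul, neg_zero, Complex.exp_zero,
      mul_one]
    have := eq_ell_smul_sec (F := fun u => κ u 0) v (fun u => Ker.per1 hκ u 0) u
    rw [this, hu, zero_smul]
  · rw [if_neg hu, mul_zero]
    rcases h1 with h1 | ⟨k, h1⟩
    · rw [h1]; rfl
    · exfalso
      apply hu
      have h2 := congrArg Complex.im h1
      simp at h2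
      exact h2.resolve_left hτ.ne

/-- The trace detects the cokernel of `nab` on the endomorphisms of a bundle. -/
theorem trK_eq_zero_iff_exists (hτ : τ.im < 0) {h : Fn} (hh : h ∈ Ker θ v v) :
    trK θ v h = 0 ↔ ∃ κ ∈ Ker θ v v, nab θ τ 0 v v κ = h := by
  rw [trK_eq_zero_iff hh]
  constructor
  · refine fun h0 => exists_nab_self_eq hτ hh fun u hu => ?_
    obtain ⟨k, hk⟩ := hu
    have h2 : v.ell u = 0 := by
      have h2 := congrArg Complex.im hk
      simp at h2
      exact h2.resolve_left hτ.ne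
    refine ⟨expo_zero u h2, ?_⟩
    have h3 : ∀ t, h u t = h 0 t := fun t => by
      have := eq_ell_smul_sec (F := fun u => h u t) v (fun u => Ker.per1 hh u t) u
      rwa [h2, zero_smul] at this
    simp only [h3, h0]
  · rintro ⟨κ, hκ, rfl⟩
    exact integral_nab_self_eq_zero hκ (expo_zero 0 (by simp))

theorem trK_idK (θ : ℝ) (v : Ray) : trK θ v (idK v) = |v.rk θ| := by
  simp [trK, idK]

/-- The parameters for which two bundles of the same class are isomorphic. -/
def Resonant (θ : ℝ) (τ δ : ℂ) (v : Ray) : Prop := ∃ j k : ℤ, v.rk θ * δ = τ * j + k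

theorem eq_zero_of_not_resonant (hδ : ¬ Resonant θ τ δ v) {κ : Fn} (hκ : κ ∈ Ker θ v v)
    (h0 : nab θ τ δ v v κ = 0) : κ = 0 := by
  funext u
  exact (eq_zero_or_resonant hκ h0 u).resolve_right fun ⟨k, hk⟩ => hδ ⟨_, k, hk⟩

theorem exists_nab_eq_of_not_resonant (hτ : τ.im < 0) (hδ : ¬ Resonant θ τ δ v) {h : Fn}
    (hh : h ∈ Ker θ v v) : ∃ κ ∈ Ker θ v v, nab θ τ δ v v κ = h :=
  exists_nab_self_eq hτ hh fun _ ⟨k, hk⟩ => absurd ⟨_, k, hk⟩ hδ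

theorem shiftK_mem (j k : ℤ) : shiftK θ v j k ∈ Ker θ v v := by
  have hr := v.rk_ne (θ := θ)
  refine ⟨fun u t => by simp [shiftK, Ray.ell_add], fun u t => ?_, ?_⟩
  · have : -(k * (t + v.rk θ) / v.rk θ) = -(k * t / v.rk θ) + ((-k : ℤ) : ℝ) := by
      push_cast; field_simp; ring
    simp only [shiftK, Ray.ell_add, Ray.ell_w, Ray.det_self, add_zero, this, e_add, e_int, mul_one]
  · refine Sch.of_hasDerivAt (h := 0) (hasDerivAt_wgt θ v v) 0
      (-(2 * Real.pi * Complex.I * k / v.rk θ))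
      (fun N => ⟨(1 + |(j / v.rk θ : ℝ)|) ^ N, fun u t => ?_⟩) Sch.zero (fun u t => ?_)
    · rw [wgt_self, abs_neg]
      by_cases h : v.ell u = j
      · rw [shiftK, if_pos h, norm_e, mul_one, h]
      · rw [shiftK, if_neg h, norm_zero, mul_zero]; positivity
    · refine (hasDerivAt_shiftK j k u t).congr_deriv ?_
      simp

theorem nab_shiftK {j k : ℤ} (h : v.rk θ * δ = τ * j + k) :
    nab θ τ δ v v (shiftK θ v j k) = 0 := by
  have hr : (v.rk θ : ℂ) ≠ 0 := by exact_mod_cast v.rk_ne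
  funext u t
  rw [nab_self, dF, (hasDerivAt_shiftK j k u t).deriv]
  by_cases hu : v.ell u = j
  · have h1 : δ = (τ * j + k) / v.rk θ := by rw [← h, mul_div_cancel_left₀ _ hr]
    rw [expo, hu, h1, Pi.zero_apply, Pi.zero_apply]
    field_simp
    ring
  · rw [shiftK, if_neg hu, mul_zero, mul_zero, add_zero]; rfl

end parallel

/-! ### Interchange of sums and integrals -/

section interchange

open MeasureTheory

theorem integrable_inv_sq {a : ℝ} (ha : a ≠ 0) (b : ℝ) :
    Integrable fun t : ℝ => ((1 + |a * t - b|) ^ 2)⁻¹ := by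
  refine ((integrable_inv_one_add_sq.comp_sub_right b).comp_mul_left' ha).mono'
    (Continuous.aestronglyMeasurable (Continuous.inv₀ (by fun_prop) fun t => by positivity))
    (Filter.Eventually.of_forall fun t => ?_)
  rw [Real.norm_of_nonneg (by positivity)]
  show _ ≤ (1 + (a * t - b) ^ 2)⁻¹
  rw [← sq_abs (a * t - b)]
  gcongr
  nlinarith [abs_nonneg (a * t - b)]

/-- Series of functions dominated by `w(t) / (1 + |at - j/r|)²` are integrated termwise. -/
theorem hasSum_integral_shift {μ : Measure ℝ} {w : ℝ → ℝ} (hw : Integrable w μ) (hw0 : ∀ t, 0 ≤ w t)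
    {r : ℝ} (hr : r ≠ 0) (a : ℝ) {f : ℤ → ℝ → ℂ} (hc : ∀ j, Continuous (f j))
    (hf : ∀ (j : ℤ) t, ‖f j t‖ ≤ w t * ((1 + |a * t - j / r|) ^ 2)⁻¹) :
    HasSum (fun j => ∫ t, f j t ∂μ) (∫ t, ∑' j, f j t ∂μ) := by
  obtain ⟨S, hS⟩ := tsum_shift_le r hr
  have h1 : ∑' j : ℤ, ∫⁻ t, ‖f j t‖ₑ ∂μ ≠ ⊤ := by
    rw [← lintegral_tsum fun j => (hc j).enorm.measurable.aemeasurable]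
    refine ne_top_of_le_ne_top (hw.mul_const S).lintegral_lt_top.ne (lintegral_mono fun t => ?_)
    have hs := (summable_shift r hr (a * t)).mul_left (w t)
    calc ∑' j : ℤ, ‖f j t‖ₑ ≤
        ∑' j : ℤ, ENNReal.ofReal (w t * ((1 + |a * t - j / r|) ^ 2)⁻¹) := by
          refine ENNReal.tsum_le_tsum fun j => ?_
          rw [← ofReal_norm]
          exact ENNReal.ofReal_le_ofReal (hf j t)
      _ = ENNReal.ofReal (∑' j : ℤ, w t * ((1 + |a * t - j / r|) ^ 2)⁻¹) :=
          (ENNReal.ofReal_tsum_of_nonneg (fun j => mul_nonneg (hw0 t) (by positivity)) hs).symm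
      _ ≤ _ := by
          refine ENNReal.ofReal_le_ofReal ?_
          rw [tsum_mul_left]
          exact mul_le_mul_of_nonneg_left (hS _) (hw0 t)
  rw [integral_tsum (fun j => (hc j).aestronglyMeasurable) h1]
  refine Summable.hasSum (Summable.of_norm_bounded (ENNReal.summable_toReal h1) fun j => ?_)
  rw [← toReal_enorm]
  exact ENNReal.toReal_mono (ENNReal.ne_top_of_tsum_ne_top h1 j)
    (enorm_integral_le_lintegral_enorm _)

/-- The integral over the line as a sum of integrals over a period. -/
theorem hasSum_integral_translates {f : ℝ → ℂ} (hf : Integrable f) {ρ : ℝ} (hρ : ρ ≠ 0) :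
    HasSum (fun k : ℤ => ∫ t in (0)..|ρ|, f (t + k * ρ)) (∫ t, f t) := by
  have h1 : ∀ {s : ℝ}, 0 < s →
      HasSum (fun k : ℤ => ∫ t in (0)..s, f (t + k * s)) (∫ t, f t) := by
    intro s hs
    have h2 := (Integrable.hasSum_intervalIntegral_comp_add_int
      (hf.comp_mul_left' hs.ne')).const_smul s
    rw [Measure.integral_comp_mul_left f s, smul_smul, abs_of_pos (inv_pos.mpr hs),
      mul_inv_cancel₀ hs.ne', one_smul] at h2
    refine h2.congr_fun fun k => ?_
    have h3 := intervalIntegral.integral_comp_mul_left (a := 0) (b := 1)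
      (fun t => f (t + k * s)) hs.ne'
    rw [mul_zero, mul_one] at h3
    rw [show (∫ t in (0)..1, f (s * (t + k))) = ∫ t in (0)..1, f (s * t + k * s) from by
      congr 1; funext t; congr 1; ring, h3, smul_smul, mul_inv_cancel₀ hs.ne', one_smul]
  rcases lt_or_gt_of_ne hρ with h | h
  · have h2 := (Equiv.neg ℤ).hasSum_iff.mpr (h1 (neg_pos.mpr h))
    rw [abs_of_neg h]
    refine h2.congr_fun fun k => ?_
    simp
  · rw [abs_of_pos h]
    exact h1 h

end interchange

/-! ### Products of Gaussians -/

/-- A class together with a point `ζ` of the complex plane, which stands for the parameter `ζ/r` of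
a holomorphic structure on the bundles of this class and rank `r`. -/
@[ext] structure Base where
  v : Ray
  ζ : ℂ

/-- The difference of the parameters of two holomorphic structures. -/
def del (θ : ℝ) (b b' : Base) : ℂ := b'.ζ / b'.v.rk θ - b.ζ / b.v.rk θ

theorem del_add (θ : ℝ) (b₁ b₂ b₃ : Base) : del θ b₁ b₃ = del θ b₂ b₃ + del θ b₁ b₂ := by
  simp only [del]; ring

/-- The structure constants of the composition, which do not depend on `θ`: the exponential of a
quadratic expression in `u`, as in a theta series. -/
def theta (τ : ℂ) (b₁ b₂ b₃ : Base) (U u : ℤ × ℤ) : ℂ :=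
  Complex.exp (-(Real.pi * Complex.I * τ * (-(b₁.v.det b₂.v * b₃.v.ell u : ℤ) +
    (b₂.v.det b₃.v * b₁.v.ell (U - u) : ℤ) + ((b₁.v.det b₂.v : ℤ) * b₃.ζ +
      (b₂.v.det b₃.v : ℤ) * b₁.ζ - (b₁.v.det b₃.v : ℤ) * b₂.ζ) / τ) ^ 2 /
        (b₁.v.det b₂.v * b₂.v.det b₃.v * b₁.v.det b₃.v : ℤ)))

section products

open MeasureTheory

variable {θ : ℝ} [Fact (Irrational θ)] {τ : ℂ}

/-- The sign of the product of the three differences of slopes does not depend on `θ`, as each rank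
occurs twice in the denominator. -/
theorem slope_mul_pos_iff (v₁ v₂ v₃ : Ray) :
    0 < slope θ v₁ v₂ * slope θ v₂ v₃ * slope θ v₁ v₃ ↔
      0 < v₁.det v₂ * v₂.det v₃ * v₁.det v₃ := by
  have h1 := v₁.rk_ne (θ := θ); have h2 := v₂.rk_ne (θ := θ); have h3 := v₃.rk_ne (θ := θ)
  have h : slope θ v₁ v₂ * slope θ v₂ v₃ * slope θ v₁ v₃ =
      ((v₁.det v₂ * v₂.det v₃ * v₁.det v₃ : ℤ) : ℝ) / (v₁.rk θ * v₂.rk θ * v₃.rk θ) ^ 2 := by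
    simp only [slope]
    push_cast
    field_simp
  rw [h, div_pos_iff_of_pos_right (by positivity), Int.cast_pos]

/-- The product of two Gaussians is a Gaussian, up to a factor that does not depend on the point of
the line. -/
theorem gaussK_mul (hτ : τ ≠ 0) {b₁ b₂ b₃ : Base} (h12 : b₁.v.det b₂.v ≠ 0)
    (h23 : b₂.v.det b₃.v ≠ 0) (h13 : b₁.v.det b₃.v ≠ 0) (U u : ℤ × ℤ) (t : ℝ) :
    gaussK θ τ (del θ b₂ b₃) b₂.v b₃.v u t *
      gaussK θ τ (del θ b₁ b₂) b₁.v b₂.v (U - u) (t + off θ u) =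
        theta τ b₁ b₂ b₃ U u * gaussK θ τ (del θ b₁ b₃) b₁.v b₃.v U t := by
  have hw := wgt_add b₁.v b₂.v b₃.v U u t (θ := θ)
  have hs := slope_add b₁.v b₂.v b₃.v (θ := θ)
  have hd := del_add θ b₁ b₂ b₃
  have r1 := b₁.v.rk_ne (θ := θ); have r2 := b₂.v.rk_ne (θ := θ); have r3 := b₃.v.rk_ne (θ := θ)
  have r1' : (b₁.v.rk θ : ℂ) ≠ 0 := by exact_mod_cast r1
  have r2' : (b₂.v.rk θ : ℂ) ≠ 0 := by exact_mod_cast r2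
  have r3' : (b₃.v.rk θ : ℂ) ≠ 0 := by exact_mod_cast r3
  have e12 : (b₁.v.det b₂.v : ℂ) = slope θ b₁.v b₂.v * (b₁.v.rk θ * b₂.v.rk θ) := by
    have := slope_ne_zero (θ := θ) h12
    simp only [slope]; push_cast; field_simp
  have e23 : (b₂.v.det b₃.v : ℂ) = slope θ b₂.v b₃.v * (b₂.v.rk θ * b₃.v.rk θ) := by
    simp only [slope]; push_cast; field_simp
  have e13 : (b₁.v.det b₃.v : ℂ) = (slope θ b₂.v b₃.v + slope θ b₁.v b₂.v) *
      (b₁.v.rk θ * b₃.v.rk θ) := by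
    rw [← Complex.ofReal_add, ← hs]
    simp only [slope]; push_cast; field_simp
  have s12 : (slope θ b₁.v b₂.v : ℂ) ≠ 0 := by exact_mod_cast slope_ne_zero (θ := θ) h12
  have s23 : (slope θ b₂.v b₃.v : ℂ) ≠ 0 := by exact_mod_cast slope_ne_zero (θ := θ) h23
  have s13 : (slope θ b₂.v b₃.v + slope θ b₁.v b₂.v : ℂ) ≠ 0 := by
    rw [← Complex.ofReal_add, ← hs]; exact_mod_cast slope_ne_zero (θ := θ) h13
  -- completing the square
  have alg : ∀ a b x y : ℂ, x ≠ 0 → y ≠ 0 → x + y ≠ 0 →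
      a ^ 2 / x + b ^ 2 / y = (y * a - x * b) ^ 2 / (y * x * (x + y)) + (a + b) ^ 2 / (x + y) := by
    intro a b x y hx hy hxy
    field_simp
    ring
  -- the weight functions on the two lines are related by a multiple of the offset
  have hoff : slope θ b₂.v b₃.v * off θ u =
      b₃.v.ell u / b₃.v.rk θ - b₂.v.ell u / b₂.v.rk θ := by
    simp only [slope]
    field_simp
    simp only [Ray.det, Ray.rk, Ray.ell, off]; push_cast; ring
  have hN : slope θ b₁.v b₂.v * wgt θ b₂.v b₃.v u t -
      slope θ b₂.v b₃.v * wgt θ b₁.v b₂.v (U - u) (t + off θ u) =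
        -(slope θ b₁.v b₂.v * (b₃.v.ell u / b₃.v.rk θ)) +
          slope θ b₂.v b₃.v * (b₁.v.ell (U - u) / b₁.v.rk θ) := by
    simp only [wgt]
    linear_combination (-slope θ b₁.v b₂.v) * hoff
  have hN' := congrArg (fun x : ℝ => (x : ℂ)) hN
  push_cast at hN'
  set A : ℂ := ((wgt θ b₂.v b₃.v u t : ℝ) : ℂ)
  set B : ℂ := ((wgt θ b₁.v b₂.v (U - u) (t + off θ u) : ℝ) : ℂ)
  set x : ℂ := ((slope θ b₂.v b₃.v : ℝ) : ℂ)
  set y : ℂ := ((slope θ b₁.v b₂.v : ℝ) : ℂ)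
  have key := alg (A + del θ b₂ b₃ / τ) (B + del θ b₁ b₂ / τ) x y s23 s12 s13
  -- numerator and denominator of the remaining exponent, in terms free of `θ`
  have hnum : (-(b₁.v.det b₂.v * b₃.v.ell u : ℤ) + (b₂.v.det b₃.v * b₁.v.ell (U - u) : ℤ) +
      ((b₁.v.det b₂.v : ℤ) * b₃.ζ + (b₂.v.det b₃.v : ℤ) * b₁.ζ -
        (b₁.v.det b₃.v : ℤ) * b₂.ζ) / τ : ℂ) =
      (y * (A + del θ b₂ b₃ / τ) - x * (B + del θ b₁ b₂ / τ)) *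
        (b₁.v.rk θ * b₂.v.rk θ * b₃.v.rk θ) := by
    have : y * (A + del θ b₂ b₃ / τ) - x * (B + del θ b₁ b₂ / τ) = (y * A - x * B) +
        (y * del θ b₂ b₃ - x * del θ b₁ b₂) / τ := by ring
    rw [this, hN']
    push_cast
    rw [e12, e23, e13]
    simp only [del]
    field_simp
    ring
  rw [gaussK, gaussK, gaussK, gauss, gauss, gauss, theta, ← Complex.exp_add, ← Complex.exp_add, hw,
    hs, hd, hnum]
  congr 1
  have hden : ((b₁.v.det b₂.v * b₂.v.det b₃.v * b₁.v.det b₃.v : ℤ) : ℂ) =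
      y * x * (x + y) * (b₁.v.rk θ * b₂.v.rk θ * b₃.v.rk θ) ^ 2 := by
    push_cast
    rw [e12, e23, e13]
    ring
  rw [hden]
  push_cast
  have hC : ((A + B : ℂ) + (del θ b₂ b₃ + del θ b₁ b₂) / τ) =
      (A + del θ b₂ b₃ / τ) + (B + del θ b₁ b₂ / τ) := by ring
  have hfr : (((y * (A + del θ b₂ b₃ / τ) - x * (B + del θ b₁ b₂ / τ)) *
      (b₁.v.rk θ * b₂.v.rk θ * b₃.v.rk θ)) ^ 2 /
        (y * x * (x + y) * (b₁.v.rk θ * b₂.v.rk θ * b₃.v.rk θ) ^ 2) : ℂ) =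
      (y * (A + del θ b₂ b₃ / τ) - x * (B + del θ b₁ b₂ / τ)) ^ 2 / (y * x * (x + y)) := by
    rw [mul_pow]
    exact mul_div_mul_right _ _ (pow_ne_zero 2 (mul_ne_zero (mul_ne_zero r1' r2') r3'))
  rw [hC]
  simp only [mul_div_assoc]
  rw [hfr]
  linear_combination (-(Real.pi * Complex.I * τ)) * key

/-- Opposite Gaussians are inverse to each other. -/
theorem gaussK_mul_gaussK_swap (b₁ b₂ : Base) (u : ℤ × ℤ) (t : ℝ) :
    gaussK θ τ (del θ b₂ b₁) b₂.v b₁.v u t *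
      gaussK θ τ (del θ b₁ b₂) b₁.v b₂.v (0 - u) (t + off θ u) = 1 := by
  have hw := wgt_add b₁.v b₂.v b₁.v 0 u t (θ := θ)
  rw [wgt, slope_self, Ray.ell_zero, zero_mul, Int.cast_zero, zero_div, sub_zero] at hw
  have h1 := eq_neg_of_add_eq_zero_right hw.symm
  have h2 : del θ b₂ b₁ = -del θ b₁ b₂ := by simp only [del]; ring
  rw [gaussK, gaussK, h1, slope_swap θ b₁.v b₂.v, h2, gauss, gauss, ← Complex.exp_add,
    Complex.exp_eq_one_iff]
  refine ⟨0, ?_⟩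
  push_cast
  rw [div_neg]
  ring

/-- The composition of the coefficient functions of classes of morphisms. -/
def compC (τ : ℂ) (b₁ b₂ b₃ : Base) (c' c : ℤ × ℤ → ℂ) (U : ℤ × ℤ) : ℂ :=
  ∑' j : ℤ, c' (j • b₂.v.sec) * c (U - j • b₂.v.sec) * theta τ b₁ b₂ b₃ U (j • b₂.v.sec)

variable {b₁ b₂ b₃ : Base}

theorem comp_gaussK (hτ : τ ≠ 0) (h12 : b₁.v.det b₂.v ≠ 0)
    (h23 : b₂.v.det b₃.v ≠ 0) (h13 : b₁.v.det b₃.v ≠ 0) (c' c : ℤ × ℤ → ℂ) :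
    comp θ b₂.v (fun u t => c' u * gaussK θ τ (del θ b₂ b₃) b₂.v b₃.v u t)
      (fun u t => c u * gaussK θ τ (del θ b₁ b₂) b₁.v b₂.v u t) =
        fun U t => compC τ b₁ b₂ b₃ c' c U * gaussK θ τ (del θ b₁ b₃) b₁.v b₃.v U t := by
  funext U t
  rw [comp, compC, ← tsum_mul_right]
  refine tsum_congr fun j => ?_
  rw [mul_assoc _ (theta _ _ _ _ _ _), ← gaussK_mul hτ h12 h23 h13]
  ring

/-- The functional `coef1` of a composition is computed termwise. -/
theorem coef1_comp (hτ : τ.im < 0) {v₁ v₂ v₃ : Ray} {δ : ℂ} (hD : slope θ v₁ v₃ < 0) {κ' κ : Fn}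
    (hκ' : κ' ∈ Ker θ v₂ v₃) (hκ : κ ∈ Ker θ v₁ v₂) (U : ℤ × ℤ) :
    coef1 θ τ δ v₁ v₃ (comp θ v₂ κ' κ) U = ∑' j : ℤ, ∫ t, κ' (j • v₂.sec) t *
      κ (U - j • v₂.sec) (t + off θ (j • v₂.sec)) / gaussK θ τ δ v₁ v₃ U t := by
  obtain ⟨C, hC0, hC⟩ := comp_term_le (Ker.rap hκ') (Ker.rap hκ) 2
  obtain ⟨B, hB0, hB⟩ := (Sch.rap (schR_gauss (δ := δ) hτ (neg_pos.mpr hD) 0)).exists_bound 0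
  have hB' : ∀ t, ‖(gaussK θ τ δ v₁ v₃ U t)⁻¹‖ ≤ B := fun t => by
    have := hB 0 (wgt θ v₁ v₃ U t)
    rwa [pow_zero, one_mul, gauss_neg] at this
  have h1 := hasSum_integral_shift (μ := volume) (r := v₂.rk θ) (a := slope θ v₂ v₃)
    (w := fun t => B * C * ((1 + |wgt θ v₁ v₃ U t|) ^ 2)⁻¹)
    (f := fun j t => κ' (j • v₂.sec) t *
      κ (U - j • v₂.sec) (t + off θ (j • v₂.sec)) / gaussK θ τ δ v₁ v₃ U t)
    ((integrable_inv_sq hD.ne _).const_mul _) (fun t => by positivity) v₂.rk_ne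
    (fun j => ((Ker.continuous hκ' _).mul ((Ker.continuous hκ _).comp
      (continuous_id.add continuous_const))).div (continuous_gaussK U) fun t =>
        gaussK_ne_zero U t) (fun j t => by
      have h2 := hC U (j • v₂.sec) t
      rw [wgt_sec, mul_comm, ← le_div_iff₀ (by positivity), div_eq_mul_inv] at h2
      rw [div_eq_mul_inv, norm_mul]
      calc _ ≤ (C * ((1 + |slope θ v₂ v₃ * t - j / v₂.rk θ|) ^ 2)⁻¹ *
            ((1 + |wgt θ v₁ v₃ U t|) ^ 2)⁻¹) * B :=
            mul_le_mul h2 (hB' t) (norm_nonneg _) (by positivity)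
        _ = _ := by ring)
  rw [h1.tsum_eq, coef1]
  congr 1
  funext t
  rw [comp, tsum_div_const]

/-- The composition of a class of the upper degree with a holomorphic kernel on the left. -/
theorem coef1_comp_left (hτ : τ.im < 0) (h12 : b₁.v.det b₂.v ≠ 0)
    (h23 : b₂.v.det b₃.v ≠ 0) (h13 : b₁.v.det b₃.v ≠ 0) (hD : slope θ b₁.v b₃.v < 0)
    (c : ℤ × ℤ → ℂ) {κ : Fn} (hκ : κ ∈ Ker θ b₁.v b₂.v)
    (hc : (fun u t => c u * gaussK θ τ (del θ b₂ b₃) b₂.v b₃.v u t) ∈ Ker θ b₂.v b₃.v) :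
    coef1 θ τ (del θ b₁ b₃) b₁.v b₃.v (comp θ b₂.v
      (fun u t => c u * gaussK θ τ (del θ b₂ b₃) b₂.v b₃.v u t) κ) =
        compC τ b₁ b₂ b₃ c (coef1 θ τ (del θ b₁ b₂) b₁.v b₂.v κ) := by
  have hτ0 : τ ≠ 0 := by rintro rfl; simp at hτ
  funext U
  rw [coef1_comp hτ hD hc hκ, compC]
  refine tsum_congr fun j => ?_
  have h1 := integral_add_right_eq_self (μ := volume) (fun t => κ (U - j • b₂.v.sec) t /
    gaussK θ τ (del θ b₁ b₂) b₁.v b₂.v (U - j • b₂.v.sec) t) (off θ (j • b₂.v.sec))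
  rw [coef1, ← h1, mul_right_comm, ← integral_const_mul]
  congr 1
  funext t
  have h2 := gaussK_mul (θ := θ) hτ0 h12 h23 h13 U (j • b₂.v.sec) t
  have g1 := gaussK_ne_zero (θ := θ) (τ := τ) (δ := del θ b₁ b₂) (v := b₁.v) (v' := b₂.v)
    (U - j • b₂.v.sec) (t + off θ (j • b₂.v.sec))
  have g2 := gaussK_ne_zero (θ := θ) (τ := τ) (δ := del θ b₁ b₃) (v := b₁.v) (v' := b₃.v) U t
  rw [mul_div_assoc', div_eq_div_iff g2 g1]
  linear_combination (c (j • b₂.v.sec) * κ (U - j • b₂.v.sec) (t + off θ (j • b₂.v.sec))) * h2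

/-- The composition of a class of the upper degree with a holomorphic kernel on the right. -/
theorem coef1_comp_right (hτ : τ.im < 0) (h12 : b₁.v.det b₂.v ≠ 0)
    (h23 : b₂.v.det b₃.v ≠ 0) (h13 : b₁.v.det b₃.v ≠ 0) (hD : slope θ b₁.v b₃.v < 0)
    (c : ℤ × ℤ → ℂ) {κ : Fn} (hκ : κ ∈ Ker θ b₂.v b₃.v)
    (hc : (fun u t => c u * gaussK θ τ (del θ b₁ b₂) b₁.v b₂.v u t) ∈ Ker θ b₁.v b₂.v) :
    coef1 θ τ (del θ b₁ b₃) b₁.v b₃.v (comp θ b₂.v κ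
      (fun u t => c u * gaussK θ τ (del θ b₁ b₂) b₁.v b₂.v u t)) =
        compC τ b₁ b₂ b₃ (coef1 θ τ (del θ b₂ b₃) b₂.v b₃.v κ) c := by
  have hτ0 : τ ≠ 0 := by rintro rfl; simp at hτ
  funext U
  rw [coef1_comp hτ hD hκ hc, compC]
  refine tsum_congr fun j => ?_
  rw [coef1, mul_assoc, mul_comm (∫ t, _), ← integral_const_mul]
  congr 1
  funext t
  have h2 := gaussK_mul (θ := θ) hτ0 h12 h23 h13 U (j • b₂.v.sec) t
  have g1 := gaussK_ne_zero (θ := θ) (τ := τ) (δ := del θ b₂ b₃) (v := b₂.v) (v' := b₃.v)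
    (j • b₂.v.sec) t
  have g2 := gaussK_ne_zero (θ := θ) (τ := τ) (δ := del θ b₁ b₃) (v := b₁.v) (v' := b₃.v) U t
  rw [mul_div_assoc', div_eq_div_iff g2 g1]
  linear_combination (c (U - j • b₂.v.sec) * κ (j • b₂.v.sec) t) * h2

/-- The trace of a composition, by unfolding the integral over a period. -/
theorem trK_comp {v₁ v₂ : Ray} (hd : v₂.det v₁ ≠ 0) {κ' κ : Fn} (hκ' : κ' ∈ Ker θ v₂ v₁)
    (hκ : κ ∈ Ker θ v₁ v₂) : trK θ v₁ (comp θ v₂ κ' κ) =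
      ∑ i ∈ Finset.range (v₂.det v₁).natAbs, ∫ t, κ' ((i : ℤ) • v₂.sec) t *
        κ (0 - (i : ℤ) • v₂.sec) (t + off θ ((i : ℤ) • v₂.sec)) := by
  have hr := v₁.rk_ne (θ := θ)
  have hD := slope_ne_zero (θ := θ) hd
  set n := (v₂.det v₁).natAbs
  have hn : NeZero n := ⟨Int.natAbs_ne_zero.mpr hd⟩
  let φ : ℤ × ℤ → ℝ → ℂ := fun u t => κ' u t * κ (0 - u) (t + off θ u)
  -- `φ(u, t)` depends only on the class of `u` modulo `w₂`, and the translation of `u` by `w₁` is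
  -- compensated by a translation of `t`
  have hφ2 : ∀ t u, φ (u + v₂.w) t = φ u t := fun t u => comp_term_per hκ' hκ 0 u t
  have hφ1 : ∀ u t, φ (u + v₁.w) (t + v₁.rk θ) = φ u t := fun u t => by
    simp only [φ]
    rw [Ker.per2 hκ', ← Ker.per1 hκ (0 - (u + v₁.w)), off_add, off_w]
    congr 2
    · abel
    · ring
  have hφ : ∀ (i k : ℤ) (t : ℝ), φ ((i + k * v₂.det v₁) • v₂.sec) t =
      φ (i • v₂.sec) (t - k * v₁.rk θ) := by
    intro i k t
    have h1 := eq_ell_smul_sec (F := fun u => φ u t) v₂ (hφ2 t) (i • v₂.sec + k • v₁.w)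
    rw [Ray.ell_add, Ray.ell_smul_sec, Ray.ell_smul, Ray.ell_w] at h1
    rw [← h1]
    have h' : Function.Periodic (fun y : (ℤ × ℤ) × ℝ => φ y.1 y.2) (v₁.w, v₁.rk θ) :=
      fun y => hφ1 y.1 y.2
    have h2 := h'.zsmul k (i • v₂.sec, t - k * v₁.rk θ)
    simp only [Prod.smul_mk, Prod.mk_add_mk, zsmul_eq_mul (v₁.rk θ), sub_add_cancel] at h2
    exact h2
  obtain ⟨C, hC0, hC⟩ := comp_term_le (Ker.rap hκ') (Ker.rap hκ) 0
  have hC' : ∀ (j : ℤ) t, ‖φ (j • v₂.sec) t‖ ≤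
      C * ((1 + |slope θ v₂ v₁ * t - j / v₂.rk θ|) ^ 2)⁻¹ := fun j t => by
    have h2 := hC 0 (j • v₂.sec) t
    rwa [wgt_sec, pow_zero, one_mul] at h2
  have hcont : ∀ j : ℤ, Continuous (φ (j • v₂.sec)) := fun j => (Ker.continuous hκ' _).mul
    ((Ker.continuous hκ _).comp (continuous_id.add continuous_const))
  have hint : ∀ j : ℤ, MeasureTheory.Integrable (φ (j • v₂.sec)) := fun j =>
    ((integrable_inv_sq hD _).const_mul C).mono' (hcont j).aestronglyMeasurable
      (Filter.Eventually.of_forall (hC' j))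
  have h1 := hasSum_integral_shift (μ := volume.restrict (Set.Ioc 0 |v₁.rk θ|))
    (integrable_const C) (fun _ => hC0) v₂.rk_ne (slope θ v₂ v₁) hcont hC'
  simp only [← intervalIntegral.integral_of_le (abs_nonneg (v₁.rk θ))] at h1
  -- the sign with which the period of the line enters
  obtain ⟨ρ, hρ0, hρ1, hρ⟩ : ∃ ρ : ℝ, ρ ≠ 0 ∧ |ρ| = |v₁.rk θ| ∧ ∀ (i k : ℤ) (t : ℝ),
      φ ((k * n + i) • v₂.sec) t = φ (i • v₂.sec) (t + k * ρ) := by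
    rcases Int.natAbs_eq (v₂.det v₁) with h | h
    · refine ⟨-v₁.rk θ, neg_ne_zero.mpr hr, abs_neg _, fun i k t => ?_⟩
      rw [add_comm, ← h, hφ]; congr 1; ring
    · refine ⟨v₁.rk θ, hr, rfl, fun i k t => ?_⟩
      have : k * (n : ℤ) + i = i + (-k) * v₂.det v₁ := by rw [h]; ring
      rw [this, hφ]; congr 1; push_cast; ring
  -- with `j = kn + i`, the sum over `k` unfolds the integral over a period to the whole line
  have h2 := (Int.divModEquiv n).symm.hasSum_iff.mpr h1
  have h3 := ((Equiv.prodComm (Fin n) ℤ).hasSum_iff.mpr h2).prod_fiberwise fun i => by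
    have h4 := hasSum_integral_translates (hint (i : ℕ)) hρ0
    rw [hρ1] at h4
    refine h4.congr_fun fun k => ?_
    simp only [Function.comp, Equiv.prodComm_apply, Prod.swap_prod_mk, Int.divModEquiv,
      Equiv.coe_fn_symm_mk]
    simp only [hρ]
  have h5 := h3.unique (hasSum_fintype _)
  rw [trK]
  refine h5.trans ?_
  rw [Finset.sum_range]

/-- The pairing of coefficient functions given by composition and trace. -/
def pairC (b₁ b₂ : Base) (c' c : ℤ × ℤ → ℂ) : ℂ :=
  ∑ i ∈ Finset.range (b₂.v.det b₁.v).natAbs,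
    c' ((i : ℤ) • b₂.v.sec) * c (0 - (i : ℤ) • b₂.v.sec)

theorem trK_comp_left (hd : b₂.v.det b₁.v ≠ 0) (c : ℤ × ℤ → ℂ)
    {κ : Fn} (hκ : κ ∈ Ker θ b₁.v b₂.v)
    (hc : (fun u t => c u * gaussK θ τ (del θ b₂ b₁) b₂.v b₁.v u t) ∈ Ker θ b₂.v b₁.v) :
    trK θ b₁.v (comp θ b₂.v (fun u t => c u * gaussK θ τ (del θ b₂ b₁) b₂.v b₁.v u t) κ) =
      pairC b₁ b₂ c (coef1 θ τ (del θ b₁ b₂) b₁.v b₂.v κ) := by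
  rw [trK_comp hd hc hκ, pairC]
  refine Finset.sum_congr rfl fun i _ => ?_
  have h1 := integral_add_right_eq_self (μ := volume) (fun t => κ (0 - (i : ℤ) • b₂.v.sec) t /
    gaussK θ τ (del θ b₁ b₂) b₁.v b₂.v (0 - (i : ℤ) • b₂.v.sec) t) (off θ ((i : ℤ) • b₂.v.sec))
  rw [coef1, ← h1, ← integral_const_mul]
  congr 1
  funext t
  have h2 := gaussK_mul_gaussK_swap (θ := θ) (τ := τ) b₁ b₂ ((i : ℤ) • b₂.v.sec) t
  rw [mul_div_assoc', eq_div_iff (gaussK_ne_zero _ _)]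
  linear_combination (c ((i : ℤ) • b₂.v.sec) *
    κ (0 - (i : ℤ) • b₂.v.sec) (t + off θ ((i : ℤ) • b₂.v.sec))) * h2

theorem trK_comp_right (hd : b₂.v.det b₁.v ≠ 0) (c : ℤ × ℤ → ℂ)
    {κ : Fn} (hκ : κ ∈ Ker θ b₂.v b₁.v)
    (hc : (fun u t => c u * gaussK θ τ (del θ b₁ b₂) b₁.v b₂.v u t) ∈ Ker θ b₁.v b₂.v) :
    trK θ b₁.v (comp θ b₂.v κ (fun u t => c u * gaussK θ τ (del θ b₁ b₂) b₁.v b₂.v u t)) =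
      pairC b₁ b₂ (coef1 θ τ (del θ b₂ b₁) b₂.v b₁.v κ) c := by
  rw [trK_comp hd hκ hc, pairC]
  refine Finset.sum_congr rfl fun i _ => ?_
  rw [coef1, mul_comm (∫ t, _), ← integral_const_mul]
  congr 1
  funext t
  have h2 := gaussK_mul_gaussK_swap (θ := θ) (τ := τ) b₁ b₂ ((i : ℤ) • b₂.v.sec) t
  rw [mul_div_assoc', eq_div_iff (gaussK_ne_zero _ _)]
  linear_combination (c (0 - (i : ℤ) • b₂.v.sec) * κ ((i : ℤ) • b₂.v.sec) t) * h2

end products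

/-! ### Numerical invariants of cohomology classes -/

/-- The values of the invariants: a coefficient function for different classes, a multiple of the
identity and a trace for endomorphisms. -/
abbrev Inv : Type := (ℤ × ℤ → ℂ) × ℂ × ℂ

open Classical in
/-- The invariant of a closed morphism of the lower degree. -/
def inv0 (θ : ℝ) (τ : ℂ) (b b' : Base) (κ : Fn) : Inv :=
  if b.v.det b'.v ≠ 0 then
    (if 0 < slope θ b.v b'.v then (coef0 θ τ (del θ b b') b.v b'.v κ, 0, 0) else 0)
  else if b = b' then (0, κ 0 0, 0) else 0

open Classical in
/-- The invariant of a morphism of the upper degree. -/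
def inv1 (θ : ℝ) (τ : ℂ) (b b' : Base) (κ : Fn) : Inv :=
  if b.v.det b'.v ≠ 0 then
    (if 0 < slope θ b.v b'.v then 0 else (coef1 θ τ (del θ b b') b.v b'.v κ, 0, 0))
  else if b = b' then (0, 0, trK θ b.v κ) else 0

open Classical in
/-- The part of an invariant that belongs to the lower degree. -/
def low (θ : ℝ) (b b' : Base) (x : Inv) : Inv :=
  if b.v.det b'.v ≠ 0 then (if 0 < slope θ b.v b'.v then x else 0) else (0, x.2.1, 0)

open Classical in
/-- The part of an invariant that belongs to the upper degree. -/
def upp (θ : ℝ) (b b' : Base) (x : Inv) : Inv :=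
  if b.v.det b'.v ≠ 0 then (if 0 < slope θ b.v b'.v then 0 else x) else (0, 0, x.2.2)

open Classical in
/-- The invariants that occur. -/
def invRange (b b' : Base) : Set Inv :=
  {x | if b.v.det b'.v ≠ 0 then x.1 ∈ Wper b.v b'.v ∧ x.2 = 0 else
    if b = b' then x.1 = 0 else x = 0}

open Classical in
/-- The composition in terms of the invariants. -/
def invComp (τ : ℂ) (b₁ b₂ b₃ : Base) (y x : Inv) : Inv :=
  if b₁ = b₂ then
    (if b₂ = b₃ then (0, y.2.1 * x.2.1, y.2.1 * x.2.2 + x.2.1 * y.2.2) else x.2.1 • y)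
  else if b₂ = b₃ then y.2.1 • x
  else if b₁ = b₃ then (0, 0, pairC b₁ b₂ y.1 x.1)
  else if 0 < b₁.v.det b₂.v * b₂.v.det b₃.v * b₁.v.det b₃.v then
    (compC τ b₁ b₂ b₃ y.1 x.1, 0, 0)
  else 0

/-- Two bases are comparable if they are equal, have different classes up to sign, or have the same
class and there is no cohomology between the bundles. -/
def Comparable (θ : ℝ) (τ : ℂ) (b b' : Base) : Prop :=
  b.v.det b'.v ≠ 0 ∨ b = b' ∨ (b.v = b'.v ∧ ¬ Resonant θ τ (del θ b b') b.v)

section invariants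

variable {θ : ℝ} {τ : ℂ} {b b' : Base}

theorem del_self (b : Base) : del θ b b = 0 := sub_self _

theorem ne_of_not_resonant (h : b.v = b'.v ∧ ¬ Resonant θ τ (del θ b b') b.v) : b ≠ b' := by
  rintro rfl
  exact h.2 ⟨0, 0, by simp [del_self]⟩

theorem det_eq_zero_of_eq (h : b.v = b'.v) : b.v.det b'.v = 0 := by rw [h, Ray.det_self]

theorem inv0_pos (hd : b.v.det b'.v ≠ 0) (hD : 0 < slope θ b.v b'.v) (κ : Fn) :
    inv0 θ τ b b' κ = (coef0 θ τ (del θ b b') b.v b'.v κ, 0, 0) := by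
  rw [inv0, if_pos hd, if_pos hD]

theorem inv1_pos (hd : b.v.det b'.v ≠ 0) (hD : 0 < slope θ b.v b'.v) (κ : Fn) :
    inv1 θ τ b b' κ = 0 := by
  rw [inv1, if_pos hd, if_pos hD]

theorem inv0_neg (hd : b.v.det b'.v ≠ 0) (hD : slope θ b.v b'.v < 0) (κ : Fn) :
    inv0 θ τ b b' κ = 0 := by
  rw [inv0, if_pos hd, if_neg hD.not_gt]

theorem inv1_neg (hd : b.v.det b'.v ≠ 0) (hD : slope θ b.v b'.v < 0) (κ : Fn) :
    inv1 θ τ b b' κ = (coef1 θ τ (del θ b b') b.v b'.v κ, 0, 0) := by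
  rw [inv1, if_pos hd, if_neg hD.not_gt]

theorem inv0_self (b : Base) (κ : Fn) : inv0 θ τ b b κ = (0, κ 0 0, 0) := by
  simp [inv0]

theorem inv1_self (b : Base) (κ : Fn) : inv1 θ τ b b κ = (0, 0, trK θ b.v κ) := by
  simp [inv1]

theorem inv0_other (h : b.v = b'.v ∧ ¬ Resonant θ τ (del θ b b') b.v) (κ : Fn) :
    inv0 θ τ b b' κ = 0 := by
  rw [inv0, if_neg (not_not.mpr (det_eq_zero_of_eq h.1)), if_neg (ne_of_not_resonant h)]

theorem inv1_other (h : b.v = b'.v ∧ ¬ Resonant θ τ (del θ b b') b.v) (κ : Fn) :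
    inv1 θ τ b b' κ = 0 := by
  rw [inv1, if_neg (not_not.mpr (det_eq_zero_of_eq h.1)), if_neg (ne_of_not_resonant h)]

theorem inv0_add (κ κ' : Fn) :
    inv0 θ τ b b' (κ + κ') = inv0 θ τ b b' κ + inv0 θ τ b b' κ' := by
  have h : coef0 θ τ (del θ b b') b.v b'.v (κ + κ') =
      coef0 θ τ (del θ b b') b.v b'.v κ + coef0 θ τ (del θ b b') b.v b'.v κ' :=
    funext fun u => add_div _ _ _
  simp only [inv0, h]
  split_ifs <;> simp

theorem inv0_smul (a : ℂ) (κ : Fn) : inv0 θ τ b b' (a • κ) = a • inv0 θ τ b b' κ := by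
  have h : coef0 θ τ (del θ b b') b.v b'.v (a • κ) = a • coef0 θ τ (del θ b b') b.v b'.v κ :=
    funext fun u => mul_div_assoc _ _ _
  simp only [inv0, h]
  split_ifs <;> simp

theorem inv1_smul (a : ℂ) (κ : Fn) : inv1 θ τ b b' (a • κ) = a • inv1 θ τ b b' κ := by
  have h : coef1 θ τ (del θ b b') b.v b'.v (a • κ) = a • coef1 θ τ (del θ b b') b.v b'.v κ := by
    funext u
    simp only [coef1, Pi.smul_apply, smul_eq_mul, mul_div_assoc]
    exact MeasureTheory.integral_const_mul _ _
  have h' : trK θ b.v (a • κ) = a * trK θ b.v κ := by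
    simp only [trK, Pi.smul_apply, smul_eq_mul]
    exact intervalIntegral.integral_const_mul _ _
  simp only [inv1, h, h']
  split_ifs <;> simp

theorem inv0_zero : inv0 θ τ b b' 0 = 0 := by
  have := inv0_smul (θ := θ) (τ := τ) (b := b) (b' := b') 0 0
  rwa [zero_smul, zero_smul] at this

theorem inv1_zero : inv1 θ τ b b' 0 = 0 := by
  have := inv1_smul (θ := θ) (τ := τ) (b := b) (b' := b') 0 0
  rwa [zero_smul, zero_smul] at this

theorem low_add (κ κ' : Fn) : low θ b b' (inv0 θ τ b b' κ + inv1 θ τ b b' κ') =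
    inv0 θ τ b b' κ := by
  simp only [low, inv0, inv1]
  split_ifs <;> simp

theorem upp_add (κ κ' : Fn) : upp θ b b' (inv0 θ τ b b' κ + inv1 θ τ b b' κ') =
    inv1 θ τ b b' κ' := by
  simp only [upp, inv0, inv1]
  split_ifs <;> simp

theorem comp_zero_left (v : Ray) (κ : Fn) : comp θ v 0 κ = 0 := by
  funext u t; simp [comp]

theorem comp_zero_right (v : Ray) (κ : Fn) : comp θ v κ 0 = 0 := by
  funext u t; simp [comp]

theorem nab_zero (δ : ℂ) (v v' : Ray) : nab θ τ δ v v' 0 = 0 := by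
  funext u t
  have : dF 0 u t = 0 := by
    show deriv (fun _ : ℝ => (0 : ℂ)) t = 0
    exact deriv_const _ _
  simp [nab, this]

theorem pairC_zero_left (b₁ b₂ : Base) (c : ℤ × ℤ → ℂ) : pairC b₁ b₂ 0 c = 0 := by
  simp [pairC]
theorem pairC_zero_right (b₁ b₂ : Base) (c : ℤ × ℤ → ℂ) : pairC b₁ b₂ c 0 = 0 := by
  simp [pairC]
theorem compC_zero_left (b₁ b₂ b₃ : Base) (c : ℤ × ℤ → ℂ) : compC τ b₁ b₂ b₃ 0 c = 0 := by
  funext U; simp [compC]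
theorem compC_zero_right (b₁ b₂ b₃ : Base) (c : ℤ × ℤ → ℂ) : compC τ b₁ b₂ b₃ c 0 = 0 := by
  funext U; simp [compC]

theorem invComp_zero_left (b₁ b₂ b₃ : Base) (x : Inv) : invComp τ b₁ b₂ b₃ 0 x = 0 := by
  simp only [invComp, Prod.fst_zero, Prod.snd_zero, pairC_zero_left, compC_zero_left]
  split_ifs <;> simp

theorem invComp_zero_right (b₁ b₂ b₃ : Base) (y : Inv) : invComp τ b₁ b₂ b₃ y 0 = 0 := by
  simp only [invComp, Prod.fst_zero, Prod.snd_zero, pairC_zero_right, compC_zero_right]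
  split_ifs <;> simp

variable [Fact (Irrational θ)]

theorem slope_neg_or_pos (hd : b.v.det b'.v ≠ 0) :
    slope θ b.v b'.v < 0 ∨ 0 < slope θ b.v b'.v := lt_or_gt_of_ne (slope_ne_zero hd)

theorem inv1_add (hτ : τ.im < 0) {κ κ' : Fn} (h : κ ∈ Ker θ b.v b'.v) (h' : κ' ∈ Ker θ b.v b'.v) :
    inv1 θ τ b b' (κ + κ') = inv1 θ τ b b' κ + inv1 θ τ b b' κ' := by
  by_cases hd : b.v.det b'.v = 0
  · have h' : b = b' → trK θ b.v (κ + κ') = trK θ b.v κ + trK θ b.v κ' := by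
      rintro rfl
      exact intervalIntegral.integral_add ((Ker.continuous h 0).intervalIntegrable _ _)
        ((Ker.continuous h' 0).intervalIntegrable _ _)
    simp only [inv1, hd, ne_eq, not_true_eq_false, if_false]
    split_ifs with hb
    · rw [h' hb]; simp
    · simp
  · rcases slope_neg_or_pos (θ := θ) hd with hD | hD
    · rw [inv1_neg hd hD, inv1_neg hd hD, inv1_neg hd hD]
      have : coef1 θ τ (del θ b b') b.v b'.v (κ + κ') =
          coef1 θ τ (del θ b b') b.v b'.v κ + coef1 θ τ (del θ b b') b.v b'.v κ' := by
        funext u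
        simp only [coef1, Pi.add_apply, add_div]
        exact MeasureTheory.integral_add (integrable_div_gaussK hτ hD h u)
          (integrable_div_gaussK hτ hD h' u)
      rw [this]; simp
    · rw [inv1_pos hd hD, inv1_pos hd hD, inv1_pos hd hD, add_zero]

/-- Closed morphisms of the lower degree are determined by their invariants. -/
theorem eq_zero_of_inv0_eq_zero (hτ : τ.im < 0) (hc : Comparable θ τ b b') {κ : Fn}
    (hκ : κ ∈ Ker θ b.v b'.v) (h0 : nab θ τ (del θ b b') b.v b'.v κ = 0)
    (h : inv0 θ τ b b' κ = 0) : κ = 0 := by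
  have hτ0 : τ ≠ 0 := by rintro rfl; simp at hτ
  rcases hc with hd | rfl | hr
  · rcases slope_neg_or_pos (θ := θ) hd with hD | hD
    · exact eq_zero_of_nab_eq_zero hτ hd hD hκ h0
    · rw [inv0_pos hd hD] at h
      have h1 : coef0 θ τ (del θ b b') b.v b'.v κ = 0 := congrArg Prod.fst h
      funext u t
      rw [eq_coef0_mul hτ0 hd hκ h0, h1]
      simp
  · rw [inv0_self] at h
    rw [del_self] at h0
    have h1 : κ 0 0 = 0 := congrArg (fun x : Inv => x.2.1) h
    rw [eq_smul_idK hτ hκ h0, h1, zero_smul]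
  · obtain ⟨h1, h2⟩ := hr
    rw [← h1] at hκ h0
    exact eq_zero_of_not_resonant h2 hκ h0

/-- Morphisms of the upper degree are exact if and only if their invariant vanishes. -/
theorem inv1_eq_zero_iff (hτ : τ.im < 0) (hc : Comparable θ τ b b') {κ : Fn}
    (hκ : κ ∈ Ker θ b.v b'.v) : inv1 θ τ b b' κ = 0 ↔
      ∃ κ' ∈ Ker θ b.v b'.v, nab θ τ (del θ b b') b.v b'.v κ' = κ := by
  rcases hc with hd | rfl | hr
  · rcases slope_neg_or_pos (θ := θ) hd with hD | hD
    · rw [inv1_neg hd hD, ← coef1_eq_zero_iff hτ hd hD hκ]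
      simp [Prod.ext_iff]
    · rw [inv1_pos hd hD]
      exact iff_of_true rfl (exists_nab_eq_of_pos hτ hd hD hκ)
  · rw [inv1_self, del_self, ← trK_eq_zero_iff_exists hτ hκ]
    simp [Prod.ext_iff]
  · rw [inv1_other hr]
    obtain ⟨h1, h2⟩ := hr
    rw [← h1] at hκ ⊢
    exact iff_of_true rfl (exists_nab_eq_of_not_resonant hτ h2 hκ)

theorem inv_mem_range (hτ : τ.im < 0) (hc : Comparable θ τ b b') {κ κ' : Fn}
    (hκ : κ ∈ Ker θ b.v b'.v) (h0 : nab θ τ (del θ b b') b.v b'.v κ = 0)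
    (hκ' : κ' ∈ Ker θ b.v b'.v) : inv0 θ τ b b' κ + inv1 θ τ b b' κ' ∈ invRange b b' := by
  have hτ0 : τ ≠ 0 := by rintro rfl; simp at hτ
  rw [invRange, Set.mem_ofPred_eq]
  rcases hc with hd | rfl | hr
  · rw [if_pos hd]
    rcases slope_neg_or_pos (θ := θ) hd with hD | hD
    · rw [inv0_neg hd hD, inv1_neg hd hD, zero_add]
      exact ⟨coef1_mem hκ', rfl⟩
    · rw [inv0_pos hd hD, inv1_pos hd hD, add_zero]
      exact ⟨coef0_mem hτ0 hd hκ h0, rfl⟩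
  · rw [inv0_self, inv1_self]
    simp
  · rw [inv0_other hr, inv1_other hr, if_neg (not_not.mpr (det_eq_zero_of_eq hr.1)),
      if_neg (ne_of_not_resonant hr), add_zero]

theorem exists_inv_eq (hτ : τ.im < 0) (hc : Comparable θ τ b b') {x : Inv}
    (hx : x ∈ invRange b b') : ∃ κ ∈ Ker θ b.v b'.v, ∃ κ' ∈ Ker θ b.v b'.v,
      nab θ τ (del θ b b') b.v b'.v κ = 0 ∧ inv0 θ τ b b' κ + inv1 θ τ b b' κ' = x := by
  have hτ0 : τ ≠ 0 := by rintro rfl; simp at hτ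
  rw [invRange, Set.mem_ofPred_eq] at hx
  rcases hc with hd | rfl | hr
  · rw [if_pos hd] at hx
    rcases slope_neg_or_pos (θ := θ) hd with hD | hD
    · obtain ⟨κ, hκ, h1⟩ := exists_coef1_eq (θ := θ) τ (del θ b b') hd hx.1
      refine ⟨0, zero_mem _, κ, hκ, nab_zero _ _ _, ?_⟩
      rw [inv0_zero, zero_add, inv1_neg hd hD, h1]
      exact Prod.ext rfl hx.2.symm
    · refine ⟨_, mul_gaussK_mem hτ hd hD hx.1, 0, zero_mem _, nab_mul_gaussK hτ0 hd _, ?_⟩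
      rw [inv1_zero, add_zero, inv0_pos hd hD, coef0_mul_gaussK]
      exact Prod.ext rfl hx.2.symm
  · simp only [Ray.det_self, ne_eq, not_true_eq_false, if_false, if_true] at hx
    have hr : ((|b.v.rk θ| : ℝ) : ℂ) ≠ 0 := by exact_mod_cast abs_ne_zero.mpr b.v.rk_ne
    refine ⟨x.2.1 • idK b.v, Submodule.smul_mem _ _ (idK_mem θ b.v),
      (x.2.2 / |b.v.rk θ|) • idK b.v, Submodule.smul_mem _ _ (idK_mem θ b.v), ?_, ?_⟩
    · have h2 : nab θ τ 0 b.v b.v (x.2.1 • idK b.v) = x.2.1 • nab θ τ 0 b.v b.v (idK b.v) := by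
        funext u t
        have h3 : dF (x.2.1 • idK b.v) u t = x.2.1 * dF (idK b.v) u t :=
          ((Ker.hasDerivAt (idK_mem θ b.v) u t).const_mul x.2.1).deriv
        show _ = x.2.1 * nab θ τ 0 b.v b.v (idK b.v) u t
        rw [nab_self, h3, nab_self]
        simp only [Pi.smul_apply, smul_eq_mul]
        ring
      rw [del_self, h2, nab_idK, smul_zero]
    · rw [inv0_smul, inv1_smul, inv0_self, inv1_self, trK_idK]
      refine Prod.ext ?_ (Prod.ext ?_ ?_)
      · simp [hx]
      · simp [idK]
      · simp [hr]
  · rw [if_neg (not_not.mpr (det_eq_zero_of_eq hr.1)), if_neg (ne_of_not_resonant hr)] at hx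
    exact ⟨0, zero_mem _, 0, zero_mem _, nab_zero _ _ _, by rw [inv0_zero, inv1_zero, add_zero, hx]⟩

/-- Between different bases, morphisms of the two degrees do not both have invariants. -/
theorem eq_zero_or_inv1_eq_zero (hτ : τ.im < 0) (hc : Comparable θ τ b b') (hne : b ≠ b') {κ : Fn}
    (hκ : κ ∈ Ker θ b.v b'.v) (h0 : nab θ τ (del θ b b') b.v b'.v κ = 0) :
    κ = 0 ∨ ∀ κ', inv1 θ τ b b' κ' = 0 := by
  rcases hc with hd | h | hr
  · rcases slope_neg_or_pos (θ := θ) hd with hD | hD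
    · exact Or.inl (eq_zero_of_nab_eq_zero hτ hd hD hκ h0)
    · exact Or.inr (inv1_pos hd hD)
  · exact absurd h hne
  · exact Or.inr (inv1_other hr)

end invariants

section composition

variable {θ : ℝ} [Fact (Irrational θ)] {τ : ℂ} {b₁ b₂ b₃ : Base}

/-- A closed morphism between different classes is the product of its coefficient function and the
Gaussian. -/
theorem eq_coef0_smul (hτ : τ.im < 0) {b b' : Base} (hd : b.v.det b'.v ≠ 0) {κ : Fn}
    (hκ : κ ∈ Ker θ b.v b'.v) (h0 : nab θ τ (del θ b b') b.v b'.v κ = 0) :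
    κ = fun u t => coef0 θ τ (del θ b b') b.v b'.v κ u * gaussK θ τ (del θ b b') b.v b'.v u t := by
  have hτ0 : τ ≠ 0 := by rintro rfl; simp at hτ
  exact funext fun u => funext fun t => eq_coef0_mul hτ0 hd hκ h0 u t

/-- The composition of pairs of kernels with three pairwise different classes. -/
theorem inv_comp_of_det_ne (hτ : τ.im < 0) (h12 : b₁.v.det b₂.v ≠ 0) (h23 : b₂.v.det b₃.v ≠ 0)
    (h13 : b₁.v.det b₃.v ≠ 0) {f f' g g' : Fn} (hf : f ∈ Ker θ b₁.v b₂.v)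
    (hf' : f' ∈ Ker θ b₁.v b₂.v) (hg : g ∈ Ker θ b₂.v b₃.v) (hg' : g' ∈ Ker θ b₂.v b₃.v)
    (hf0 : nab θ τ (del θ b₁ b₂) b₁.v b₂.v f = 0) (hg0 : nab θ τ (del θ b₂ b₃) b₂.v b₃.v g = 0) :
    inv0 θ τ b₁ b₃ (comp θ b₂.v g f) +
      inv1 θ τ b₁ b₃ (comp θ b₂.v g f' + comp θ b₂.v g' f) =
        invComp τ b₁ b₂ b₃ (inv0 θ τ b₂ b₃ g + inv1 θ τ b₂ b₃ g')
          (inv0 θ τ b₁ b₂ f + inv1 θ τ b₁ b₂ f') := by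
  have hτ0 : τ ≠ 0 := by rintro rfl; simp at hτ
  have ne : ∀ {b b' : Base}, b.v.det b'.v ≠ 0 → b ≠ b' := by
    rintro b _ h rfl; exact h (Ray.det_self _)
  have hiff := slope_mul_pos_iff (θ := θ) b₁.v b₂.v b₃.v
  have hs := slope_add b₁.v b₂.v b₃.v (θ := θ)
  rw [invComp, if_neg (ne h12), if_neg (ne h23), if_neg (ne h13)]
  -- a closed morphism of the lower degree vanishes if the difference of slopes is negative, so the
  -- signs decide which of the three products can be nonzero
  rcases slope_neg_or_pos (θ := θ) h12 with d12 | d12 <;>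
    rcases slope_neg_or_pos (θ := θ) h23 with d23 | d23
  · have d13 : slope θ b₁.v b₃.v < 0 := by linarith
    obtain rfl := eq_zero_of_nab_eq_zero hτ h12 d12 hf hf0
    obtain rfl := eq_zero_of_nab_eq_zero hτ h23 d23 hg hg0
    rw [comp_zero_left, comp_zero_left, comp_zero_right, add_zero, inv0_zero, inv1_zero, add_zero,
      if_neg (mt hiff.mpr (mul_neg_of_pos_of_neg (mul_pos_of_neg_of_neg d12 d23) d13).not_gt)]
  · obtain rfl := eq_zero_of_nab_eq_zero hτ h12 d12 hf hf0
    rw [comp_zero_right, comp_zero_right, add_zero, inv0_zero, inv0_zero, zero_add, zero_add]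
    rcases slope_neg_or_pos (θ := θ) h13 with d13 | d13
    · rw [if_pos (hiff.mp (mul_pos_of_neg_of_neg (mul_neg_of_neg_of_pos d12 d23) d13)),
        inv1_neg h13 d13, inv0_pos h23 d23, inv1_pos h23 d23, inv1_neg h12 d12, add_zero]
      have hg1 := eq_coef0_smul hτ h23 hg hg0
      have hg2 := hg
      rw [hg1] at hg2
      have := coef1_comp_left hτ h12 h23 h13 d13 _ hf' hg2
      rw [← hg1] at this
      rw [this]
    · rw [if_neg (mt hiff.mpr (mul_neg_of_neg_of_pos (mul_neg_of_neg_of_pos d12 d23) d13).not_gt),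
        inv1_pos h13 d13]
  · obtain rfl := eq_zero_of_nab_eq_zero hτ h23 d23 hg hg0
    rw [comp_zero_left, comp_zero_left, zero_add, inv0_zero, inv0_zero, zero_add, zero_add]
    rcases slope_neg_or_pos (θ := θ) h13 with d13 | d13
    · rw [if_pos (hiff.mp (mul_pos_of_neg_of_neg (mul_neg_of_pos_of_neg d12 d23) d13)),
        inv1_neg h13 d13, inv0_pos h12 d12, inv1_pos h12 d12, inv1_neg h23 d23, add_zero]
      have hf1 := eq_coef0_smul hτ h12 hf hf0
      have hf2 := hf
      rw [hf1] at hf2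
      have := coef1_comp_right hτ h12 h23 h13 d13 _ hg' hf2
      rw [← hf1] at this
      rw [this]
    · rw [if_neg (mt hiff.mpr (mul_neg_of_neg_of_pos (mul_neg_of_pos_of_neg d12 d23) d13).not_gt),
        inv1_pos h13 d13]
  · have d13 : 0 < slope θ b₁.v b₃.v := by linarith
    rw [if_pos (hiff.mp (mul_pos (mul_pos d12 d23) d13)), inv0_pos h13 d13, inv1_pos h13 d13,
      inv0_pos h23 d23, inv1_pos h23 d23, inv0_pos h12 d12, inv1_pos h12 d12, add_zero, add_zero,
      add_zero]
    have := comp_gaussK (θ := θ) hτ0 h12 h23 h13 (coef0 θ τ (del θ b₂ b₃) b₂.v b₃.v g)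
      (coef0 θ τ (del θ b₁ b₂) b₁.v b₂.v f)
    rw [← eq_coef0_smul hτ h12 hf hf0, ← eq_coef0_smul hτ h23 hg hg0] at this
    rw [this, coef0_mul_gaussK]

/-- The composition of pairs of kernels that go from a class to a different one and back. -/
theorem inv_comp_back (hτ : τ.im < 0) (h12 : b₁.v.det b₂.v ≠ 0) (h21 : b₂.v.det b₁.v ≠ 0)
    {f f' g g' : Fn} (hf : f ∈ Ker θ b₁.v b₂.v)
    (hf' : f' ∈ Ker θ b₁.v b₂.v) (hg : g ∈ Ker θ b₂.v b₁.v) (hg' : g' ∈ Ker θ b₂.v b₁.v)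
    (hf0 : nab θ τ (del θ b₁ b₂) b₁.v b₂.v f = 0) (hg0 : nab θ τ (del θ b₂ b₁) b₂.v b₁.v g = 0) :
    inv0 θ τ b₁ b₁ (comp θ b₂.v g f) +
      inv1 θ τ b₁ b₁ (comp θ b₂.v g f' + comp θ b₂.v g' f) =
        invComp τ b₁ b₂ b₁ (inv0 θ τ b₂ b₁ g + inv1 θ τ b₂ b₁ g')
          (inv0 θ τ b₁ b₂ f + inv1 θ τ b₁ b₂ f') := by
  have ne : ∀ {b b' : Base}, b.v.det b'.v ≠ 0 → b ≠ b' := by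
    rintro b _ h rfl; exact h (Ray.det_self _)
  rw [invComp, if_neg (ne h12), if_neg (ne h21), if_pos rfl]
  rcases slope_neg_or_pos (θ := θ) h12 with d12 | d12
  · have d21 : 0 < slope θ b₂.v b₁.v := by rw [slope_swap]; linarith
    obtain rfl := eq_zero_of_nab_eq_zero hτ h12 d12 hf hf0
    rw [comp_zero_right, comp_zero_right, add_zero, inv0_zero, inv0_zero, zero_add, zero_add,
      inv1_self, inv1_neg h12 d12, inv0_pos h21 d21, inv1_pos h21 d21, add_zero]
    have hg1 := eq_coef0_smul hτ h21 hg hg0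
    have hg2 := hg
    rw [hg1] at hg2
    have := trK_comp_left h21 _ hf' hg2
    rw [← hg1] at this
    rw [this]
  · have d21 : slope θ b₂.v b₁.v < 0 := by rw [slope_swap]; linarith
    obtain rfl := eq_zero_of_nab_eq_zero hτ h21 d21 hg hg0
    rw [comp_zero_left, comp_zero_left, zero_add, inv0_zero, inv0_zero, zero_add, zero_add,
      inv1_self, inv0_pos h12 d12, inv1_pos h12 d12, inv1_neg h21 d21, add_zero]
    have hf1 := eq_coef0_smul hτ h12 hf hf0
    have hf2 := hf
    rw [hf1] at hf2
    have := trK_comp_right h21 _ hg' hf2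
    rw [← hf1] at this
    rw [this]

/-- The invariants of a composition. -/
theorem inv_comp (hτ : τ.im < 0) (c12 : Comparable θ τ b₁ b₂) (c23 : Comparable θ τ b₂ b₃)
    (c13 : Comparable θ τ b₁ b₃) {f f' g g' : Fn} (hf : f ∈ Ker θ b₁.v b₂.v)
    (hf' : f' ∈ Ker θ b₁.v b₂.v) (hg : g ∈ Ker θ b₂.v b₃.v) (hg' : g' ∈ Ker θ b₂.v b₃.v)
    (hf0 : nab θ τ (del θ b₁ b₂) b₁.v b₂.v f = 0) (hg0 : nab θ τ (del θ b₂ b₃) b₂.v b₃.v g = 0) :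
    inv0 θ τ b₁ b₃ (comp θ b₂.v g f) +
      inv1 θ τ b₁ b₃ (comp θ b₂.v g f' + comp θ b₂.v g' f) =
        invComp τ b₁ b₂ b₃ (inv0 θ τ b₂ b₃ g + inv1 θ τ b₂ b₃ g')
          (inv0 θ τ b₁ b₂ f + inv1 θ τ b₁ b₂ f') := by
  -- a closed endomorphism of the lower degree is a scalar
  by_cases e12 : b₁ = b₂
  · subst e12
    rw [del_self] at hf0
    have hid := eq_smul_idK hτ hf hf0
    have hgf : ∀ {h}, h ∈ Ker θ b₁.v b₃.v → comp θ b₁.v h f = f 0 0 • h := fun hh => by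
      conv_lhs => rw [hid]
      rw [comp_smul_right, comp_idK hh]
    rw [hgf hg, hgf hg', inv1_add hτ (Ker.comp hg hf') (Submodule.smul_mem _ _ hg'), inv0_smul,
      inv1_smul, inv0_self, inv1_self, invComp, if_pos rfl]
    by_cases e23 : b₁ = b₃
    · subst e23
      rw [del_self] at hg0
      have h1 : comp θ b₁.v g f' = g 0 0 • f' := by
        conv_lhs => rw [eq_smul_idK hτ hg hg0]
        rw [comp_smul_left, idK_comp]
      rw [if_pos rfl, h1, inv1_smul]
      simp only [inv0_self, inv1_self]
      refine Prod.ext ?_ (Prod.ext ?_ ?_)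
      · simp
      · simp [mul_comm]
      · simp
    · rw [if_neg e23]
      have h1 : inv1 θ τ b₁ b₃ (comp θ b₁.v g f') = 0 := by
        rcases eq_zero_or_inv1_eq_zero hτ c23 e23 hg hg0 with rfl | h
        · rw [comp_zero_left, inv1_zero]
        · exact h _
      rw [h1, zero_add, smul_add]
      simp
  by_cases e23 : b₂ = b₃
  · subst e23
    rw [del_self] at hg0
    have hid := eq_smul_idK hτ hg hg0
    have hgf : ∀ h, comp θ b₂.v g h = g 0 0 • h := fun h => by
      conv_lhs => rw [hid]
      rw [comp_smul_left, idK_comp]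
    rw [hgf f, hgf f', inv1_add hτ (Submodule.smul_mem _ _ hf') (Ker.comp hg' hf), inv0_smul,
      inv1_smul, inv0_self, inv1_self, invComp, if_neg e12, if_pos rfl]
    have h1 : inv1 θ τ b₁ b₂ (comp θ b₂.v g' f) = 0 := by
      rcases eq_zero_or_inv1_eq_zero hτ c12 e12 hf hf0 with rfl | h
      · rw [comp_zero_right, inv1_zero]
      · exact h _
    rw [h1, add_zero, smul_add]
    simp
  -- by the Leibniz rule, the product of a closed and an exact morphism is exact; this settles the
  -- cases in which one of the factors lies between nonisomorphic bundles of the same class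
  have hexact : ∀ {h h' : Fn}, h ∈ Ker θ b₂.v b₃.v → h' ∈ Ker θ b₁.v b₂.v →
      nab θ τ (del θ b₁ b₃) b₁.v b₃.v (comp θ b₂.v h h') =
        comp θ b₂.v (nab θ τ (del θ b₂ b₃) b₂.v b₃.v h) h' +
          comp θ b₂.v h (nab θ τ (del θ b₁ b₂) b₁.v b₂.v h') := fun h h' => by
    rw [del_add θ b₁ b₂ b₃]
    exact nab_comp h h' τ _ _
  rcases c12 with h12 | h | h12
  · rcases c23 with h23 | h | h23
    · by_cases e13 : b₁ = b₃
      · subst e13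
        exact inv_comp_back hτ h12 h23 hf hf' hg hg' hf0 hg0
      · rcases c13 with h13 | h | h13
        · exact inv_comp_of_det_ne hτ h12 h23 h13 hf hf' hg hg' hf0 hg0
        · exact absurd h e13
        · rw [inv0_other h13, inv1_other h13, invComp, if_neg e12, if_neg e23, if_neg e13,
            det_eq_zero_of_eq h13.1, mul_zero, if_neg (lt_irrefl _), add_zero]
    · exact absurd h e23
    · have hg1 : g = 0 := eq_zero_of_inv0_eq_zero hτ (Or.inr (Or.inr h23)) hg hg0 (inv0_other h23 _)
      subst hg1
      obtain ⟨σ, hσ, rfl⟩ := (inv1_eq_zero_iff hτ (Or.inr (Or.inr h23)) hg').mp (inv1_other h23 _)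
      have h1 : inv1 θ τ b₁ b₃ (comp θ b₂.v (nab θ τ (del θ b₂ b₃) b₂.v b₃.v σ) f) = 0 :=
        (inv1_eq_zero_iff hτ c13 (Ker.comp hg' hf)).mpr ⟨_, Ker.comp hσ hf, by
          rw [hexact hσ hf, hf0, comp_zero_right, add_zero]⟩
      rw [comp_zero_left, comp_zero_left, zero_add, inv0_zero, h1, inv0_zero, inv1_other h23,
        add_zero, invComp_zero_left]
  · exact absurd h e12
  · have hf1 : f = 0 := eq_zero_of_inv0_eq_zero hτ (Or.inr (Or.inr h12)) hf hf0 (inv0_other h12 _)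
    subst hf1
    obtain ⟨σ, hσ, rfl⟩ := (inv1_eq_zero_iff hτ (Or.inr (Or.inr h12)) hf').mp (inv1_other h12 _)
    have h1 : inv1 θ τ b₁ b₃ (comp θ b₂.v g (nab θ τ (del θ b₁ b₂) b₁.v b₂.v σ)) = 0 :=
      (inv1_eq_zero_iff hτ c13 (Ker.comp hg hf')).mpr ⟨_, Ker.comp hg hσ, by
        rw [hexact hg hσ, hg0, comp_zero_left, zero_add]⟩
    rw [comp_zero_right, comp_zero_right, add_zero, inv0_zero, h1, inv0_zero, inv1_other h12,
      add_zero, invComp_zero_right]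

end composition

/-! ### Bases of standard bundles -/

section twist

variable {θ : ℝ} [Fact (Irrational θ)] {τ : ℂ}

/-- The composition with an invertible kernel. -/
def shiftEquiv (θ : ℝ) [Fact (Irrational θ)] (v₀ v : Ray) (j k : ℤ) :
    Ker θ v₀ v ≃ₗ[ℂ] Ker θ v₀ v :=
  LinearEquiv.ofBijective
    { toFun := fun κ => ⟨comp θ v (shiftK θ v j k) κ.1, Ker.comp (shiftK_mem j k) κ.2⟩
      map_add' := fun κ κ' => Subtype.ext
        (comp_add_right (Ker.rap (shiftK_mem j k)) (Ker.rap κ.2) (Ker.rap κ'.2))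
      map_smul' := fun a κ => Subtype.ext (comp_smul_right a _ κ.1) } (by
    have hinv : ∀ (j k : ℤ) (κ : Fn), κ ∈ Ker θ v₀ v →
        comp θ v (shiftK θ v (-j) (-k)) (comp θ v (shiftK θ v j k) κ) =
          e (-(k * off θ ((-j) • v.sec) / v.rk θ)) • κ := fun j k κ hκ => by
      rw [← comp_assoc (shiftK_mem _ _) (shiftK_mem _ _) hκ, shiftK_comp, comp_smul_left, idK_comp]
    have he : ∀ t, e t ≠ 0 := fun t => by
      rw [← norm_ne_zero_iff, norm_e]; exact one_ne_zero
    constructor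
    · refine (injective_iff_map_eq_zero _).mpr fun κ hκ => Subtype.ext ?_
      have h1 : comp θ v (shiftK θ v j k) κ.1 = 0 := congrArg Subtype.val hκ
      have h2 := hinv j k κ.1 κ.2
      rw [h1, comp_zero_right] at h2
      exact (smul_eq_zero.mp h2.symm).resolve_left (he _)
    · intro κ
      have h2 := hinv (-j) (-k) κ.1 κ.2
      rw [neg_neg, neg_neg] at h2
      refine ⟨(e (-((-k : ℤ) * off θ (j • v.sec) / v.rk θ)))⁻¹ •
        ⟨comp θ v (shiftK θ v (-j) (-k)) κ.1, Ker.comp (shiftK_mem _ _) κ.2⟩, Subtype.ext ?_⟩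
      show comp θ v (shiftK θ v j k) (_ • comp θ v (shiftK θ v (-j) (-k)) κ.1) = κ.1
      rw [comp_smul_right, h2, smul_smul, inv_mul_cancel₀ (he _), one_smul])

/-- The parameter of a chart may be changed within its class. -/
theorem Chart.twist {E : HolMod θ τ} {v : Ray} {z δ : ℂ} (c : Chart E v z) {j k : ℤ}
    (h : v.rk θ * δ = τ * j + k) : Nonempty (Chart E v (z + δ)) := by
  refine ⟨⟨c.ι.trans (shiftEquiv θ Ray.unit v j k), fun x a => ?_, fun x => ?_⟩⟩
  · show comp θ v (shiftK θ v j k) (c.ι (MulOpposite.op a • x)).1 =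
      comp θ Ray.unit (comp θ v (shiftK θ v j k) (c.ι x).1) (algK θ a).1
    rw [c.act, comp_assoc (shiftK_mem j k) (c.ι x).2 (algK θ a).2]
  · show comp θ v (shiftK θ v j k) (c.ι (E.nabla x)).1 =
      nab θ τ (z + δ) Ray.unit v (comp θ v (shiftK θ v j k) (c.ι x).1)
    rw [c.nabla, add_comm z, nab_comp (shiftK_mem j k) (c.ι x).2, nab_shiftK h, comp_zero_left,
      zero_add]

end twist

/-- The lattice `ℤτ + ℤ`. -/
def lat (τ : ℂ) : AddSubgroup ℂ where
  carrier := {x | ∃ j k : ℤ, x = τ * j + k}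
  add_mem' := by
    rintro _ _ ⟨j, k, rfl⟩ ⟨j', k', rfl⟩
    exact ⟨j + j', k + k', by push_cast; ring⟩
  zero_mem' := ⟨0, 0, by simp⟩
  neg_mem' := by
    rintro _ ⟨j, k, rfl⟩
    exact ⟨-j, -k, by push_cast; ring⟩

/-- A representative of the class modulo `ℤτ + ℤ`. -/
def rep (τ x : ℂ) : ℂ := (QuotientAddGroup.mk x : ℂ ⧸ lat τ).out

theorem rep_eq_iff {τ x y : ℂ} : rep τ x = rep τ y ↔ y - x ∈ lat τ := by
  rw [rep, rep, Quotient.out_inj, QuotientAddGroup.eq, neg_add_eq_sub]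

theorem rep_sub_mem (τ x : ℂ) : rep τ x - x ∈ lat τ := by
  have : (QuotientAddGroup.mk x : ℂ ⧸ lat τ) = QuotientAddGroup.mk (rep τ x) :=
    (QuotientAddGroup.out_eq' _).symm
  rwa [QuotientAddGroup.eq, neg_add_eq_sub] at this

theorem rep_rep (τ x : ℂ) : rep τ (rep τ x) = rep τ x := by
  rw [eq_comm, rep_eq_iff]
  exact rep_sub_mem τ x

/-- A base whose class has positive rank at `θ₀` and whose parameter is the chosen representative
of its class. -/
def Base.Normal (θ₀ : ℝ) (τ : ℂ) (b : Base) : Prop := 0 < b.v.rk θ₀ ∧ rep τ b.ζ = b.ζ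

theorem Ray.eq_of_det_eq_zero {θ₀ : ℝ} {v v' : Ray} (h : v.det v' = 0) (hv : 0 < v.rk θ₀)
    (hv' : 0 < v'.rk θ₀) : v = v' := by
  rw [← Ray.ell_w] at h
  obtain ⟨i, hi⟩ := v.exists_of_ell_eq_zero h
  have h1 : v'.m = i * v.m := congrArg Prod.snd hi
  have h2 : v'.n = i * v.n := by
    have : -v'.n = i * -v.n := congrArg Prod.fst hi
    linarith
  have hu : IsUnit i := by
    have := v'.coprime
    rw [h1, h2] at this
    exact isCoprime_self.mp this.of_mul_left_left.of_mul_right_left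
  rcases Int.isUnit_iff.mp hu with rfl | rfl
  · ext <;> simp [h1, h2]
  · simp only [Ray.rk, h1, h2] at hv hv'
    push_cast at hv'
    linarith

theorem Base.Normal.comparable {θ₀ θ : ℝ} [Fact (Irrational θ)] {τ : ℂ} {b b' : Base}
    (h : b.Normal θ₀ τ) (h' : b'.Normal θ₀ τ) : Comparable θ τ b b' := by
  by_cases hd : b.v.det b'.v = 0
  · right
    have hv := Ray.eq_of_det_eq_zero hd h.1 h'.1
    by_cases hζ : b.ζ = b'.ζ
    · exact Or.inl (Base.ext hv hζ)
    · refine Or.inr ⟨hv, fun ⟨j, k, hjk⟩ => hζ ?_⟩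
      have hr : (b.v.rk θ : ℂ) ≠ 0 := by exact_mod_cast b.v.rk_ne
      rw [del, ← hv] at hjk
      rw [← h.2, ← h'.2, rep_eq_iff]
      exact ⟨j, k, by rw [← hjk]; field_simp⟩
  · exact Or.inl hd

open Classical in
/-- The one of the vectors `v`, `-v` that has positive rank at `θ₀`. -/
def normRay (θ₀ : ℝ) (v : Ray) : Ray := if 0 < v.rk θ₀ then v else v.neg

theorem Ray.neg_neg (v : Ray) : v.neg.neg = v := by
  ext <;> simp [Ray.neg]

theorem normRay_pos {θ₀ : ℝ} [Fact (Irrational θ₀)] (v : Ray) : 0 < (normRay θ₀ v).rk θ₀ := by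
  rw [normRay]
  split_ifs with h
  · exact h
  · rw [Ray.rk_neg, neg_pos]
    exact lt_of_le_of_ne (not_lt.mp h) v.rk_ne

theorem normRay_of_pos {θ₀ : ℝ} {v : Ray} (h : 0 < v.rk θ₀) : normRay θ₀ v = v := if_pos h

theorem normRay_neg_of_pos {θ₀ : ℝ} {v : Ray} (h : 0 < v.rk θ₀) : normRay θ₀ v.neg = v := by
  rw [normRay, if_neg (by rw [Ray.rk_neg]; linarith), Ray.neg_neg]

/-- The base of a standard bundle, with respect to a second irrational number `θ₀`. -/
def StdBundle.base (θ₀ : ℝ) (τ : ℂ) {θ : ℝ} (E : StdBundle θ) : Base :=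
  ⟨normRay θ₀ (stdRay E), rep τ ((normRay θ₀ (stdRay E)).rk θ * E.z)⟩

theorem StdBundle.base_normal {θ₀ θ : ℝ} [Fact (Irrational θ₀)] {τ : ℂ}
    (E : StdBundle θ) : (E.base θ₀ τ).Normal θ₀ τ :=
  ⟨normRay_pos _, rep_rep _ _⟩

section base

variable {θ₀ θ : ℝ} [Fact (Irrational θ₀)] [Fact (Irrational θ)] {τ : ℂ}

theorem StdBundle.exists_baseChart (θ₀ : ℝ) [Fact (Irrational θ₀)] (τ : ℂ) (E : StdBundle θ) :
    Nonempty (Chart (E.toHolMod τ) (E.base θ₀ τ).v ((E.base θ₀ τ).ζ / (E.base θ₀ τ).v.rk θ)) := by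
  have h1 : Nonempty (Chart (E.toHolMod τ) (E.base θ₀ τ).v E.z) := by
    obtain ⟨c⟩ := exists_stdChart τ E
    show Nonempty (Chart (E.toHolMod τ) (normRay θ₀ (stdRay E)) E.z)
    rw [normRay]
    split_ifs
    · exact ⟨c⟩
    · exact c.neg
  obtain ⟨c⟩ := h1
  obtain ⟨j, k, h⟩ := rep_sub_mem τ ((E.base θ₀ τ).v.rk θ * E.z)
  have hr : ((E.base θ₀ τ).v.rk θ : ℂ) ≠ 0 := by exact_mod_cast (E.base θ₀ τ).v.rk_ne
  have h2 : (E.base θ₀ τ).ζ / (E.base θ₀ τ).v.rk θ =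
      E.z + ((E.base θ₀ τ).ζ / (E.base θ₀ τ).v.rk θ - E.z) := by ring
  rw [h2]
  refine c.twist (j := j) (k := k) ?_
  rw [← h, mul_sub, mul_div_cancel₀ _ hr]
  rfl

/-- A chart of a standard bundle whose parameters are given by its base. -/
def StdBundle.baseChart (θ₀ : ℝ) [Fact (Irrational θ₀)] (τ : ℂ) (E : StdBundle θ) :
    Chart (E.toHolMod τ) (E.base θ₀ τ).v ((E.base θ₀ τ).ζ / (E.base θ₀ τ).v.rk θ) :=
  (E.exists_baseChart θ₀ τ).some

end base

/-! ### Invariants of cohomology classes of morphisms -/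

section cohomology

open DGCategory

theorem low_zero {θ : ℝ} (b b' : Base) : low θ b b' 0 = 0 := by
  simp only [low]
  split_ifs <;> rfl

theorem upp_zero {θ : ℝ} (b b' : Base) : upp θ b b' 0 = 0 := by
  simp only [upp]
  split_ifs <;> rfl

theorem negOnePow_ne_zero (i : ℤ) : ((i.negOnePow : ℤ) : ℂ) ≠ 0 := by
  exact_mod_cast i.negOnePow.ne_zero

theorem mem_boundaries_iff {θ : ℝ} {τ : ℂ} {X Y : Cst θ τ} (f : cycles X Y) : f ∈ boundaries X Y ↔
    (f.1 : DGCategory.Hom X Y).1 = 0 ∧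
      ∃ φ, HolMod.nablaHom _ _ φ = (f.1 : DGCategory.Hom X Y).2 := by
  have h1 : ∀ h, d X Y h = ((Y.shift.negOnePow : ℤ) : ℂ) •
    ((0, HolMod.nablaHom _ _ h.1) : DGCategory.Hom X Y) := fun h => rfl
  constructor
  · rintro ⟨h, hh⟩
    rw [h1] at hh
    refine ⟨?_, ((Y.shift.negOnePow : ℤ) : ℂ) • h.1, ?_⟩
    · rw [← show _ = f.1 from hh]
      exact smul_zero _
    · rw [← show _ = f.1 from hh, map_smul]
      rfl
  · rintro ⟨h2, φ, h3⟩
    refine ⟨(((Y.shift.negOnePow : ℤ) : ℂ)⁻¹ • φ, 0), ?_⟩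
    rw [h1]
    refine Prod.ext ?_ ?_
    · exact (smul_zero _).trans h2.symm
    · show ((Y.shift.negOnePow : ℤ) : ℂ) • HolMod.nablaHom _ _
        (((Y.shift.negOnePow : ℤ) : ℂ)⁻¹ • φ) = f.1.2
      rw [map_smul, smul_smul, mul_inv_cancel₀ (negOnePow_ne_zero _), one_smul, h3]

variable {θ₀ θ : ℝ} [Fact (Irrational θ₀)] [Fact (Irrational θ)] {τ : ℂ}

/-- The base of an object. -/
def Cst.base (θ₀ : ℝ) (X : Cst θ τ) : Base := X.E.base θ₀ τ

/-- The kernel of a homomorphism between the bundles underlying two objects. -/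
def homKer (θ₀ : ℝ) [Fact (Irrational θ₀)] (X Y : Cst θ τ) :
    (X.E.toHolMod τ).AHom (Y.E.toHolMod τ) ≃ₗ[ℂ] Ker θ (X.base θ₀).v (Y.base θ₀).v :=
  (X.E.baseChart θ₀ τ).kernel (Y.E.baseChart θ₀ τ)

theorem homKer_nabla (X Y : Cst θ τ) (φ : (X.E.toHolMod τ).AHom (Y.E.toHolMod τ)) :
    (homKer θ₀ X Y (HolMod.nablaHom _ _ φ)).1 =
      nab θ τ (del θ (X.base θ₀) (Y.base θ₀)) (X.base θ₀).v (Y.base θ₀).v (homKer θ₀ X Y φ).1 :=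
  Chart.kernel_nabla _ _ φ

theorem comparable (X Y : Cst θ τ) : Comparable θ τ (X.base θ₀) (Y.base θ₀) :=
  X.E.base_normal.comparable Y.E.base_normal

theorem mem_cycles_iff {X Y : Cst θ τ} (f : DGCategory.Hom X Y) : f ∈ cycles X Y ↔
    nab θ τ (del θ (X.base θ₀) (Y.base θ₀)) (X.base θ₀).v (Y.base θ₀).v
      (homKer θ₀ X Y f.1).1 = 0 := by
  have h1 : d X Y f = ((Y.shift.negOnePow : ℤ) : ℂ) •
    ((0, HolMod.nablaHom _ _ f.1) : DGCategory.Hom X Y) := rfl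
  rw [cycles, LinearMap.mem_ker, h1, smul_eq_zero, or_iff_right (negOnePow_ne_zero _),
    ← homKer_nabla]
  constructor
  · intro h
    have h2 : HolMod.nablaHom _ _ f.1 = 0 := congrArg Prod.snd h
    rw [h2, map_zero]
    rfl
  · intro h
    have h2 : homKer θ₀ X Y (HolMod.nablaHom _ _ f.1) = 0 := Subtype.ext h
    exact Prod.ext rfl ((LinearEquiv.map_eq_zero_iff _).mp h2)

/-- The invariant of a closed morphism. -/
def cycInv (θ₀ : ℝ) [Fact (Irrational θ₀)] (hτ : τ.im < 0) (X Y : Cst θ τ) :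
    cycles X Y →ₗ[ℂ] Inv where
  toFun f := inv0 θ τ (X.base θ₀) (Y.base θ₀) (homKer θ₀ X Y (f.1 : DGCategory.Hom X Y).1).1 +
    inv1 θ τ (X.base θ₀) (Y.base θ₀) (homKer θ₀ X Y (f.1 : DGCategory.Hom X Y).2).1
  map_add' f g := by
    have h1 : ((f + g).1 : DGCategory.Hom X Y) = (f.1.1 + g.1.1, f.1.2 + g.1.2) := rfl
    rw [h1, map_add, map_add, Submodule.coe_add, Submodule.coe_add, inv0_add,
      inv1_add hτ (Subtype.mem _) (Subtype.mem _)]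
    abel
  map_smul' a f := by
    have h1 : ((a • f).1 : DGCategory.Hom X Y) = (a • f.1.1, a • f.1.2) := rfl
    rw [h1, map_smul, map_smul, Submodule.coe_smul, Submodule.coe_smul, inv0_smul, inv1_smul,
      RingHom.id_apply, smul_add]

theorem boundaries_le (hτ : τ.im < 0) (X Y : Cst θ τ) :
    boundaries X Y ≤ LinearMap.ker (cycInv θ₀ hτ X Y) := by
  intro f hf
  obtain ⟨h1, φ, h2⟩ := (mem_boundaries_iff f).mp hf
  rw [LinearMap.mem_ker]
  show inv0 θ τ _ _ (homKer θ₀ X Y (f.1 : DGCategory.Hom X Y).1).1 +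
    inv1 θ τ _ _ (homKer θ₀ X Y (f.1 : DGCategory.Hom X Y).2).1 = 0
  rw [h1, map_zero, Submodule.coe_zero, inv0_zero, zero_add,
    inv1_eq_zero_iff hτ (comparable X Y) (Subtype.mem _)]
  exact ⟨_, Subtype.mem (homKer θ₀ X Y φ), by rw [← homKer_nabla, h2]⟩

/-- The invariant of a cohomology class of morphisms. -/
def classInv (θ₀ : ℝ) [Fact (Irrational θ₀)] (hτ : τ.im < 0) (X Y : Cst θ τ) :
    HHom X Y →ₗ[ℂ] Inv :=
  (boundaries X Y).liftQ (cycInv θ₀ hτ X Y) (boundaries_le hτ X Y)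

theorem classInv_mk (hτ : τ.im < 0) {X Y : Cst θ τ} (f : cycles X Y) :
    classInv θ₀ hτ X Y ((boundaries X Y).mkQ f) =
      inv0 θ τ (X.base θ₀) (Y.base θ₀) (homKer θ₀ X Y (f.1 : DGCategory.Hom X Y).1).1 +
        inv1 θ τ (X.base θ₀) (Y.base θ₀) (homKer θ₀ X Y (f.1 : DGCategory.Hom X Y).2).1 := rfl

theorem fst_eq_zero_of_inv0 (hτ : τ.im < 0) {X Y : Cst θ τ} (f : cycles X Y)
    (h : inv0 θ τ (X.base θ₀) (Y.base θ₀) (homKer θ₀ X Y (f.1 : DGCategory.Hom X Y).1).1 = 0) :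
    (f.1 : DGCategory.Hom X Y).1 = 0 := by
  have h1 := eq_zero_of_inv0_eq_zero hτ (comparable X Y) (Subtype.mem _)
    ((mem_cycles_iff f.1).mp f.2) h
  exact (LinearEquiv.map_eq_zero_iff _).mp (Subtype.ext h1)

theorem exists_nabla_of_inv1 (hτ : τ.im < 0) {X Y : Cst θ τ}
    (φ : (X.E.toHolMod τ).AHom (Y.E.toHolMod τ))
    (h : inv1 θ τ (X.base θ₀) (Y.base θ₀) (homKer θ₀ X Y φ).1 = 0) :
    ∃ ψ, HolMod.nablaHom _ _ ψ = φ := by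
  obtain ⟨κ, hκ, h1⟩ := (inv1_eq_zero_iff hτ (comparable X Y) (Subtype.mem _)).mp h
  refine ⟨(homKer θ₀ X Y).symm ⟨κ, hκ⟩, (homKer θ₀ X Y).injective (Subtype.ext ?_)⟩
  rw [homKer_nabla, LinearEquiv.apply_symm_apply, h1]

theorem classInv_injective (hτ : τ.im < 0) (X Y : Cst θ τ) :
    Function.Injective (classInv θ₀ hτ X Y) := by
  refine (injective_iff_map_eq_zero _).mpr fun x hx => ?_
  obtain ⟨f, rfl⟩ := (boundaries X Y).mkQ_surjective x
  rw [classInv_mk] at hx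
  have h0 := congrArg (low θ (X.base θ₀) (Y.base θ₀)) hx
  have h1 := congrArg (upp θ (X.base θ₀) (Y.base θ₀)) hx
  rw [low_add, low_zero] at h0
  rw [upp_add, upp_zero] at h1
  exact (Submodule.Quotient.mk_eq_zero _).mpr ((mem_boundaries_iff f).mpr
    ⟨fst_eq_zero_of_inv0 hτ f h0, exists_nabla_of_inv1 hτ _ h1⟩)

theorem range_classInv (hτ : τ.im < 0) (X Y : Cst θ τ) :
    Set.range (classInv θ₀ hτ X Y) = invRange (X.base θ₀) (Y.base θ₀) := by
  refine Set.Subset.antisymm ?_ fun x hx => ?_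
  · rintro _ ⟨x, rfl⟩
    obtain ⟨f, rfl⟩ := (boundaries X Y).mkQ_surjective x
    exact inv_mem_range hτ (comparable X Y) (Subtype.mem _) ((mem_cycles_iff f.1).mp f.2)
      (Subtype.mem _)
  · obtain ⟨κ, hκ, κ', hκ', h0, h1⟩ := exists_inv_eq hτ (comparable X Y) hx
    let f : DGCategory.Hom X Y := ((homKer θ₀ X Y).symm ⟨κ, hκ⟩, (homKer θ₀ X Y).symm ⟨κ', hκ'⟩)
    have e1 : homKer θ₀ X Y f.1 = ⟨κ, hκ⟩ := LinearEquiv.apply_symm_apply _ _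
    have e2 : homKer θ₀ X Y f.2 = ⟨κ', hκ'⟩ := LinearEquiv.apply_symm_apply _ _
    have hf : f ∈ cycles X Y := (mem_cycles_iff (θ₀ := θ₀) f).mpr (by rw [e1, h0])
    refine ⟨(boundaries X Y).mkQ ⟨f, hf⟩, ?_⟩
    rw [classInv_mk, e1, e2, h1]

theorem classInv_comp (hτ : τ.im < 0) {X Y Z : Cst θ τ} (g : HHom Y Z) (f : HHom X Y) :
    classInv θ₀ hτ X Z (compH X Y Z g f) = invComp τ (X.base θ₀) (Y.base θ₀) (Z.base θ₀)
      (classInv θ₀ hτ Y Z g) (classInv θ₀ hτ X Y f) := by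
  obtain ⟨f, rfl⟩ := (boundaries X Y).mkQ_surjective f
  obtain ⟨g, rfl⟩ := (boundaries Y Z).mkQ_surjective g
  rw [compH_mk, classInv_mk, classInv_mk, classInv_mk]
  have hk : ∀ (ψ : (Y.E.toHolMod τ).AHom (Z.E.toHolMod τ))
      (φ : (X.E.toHolMod τ).AHom (Y.E.toHolMod τ)), (homKer θ₀ X Z (ψ ∘ₗ φ)).1 =
        comp θ (Y.base θ₀).v (homKer θ₀ Y Z ψ).1 (homKer θ₀ X Y φ).1 := fun ψ φ =>
    Chart.kernel_comp _ _ _ ψ φ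
  have h1 : ((compCycles X Y Z g f).1 : DGCategory.Hom X Z) =
    (g.1.1 ∘ₗ f.1.1, g.1.1 ∘ₗ f.1.2 + g.1.2 ∘ₗ f.1.1) := rfl
  rw [h1, map_add, Submodule.coe_add, hk, hk, hk]
  exact inv_comp hτ (comparable X Y) (comparable Y Z) (comparable X Z) (Subtype.mem _)
    (Subtype.mem _) (Subtype.mem _) (Subtype.mem _) ((mem_cycles_iff f.1).mp f.2)
    ((mem_cycles_iff g.1).mp g.2)

theorem classInv_one (hτ : τ.im < 0) (X : Cst θ τ) : classInv θ₀ hτ X X (oneH X) = (0, 1, 0) := by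
  rw [oneH, classInv_mk]
  have h1 : (one X : DGCategory.Hom X X) = (LinearMap.id, 0) := rfl
  have h2 : (homKer θ₀ X X LinearMap.id).1 = idK (X.base θ₀).v := Chart.kernel_id _
  simp only [h1]
  rw [h2, map_zero, Submodule.coe_zero, inv1_zero, inv0_self, add_zero]
  simp [idK]

/-- The degree of a cohomology class in terms of its invariant. -/
theorem mem_degH_iff (hτ : τ.im < 0) {X Y : Cst θ τ} (x : HHom X Y) (i : ℤ) : x ∈ degH X Y i ↔
    (i ≠ X.shift - Y.shift → low θ (X.base θ₀) (Y.base θ₀) (classInv θ₀ hτ X Y x) = 0) ∧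
      (i ≠ X.shift - Y.shift + 1 →
        upp θ (X.base θ₀) (Y.base θ₀) (classInv θ₀ hτ X Y x) = 0) := by
  constructor
  · rintro ⟨f, ⟨hf1, hf2⟩, rfl⟩
    rw [classInv_mk, low_add, upp_add]
    refine ⟨fun h => ?_, fun h => ?_⟩
    · have : (f.1 : DGCategory.Hom X Y).1 = 0 := hf1 h
      rw [this, map_zero, Submodule.coe_zero, inv0_zero]
    · have : (f.1 : DGCategory.Hom X Y).2 = 0 := hf2 h
      rw [this, map_zero, Submodule.coe_zero, inv1_zero]
  · obtain ⟨f, rfl⟩ := (boundaries X Y).mkQ_surjective x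
    rw [classInv_mk, low_add, upp_add]
    rintro ⟨h0, h1⟩
    by_cases hi : i = X.shift - Y.shift + 1
    · refine ⟨f, ⟨fun h => fst_eq_zero_of_inv0 hτ f (h0 h), fun h => absurd hi h⟩, rfl⟩
    · -- the upper component is exact and can be removed
      have hg : ((f.1.1, 0) : DGCategory.Hom X Y) ∈ cycles X Y :=
        (mem_cycles_iff (θ₀ := θ₀) _).mpr ((mem_cycles_iff f.1).mp f.2)
      refine ⟨⟨(f.1.1, 0), hg⟩, ⟨fun h => fst_eq_zero_of_inv0 hτ f (h0 h), fun _ => rfl⟩, ?_⟩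
      rw [← sub_eq_zero, ← map_sub]
      refine (Submodule.Quotient.mk_eq_zero _).mpr ((mem_boundaries_iff _).mpr ⟨?_, ?_⟩)
      · exact sub_self _
      · obtain ⟨ψ, hψ⟩ := exists_nabla_of_inv1 hτ _ (h1 hi)
        refine ⟨-ψ, ?_⟩
        rw [map_neg, hψ]
        exact (zero_sub _).symm

end cohomology

/-! ### Shifts and the comparison of degrees -/

open Classical in
/-- The shift that has to be applied to a bundle whose class is positive at `θ₀`, when it is viewed
at `θ`. -/
def shiftSign (θ₀ θ : ℝ) (v : Ray) : ℤ := if 0 < v.rk θ then 0 else if θ < θ₀ then 1 else -1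

/-- Relates the ranks of two vectors at two parameters; it decides the direction of the shift when
one of the ranks changes sign. -/
theorem Ray.det_mul_sub (θ₀ θ : ℝ) (v v' : Ray) :
    (v.det v' : ℝ) * (θ - θ₀) = v.rk θ₀ * v'.rk θ - v'.rk θ₀ * v.rk θ := by
  simp only [Ray.det, Ray.rk]
  push_cast
  ring

open Classical in
/-- The degree in which the cohomology of the morphisms between two bundles is concentrated depends
on the sign of the difference of their slopes; passing from `θ` to `θ₀`, the sign changes exactly
when one of the two ranks does, and this is compensated by the shifts. -/
theorem degree_shift {θ₀ θ : ℝ} [Fact (Irrational θ)] {v v' : Ray} (hd : v.det v' ≠ 0)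
    (hv : 0 < v.rk θ₀) (hv' : 0 < v'.rk θ₀) :
    (if 0 < slope θ v v' then 0 else 1) + shiftSign θ₀ θ v - shiftSign θ₀ θ v' =
      if 0 < slope θ₀ v v' then 0 else 1 := by
  have key := Ray.det_mul_sub θ₀ θ v v'
  have hd' : (v.det v' : ℝ) ≠ 0 := by exact_mod_cast hd
  have h0 : 0 < slope θ₀ v v' ↔ 0 < (v.det v' : ℝ) := div_pos_iff_of_pos_right (mul_pos hv hv')
  rw [if_congr h0 rfl rfl]
  have hr : v.rk θ ≠ 0 := v.rk_ne
  have hr' : v'.rk θ ≠ 0 := v'.rk_ne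
  rcases lt_or_gt_of_ne hr with h | h <;> rcases lt_or_gt_of_ne hr' with h' | h'
  · have h1 : 0 < slope θ v v' ↔ 0 < (v.det v' : ℝ) :=
      div_pos_iff_of_pos_right (mul_pos_of_neg_of_neg h h')
    rw [if_congr h1 rfl rfl, shiftSign, shiftSign, if_neg h.not_gt, if_neg h'.not_gt]
    ring
  · have h1 : 0 < slope θ v v' ↔ (v.det v' : ℝ) < 0 := by
      rw [slope, ← neg_div_neg_eq,
        div_pos_iff_of_pos_right (neg_pos.mpr (mul_neg_of_neg_of_pos h h')), neg_pos]
    have h2 : 0 < (v.det v' : ℝ) * (θ - θ₀) := by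
      rw [key]; nlinarith [mul_pos hv h', mul_pos hv' (neg_pos.mpr h)]
    rw [if_congr h1 rfl rfl, shiftSign, shiftSign, if_neg h.not_gt, if_pos h']
    rcases lt_or_gt_of_ne hd' with h3 | h3
    · rw [if_pos h3, if_neg h3.not_gt, if_pos (by nlinarith)]; rfl
    · rw [if_neg h3.not_gt, if_pos h3, if_neg (by nlinarith)]; rfl
  · have h1 : 0 < slope θ v v' ↔ (v.det v' : ℝ) < 0 := by
      rw [slope, ← neg_div_neg_eq,
        div_pos_iff_of_pos_right (neg_pos.mpr (mul_neg_of_pos_of_neg h h')), neg_pos]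
    have h2 : (v.det v' : ℝ) * (θ - θ₀) < 0 := by
      rw [key]; nlinarith [mul_pos hv (neg_pos.mpr h'), mul_pos hv' h]
    rw [if_congr h1 rfl rfl, shiftSign, shiftSign, if_pos h, if_neg h'.not_gt]
    rcases lt_or_gt_of_ne hd' with h3 | h3
    · rw [if_pos h3, if_neg h3.not_gt, if_neg (by nlinarith)]; rfl
    · rw [if_neg h3.not_gt, if_pos h3, if_pos (by nlinarith)]; rfl
  · have h1 : 0 < slope θ v v' ↔ 0 < (v.det v' : ℝ) := div_pos_iff_of_pos_right (mul_pos h h')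
    rw [if_congr h1 rfl rfl, shiftSign, shiftSign, if_pos h, if_pos h']
    ring

/-- The invariants that belong to the degree `k`, relative to the shifts. -/
def degCond (θ : ℝ) (b b' : Base) (k : ℤ) (x : Inv) : Prop :=
  (k ≠ 0 → low θ b b' x = 0) ∧ (k ≠ 1 → upp θ b b' x = 0)

open Classical in
theorem degCond_of_det_ne {θ : ℝ} {b b' : Base} (hd : b.v.det b'.v ≠ 0) (k : ℤ) (x : Inv) :
    degCond θ b b' k x ↔ (k ≠ (if 0 < slope θ b.v b'.v then 0 else 1) → x = 0) := by
  simp only [degCond, low, upp, if_pos hd]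
  split_ifs <;> simp

theorem degCond_iff {θ₀ θ : ℝ} [Fact (Irrational θ)] {b b' : Base} (hb : 0 < b.v.rk θ₀)
    (hb' : 0 < b'.v.rk θ₀) (k : ℤ) (x : Inv) :
    degCond θ b b' (k - shiftSign θ₀ θ b.v + shiftSign θ₀ θ b'.v) x ↔ degCond θ₀ b b' k x := by
  by_cases hd : b.v.det b'.v = 0
  · rw [Ray.eq_of_det_eq_zero hd hb hb', sub_add_cancel]
    simp only [degCond, low, upp, if_neg (not_not.mpr hd)]
  · rw [degCond_of_det_ne hd, degCond_of_det_ne hd, ← degree_shift (θ := θ) hd hb hb']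
    refine imp_congr_left (not_congr ?_)
    constructor <;> intro h <;> linarith

/-! ### Graded categories described by invariants -/

/-- A description of a graded category by bases and shifts of its objects and invariants of its
morphisms. A graded category is determined up to equivalence by the pairs of a base and a shift
that occur. -/
structure InvSystem (θ₀ : ℝ) (τ : ℂ) (C : Type*) [Category C] [Preadditive C] [Linear ℂ C]
    [GradedCategory C] where
  base : C → Base
  shift : C → ℤ
  inv : ∀ X Y : C, (X ⟶ Y) →ₗ[ℂ] Inv
  injective : ∀ X Y, Function.Injective (inv X Y)
  range : ∀ X Y, Set.range (inv X Y) = invRange (base X) (base Y)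
  id : ∀ X, inv X X (𝟙 X) = (0, 1, 0)
  comp : ∀ {X Y Z} (f : X ⟶ Y) (g : Y ⟶ Z),
    inv X Z (f ≫ g) = invComp τ (base X) (base Y) (base Z) (inv Y Z g) (inv X Y f)
  mem_deg : ∀ {X Y} (f : X ⟶ Y) (i : ℤ), f ∈ GradedCategory.deg X Y i ↔
    degCond θ₀ (base X) (base Y) (i - (shift X - shift Y)) (inv X Y f)

namespace InvSystem

section transfer

variable {θ₀ : ℝ} {τ : ℂ} {C D : Type*} [Category C] [Preadditive C] [Linear ℂ C]
  [GradedCategory C] [Category D] [Preadditive D] [Linear ℂ D] [GradedCategory D]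
  (S : InvSystem θ₀ τ C) (T : InvSystem θ₀ τ D)

theorem exists_inv_eq {X Y : C} {X' Y' : D} (hX : T.base X' = S.base X)
    (hY : T.base Y' = S.base Y) (f : X ⟶ Y) : ∃ f' : X' ⟶ Y', T.inv X' Y' f' = S.inv X Y f := by
  have h : S.inv X Y f ∈ Set.range (T.inv X' Y') := by
    rw [T.range, hX, hY, ← S.range]
    exact ⟨f, rfl⟩
  exact h

/-- The morphism with the same invariant as a given one. -/
def transfer {X Y : C} {X' Y' : D} (hX : T.base X' = S.base X) (hY : T.base Y' = S.base Y)
    (f : X ⟶ Y) : X' ⟶ Y' := (S.exists_inv_eq T hX hY f).choose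

@[simp] theorem inv_transfer {X Y : C} {X' Y' : D} (hX : T.base X' = S.base X)
    (hY : T.base Y' = S.base Y) (f : X ⟶ Y) :
    T.inv X' Y' (S.transfer T hX hY f) = S.inv X Y f :=
  (S.exists_inv_eq T hX hY f).choose_spec

theorem transfer_mem_deg {X Y : C} {X' Y' : D} (hX : T.base X' = S.base X)
    (hY : T.base Y' = S.base Y) (hX' : T.shift X' = S.shift X) (hY' : T.shift Y' = S.shift Y)
    {f : X ⟶ Y} {i : ℤ} (hf : f ∈ GradedCategory.deg X Y i) :
    S.transfer T hX hY f ∈ GradedCategory.deg X' Y' i := by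
  rw [T.mem_deg, inv_transfer, hX, hY, hX', hY']
  exact (S.mem_deg f i).mp hf

theorem inv_comp_right {X Y Z : C} (h : S.base Y = S.base Z) (f : X ⟶ Y) {g : Y ⟶ Z}
    (hg : S.inv Y Z g = (0, 1, 0)) : S.inv X Z (f ≫ g) = S.inv X Y f := by
  rw [S.comp, hg, ← h, ← S.id Y, ← S.comp, Category.comp_id]

theorem inv_comp_left {X Y Z : C} (h : S.base X = S.base Y) {f : X ⟶ Y} (g : Y ⟶ Z)
    (hf : S.inv X Y f = (0, 1, 0)) : S.inv X Z (f ≫ g) = S.inv Y Z g := by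
  rw [S.comp, hf, h, ← S.id Y, ← S.comp, Category.id_comp]

/-- Objects with the same base are isomorphic. -/
def isoOfBase {X Y : C} (h : S.base X = S.base Y) : X ≅ Y where
  hom := S.transfer S rfl h.symm (𝟙 X)
  inv := S.transfer S h.symm rfl (𝟙 X)
  hom_inv_id := S.injective _ _ (by
    rw [S.inv_comp_right h.symm _ (by rw [inv_transfer, S.id]), inv_transfer])
  inv_hom_id := S.injective _ _ (by
    rw [S.inv_comp_right h _ (by rw [inv_transfer, S.id]), inv_transfer, S.id, S.id])

theorem inv_isoOfBase_hom {X Y : C} (h : S.base X = S.base Y) :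
    S.inv X Y (S.isoOfBase h).hom = (0, 1, 0) := (S.inv_transfer S rfl h.symm (𝟙 X)).trans (S.id X)

theorem isoOfBase_hom_mem {X Y : C} (h : S.base X = S.base Y) (h' : S.shift X = S.shift Y) :
    (S.isoOfBase h).hom ∈ GradedCategory.deg X Y 0 :=
  S.transfer_mem_deg S rfl h.symm rfl h'.symm (GradedCategory.id_mem X)

/-- The functor that preserves bases and invariants. -/
def functor (o : C → D) (ho : ∀ X, T.base (o X) = S.base X) : C ⥤ D where
  obj := o
  map f := S.transfer T (ho _) (ho _) f
  map_id X := T.injective _ _ (by rw [inv_transfer, T.id, S.id])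
  map_comp f g := T.injective _ _ (by
    rw [inv_transfer, T.comp, inv_transfer, inv_transfer, S.comp, ho, ho, ho])

theorem inv_functor_map (o : C → D) (ho : ∀ X, T.base (o X) = S.base X) {X Y : C} (f : X ⟶ Y) :
    T.inv _ _ ((S.functor T o ho).map f) = S.inv X Y f := S.inv_transfer T (ho X) (ho Y) f

theorem functor_additive (o : C → D) (ho : ∀ X, T.base (o X) = S.base X) :
    (S.functor T o ho).Additive where
  map_add := T.injective _ _ (by rw [map_add, inv_functor_map, inv_functor_map,
    inv_functor_map, map_add])

theorem functor_linear (o : C → D) (ho : ∀ X, T.base (o X) = S.base X) :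
    (S.functor T o ho).Linear ℂ where
  map_smul f a := T.injective _ _ (by rw [map_smul, inv_functor_map, inv_functor_map, map_smul])

/-- Two graded categories are equivalent if they are described by invariants and the same pairs of
bases and shifts occur. -/
theorem nonempty_gradedEquivalence
    (hST : ∀ X : C, ∃ Y : D, T.base Y = S.base X ∧ T.shift Y = S.shift X)
    (hTS : ∀ Y : D, ∃ X : C, S.base X = T.base Y ∧ S.shift X = T.shift Y) :
    Nonempty (GradedEquivalence C D) := by
  choose o ho ho' using hST
  choose p hp hp' using hTS
  have hpo : ∀ X, S.base X = S.base (p (o X)) := fun X => by rw [hp, ho]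
  have hop : ∀ Y, T.base (o (p Y)) = T.base Y := fun Y => by rw [ho, hp]
  let F := S.functor T o ho
  let G := T.functor S p hp
  have hF : ∀ {X Y : C} (f : X ⟶ Y), T.inv (o X) (o Y) (F.map f) = S.inv X Y f :=
    S.inv_functor_map T o ho
  have hG : ∀ {X Y : D} (f : X ⟶ Y), S.inv (p X) (p Y) (G.map f) = T.inv X Y f :=
    T.inv_functor_map S p hp
  let η : 𝟭 C ≅ F ⋙ G := NatIso.ofComponents (fun X => S.isoOfBase (hpo X)) fun {X Y} f =>
    S.injective _ _ (((S.inv_comp_right (hpo Y) f (S.inv_isoOfBase_hom _)).trans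
      ((hG (F.map f)).trans (hF f)).symm).trans
        (S.inv_comp_left (hpo X) (G.map (F.map f)) (S.inv_isoOfBase_hom _)).symm)
  let ε : G ⋙ F ≅ 𝟭 D := NatIso.ofComponents (fun Y => T.isoOfBase (hop Y)) fun {X Y} f =>
    T.injective _ _ (((T.inv_comp_right (hop Y) (F.map (G.map f)) (T.inv_isoOfBase_hom _)).trans
      ((hF (G.map f)).trans (hG f))).trans
        (T.inv_comp_left (hop X) f (T.inv_isoOfBase_hom _)).symm)
  refine ⟨⟨⟨F, G, η, ε, fun X => T.injective _ _ ?_⟩, S.functor_additive T o ho,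
    S.functor_linear T o ho, T.functor_additive S p hp, T.functor_linear S p hp, ?_, ?_, ?_, ?_⟩⟩
  · refine (T.inv_comp_right (hop (o X)) (F.map (S.isoOfBase (hpo X)).hom)
      (T.inv_isoOfBase_hom (hop (o X)))).trans ?_
    exact ((hF _).trans (S.inv_isoOfBase_hom _)).trans (T.id _).symm
  · intro X Y i f hf
    exact S.transfer_mem_deg T (ho X) (ho Y) (ho' X) (ho' Y) hf
  · intro X Y i f hf
    exact T.transfer_mem_deg S (hp X) (hp Y) (hp' X) (hp' Y) hf
  · intro X
    exact S.isoOfBase_hom_mem (hpo X) (by rw [hp', ho'])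
  · intro Y
    exact T.isoOfBase_hom_mem (hop Y) (by rw [ho', hp'])

end transfer

end InvSystem

/-! ### The cohomology categories of the standard bundles -/

section standard

open DGCategory

/-- The description of the cohomology category of the standard bundles by invariants; with the
corrected shifts, the degrees are those at `θ₀`. -/
def cstInvSystem (θ₀ θ : ℝ) [Fact (Irrational θ₀)] [Fact (Irrational θ)] {τ : ℂ}
    (hτ : τ.im < 0) : InvSystem θ₀ τ (HStar (Cst θ τ)) where
  base X := X.obj.base θ₀
  shift X := X.obj.shift - shiftSign θ₀ θ (X.obj.base θ₀).v
  inv X Y := classInv θ₀ hτ X.obj Y.obj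
  injective X Y := classInv_injective hτ X.obj Y.obj
  range X Y := range_classInv hτ X.obj Y.obj
  id X := classInv_one hτ X.obj
  comp f g := classInv_comp hτ g f
  mem_deg {X Y} f i := by
    refine (mem_degH_iff (θ₀ := θ₀) hτ f i).trans (Iff.trans ?_ (degCond_iff (θ := θ)
      X.obj.E.base_normal.1 Y.obj.E.base_normal.1 _ _))
    refine and_congr (imp_congr_left (not_congr ?_)) (imp_congr_left (not_congr ?_)) <;>
    · simp only [Cst.base]
      constructor <;> intro h <;> linarith

/-- Every normal base is the base of a standard bundle, the class of which is `v` or `-v`. -/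
theorem exists_base_eq {θ₀ θ : ℝ} [Fact (Irrational θ)] {τ : ℂ} {b : Base}
    (hb : b.Normal θ₀ τ) : ∃ E : StdBundle θ, E.base θ₀ τ = b := by
  have hr : (b.v.rk θ : ℂ) ≠ 0 := by exact_mod_cast b.v.rk_ne
  have key : ∀ E : StdBundle θ, normRay θ₀ (stdRay E) = b.v → E.z = b.ζ / b.v.rk θ →
      E.base θ₀ τ = b := fun E h h' => by
    refine Base.ext h ?_
    show rep τ ((normRay θ₀ (stdRay E)).rk θ * E.z) = b.ζ
    rw [h, h', mul_div_cancel₀ _ hr, hb.2]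
  by_cases h : 0 < b.v.rk θ
  · exact ⟨⟨b.v.n, b.v.m, b.v.coprime, h, _⟩, key _ (normRay_of_pos hb.1) rfl⟩
  · have h' : 0 < b.v.neg.rk θ := by
      rw [Ray.rk_neg, neg_pos]
      exact lt_of_le_of_ne (not_lt.mp h) b.v.rk_ne
    exact ⟨⟨b.v.neg.n, b.v.neg.m, b.v.neg.coprime, h', _⟩, key _ (normRay_neg_of_pos hb.1) rfl⟩

theorem exists_base_shift_eq (θ : ℝ) {θ₀ : ℝ} [Fact (Irrational θ)] {τ : ℂ} {b : Base}
    (hb : b.Normal θ₀ τ) (s : ℤ) : ∃ X : HStar (Cst θ τ), X.obj.base θ₀ = b ∧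
      X.obj.shift - shiftSign θ₀ θ (X.obj.base θ₀).v = s := by
  obtain ⟨E, rfl⟩ := exists_base_eq (θ := θ) hb
  exact ⟨⟨⟨E, s + shiftSign θ₀ θ (E.base θ₀ τ).v⟩⟩, rfl, add_sub_cancel_right _ _⟩

end standard

end

end NCTorus

theorem mainTheorem3 (θ θ' : ℝ) (hθ : Irrational θ) (hθ' : Irrational θ') (τ : ℂ)
    (hτ : τ.im < 0) :
    Nonempty (NCTorus.GradedEquivalence (NCTorus.HStar (NCTorus.Cst θ τ))
      (NCTorus.HStar (NCTorus.Cst θ' τ))) := by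
  have : Fact (Irrational θ) := ⟨hθ⟩
  have : Fact (Irrational θ') := ⟨hθ'⟩
  -- the bases and shifts of both categories are taken with respect to `θ`
  exact (NCTorus.cstInvSystem θ θ hτ).nonempty_gradedEquivalence (NCTorus.cstInvSystem θ θ' hτ)
    (fun X => NCTorus.exists_base_shift_eq θ' X.obj.E.base_normal _)
    (fun Y => NCTorus.exists_base_shift_eq θ Y.obj.E.base_normal _)
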